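/- Let $p$ be a prime and $f\ge 1$. Let $\mathcal O$ be a complete discrete valuation ring with maximal ideal $p\mathcal O$, field of fractions $K$ (so $K$ is a complete unramified extension of $\mathbb Q_p$) and residue field $k$; let $\bar K,\bar k$ be algebraic closures. Let $\Delta_2(p^f)\le \mathrm{SL}_2(\mathbb F_{p^f})$ be the group of upper triangular matrices $\begin{pmatrix} a&b\\0&a^{-1}\end{pmatrix}$ and let $B_0(\bar k\Delta_2(p^f))$ be the principal block of its group algebra. A \emph{split $k$-form} of $B_0(\bar k\Delta_2(p^f))$ is a split $k$-algebra $\overline\Lambda$ (all simple modules have endomorphism ring $k$) with $\bar k\otimes_k\overline\Lambda\cong B_0(\bar k\Delta_2(p^f))$. For a finite-dimensional semisimple $K$-algebra $A=\bigoplus_i A_i$ with simple components $A_i$ and $u=(u_i)_i\in Z(A)^\times$ put $T_u(a)=\sum_i \mathrm{tr}_{Z(A_i)/K}\,\mathrm{tr.red.}_{A_i/Z(A_i)}(u_ia_i)$. A full $\mathcal O$-order $\Lambda\subset A$ is self-dual with respect to $T_u$ if $\Lambda=\{a\in A\mid T_u(a\Lambda)\subseteq\mathcal O\}$. \textbf{Theorem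 (Unique lifting).} Let $A$ be a finite-dimensional semisimple $K$-algebra with $\dim_K Z(A)=\dim_{\bar k}Z(B_0(\bar k\Delta_2(p^f)))$ that is split by some finite totally ramified extension of $K$. We call two orders in $A$ \emph{conjugate up to relabelling} if the second equals $y\,\tau(\Lambda)\,y^{-1}$, where $\Lambda$ is the first, for some $y\in A^\times$ and some $K$-algebra automorphism $\tau$ of $A$ which is the identity on every simple component of dimension greater than one over $K$ (so that $\tau$ merely permutes the simple components isomorphic to $K$). Let $u\in Z(A)^\times$ have $p$-valuation $-f$ in every component of $Z(\bar K\otimes_K A)$. Then, up to conjugacy up to relabelling, there is at most one full $\mathcal O$-order $\Lambda_u\subset A$ such that \begin{enumerate} \item $\Lambda_u$ is self-dual with respect to $T_u$, and \item $k\otimes_{\mathcal O}\Lambda_u$ is a split $k$-form of $B_0(\bar k\Delta_2(p^f))$. \end{enumerate} \textbf{Addendum (dependence on $u$).} Let $u,u'\in Z(A)^\times$ both have valuation $-f$ in every component of $Z(\bar K\otimes_K A)$, and let $\Lambda_u$, $\Lambda_{u'}$ be full $\mathcal O$-orders in $A$ satisfying (1) and (2) for $u$ and for $u'$ respectively. \begin{enumerate}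 \item If $p=2$, then $\Lambda_u$ and $\Lambda_{u'}$ are conjugate up to relabelling. \item Suppose $p\ne2$ and $K$ splits $A$. Let $\varepsilon_{\kappa+1}\neq\varepsilon_{\kappa+2}$ be central primitive idempotents of $A$ such that all other simple components of $A$ have dimension one over $K$ (they are the last two of $\kappa+2$ idempotents, $\kappa=\frac{p^f-1}{2}$, ordered so that the components of dimension greater than one come last), and let $u_j\in K^\times$ be given by $\varepsilon_ju=u_j\varepsilon_j$, similarly for $u'$. If $\frac{u_{\kappa+1}}{u_{\kappa+2}}=\frac{u'_{\kappa+1}}{u'_{\kappa+2}}$, then $\Lambda_u$ and $\Lambda_{u'}$ are conjugate up to relabelling. \item Suppose $p\ne2$ and $K$ does not split $A$. Let $\varepsilon_{\kappa+1}$ be a central primitive idempotent of $A$ such that all other simple components of $A$ have dimension one over $K$ (the last in such an ordering), and put $u_{\kappa+1}=\varepsilon_{\kappa+1}u$, $u'_{\kappa+1}=\varepsilon_{\kappa+1}u'$. If $u_{\kappa+1}\mathcal O^\times=u'_{\kappa+1}\mathcal O^\times$, then $\Lambda_u$ and $\Lambda_{u'}$ are conjugate up to relabelling. \end{enumerate}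 -/

import Mathlib

open scoped TensorProduct

noncomputable section

namespace UniqueLifting

/-! ### Central primitive idempotents and principal blocks -/

/-- A central primitive idempotent of a ring: a nonzero idempotent of the centre that has no
proper nonzero central idempotent below it. -/
structure IsCentralPrimitive {R : Type*} [Ring R] (e : R) : Prop where
  central : e ∈ Subring.center R
  idem : IsIdempotentElem e
  ne_zero : e ≠ 0
  minimal : ∀ d ∈ Subring.center R, IsIdempotentElem d → d * e = d → d = 0 ∨ d = e

section PrincipalBlock

variable (F : Type*) [Field F] (G : Type*) [Group G]

/-- The augmentation `F G → F`, i.e. the trivial representation of `G`. -/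
def augmentation : MonoidAlgebra F G →ₐ[F] F :=
  MonoidAlgebra.lift F F G (1 : G →* F)

/-- The idempotent of the principal block: the central primitive idempotent that acts as the
identity on the trivial module. -/
structure IsPrincipalBlockIdempotent (e : MonoidAlgebra F G) : Prop where
  primitive : IsCentralPrimitive e
  augmentation_eq_one : augmentation F G e = 1

theorem exists_isPrincipalBlockIdempotent [Finite G] :
    ∃ e : MonoidAlgebra F G, IsPrincipalBlockIdempotent F G e := by
  classical
  have : Module.Finite F (MonoidAlgebra F G) :=
    Module.Finite.of_basis (MonoidAlgebra.basis G F)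
  let S : Set (MonoidAlgebra F G) :=
    {e | e ∈ Subring.center (MonoidAlgebra F G) ∧ IsIdempotentElem e ∧ augmentation F G e = 1}
  let d : MonoidAlgebra F G → ℕ := fun e =>
    Module.finrank F (LinearMap.range (LinearMap.mulLeft F e))
  have hS : S.Nonempty := ⟨1, Subring.one_mem _, IsIdempotentElem.one, map_one _⟩
  obtain ⟨e, ⟨hec, hei, hea⟩, hmin⟩ :=
    WellFounded.has_min (InvImage.wf d Nat.lt_wfRel.wf) S hS
  -- an idempotent of `S` below `e` is equal to `e`
  have key : ∀ e' ∈ S, e' * e = e' → e' = e := by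
    rintro e' he' h
    have hcomm : e * e' = e' := by
      rw [← h, ← mul_assoc, (Subring.mem_center_iff.1 hec e').symm, mul_assoc, hei.eq]
    have hle : LinearMap.range (LinearMap.mulLeft F e') ≤
        LinearMap.range (LinearMap.mulLeft F e) := by
      rintro _ ⟨x, rfl⟩
      exact ⟨e' * x, by simp [← mul_assoc, hcomm]⟩
    have heq := Submodule.eq_of_le_of_finrank_le hle (not_lt.1 (hmin e' he'))
    have : e ∈ LinearMap.range (LinearMap.mulLeft F e') := by
      rw [heq]
      exact ⟨1, by simp⟩
    obtain ⟨x, hx⟩ := this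
    have hx' : e' * x = e := hx
    have : e' * e = e := by rw [← hx', ← mul_assoc, he'.2.1.eq]
    rw [← h, this]
  refine ⟨e, ⟨hec, hei, ?_, ?_⟩, hea⟩
  · rintro rfl
    simp at hea
  · intro e' hc hi h
    have ha : augmentation F G e' = 0 ∨ augmentation F G e' = 1 := by
      have := congrArg (augmentation F G) hi.eq
      rw [map_mul] at this
      exact IsIdempotentElem.iff_eq_zero_or_one.1 this
    have hcomm : e * e' = e' := by
      rw [← h, ← mul_assoc, (Subring.mem_center_iff.1 hec e').symm, mul_assoc, hei.eq]
    rcases ha with ha | ha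
    · left
      have h1 : e - e' = e := by
        apply key
        · refine ⟨Subring.sub_mem _ hec hc, ?_, by rw [map_sub, hea, ha, sub_zero]⟩
          change (e - e') * (e - e') = e - e'
          rw [mul_sub, sub_mul, sub_mul, hei.eq, h, hcomm, hi.eq]
          abel
        · rw [sub_mul, hei.eq, h]
      simpa using h1
    · exact Or.inr (key e' ⟨hc, hi, ha⟩ h)

theorem IsPrincipalBlockIdempotent.unique {e e' : MonoidAlgebra F G}
    (h : IsPrincipalBlockIdempotent F G e) (h' : IsPrincipalBlockIdempotent F G e') : e = e' := by
  have hc : e' * e = e * e' := Subring.mem_center_iff.1 h.primitive.central e'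
  have hcen := Subring.mul_mem _ h.primitive.central h'.primitive.central
  have hid : IsIdempotentElem (e * e') :=
    h.primitive.idem.mul_of_commute hc.symm h'.primitive.idem
  have hne : e * e' ≠ 0 := by
    intro h0
    have := congrArg (augmentation F G) h0
    rw [map_mul, h.augmentation_eq_one, h'.augmentation_eq_one, map_zero, one_mul] at this
    exact one_ne_zero this
  have h1 := (h.primitive.minimal _ hcen hid
    (by rw [mul_assoc, hc, ← mul_assoc, h.primitive.idem.eq])).resolve_left hne
  have h2 := (h'.primitive.minimal _ hcen hid
    (by rw [mul_assoc, h'.primitive.idem.eq])).resolve_left hne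
  rw [← h1, h2]

/-- The principal block idempotent of `F G`. -/
def principalBlockIdempotent [Finite G] : MonoidAlgebra F G :=
  (exists_isPrincipalBlockIdempotent F G).choose

theorem principalBlockIdempotent_spec [Finite G] :
    IsPrincipalBlockIdempotent F G (principalBlockIdempotent F G) :=
  (exists_isPrincipalBlockIdempotent F G).choose_spec

/-- The principal block `B₀(F G) = e · F G · e = e · F G`, an algebra with unit element `e`. -/
def PrincipalBlock [Finite G] : Type _ :=
  (principalBlockIdempotent_spec F G).primitive.idem.Corner

instance [Finite G] : Ring (PrincipalBlock F G) :=
  inferInstanceAs (Ring (principalBlockIdempotent_spec F G).primitive.idem.Corner)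

/-- The inclusion of the principal block into the group algebra. -/
def PrincipalBlock.val [Finite G] (x : PrincipalBlock F G) : MonoidAlgebra F G := x.1

theorem PrincipalBlock.mem_iff [Finite G] (x : MonoidAlgebra F G) :
    x ∈ Subsemigroup.corner (principalBlockIdempotent F G) ↔
      principalBlockIdempotent F G * x = x ∧ x * principalBlockIdempotent F G = x :=
  Subsemigroup.mem_corner_iff (principalBlockIdempotent_spec F G).primitive.idem

instance [Finite G] : Algebra F (PrincipalBlock F G) where
  smul c x := ⟨c • x.1, by
    have h := (PrincipalBlock.mem_iff F G x.1).1 x.2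
    exact (PrincipalBlock.mem_iff F G _).2
      ⟨by rw [mul_smul_comm, h.1], by rw [smul_mul_assoc, h.2]⟩⟩
  algebraMap :=
    { toFun := fun c => ⟨c • principalBlockIdempotent F G, by
        have h := (principalBlockIdempotent_spec F G).primitive.idem
        exact (PrincipalBlock.mem_iff F G _).2
          ⟨by rw [mul_smul_comm, h.eq], by rw [smul_mul_assoc, h.eq]⟩⟩
      map_one' := Subtype.ext (one_smul _ _)
      map_mul' := fun a b => Subtype.ext (by
        have h := (principalBlockIdempotent_spec F G).primitive.idem
        change (a * b) • _ = (a • _) * (b • _)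
        rw [smul_mul_smul_comm, h.eq])
      map_zero' := Subtype.ext (zero_smul _ _)
      map_add' := fun a b => Subtype.ext (add_smul _ _ _) }
  commutes' c x := Subtype.ext (by
    have h := (PrincipalBlock.mem_iff F G x.1).1 x.2
    change (c • principalBlockIdempotent F G) * x.1 = x.1 * (c • principalBlockIdempotent F G)
    rw [mul_smul_comm, smul_mul_assoc, h.1, h.2])
  smul_def' c x := Subtype.ext (by
    have h := (PrincipalBlock.mem_iff F G x.1).1 x.2
    change c • x.1 = (c • principalBlockIdempotent F G) * x.1
    rw [smul_mul_assoc, h.1])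

end PrincipalBlock

/-! ### The group `Δ₂(p^f)` -/

/-- The group of matrices `[a, b; 0, a⁻¹]` with entries in `F`, i.e. the upper triangular
matrices in `SL₂(F)`. -/
def upperTriangularSL2 (F : Type*) [Field F] : Subgroup (Matrix.SpecialLinearGroup (Fin 2) F) where
  carrier := {g | g 1 0 = 0}
  one_mem' := by simp
  mul_mem' := by
    intro a b ha hb
    change a 1 0 = 0 at ha
    change b 1 0 = 0 at hb
    change (a * b) 1 0 = 0
    rw [Matrix.SpecialLinearGroup.coe_mul, Matrix.mul_apply, Fin.sum_univ_two, ha, hb]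
    simp
  inv_mem' := by
    intro a ha
    change a 1 0 = 0 at ha
    change a⁻¹ 1 0 = 0
    rw [Matrix.SpecialLinearGroup.coe_inv, Matrix.adjugate_fin_two]
    simp [ha]

/-- `Δ₂(p^f)`. -/
abbrev Delta2 (p : ℕ) [Fact p.Prime] (f : ℕ) :=
  upperTriangularSL2 (GaloisField p f)

/-! ### Split algebras and split forms -/

/-- An `F`-algebra `B` is split if `F` is the full endomorphism ring of every simple `B`-module
(every simple module has the form `B ⧸ I` for a maximal left ideal `I`). -/
def IsSplit (F B : Type*) [Field F] [Ring B] [Algebra F B] : Prop :=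
  ∀ I : Submodule B B, IsCoatom I → ∀ φ : (B ⧸ I) →ₗ[B] (B ⧸ I),
    ∃ c : F, ∀ x, φ x = algebraMap F B c • x

/-- `B` is a finite product of full matrix algebras over `F` (i.e. `F` splits the semisimple
algebra `B`). -/
def IsSplitSemisimple (F B : Type*) [Field F] [Ring B] [Algebra F B] : Prop :=
  ∃ (n : ℕ) (d : Fin n → ℕ), (∀ i, 0 < d i) ∧
    Nonempty (B ≃ₐ[F] Π i, Matrix (Fin (d i)) (Fin (d i)) F)

/-- A split `k`-form of `B₀(k̄ Δ₂(p^f))`: a split `k`-algebra `B` with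
`k̄ ⊗ B ≅ B₀(k̄ Δ₂(p^f))`. -/
def IsSplitFormDelta2 (p : ℕ) [Fact p.Prime] (f : ℕ) (k B : Type*) [Field k] [Ring B]
    [Algebra k B] : Prop :=
  IsSplit k B ∧
    Nonempty ((AlgebraicClosure k ⊗[k] B) ≃ₐ[AlgebraicClosure k]
      PrincipalBlock (AlgebraicClosure k) (Delta2 p f))

/-! ### Totally ramified extensions and valuations -/

/-- A finite extension `L` of the fraction field `K` of a complete discrete valuation ring `O` is
totally ramified if its residue field is that of `O`: every element of the integral closure `O_L`
of `O` in `L` is congruent to an element of `O` modulo the maximal ideal of `O_L` (the ideal of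
nonunits). -/
def IsTotallyRamified (O K L : Type*) [CommRing O] [Field K] [Field L] [Algebra K L]
    [Algebra O L] : Prop :=
  FiniteDimensional K L ∧
    ∀ x : integralClosure O L, ∃ a : O, ¬ IsUnit (x - algebraMap O (integralClosure O L) a)

/-- `x ∈ F` has `p`-valuation `n`: `x / p^n` is a unit of the integral closure of `O` in `F`. -/
def HasValuation (O : Type*) {F : Type*} [CommRing O] [Field F] [Algebra O F]
    (p : ℕ) (n : ℤ) (x : F) : Prop :=
  x ≠ 0 ∧ IsIntegral O (x / (p : F) ^ n) ∧ IsIntegral O (x / (p : F) ^ n)⁻¹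

/-- `u ∈ Z(A)ˣ` has `p`-valuation `n` in every Wedderburn component of `Z(K̄ ⊗ A) = K̄ ⊗ Z(A)`
(the components are given by the `K`-algebra homomorphisms `Z(A) → K̄`). -/
def HasValuationEverywhere (O K : Type*) {A : Type*} [CommRing O] [Field K] [Algebra O K]
    [Ring A] [Algebra K A] (p : ℕ) (n : ℤ) (u : (Subalgebra.center K A)ˣ) : Prop :=
  ∀ χ : Subalgebra.center K A →ₐ[K] AlgebraicClosure K,
    HasValuation O p n (χ (u : Subalgebra.center K A))

/-! ### The trace form and self-dual orders -/

section Orders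

variable (O K : Type*) {A : Type*} [CommRing O] [Field K] [Algebra O K]
  [Ring A] [Algebra K A] [Algebra O A] [IsScalarTower O K A]

/-- A Wedderburn decomposition of `K̄ ⊗ A`. -/
structure Splitting (K A : Type*) [Field K] [Ring A] [Algebra K A] where
  num : ℕ
  deg : Fin num → ℕ
  iso : (AlgebraicClosure K ⊗[K] A) ≃ₐ[AlgebraicClosure K]
    Π i, Matrix (Fin (deg i)) (Fin (deg i)) (AlgebraicClosure K)

open Classical in
/-- For a semisimple algebra `A = ⨁ Aᵢ` in characteristic zero with centre `⨁ Zᵢ`, the form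
`a ↦ ∑ᵢ tr_{Zᵢ/K} (tr.red._{Aᵢ/Zᵢ} aᵢ)`, regarded as an element of `K̄`. The reduced trace
of `Aᵢ` is by definition the matrix trace after extension of scalars to `K̄` along an embedding
`Zᵢ → K̄`, and `tr_{Zᵢ/K}` is the sum over the embeddings; so the form is the sum of the matrix
traces in the Wedderburn components of `K̄ ⊗ A`. It does not depend on the decomposition. -/
def reducedTrace (a : A) : AlgebraicClosure K :=
  if h : Nonempty (Splitting K A) then
    ∑ i, Matrix.trace (h.some.iso ((1 : AlgebraicClosure K) ⊗ₜ[K] a) i)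
  else 0

/-- The trace form `T_u(a) = ∑ᵢ tr_{Zᵢ/K} (tr.red.(uᵢ aᵢ))`. -/
def traceForm (u : (Subalgebra.center K A)ˣ) (a : A) : AlgebraicClosure K :=
  reducedTrace K ((u : Subalgebra.center K A) * a : A)

/-- A full `O`-order in the finite-dimensional `K`-algebra `A`. -/
structure IsFullOrder (Λ : Subalgebra O A) : Prop where
  fg : Λ.toSubmodule.FG
  span_eq_top : Submodule.span K (Λ : Set A) = ⊤

/-- `Λ` is self-dual with respect to `T_u`: `Λ = {a ∈ A | T_u(a Λ) ⊆ O}`. -/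
def IsSelfDual (u : (Subalgebra.center K A)ˣ) (Λ : Subalgebra O A) : Prop :=
  ∀ a : A, a ∈ Λ ↔ ∀ b ∈ Λ, ∃ c : O,
    traceForm K u (a * b) = algebraMap K (AlgebraicClosure K) (algebraMap O K c)

/-- The orders of the theorem: full `O`-orders in `A` that are self-dual with respect to `T_u`
and whose reduction is a split `k`-form of `B₀(k̄ Δ₂(p^f))`. -/
structure IsDelta2Order [IsLocalRing O] (p : ℕ) [Fact p.Prime] (f : ℕ)
    (u : (Subalgebra.center K A)ˣ) (Λ : Subalgebra O A) : Prop where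
  full : IsFullOrder O K Λ
  selfDual : IsSelfDual O K u Λ
  reduction : IsSplitFormDelta2 p f (IsLocalRing.ResidueField O)
    (IsLocalRing.ResidueField O ⊗[O] Λ)

/-- The Wedderburn component `εA` is one-dimensional over `K`: `εA = Kε`. -/
def IsLinear (ε : A) : Prop :=
  ∀ a : A, ∃ c : K, ε * a = c • ε

/-- `Λ` and `Λ'` are conjugate up to a permutation of the one-dimensional Wedderburn components
of `A`: there are a `K`-algebra automorphism `τ` of `A` that is the identity on every Wedderburn
component of dimension greater than one (so that `τ` just permutes the one-dimensional ones)
and a unit `y` of `A` with `Λ' = y τ(Λ) y⁻¹`. -/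
def ConjUpToLinear (Λ Λ' : Subalgebra O A) : Prop :=
  ∃ τ : A ≃ₐ[K] A,
    (∀ ε : A, IsCentralPrimitive ε → ¬ IsLinear K ε → ∀ a, τ (ε * a) = ε * a) ∧
    ∃ y : Aˣ, (Λ' : Set A) = (fun a => (y : A) * τ a * (↑y⁻¹ : A)) '' (Λ : Set A)

/-- An ordering of the Wedderburn components of `A` in which the ones of dimension greater than
one come last may end in `ε`. -/
def IsLast (ε : A) : Prop :=
  IsCentralPrimitive ε ∧ ∀ ε' : A, IsCentralPrimitive ε' → ε' ≠ ε → IsLinear K ε'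

/-- An ordering of the Wedderburn components of `A` in which the ones of dimension greater than
one come last may end in `ε₁, ε₂`. -/
def IsLastPair (ε₁ ε₂ : A) : Prop :=
  IsCentralPrimitive ε₁ ∧ IsCentralPrimitive ε₂ ∧ ε₁ ≠ ε₂ ∧
    ∀ ε : A, IsCentralPrimitive ε → ε ≠ ε₁ → ε ≠ ε₂ → IsLinear K ε

end Orders

end UniqueLifting

end

noncomputable section

namespace UniqueLifting

open Finset

/-! Put q = p^f, c = gcd(2, q-1) and q = cκ + 1. Over the algebraic closure of k the block is
explicit: the group algebra of the unipotent subgroup is a truncated divided power algebra with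
basis z_m, m < q, the torus acts on z_m through the square of its m-th power, and cutting by the
even characters leaves the basis e_i z_m, i in ℤ/κ, with e_i z_m = z_m e_{i+m}
(`exists_dividedPowerBasis_delta2`). By Lucas' theorem the z_{p^j} generate it over the idempotents.

An order Λ with this reduction inherits the shape (`exists_isCyclicOrder_of_form`). It has
idempotents ε_i and arrows X_{ij} from i to i + p^j. Every Peirce component is spanned by paths, and
a path that repeats one letter p times is divisible by p. A loop which uses every letter d = (p-1)/c
times generates the diagonal corner. Each Peirce component of A therefore has dimension at most c
off the diagonal and c + 1 on it. These bounds add up to dim A, and dim Z(A) ≥ κ + c, which forces A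
≅ K^κ × M_κ(R) with dim R = c ≤ 2 (`exists_blocks`, `exists_coordinates`).

In such coordinates Λ is described by elements of the commutative algebra R: loops y_i and arrows
(`mem_iff_coordinates`). Self-duality says that y_i O[y_i] is the dual of O[y_i] for the form T =
tr(u ·) on R and that y_i has norm p^f up to a unit. Orders in an algebra of dimension at most two
form a chain, so all O[y_i] are one order Γ, which depends only on T up to a unit of O, and each y_i
is unique up to units of Γ (`IsLoop.eq`). The p-fold repetition of an arrow of weight p^j is p times
an arrow of weight p^(j+1) times some g in Γ. Since p^f ≡ 1 mod κ the letters form a cycle, and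
comparing norms along it shows that g is a unit (`IsArrowSystem.exists_inverse`). Modulo the units
of Γ all arrows are thus determined by those of weight one, and these by their product around the
circle up to a diagonal change of frame (`IsArrowSystem.exists_frame`). Matching the coordinates of
two orders and conjugating by that frame gives `IsCyclicOrder.conjUpToLinear`. Only the R-component
of u up to units of O enters, which yields the addendum as well.

The argument needs κ ≥ 2. If κ = 1, then q is 2 or 3, A is commutative of dimension p and Λ is
local. Two such self-dual orders are then equal, because the trace takes values in pO on the order
they generate (`le_of_dual_of_local`). -/

/-- A presentation of an algebra by idempotents `e i` and commuting divided powers `z m` in which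
`z m` shifts the idempotents by `m`. -/
structure DividedPowerBasis (F : Type*) {B : Type*} [Field F] [Ring B] [Algebra F B]
    (q κ : ℕ) [NeZero κ] (e : ZMod κ → B) (z : ℕ → B) : Prop where
  e_mul : ∀ i j, e i * e j = if i = j then e i else 0
  e_sum : ∑ i, e i = 1
  z_zero : z 0 = 1
  z_mul : ∀ m n, z m * z n = ((m + n).choose m : F) • z (m + n)
  z_eq_zero : ∀ m, q ≤ m → z m = 0
  e_z : ∀ i (m : ℕ), e i * z m = z m * e (i + m)
  linearIndependent : LinearIndependent F (fun x : ZMod κ × Fin q => e x.1 * z x.2)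
  span_eq_top : Submodule.span F (Set.range (fun x : ZMod κ × Fin q => e x.1 * z x.2)) = ⊤

/-! ### The group algebra of a finite field as a divided power algebra. -/

section Vandermonde

variable {F 𝔽 : Type*} [Field F] [Field 𝔽] {q : ℕ} (σ : Fin q ≃ 𝔽) (ι : 𝔽 →+* F)

/-- The Vandermonde matrix of the images in `F` of the elements of a finite field. -/
def vdm : Matrix (Fin q) (Fin q) F := Matrix.vandermonde (fun i => ι (σ i))

theorem isUnit_det_vdm : IsUnit (vdm σ ι).det := by
  rw [isUnit_iff_ne_zero]
  exact Matrix.det_vandermonde_ne_zero_iff.2 (ι.injective.comp σ.injective)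

/-- Inverting the Vandermonde matrix shows that a polynomial of degree below q with vector
coefficients is determined by its values at the q points of 𝔽. All later comparisons of coefficients
go through this. -/
theorem eq_zero_of_forall_sum_pow_smul {C : Type*} [AddCommGroup C] [Module F C] (y : ℕ → C)
    (σ : Fin q ≃ 𝔽) (ι : 𝔽 →+* F)
    (h : ∀ b : 𝔽, ∑ m ∈ range q, ι b ^ m • y m = 0) (m : ℕ) (hm : m < q) : y m = 0 := by
  have h1 : ∑ i : Fin q, ∑ l : Fin q,
      ((vdm σ ι)⁻¹ ⟨m, hm⟩ i * (vdm σ ι) i l) • y l = 0 := by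
    refine sum_eq_zero fun i _ => ?_
    have := h (σ i)
    rw [← Fin.sum_univ_eq_sum_range (fun m => ι (σ i) ^ m • y m)] at this
    simp_rw [mul_smul, ← smul_sum]
    rw [show (∑ l : Fin q, vdm σ ι i l • y l) = 0 from this, smul_zero]
  rw [sum_comm] at h1
  simp_rw [← sum_smul] at h1
  have h2 : ∀ l, ∑ i, (vdm σ ι)⁻¹ ⟨m, hm⟩ i * (vdm σ ι) i l =
      (1 : Matrix (Fin q) (Fin q) F) ⟨m, hm⟩ l := by
    intro l
    rw [← Matrix.nonsing_inv_mul _ (isUnit_det_vdm σ ι), Matrix.mul_apply]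
  simp_rw [h2, Matrix.one_apply] at h1
  simpa using h1

/-- The divided powers attached to an exponential `u`. -/
def dividedPower {C : Type*} [AddCommGroup C] [Module F C] (u : 𝔽 → C) (m : ℕ) : C :=
  if hm : m < q then ∑ i, (vdm σ ι)⁻¹ ⟨m, hm⟩ i • u (σ i) else 0

/-- The divided powers are the coefficients of the truncated exponential `u b` = exp(bz), obtained
by interpolation. At b = 0 the convention 0^0 = 1 applies. -/
theorem sum_pow_smul_dividedPower {C : Type*} [AddCommGroup C] [Module F C] (u : 𝔽 → C) (b : 𝔽) :
    ∑ m ∈ range q, ι b ^ m • dividedPower σ ι u m = u b := by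
  obtain ⟨i, rfl⟩ := σ.surjective b
  rw [← Fin.sum_univ_eq_sum_range (fun m => ι (σ i) ^ m • dividedPower σ ι u m)]
  simp only [dividedPower, Fin.is_lt, dite_true, Fin.eta, smul_sum, smul_smul]
  rw [sum_comm]
  simp_rw [← sum_smul]
  have h2 : ∀ l, ∑ m : Fin q, ι (σ i) ^ (m : ℕ) * (vdm σ ι)⁻¹ m l =
      (1 : Matrix (Fin q) (Fin q) F) i l := by
    intro l
    rw [← Matrix.mul_nonsing_inv _ (isUnit_det_vdm σ ι), Matrix.mul_apply]
    rfl
  simp_rw [h2, Matrix.one_apply]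
  simp

theorem dividedPower_eq_zero {C : Type*} [AddCommGroup C] [Module F C] (u : 𝔽 → C) {m : ℕ}
    (hm : q ≤ m) : dividedPower σ ι u m = 0 := by
  rw [dividedPower, dif_neg (by omega)]

/-- Compare the coefficients of b^m c^n in u(b + c) = u(b)u(c). This is legitimate because both
exponents stay below q. -/
theorem dividedPower_mul {C : Type*} [Ring C] [Algebra F C] (u : 𝔽 → C)
    (hu : ∀ b c, u (b + c) = u b * u c) (m n : ℕ) :
    dividedPower σ ι u m * dividedPower σ ι u n =
      ((m + n).choose m : F) • dividedPower σ ι u (m + n) := by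
  set z := dividedPower σ ι u with hz
  have hz0 : ∀ m, q ≤ m → z m = 0 := fun m hm => dividedPower_eq_zero σ ι u hm
  by_cases hm : m < q
  swap
  · rw [hz0 m (by omega), hz0 (m + n) (by omega), zero_mul, smul_zero]
  by_cases hn : n < q
  swap
  · rw [hz0 n (by omega), hz0 (m + n) (by omega), mul_zero, smul_zero]
  have key : ∀ b c : 𝔽, ∑ m ∈ range q, ι b ^ m • ∑ n ∈ range q,
      ι c ^ n • (z m * z n - ((m + n).choose m : F) • z (m + n)) = 0 := by
    intro b c
    have h1 : ∑ m ∈ range q, ι b ^ m • ∑ n ∈ range q, ι c ^ n • (z m * z n) = u (b + c) := by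
      rw [hu, ← sum_pow_smul_dividedPower σ ι u b, ← sum_pow_smul_dividedPower σ ι u c, sum_mul]
      refine sum_congr rfl fun m _ => ?_
      rw [smul_mul_assoc, mul_sum]
      simp_rw [mul_smul_comm]
      rfl
    have h2 : ∑ m ∈ range q, ι b ^ m • ∑ n ∈ range q,
        ι c ^ n • (((m + n).choose m : F) • z (m + n)) = u (b + c) := by
      -- Terms with m + n ≥ q vanish, so the square of summation may be cut to a triangle and
      -- regrouped by m + n, where the binomial theorem applies.
      have h3 : ∀ m ∈ range q, ι b ^ m • ∑ n ∈ range q,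
          ι c ^ n • (((m + n).choose m : F) • z (m + n)) = ∑ n ∈ range (q - m),
            (ι b ^ m * ι c ^ n * ((m + n).choose m : F)) • z (m + n) := by
        intro m _
        rw [smul_sum]
        symm
        simp_rw [smul_smul, ← mul_assoc]
        refine sum_subset (fun x hx => ?_) fun x _ hx => ?_
        · simp only [mem_range] at hx ⊢; omega
        · simp only [mem_range] at hx
          rw [hz0 _ (by omega), smul_zero]
      rw [sum_congr rfl h3, ← sum_range_diag_flip q
        (fun m n => (ι b ^ m * ι c ^ n * ((m + n).choose m : F)) • z (m + n)),
        ← sum_pow_smul_dividedPower σ ι u (b + c)]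
      refine sum_congr rfl fun l _ => ?_
      rw [map_add, add_pow, sum_smul]
      refine sum_congr rfl fun k hk => ?_
      rw [mem_range] at hk
      rw [show k + (l - k) = l by omega]
    have h4 : ∀ m, ι b ^ m • ∑ n ∈ range q,
        ι c ^ n • (z m * z n - ((m + n).choose m : F) • z (m + n)) =
        ι b ^ m • (∑ n ∈ range q, ι c ^ n • (z m * z n)) - ι b ^ m • ∑ n ∈ range q,
        ι c ^ n • (((m + n).choose m : F) • z (m + n)) := by
      intro m
      simp_rw [smul_sub]
      rw [sum_sub_distrib, smul_sub]
    simp_rw [h4]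
    rw [sum_sub_distrib, h1, h2, sub_self]
  have h1 : ∀ c : 𝔽, ∑ n ∈ range q,
      ι c ^ n • (z m * z n - ((m + n).choose m : F) • z (m + n)) = 0 := fun c =>
    eq_zero_of_forall_sum_pow_smul _ σ ι (fun b => key b c) m hm
  exact sub_eq_zero.1 (eq_zero_of_forall_sum_pow_smul _ σ ι h1 n hn)

theorem dividedPower_zero {C : Type*} [Ring C] [Algebra F C] (u : 𝔽 → C) (hu : u 0 = 1)
    (hq : 0 < q) : dividedPower σ ι u 0 = 1 := by
  have := sum_pow_smul_dividedPower σ ι u 0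
  rw [hu, sum_eq_single 0] at this
  · simpa using this
  · intro b _ hb
    simp [hb]
  · intro h; simp [hq.ne'] at h

end Vandermonde

end UniqueLifting

end

noncomputable section

namespace UniqueLifting

open Finset

set_option linter.unusedSectionVars false

/-! ### Idempotents of the torus and their action on divided powers. -/

section Torus

variable {F 𝔽 : Type*} [Field F] [Field 𝔽] [Fintype 𝔽] {q κ : ℕ} [NeZero κ] (σ : Fin q ≃ 𝔽)
  (ι : 𝔽 →+* F) {C : Type*} [Ring C] [Algebra F C] (t : 𝔽ˣ →* C) (u : 𝔽 → C)

/-- The even characters of the torus. -/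
def torusChar (ι : 𝔽 →+* F) (i : ZMod κ) (a : 𝔽ˣ) : F := ι a ^ (2 * i.val)

/-- The idempotent of the torus on which `t a` acts by `a ^ (-2 i)`. -/
def torusIdem [DecidableEq 𝔽] (i : ZMod κ) : C := -∑ a : 𝔽ˣ, torusChar ι i a • t a

variable (hq : Fintype.card 𝔽 = q) (hκ : ∀ n : ℕ, q - 1 ∣ 2 * n ↔ κ ∣ n)

include hq hκ

/-- Even characters depend on the index modulo κ only, because q - 1 divides 2κ. -/
theorem torusChar_natCast (n : ℕ) (a : 𝔽ˣ) : torusChar ι (n : ZMod κ) a = ι a ^ (2 * n) := by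
  have h1 : (ι a) ^ (2 * κ) = 1 := by
    obtain ⟨s, hs⟩ := (hκ κ).2 dvd_rfl
    rw [hs, pow_mul, ← map_pow, ← hq, FiniteField.pow_card_sub_one_eq_one _ a.ne_zero,
      map_one, one_pow]
  rw [torusChar, ZMod.val_natCast]
  have h2 : 2 * n = 2 * (n % κ) + 2 * κ * (n / κ) := by
    conv_lhs => rw [← Nat.mod_add_div n κ]
    ring
  rw [h2, pow_add, pow_mul _ (2 * κ), h1, one_pow, mul_one]

theorem torusChar_add (i j : ZMod κ) (a : 𝔽ˣ) :
    torusChar ι (i + j) a = torusChar ι i a * torusChar ι j a := by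
  have : i + j = ((i.val + j.val : ℕ) : ZMod κ) := by simp
  rw [this, torusChar_natCast ι hq hκ, mul_add, pow_add]
  rfl

theorem torusChar_mul (i : ZMod κ) (a b : 𝔽ˣ) :
    torusChar ι i (a * b) = torusChar ι i a * torusChar ι i b := by
  simp [torusChar, mul_pow]

theorem torusChar_zero (a : 𝔽ˣ) : torusChar ι (0 : ZMod κ) a = 1 := by
  simp [torusChar]

/-- The order q - 1 of the torus equals -1 in F, which explains the sign in `torusIdem`. -/
theorem sum_torusChar [DecidableEq 𝔽] (i : ZMod κ) :
    ∑ a : 𝔽ˣ, torusChar ι i a = if i = 0 then -1 else 0 := by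
  have h := FiniteField.sum_pow_units 𝔽 (2 * i.val)
  have h2 : (q - 1 ∣ 2 * i.val) ↔ i = 0 := by
    rw [hκ, ← ZMod.natCast_eq_zero_iff, ZMod.natCast_val, ZMod.cast_id]
  rw [hq] at h
  simp only [h2] at h
  have := congrArg ι h
  simp only [map_sum, map_pow] at this
  simp only [torusChar]
  rw [this]
  split_ifs <;> simp

variable [DecidableEq 𝔽]

theorem t_mul_torusIdem (i : ZMod κ) (a : 𝔽ˣ) :
    torusChar ι i a • (t a * torusIdem ι t i) = torusIdem ι t i := by
  rw [torusIdem, mul_neg, smul_neg, mul_sum, smul_sum, neg_inj]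
  refine Fintype.sum_equiv (Equiv.mulLeft a) _ _ fun b => ?_
  rw [Equiv.coe_mulLeft, torusChar_mul ι hq hκ, map_mul, mul_smul_comm, smul_smul]

/-- Each `t a` acts on the j-th idempotent through the character of index -j, so the product reduces
to orthogonality of characters. -/
theorem torusIdem_mul (i j : ZMod κ) :
    (torusIdem ι t i : C) * torusIdem ι t j = if i = j then torusIdem ι t i else 0 := by
  have h1 : ∀ a, t a * torusIdem ι t j = torusChar ι (-j) a • torusIdem ι t j := by
    intro a
    conv_rhs => rw [← t_mul_torusIdem ι t hq hκ j a, smul_smul, ← torusChar_add ι hq hκ,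
      neg_add_cancel, torusChar_zero ι hq hκ, one_smul]
  conv_lhs => rw [torusIdem, neg_mul, sum_mul]
  simp_rw [smul_mul_assoc, h1, smul_smul, ← torusChar_add ι hq hκ]
  rw [← sum_smul, sum_torusChar ι hq hκ, ← sub_eq_add_neg]
  simp only [sub_eq_zero]
  split_ifs with h
  · simp [h]
  · simp

variable (htu : ∀ a b, t a * u b = u (a ^ 2 * b) * t a)

-- Comparing coefficients of b^m in t(a)u(b) = u(a²b)t(a) shows that the m-th divided power is a
-- weight vector for the even character of index m.
include htu in
theorem t_mul_dividedPower (a : 𝔽ˣ) (m : ℕ) :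
    t a * dividedPower σ ι u m = ι a ^ (2 * m) • (dividedPower σ ι u m * t a) := by
  by_cases hm : m < q
  swap
  · simp [dividedPower_eq_zero σ ι u (not_lt.1 hm)]
  have := eq_zero_of_forall_sum_pow_smul (fun m => t a * dividedPower σ ι u m -
    ι a ^ (2 * m) • (dividedPower σ ι u m * t a)) σ ι (fun b => ?_) m hm
  · exact sub_eq_zero.1 this
  · simp_rw [smul_sub]
    rw [sum_sub_distrib, sub_eq_zero]
    have h1 := congrArg (t a * ·) (sum_pow_smul_dividedPower σ ι u b)
    have h2 := congrArg (· * t a) (sum_pow_smul_dividedPower σ ι u (a ^ 2 * b))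
    simp only [mul_sum, sum_mul, mul_smul_comm, smul_mul_assoc, map_mul, map_pow, mul_pow] at h1 h2
    rw [h1, htu, ← h2]
    refine sum_congr rfl fun m _ => ?_
    rw [smul_smul, ← pow_mul, mul_comm]

include htu in
theorem torusIdem_mul_dividedPower (i : ZMod κ) (m : ℕ) :
    torusIdem ι t i * dividedPower σ ι u m =
      dividedPower σ ι u m * torusIdem ι t (i + (m : ZMod κ)) := by
  rw [torusIdem, torusIdem, neg_mul, mul_neg, sum_mul, mul_sum, neg_inj]
  refine sum_congr rfl fun a _ => ?_
  rw [smul_mul_assoc, t_mul_dividedPower σ ι t u hq hκ htu, smul_smul, mul_smul_comm,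
    torusChar_add ι hq hκ, torusChar_natCast ι hq hκ]

/-- The even idempotents need not span the torus algebra, so this is no mere change of basis.
Multiplying by one idempotent isolates a row, the group-basis coefficients at the identity of the
torus are read off, and the Vandermonde matrix is undone. -/
theorem linearIndependent_torusIdem_mul_dividedPower
    (hli : LinearIndependent F (fun x : 𝔽ˣ × 𝔽 => t x.1 * u x.2)) :
    LinearIndependent F (fun x : ZMod κ × Fin q => torusIdem ι t x.1 * dividedPower σ ι u x.2) := by
  rw [Fintype.linearIndependent_iff]
  intro c hc
  rintro ⟨i, l⟩
  have h1 : ∑ m : Fin q, c (i, m) • (torusIdem ι t i * dividedPower σ ι u m) = 0 := by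
    have := congrArg (torusIdem ι t i * ·) hc
    simp only [mul_sum, mul_zero, Fintype.sum_prod_type] at this
    rw [sum_eq_single i] at this
    · rw [← this]
      refine sum_congr rfl fun m _ => ?_
      rw [mul_smul_comm, ← mul_assoc, torusIdem_mul ι t hq hκ, if_pos rfl]
    · intro j _ hj
      refine sum_eq_zero fun m _ => ?_
      rw [mul_smul_comm, ← mul_assoc, torusIdem_mul ι t hq hκ, if_neg hj.symm, zero_mul, smul_zero]
    · simp
  have h2 : ∑ x : 𝔽ˣ × 𝔽, (torusChar ι i x.1 *
      ∑ m : Fin q, c (i, m) * (vdm σ ι)⁻¹ m (σ.symm x.2)) • (t x.1 * u x.2) = 0 := by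
    rw [Fintype.sum_prod_type, ← neg_eq_zero, ← h1]
    simp only [torusIdem, neg_mul, smul_neg, sum_neg_distrib, sum_mul, neg_inj, smul_sum]
    rw [sum_comm (s := (univ : Finset (Fin q)))]
    refine sum_congr rfl fun a _ => ?_
    simp only [dividedPower, Fin.is_lt, dite_true, Fin.eta, mul_sum, smul_sum, sum_smul]
    rw [sum_comm]
    refine sum_congr rfl fun m _ => ?_
    refine Fintype.sum_equiv σ.symm _ _ fun b => ?_
    rw [Equiv.apply_symm_apply, smul_mul_assoc, mul_smul_comm, smul_smul, smul_smul]
    congr 1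
    ring
  have h3 : ∀ b : Fin q, ∑ m : Fin q, c (i, m) * (vdm σ ι)⁻¹ m b = 0 := by
    intro b
    have := Fintype.linearIndependent_iff.1 hli _ h2 (1, σ b)
    simpa [torusChar] using this
  have h4 : Matrix.vecMul (fun m => c (i, m)) (vdm σ ι)⁻¹ = 0 := funext h3
  have h5 := congrArg (fun v => Matrix.vecMul v (vdm σ ι)) h4
  simp only [Matrix.vecMul_vecMul, Matrix.nonsing_inv_mul _ (isUnit_det_vdm σ ι),
    Matrix.vecMul_one, Matrix.zero_vecMul] at h5
  exact congrFun h5 l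

-- Commuting with the m-th divided power only shifts the index of the summands by m, so the full sum
-- is central.
omit hq hκ in
theorem sum_torusIdem_mul_comm (hq : Fintype.card 𝔽 = q) (hκ : ∀ n : ℕ, q - 1 ∣ 2 * n ↔ κ ∣ n)
    (htu : ∀ a b, t a * u b = u (a ^ 2 * b) * t a)
    (hspan : Submodule.span F (Set.range (fun x : 𝔽ˣ × 𝔽 => t x.1 * u x.2)) = ⊤) (x : C) :
    (∑ i : ZMod κ, torusIdem ι t i) * x = x * ∑ i : ZMod κ, torusIdem ι t i := by
  have hx : x ∈ Submodule.span F (Set.range (fun x : 𝔽ˣ × 𝔽 => t x.1 * u x.2)) := by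
    rw [hspan]; trivial
  have h1 : ∀ a, (∑ i : ZMod κ, torusIdem ι t i) * t a = t a * ∑ i : ZMod κ, torusIdem ι t i := by
    intro a
    rw [sum_mul, mul_sum]
    refine sum_congr rfl fun i _ => ?_
    rw [torusIdem, neg_mul, mul_neg, sum_mul, mul_sum]
    congr 1
    refine sum_congr rfl fun b _ => ?_
    rw [smul_mul_assoc, mul_smul_comm, ← map_mul, ← map_mul, mul_comm]
  obtain ⟨σ⟩ : Nonempty (Fin q ≃ 𝔽) := ⟨(Fintype.equivFinOfCardEq hq).symm⟩
  have h2 : ∀ b, (∑ i : ZMod κ, torusIdem ι t i) * u b = u b * ∑ i : ZMod κ, torusIdem ι t i := by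
    intro b
    rw [← sum_pow_smul_dividedPower σ ι u b, mul_sum, sum_mul]
    refine sum_congr rfl fun m _ => ?_
    rw [sum_mul, mul_sum]
    refine Fintype.sum_equiv (Equiv.addRight (m : ZMod κ)) _ _ fun i => ?_
    rw [Equiv.coe_addRight, mul_smul_comm, smul_mul_assoc,
      torusIdem_mul_dividedPower σ ι t u hq hκ htu]
  induction hx using Submodule.span_induction with
  | mem x hx =>
    obtain ⟨⟨a, b⟩, rfl⟩ := hx
    rw [← mul_assoc, h1, mul_assoc, h2, mul_assoc]
  | zero => simp
  | add x y _ _ hx hy => rw [mul_add, hx, hy, add_mul]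
  | smul c x _ hx => rw [mul_smul_comm, hx, smul_mul_assoc]

theorem sum_torusIdem_mul_mem_span
    (hspan : Submodule.span F (Set.range (fun x : 𝔽ˣ × 𝔽 => t x.1 * u x.2)) = ⊤) (x : C) :
    (∑ i : ZMod κ, torusIdem ι t i) * x ∈ Submodule.span F
      (Set.range (fun x : ZMod κ × Fin q => torusIdem ι t x.1 * dividedPower σ ι u x.2)) := by
  have hx : x ∈ Submodule.span F (Set.range (fun x : 𝔽ˣ × 𝔽 => t x.1 * u x.2)) := by
    rw [hspan]; trivial
  have h1 : ∀ (i : ZMod κ) a, torusIdem ι t i * t a = torusChar ι (-i) a • torusIdem ι t i := by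
    intro i a
    have h2 : torusIdem ι t i * t a = t a * torusIdem ι t i := by
      rw [torusIdem, neg_mul, mul_neg, sum_mul, mul_sum]
      congr 1
      refine sum_congr rfl fun b _ => ?_
      rw [smul_mul_assoc, mul_smul_comm, ← map_mul, ← map_mul, mul_comm]
    rw [h2]
    conv_rhs => rw [← t_mul_torusIdem ι t hq hκ i a, smul_smul, ← torusChar_add ι hq hκ,
      neg_add_cancel, torusChar_zero ι hq hκ, one_smul]
  induction hx using Submodule.span_induction with
  | mem x hx =>
    obtain ⟨⟨a, b⟩, rfl⟩ := hx
    simp only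
    rw [← sum_pow_smul_dividedPower σ ι u b, sum_mul]
    refine Submodule.sum_mem _ fun i _ => ?_
    rw [← mul_assoc, h1, mul_sum]
    refine Submodule.sum_mem _ fun m hm => ?_
    rw [mul_smul_comm, smul_mul_assoc]
    exact Submodule.smul_mem _ _ (Submodule.smul_mem _ _ (Submodule.subset_span
      ⟨(i, ⟨m, mem_range.1 hm⟩), rfl⟩))
  | zero => simp
  | add x y _ _ hx hy => rw [mul_add]; exact Submodule.add_mem _ hx hy
  | smul c x _ hx => rw [mul_smul_comm]; exact Submodule.smul_mem _ _ hx

end Torus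

end UniqueLifting

end

noncomputable section

namespace UniqueLifting

open Finset

set_option linter.unusedSectionVars false

/-! ### The degree filtration. -/

section Filtration

variable {F C : Type*} [Field F] [Ring C] [Algebra F C]

/-- The filtration of the divided power algebra by degree. -/
def dpFil (F : Type*) {C : Type*} [Field F] [Ring C] [Algebra F C] (z : ℕ → C) (n : ℕ) :
    Submodule F C :=
  Submodule.span F (z '' {l | n ≤ l})

theorem mem_dpFil {z : ℕ → C} {n l : ℕ} (h : n ≤ l) : z l ∈ dpFil F z n :=
  Submodule.subset_span ⟨l, h, rfl⟩

theorem dpFil_anti (z : ℕ → C) {m n : ℕ} (h : m ≤ n) : dpFil F z n ≤ dpFil F z m :=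
  Submodule.span_mono (Set.image_mono fun _ hl => le_trans h hl)

variable {z : ℕ → C}
  (hz : ∀ m n, z m * z n = ((m + n).choose m : F) • z (m + n))

include hz in
theorem dpFil_mul {m n : ℕ} {x y : C} (hx : x ∈ dpFil F z m) (hy : y ∈ dpFil F z n) :
    x * y ∈ dpFil F z (m + n) := by
  induction hx, hy using Submodule.span_induction₂ with
  | mem_mem x y hx hy =>
    obtain ⟨a, ha, rfl⟩ := hx
    obtain ⟨b, hb, rfl⟩ := hy
    rw [hz]
    exact Submodule.smul_mem _ _ (mem_dpFil (add_le_add ha hb))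
  | zero_left => simp
  | zero_right => simp
  | add_left x y w _ _ _ hx hy => rw [add_mul]; exact Submodule.add_mem _ hx hy
  | add_right x y w _ _ _ hx hy => rw [mul_add]; exact Submodule.add_mem _ hx hy
  | smul_left r x y _ _ h => rw [smul_mul_assoc]; exact Submodule.smul_mem _ _ h
  | smul_right r x y _ _ h => rw [mul_smul_comm]; exact Submodule.smul_mem _ _ h

include hz in
theorem dpFil_commute {m n : ℕ} {x y : C} (hx : x ∈ dpFil F z m) (hy : y ∈ dpFil F z n) :
    x * y = y * x := by
  induction hx, hy using Submodule.span_induction₂ with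
  | mem_mem x y hx hy =>
    obtain ⟨a, ha, rfl⟩ := hx
    obtain ⟨b, hb, rfl⟩ := hy
    rw [hz, hz, add_comm, Nat.choose_symm_add]
  | zero_left => simp
  | zero_right => simp
  | add_left x y w _ _ _ hx hy => rw [add_mul, mul_add, hx, hy]
  | add_right x y w _ _ _ hx hy => rw [add_mul, mul_add, hx, hy]
  | smul_left r x y _ _ h => rw [smul_mul_assoc, mul_smul_comm, h]
  | smul_right r x y _ _ h => rw [smul_mul_assoc, mul_smul_comm, h]

theorem dpFil_eq_bot {q : ℕ} (hz0 : ∀ m, q ≤ m → z m = 0) {n : ℕ} (hn : q ≤ n) :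
    dpFil F z n = ⊥ := by
  rw [dpFil, Submodule.span_eq_bot]
  rintro _ ⟨l, hl, rfl⟩
  exact hz0 _ (hn.trans hl)

theorem exists_of_mem_dpFil {n : ℕ} {x : C} (hx : x ∈ dpFil F z n) :
    ∃ a : F, ∃ t ∈ dpFil F z (n + 1), x = a • z n + t := by
  induction hx using Submodule.span_induction with
  | mem x hx =>
    obtain ⟨l, hl, rfl⟩ := hx
    rcases eq_or_lt_of_le (show n ≤ l from hl) with rfl | h
    · exact ⟨1, 0, Submodule.zero_mem _, by simp⟩
    · exact ⟨0, z l, mem_dpFil h, by simp⟩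
  | zero => exact ⟨0, 0, Submodule.zero_mem _, by simp⟩
  | add x y _ _ hx hy =>
    obtain ⟨a, t, ht, rfl⟩ := hx
    obtain ⟨b, s, hs, rfl⟩ := hy
    exact ⟨a + b, t + s, Submodule.add_mem _ ht hs, by rw [add_smul]; abel⟩
  | smul r x _ hx =>
    obtain ⟨a, t, ht, rfl⟩ := hx
    exact ⟨r * a, r • t, Submodule.smul_mem _ _ ht, by rw [smul_add, smul_smul]⟩

include hz in
theorem dpFil_pow {t : C} (ht : t ∈ dpFil F z 1) (h0 : z 0 = 1) (n : ℕ) :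
    t ^ n ∈ dpFil F z n := by
  induction n with
  | zero => rw [pow_zero, ← h0]; exact mem_dpFil le_rfl
  | succ n ih => rw [pow_succ]; exact dpFil_mul hz ih ht

end Filtration

/-! ### Primitivity of the sum of the even idempotents. -/

section Connected

variable {F C : Type*} [Field F] [Ring C] [Algebra F C] {q κ : ℕ} [NeZero κ]
  {e : ZMod κ → C} {z : ℕ → C}

/-- An idempotent presented by divided powers is centrally primitive. -/
theorem isCentralPrimitive_sum (hq : 2 ≤ q)
    (hee : ∀ i j, e i * e j = if i = j then e i else 0)
    (h0 : z 0 = 1)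
    (hz : ∀ m n, z m * z n = ((m + n).choose m : F) • z (m + n))
    (hz0 : ∀ m, q ≤ m → z m = 0)
    (hez : ∀ i (m : ℕ), e i * z m = z m * e (i + m))
    (hli : LinearIndependent F (fun x : ZMod κ × Fin q => e x.1 * z x.2))
    (hcomm : ∀ x, (∑ i, e i) * x = x * ∑ i, e i)
    (hspan : ∀ x, (∑ i, e i) * x ∈
      Submodule.span F (Set.range (fun x : ZMod κ × Fin q => e x.1 * z x.2))) :
    IsCentralPrimitive (∑ i, e i) := by
  have hne : ∀ i, ∀ m < q, e i * z m ≠ 0 := fun i m hm => hli.ne_zero (i, ⟨m, hm⟩)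
  have hE : ∀ i, e i * ∑ j, e j = e i := by
    intro i
    rw [mul_sum, sum_eq_single i] <;> simp +contextual [hee, eq_comm]
  have hcen : (∑ i, e i) ∈ Subring.center C := by
    rw [Subring.mem_center_iff]; intro g; exact (hcomm g).symm
  have hidem : IsIdempotentElem (∑ i, e i) := by
    rw [IsIdempotentElem, sum_mul]
    exact sum_congr rfl fun i _ => hE i
  refine ⟨hcen, hidem, ?_, ?_⟩
  · intro h
    have := hE 0
    rw [h, mul_zero] at this
    have h1 := hne 0 0 (by omega)
    rw [← this, zero_mul] at h1
    exact h1 rfl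
  -- dichotomy at each idempotent
  have hei : ∀ i x, ∃ s ∈ dpFil F z 0, e i * x = e i * s := by
    intro i x
    have h := hspan x
    have h2 : e i * x = e i * ((∑ j, e j) * x) := by rw [← mul_assoc, hE]
    rw [h2]
    generalize (∑ j, e j) * x = y at h
    induction h using Submodule.span_induction with
    | mem y hy =>
      obtain ⟨⟨j, m⟩, rfl⟩ := hy
      simp only [← mul_assoc, hee]
      split_ifs with h
      · exact ⟨z m, mem_dpFil (Nat.zero_le _), rfl⟩
      · exact ⟨0, Submodule.zero_mem _, by simp⟩
    | zero => exact ⟨0, Submodule.zero_mem _, by simp⟩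
    | add x y _ _ hx hy =>
      obtain ⟨s, hs, h1⟩ := hx
      obtain ⟨t, ht, h2⟩ := hy
      exact ⟨s + t, Submodule.add_mem _ hs ht, by rw [mul_add, h1, h2, mul_add]⟩
    | smul r x _ hx =>
      obtain ⟨s, hs, h1⟩ := hx
      exact ⟨r • s, Submodule.smul_mem _ _ hs, by rw [mul_smul_comm, h1, mul_smul_comm]⟩
  -- Multiplication by the top power `z (q - 1)` kills everything of positive degree but not `e i`,
  -- so it reads off the constant term.
  have hcoef : ∀ i (a : F), ∀ t ∈ dpFil F z 1, e i * (a • 1 + t) = 0 → a = 0 := by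
    intro i a t ht h
    have h1 : t * z (q - 1) = 0 := by
      have := dpFil_mul hz ht (mem_dpFil (F := F) (z := z) (le_refl (q - 1)))
      rw [dpFil_eq_bot hz0 (by omega)] at this
      simpa using this
    have h2 := congrArg (· * z (q - 1)) h
    simp only [mul_assoc, add_mul, h1, smul_mul_assoc, one_mul, add_zero, zero_mul,
      mul_smul_comm] at h2
    exact (smul_eq_zero.1 h2).resolve_right (hne i _ (by omega))
  -- Here `d * e i` is idempotent and equals `e i * t ^ n` for all n > 0. Positive degree makes t
  -- nilpotent.
  have hnil : ∀ d, (∀ x, d * x = x * d) → IsIdempotentElem d → ∀ i, ∀ t ∈ dpFil F z 1,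
      d * e i = e i * t → d * e i = 0 := by
    intro d hd hdi i t ht h
    have h1 : ∀ n, 0 < n → d * e i = e i * t ^ n := by
      intro n hn
      induction n, hn using Nat.le_induction with
      | base => simpa using h
      | succ n _ ih =>
        rw [pow_succ', ← mul_assoc, ← h, mul_assoc, ← ih, ← mul_assoc, hdi.eq]
    rw [h1 q (by omega)]
    have := dpFil_pow hz ht h0 q
    rw [dpFil_eq_bot hz0 le_rfl] at this
    rw [(Submodule.mem_bot F).1 this, mul_zero]
  intro d hd hdi hdE
  have hdc : ∀ x, d * x = x * d := fun x => (Subring.mem_center_iff.1 hd x).symm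
  -- The constant term a of d in row i satisfies a² = a. For a = 0 the previous step applies to d,
  -- for a = 1 it applies to 1 - d.
  have hdich : ∀ i, d * e i = 0 ∨ d * e i = e i := by
    intro i
    obtain ⟨s, hs, h⟩ := hei i d
    obtain ⟨a, t, ht, rfl⟩ := exists_of_mem_dpFil hs
    rw [zero_add] at ht
    rw [h0] at h
    have hde : d * e i = e i * (a • 1 + t) := by rw [hdc, h]
    have h2 : d * e i = e i * ((a • 1 + t) * (a • 1 + t)) := by
      rw [← mul_assoc, ← hde, mul_assoc, ← hde, ← mul_assoc, hdi.eq]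
    have h3 : e i * ((a * a - a) • 1 + (a • t + a • t + t * t - t)) = 0 := by
      have : (a * a - a) • (1 : C) + (a • t + a • t + t * t - t) =
          (a • 1 + t) * (a • 1 + t) - (a • 1 + t) := by
        simp only [add_mul, mul_add, smul_mul_assoc, mul_smul_comm, one_mul, mul_one, sub_smul,
          smul_smul, smul_add]
        abel
      rw [this, mul_sub, ← h2, ← hde, sub_self]
    have htt : t * t ∈ dpFil F z 1 := dpFil_anti z (Nat.le_add_left 1 1) (dpFil_mul hz ht ht)
    have h4 := hcoef i _ _ (Submodule.sub_mem _ (Submodule.add_mem _ (Submodule.add_mem _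
      (Submodule.smul_mem _ a ht) (Submodule.smul_mem _ a ht)) htt) ht) h3
    have h5 : a = 0 ∨ a = 1 := by
      have : a * (a - 1) = 0 := by linear_combination h4
      rcases mul_eq_zero.1 this with h | h
      · exact Or.inl h
      · exact Or.inr (sub_eq_zero.1 h)
    rcases h5 with rfl | rfl
    · left
      exact hnil d hdc hdi i t ht (by rw [hde, zero_smul, zero_add])
    · right
      have := hnil (1 - d) (fun x => by rw [sub_mul, mul_sub, hdc, one_mul, mul_one])
        hdi.one_sub i (-t) (Submodule.neg_mem _ ht) (by
          rw [sub_mul, hde, one_smul, mul_add, mul_one, one_mul, mul_neg]; abel)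
      rw [sub_mul, one_mul, sub_eq_zero] at this
      exact this.symm
  -- The nonzero element `e i * z 1` links neighbouring idempotents, so d cannot separate them.
  -- Going around ℤ/κ reaches all of them.
  have hstep : ∀ i, d * e i = e i → d * e (i + 1) = e (i + 1) := by
    intro i hi
    refine (hdich (i + 1)).resolve_left fun h => ?_
    apply hne i 1 (by omega)
    rw [← hi, mul_assoc, hez, Nat.cast_one, ← mul_assoc, hdc (z 1), mul_assoc, h, mul_zero]
  by_cases hall : ∀ i, d * e i = 0
  · left
    rw [← hdE, mul_sum]
    exact sum_eq_zero fun i _ => hall i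
  · right
    push Not at hall
    obtain ⟨i, hi⟩ := hall
    have h1 : ∀ n : ℕ, d * e (i + n) = e (i + n) := by
      intro n
      induction n with
      | zero => simpa using (hdich i).resolve_left hi
      | succ n ih => rw [Nat.cast_succ, ← add_assoc]; exact hstep _ ih
    rw [← hdE, mul_sum]
    refine sum_congr rfl fun j _ => ?_
    have := h1 (j - i).val
    rwa [ZMod.natCast_val, ZMod.cast_id', id, add_sub_cancel] at this

end Connected

end UniqueLifting

end

noncomputable section

namespace UniqueLifting

open Finset

set_option linter.unusedSectionVars false

/-! ### Unique factorisation into a torus element and a unipotent one. -/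

section Group

variable {𝔽 : Type*} [Field 𝔽]

/-- The diagonal torus of the group of upper triangular matrices. -/
def torusHom : 𝔽ˣ →* upperTriangularSL2 𝔽 where
  toFun a := ⟨⟨!![(a : 𝔽), 0; 0, (a⁻¹ : 𝔽ˣ)], by simp [Matrix.det_fin_two]⟩, by
    change (!![(a : 𝔽), 0; 0, (a⁻¹ : 𝔽ˣ)]) 1 0 = 0
    simp⟩
  map_one' := by
    ext i j
    fin_cases i <;> fin_cases j <;> simp
  map_mul' a b := by
    refine Subtype.ext (Subtype.ext ?_)
    change !![((a * b : 𝔽ˣ) : 𝔽), 0; 0, ((a * b)⁻¹ : 𝔽ˣ)] =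
      !![(a : 𝔽), 0; 0, (a⁻¹ : 𝔽ˣ)] * !![(b : 𝔽), 0; 0, (b⁻¹ : 𝔽ˣ)]
    rw [Matrix.mul_fin_two]
    simp [mul_comm]

/-- The unipotent upper triangular matrices. -/
def unipotent (b : 𝔽) : upperTriangularSL2 𝔽 :=
  ⟨⟨!![1, b; 0, 1], by simp [Matrix.det_fin_two]⟩, by
    change (!![1, b; 0, 1]) 1 0 = 0
    simp⟩

theorem unipotent_zero : unipotent (0 : 𝔽) = 1 := by
  ext i j
  fin_cases i <;> fin_cases j <;> simp [unipotent]

theorem unipotent_add (b c : 𝔽) : unipotent (b + c) = unipotent b * unipotent c := by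
  refine Subtype.ext (Subtype.ext ?_)
  change !![1, b + c; 0, 1] = !![1, b; 0, 1] * !![1, c; 0, 1]
  rw [Matrix.mul_fin_two]
  simp [add_comm]

theorem torusHom_mul_unipotent (a : 𝔽ˣ) (b : 𝔽) :
    torusHom a * unipotent b = unipotent ((a : 𝔽) ^ 2 * b) * torusHom a := by
  refine Subtype.ext (Subtype.ext ?_)
  change !![(a : 𝔽), 0; 0, (a⁻¹ : 𝔽ˣ)] * !![1, b; 0, 1] =
    !![1, (a : 𝔽) ^ 2 * b; 0, 1] * !![(a : 𝔽), 0; 0, (a⁻¹ : 𝔽ˣ)]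
  rw [Matrix.mul_fin_two, Matrix.mul_fin_two]
  simp only [mul_one, mul_zero, add_zero, zero_add, one_mul, zero_mul]
  rw [show (a : 𝔽) ^ 2 * b * ((a⁻¹ : 𝔽ˣ) : 𝔽) = a * b by
    rw [Units.val_inv_eq_inv_val]; field_simp]

theorem bijective_torusHom_mul_unipotent :
    Function.Bijective (fun x : 𝔽ˣ × 𝔽 => torusHom x.1 * unipotent x.2) := by
  constructor
  · rintro ⟨a, b⟩ ⟨a', b'⟩ h
    have h0 : !![(a : 𝔽), 0; 0, (a⁻¹ : 𝔽ˣ)] * !![1, b; 0, 1] =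
        !![(a' : 𝔽), 0; 0, (a'⁻¹ : 𝔽ˣ)] * !![1, b'; 0, 1] :=
      congrArg (fun g : upperTriangularSL2 𝔽 => g.1.1) h
    rw [Matrix.mul_fin_two, Matrix.mul_fin_two] at h0
    have h1 := congrFun (congrFun h0 0) 0
    have h2 := congrFun (congrFun h0 0) 1
    simp at h1 h2
    obtain rfl := Units.ext h1
    simpa using h2
  · intro g
    have h10 : g.1.1 1 0 = 0 := g.2
    have hdet : g.1.1 0 0 * g.1.1 1 1 = 1 := by
      have := g.1.2
      rw [Matrix.det_fin_two, h10, mul_zero, sub_zero] at this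
      exact this
    refine ⟨⟨⟨g.1.1 0 0, g.1.1 1 1, hdet, by rw [mul_comm, hdet]⟩, g.1.1 1 1 * g.1.1 0 1⟩, ?_⟩
    refine Subtype.ext (Subtype.ext ?_)
    change !![g.1.1 0 0, 0; 0, g.1.1 1 1] * !![1, g.1.1 1 1 * g.1.1 0 1; 0, 1] = g.1.1
    rw [Matrix.mul_fin_two, Matrix.eta_fin_two g.1.1, h10]
    simp [← mul_assoc, hdet]

end Group

/-! ### Identification of the principal block. -/

section Block

variable {F 𝔽 : Type*} [Field F] [Field 𝔽] [Fintype 𝔽] [DecidableEq 𝔽]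

/-- The sum E of the even torus idempotents is central and primitive and has augmentation one, so it
is the block idempotent. The relations and the basis are transported along x ↦ Ex, which is
multiplicative because E is central. -/
theorem exists_dividedPowerBasis_principalBlock {q κ : ℕ} [NeZero κ] (ι : 𝔽 →+* F)
    (hq : Fintype.card 𝔽 = q)
    (hκ : ∀ n : ℕ, q - 1 ∣ 2 * n ↔ κ ∣ n) [Finite (upperTriangularSL2 𝔽)] :
    ∃ (e : ZMod κ → PrincipalBlock F (upperTriangularSL2 𝔽))
      (z : ℕ → PrincipalBlock F (upperTriangularSL2 𝔽)), DividedPowerBasis F q κ e z := by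
  classical
  set G := upperTriangularSL2 𝔽
  have hq2 : 2 ≤ q := hq ▸ Fintype.one_lt_card
  obtain ⟨σ⟩ : Nonempty (Fin q ≃ 𝔽) := ⟨(Fintype.equivFinOfCardEq hq).symm⟩
  let t : 𝔽ˣ →* MonoidAlgebra F G := (MonoidAlgebra.of F G).comp torusHom
  let u : 𝔽 → MonoidAlgebra F G := fun b => MonoidAlgebra.of F G (unipotent b)
  have hu0 : u 0 = 1 := by simp only [u, unipotent_zero, map_one]
  have hadd : ∀ b c, u (b + c) = u b * u c := fun b c => by
    simp only [u, unipotent_add, map_mul]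
  have htu : ∀ a b, t a * u b = u (a ^ 2 * b) * t a := fun a b => by
    simp only [t, u, MonoidHom.comp_apply, ← map_mul]
    rw [torusHom_mul_unipotent]
  let bs := (MonoidAlgebra.basis G F).reindex
    (Equiv.ofBijective _ (bijective_torusHom_mul_unipotent (𝔽 := 𝔽))).symm
  have hbs : ⇑bs = fun x : 𝔽ˣ × 𝔽 => t x.1 * u x.2 := by
    funext x
    simp only [bs, t, u, MonoidHom.comp_apply, ← map_mul]
    simp [MonoidAlgebra.of_apply]
  have hli : LinearIndependent F (fun x : 𝔽ˣ × 𝔽 => t x.1 * u x.2) :=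
    hbs ▸ bs.linearIndependent
  have hspan : Submodule.span F (Set.range (fun x : 𝔽ˣ × 𝔽 => t x.1 * u x.2)) = ⊤ :=
    hbs ▸ bs.span_eq
  set e : ZMod κ → MonoidAlgebra F G := torusIdem ι t with he
  set z : ℕ → MonoidAlgebra F G := dividedPower σ ι u with hzdef
  have hee : ∀ i j, e i * e j = if i = j then e i else 0 := torusIdem_mul ι t hq hκ
  have hz0 : z 0 = 1 := dividedPower_zero σ ι u hu0 (by omega)
  have hzz : ∀ m n, z m * z n = ((m + n).choose m : F) • z (m + n) :=
    dividedPower_mul σ ι u hadd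
  have hzq : ∀ m, q ≤ m → z m = 0 := fun m hm => dividedPower_eq_zero σ ι u hm
  have hez : ∀ i (m : ℕ), e i * z m = z m * e (i + m) :=
    torusIdem_mul_dividedPower σ ι t u hq hκ htu
  have hli2 := linearIndependent_torusIdem_mul_dividedPower (κ := κ) σ ι t u hq hκ hli
  have hcomm := sum_torusIdem_mul_comm (κ := κ) ι t u hq hκ htu hspan
  have hspan2 := sum_torusIdem_mul_mem_span (κ := κ) σ ι t u hq hκ hspan
  set E := ∑ i, e i with hE
  have heE : ∀ i, e i * E = e i := by
    intro i
    rw [hE, mul_sum, sum_eq_single i] <;> simp +contextual [hee, eq_comm]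
  have hEe : ∀ i, E * e i = e i := fun i => (hcomm (e i)).trans (heE i)
  have hEE : E * E = E := by
    conv_lhs => rw [hE, sum_mul]
    exact sum_congr rfl fun i _ => heE i
  have hblock : IsPrincipalBlockIdempotent F G E := by
    refine ⟨isCentralPrimitive_sum hq2 hee hz0 hzz hzq hez hli2 hcomm hspan2, ?_⟩
    -- Under the augmentation every torus element becomes 1, and orthogonality of characters leaves
    -- only the index 0.
    have h1 : ∀ i, augmentation F G (e i) = if i = 0 then 1 else 0 := by
      intro i
      have h2 : ∀ a, augmentation F G (t a) = 1 := by
        intro a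
        simp [t, augmentation, MonoidAlgebra.of_apply]
      simp only [e, torusIdem, map_neg, map_sum, map_smul, h2, smul_eq_mul, mul_one]
      rw [sum_torusChar ι hq hκ]
      split_ifs <;> simp
    simp [E, map_sum, h1]
  have hEb : principalBlockIdempotent F G = E :=
    IsPrincipalBlockIdempotent.unique F G (principalBlockIdempotent_spec F G) hblock
  have hmem : ∀ x, E * x ∈ Subsemigroup.corner (principalBlockIdempotent F G) := by
    intro x
    rw [PrincipalBlock.mem_iff, hEb]
    exact ⟨by rw [← mul_assoc, hEE], by rw [mul_assoc, ← hcomm, ← mul_assoc, hEE]⟩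
  let mk : MonoidAlgebra F G → PrincipalBlock F G := fun x => ⟨E * x, hmem x⟩
  have mk_val : ∀ x, (mk x).val = E * x := fun x => rfl
  have val_inj : ∀ x y : PrincipalBlock F G, x.val = y.val → x = y := fun x y h => Subtype.ext h
  have val_mul : ∀ x y : PrincipalBlock F G, (x * y).val = x.val * y.val := fun _ _ => rfl
  have val_add : ∀ x y : PrincipalBlock F G, (x + y).val = x.val + y.val := fun _ _ => rfl
  have val_smul : ∀ (c : F) (y : PrincipalBlock F G), (c • y).val = c • y.val := fun _ _ => rfl
  have val_zero : (0 : PrincipalBlock F G).val = 0 := rfl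
  have val_one : (1 : PrincipalBlock F G).val = E := hEb
  have mk_mul : ∀ x y, mk x * mk y = mk (x * y) := by
    intro x y
    apply val_inj
    rw [val_mul, mk_val, mk_val, mk_val, mul_assoc, ← mul_assoc x, ← hcomm x, mul_assoc,
      ← mul_assoc E E, hEE]
  let val : PrincipalBlock F G →ₗ[F] MonoidAlgebra F G :=
    { toFun := PrincipalBlock.val F G, map_add' := val_add, map_smul' := val_smul }
  let mkl : MonoidAlgebra F G →ₗ[F] PrincipalBlock F G :=
    { toFun := mk
      map_add' := fun x y => val_inj _ _ (by rw [val_add, mk_val, mk_val, mk_val, mul_add])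
      map_smul' := fun c x => val_inj _ _ (by
        rw [val_smul, mk_val, mk_val, RingHom.id_apply, mul_smul_comm]) }
  have hval : ∀ x : PrincipalBlock F G, E * x.val = x.val := fun x =>
    hEb ▸ ((PrincipalBlock.mem_iff F G x.1).1 x.2).1
  have hmkval : ∀ x : PrincipalBlock F G, mk x.val = x := fun x => val_inj _ _ (hval x)
  have hmkez : ∀ x : ZMod κ × Fin q, mk (e x.1) * mk (z x.2) = mkl (e x.1 * z x.2) :=
    fun x => mk_mul _ _
  refine ⟨fun i => mk (e i), fun m => mk (z m), ?_, ?_, ?_, ?_, ?_, ?_, ?_, ?_⟩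
  · intro i j
    rw [mk_mul, hee]
    split_ifs
    · rfl
    · exact map_zero mkl
  · change ∑ i, mkl (e i) = 1
    rw [← map_sum]
    exact val_inj _ _ (by rw [val_one]; exact hEE)
  · exact val_inj _ _ (by rw [val_one, hz0, mk_val, mul_one])
  · intro m n
    rw [mk_mul, hzz]
    exact map_smul mkl _ _
  · intro m hm
    simp only [hzq m hm]
    exact map_zero mkl
  · intro i m
    rw [mk_mul, mk_mul, hez]
  · simp_rw [hmkez]
    have : LinearIndependent F (val ∘ (fun x : ZMod κ × Fin q => mkl (e x.1 * z x.2))) := by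
      have h : (val ∘ fun x : ZMod κ × Fin q => mkl (e x.1 * z x.2)) =
          fun x : ZMod κ × Fin q => torusIdem ι t x.1 * dividedPower σ ι u x.2 := by
        funext x
        change E * (e x.1 * z x.2) = _
        rw [← mul_assoc, hEe]
      rw [h]
      exact hli2
    exact LinearIndependent.of_comp val this
  · simp_rw [hmkez]
    rw [eq_top_iff]
    intro x _
    rw [Set.range_comp' mkl, ← Submodule.map_span]
    refine ⟨_, hspan2 x.val, ?_⟩
    change mk (E * x.val) = x
    rw [hval, hmkval]

/-- For p = 2 the number κ = q - 1 is odd and the factor 2 may be cancelled. For odd p one has q - 1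
= 2κ. -/
theorem dvd_two_mul_iff {p f c κ q : ℕ} (hp : p.Prime) (hf : 1 ≤ f) (hpq : q = p ^ f)
    (hq : q = c * κ + 1) (hc : c = 1 ∧ p = 2 ∨ c = 2 ∧ p ≠ 2) (n : ℕ) :
    q - 1 ∣ 2 * n ↔ κ ∣ n := by
  have h1 : q - 1 = c * κ := by omega
  rw [h1]
  rcases hc with ⟨rfl, rfl⟩ | ⟨rfl, -⟩
  · rw [one_mul]
    have h2 : Nat.Coprime κ 2 := by
      rw [Nat.coprime_two_right, ← Nat.not_even_iff_odd]
      intro h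
      have h3 : Even q := by rw [hpq]; exact (even_two).pow_of_ne_zero (by omega)
      rw [Nat.even_iff] at h h3
      omega
    exact h2.dvd_mul_left
  · exact Nat.mul_dvd_mul_iff_left two_pos

theorem exists_dividedPowerBasis_delta2 (p : ℕ) [Fact p.Prime] {f c κ q : ℕ} [NeZero κ]
    (hf : 1 ≤ f) (hpq : q = p ^ f)
    (hq : q = c * κ + 1) (hc : c = 1 ∧ p = 2 ∨ c = 2 ∧ p ≠ 2) (F : Type*) [Field F] [CharP F p]
    [IsAlgClosed F] : ∃ e z : _ → PrincipalBlock F (Delta2 p f), DividedPowerBasis F q κ e z := by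
  classical
  let := ZMod.algebra F p
  let ι : GaloisField p f →+* F := (IsAlgClosed.lift (R := ZMod p) (M := F)
    (S := GaloisField p f)).toRingHom
  let : Fintype (GaloisField p f) := Fintype.ofFinite _
  refine exists_dividedPowerBasis_principalBlock ι ?_
    (dvd_two_mul_iff (Fact.out : p.Prime) hf hpq hq hc)
  rw [← Nat.card_eq_fintype_card, GaloisField.card p f (by omega), hpq]

end Block

end UniqueLifting

end

noncomputable section

namespace UniqueLifting

open Finset

set_option linter.unusedSectionVars false

/-! ### Rows, characters, radical and centre of the block. -/

namespace DividedPowerBasis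

variable {F B : Type*} [Field F] [Ring B] [Algebra F B] {q κ : ℕ} [NeZero κ]
  {e : ZMod κ → B} {z : ℕ → B} (h : DividedPowerBasis F q κ e z)

include h

theorem e_mul_self (i : ZMod κ) : e i * e i = e i := by rw [h.e_mul, if_pos rfl]

theorem e_mul_ne {i j : ZMod κ} (hij : i ≠ j) : e i * e j = 0 := by rw [h.e_mul, if_neg hij]

theorem e_z_e (i j : ZMod κ) (m : ℕ) : e i * z m * e j = if i + m = j then e i * z m else 0 := by
  rw [h.e_z, mul_assoc, h.e_mul]
  split_ifs with h1
  · rfl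
  · rw [mul_zero]

/-- The basis of a divided power algebra. -/
def basis : Module.Basis (ZMod κ × Fin q) F B :=
  Module.Basis.mk h.linearIndependent h.span_eq_top.ge

theorem basis_apply (x : ZMod κ × Fin q) : h.basis x = e x.1 * z x.2 := by
  simp [basis]

theorem finite : Module.Finite F B := Module.Finite.of_basis h.basis

theorem finrank_eq : Module.finrank F B = κ * q := by
  rw [Module.finrank_eq_card_basis h.basis]
  simp [ZMod.card]

theorem mul_mul_e_z (i j : ZMod κ) (m n : ℕ) : e i * z m * (e j * z n) =
    if i + m = j then ((m + n).choose m : F) • (e i * z (m + n)) else 0 := by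
  rw [← mul_assoc, h.e_z_e]
  split_ifs
  · rw [mul_assoc, h.z_mul, mul_smul_comm]
  · rw [zero_mul]

/-- An induction principle: every element is a combination of the basis. -/
theorem induction_basis {P : B → Prop} (x : B) (h0 : P 0) (hadd : ∀ x y, P x → P y → P (x + y))
    (hsmul : ∀ (c : F) x, P x → P (c • x)) (hb : ∀ i, ∀ m < q, P (e i * z m)) : P x := by
  have hx : x ∈ Submodule.span F (Set.range (fun x : ZMod κ × Fin q => e x.1 * z x.2)) := by
    rw [h.span_eq_top]; trivial
  induction hx using Submodule.span_induction with
  | mem x hx => obtain ⟨⟨i, m⟩, rfl⟩ := hx; exact hb i m m.2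
  | zero => exact h0
  | add x y _ _ hx hy => exact hadd x y hx hy
  | smul c x _ hx => exact hsmul c x hx

/-- Every row is the image of the divided power algebra. -/
theorem exists_row (i : ZMod κ) (x : B) : ∃ s ∈ dpFil F z 0, e i * x = e i * s := by
  induction x using h.induction_basis with
  | h0 => exact ⟨0, Submodule.zero_mem _, rfl⟩
  | hadd x y hx hy =>
    obtain ⟨s, hs, h1⟩ := hx
    obtain ⟨t, ht, h2⟩ := hy
    exact ⟨s + t, Submodule.add_mem _ hs ht, by rw [mul_add, h1, h2, mul_add]⟩
  | hsmul c x hx =>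
    obtain ⟨s, hs, h1⟩ := hx
    exact ⟨c • s, Submodule.smul_mem _ _ hs, by rw [mul_smul_comm, h1, mul_smul_comm]⟩
  | hb j m hm =>
    rw [← mul_assoc, h.e_mul]
    split_ifs
    · exact ⟨z m, mem_dpFil (Nat.zero_le _), rfl⟩
    · exact ⟨0, Submodule.zero_mem _, by simp⟩

/-- The one-dimensional representations. -/
theorem exists_chi (hq : 0 < q) (i : ZMod κ) : ∃ χ : B →ₐ[F] F, ∀ j m, χ (e j * z m) =
    if j = i ∧ m = 0 then 1 else 0 := by
  classical
  have hlow : ∀ j m, h.basis.repr (e j * z m) = if hm : m < q then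
      Finsupp.single (j, ⟨m, hm⟩) 1 else 0 := by
    intro j m
    split_ifs with hm
    · rw [← h.basis.repr_self, h.basis_apply]
    · rw [h.z_eq_zero m (not_lt.1 hm), mul_zero, map_zero]
  let χ : B →ₗ[F] F := (Finsupp.lapply (i, (⟨0, hq⟩ : Fin q))).comp h.basis.repr.toLinearMap
  have hχ : ∀ j m, χ (e j * z m) = if j = i ∧ m = 0 then 1 else 0 := by
    intro j m
    simp only [χ, LinearMap.comp_apply, LinearEquiv.coe_coe, hlow]
    split_ifs with hm h1 h1
    · obtain ⟨rfl, rfl⟩ := h1; simp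
    · rw [Finsupp.lapply_apply, Finsupp.single_apply, if_neg]
      rintro ⟨⟩
      exact h1 ⟨rfl, rfl⟩
    · omega
    · simp
  refine ⟨AlgHom.ofLinearMap χ ?_ ?_, hχ⟩
  · rw [← h.e_sum, map_sum, sum_eq_single i]
    · have := hχ i 0
      rwa [h.z_zero, mul_one, if_pos ⟨rfl, rfl⟩] at this
    · intro j _ hj
      have := hχ j 0
      rwa [h.z_zero, mul_one, if_neg (fun h => hj h.1)] at this
    · simp
  · intro x y
    induction x using h.induction_basis with
    | h0 => simp
    | hadd x x' hx hx' => rw [add_mul, map_add, hx, hx', map_add, add_mul]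
    | hsmul c x hx => rw [smul_mul_assoc, map_smul, hx, map_smul, smul_mul_assoc]
    | hb j m hm =>
      induction y using h.induction_basis with
      | h0 => simp
      | hadd x x' hx hx' => rw [mul_add, map_add, hx, hx', map_add, mul_add]
      | hsmul c x hx => rw [mul_smul_comm, map_smul, hx, map_smul, mul_smul_comm]
      | hb l n hn =>
        rw [h.mul_mul_e_z, hχ, hχ]
        by_cases hm0 : m = 0
        · subst hm0
          simp only [Nat.cast_zero, add_zero, and_true, zero_add, Nat.choose_zero_right,
            Nat.cast_one, one_smul]
          by_cases h1 : j = l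
          · subst h1
            rw [if_pos rfl, hχ]
            by_cases h2 : j = i <;> simp [h2]
          · rw [if_neg h1, map_zero]
            by_cases h2 : j = i
            · rw [if_pos h2, if_neg (show ¬(l = i ∧ n = 0) from fun h => h1 (h2.trans h.1.symm)), mul_zero]
            · rw [if_neg h2, zero_mul]
        · rw [if_neg (show ¬(j = i ∧ m = 0) from fun h => hm0 h.2), zero_mul]
          split_ifs with h1
          · rw [map_smul, hχ, if_neg (by omega), smul_zero]
          · simp

/-- Moving `e i` past `z l` turns it into `e (i + l)`, which is why x has to be controlled in all
rows at once. Degrees add although x need not commute with the `z l`. -/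
theorem dpFil_e (i : ZMod κ) {n : ℕ} {s x : B} (hs : s ∈ dpFil F z n) {m : ℕ}
    (hx : ∀ i, ∃ t ∈ dpFil F z m, e i * x = e i * t) :
    ∃ t ∈ dpFil F z (n + m), e i * s * x = e i * t := by
  induction hs using Submodule.span_induction with
  | mem s hs =>
    obtain ⟨l, hl, rfl⟩ := hs
    obtain ⟨t, ht, h1⟩ := hx (i + l)
    refine ⟨z l * t, dpFil_mul h.z_mul (mem_dpFil hl) ht, ?_⟩
    rw [h.e_z, mul_assoc, h1, ← mul_assoc, ← h.e_z, mul_assoc]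
  | zero => exact ⟨0, Submodule.zero_mem _, by simp⟩
  | add s s' _ _ hs hs' =>
    obtain ⟨t, ht, h1⟩ := hs
    obtain ⟨t', ht', h2⟩ := hs'
    exact ⟨t + t', Submodule.add_mem _ ht ht', by rw [mul_add, add_mul, h1, h2, mul_add]⟩
  | smul c s _ hs =>
    obtain ⟨t, ht, h1⟩ := hs
    exact ⟨c • t, Submodule.smul_mem _ _ ht, by
      rw [mul_smul_comm, smul_mul_assoc, h1, mul_smul_comm]⟩

theorem ext_rows {x y : B} (hxy : ∀ i, e i * x = e i * y) : x = y := by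
  rw [← one_mul x, ← one_mul y, ← h.e_sum, sum_mul, sum_mul]
  exact sum_congr rfl fun i _ => hxy i

theorem pow_eq_zero_of_rows {x : B} (hx : ∀ i, ∃ t ∈ dpFil F z 1, e i * x = e i * t) :
    x ^ q = 0 := by
  have h1 : ∀ n i, ∃ t ∈ dpFil F z n, e i * x ^ n = e i * t := by
    intro n
    induction n with
    | zero => exact fun i => ⟨z 0, mem_dpFil le_rfl, by rw [h.z_zero, pow_zero]⟩
    | succ n ih =>
      intro i
      obtain ⟨t, ht, h2⟩ := ih i
      obtain ⟨s, hs, h3⟩ := h.dpFil_e i ht hx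
      exact ⟨s, hs, by rw [pow_succ, ← mul_assoc, h2, h3]⟩
  refine h.ext_rows fun i => ?_
  obtain ⟨t, ht, h2⟩ := h1 q i
  rw [dpFil_eq_bot h.z_eq_zero le_rfl] at ht
  rw [h2, (Submodule.mem_bot F).1 ht]

/-- The value of χ_i is the constant term of row i. If all of them vanish, every row has positive
degree, and each further factor raises the degree until it reaches q. -/
theorem pow_eq_zero_of_chi {χ : ZMod κ → B →ₐ[F] F} (hχ : ∀ i j m, χ i (e j * z m) =
    if j = i ∧ m = 0 then 1 else 0) {x : B} (hx : ∀ i, χ i x = 0) : x ^ q = 0 := by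
  refine h.pow_eq_zero_of_rows fun i => ?_
  obtain ⟨s, hs, h1⟩ := h.exists_row i x
  obtain ⟨a, t, ht, rfl⟩ := exists_of_mem_dpFil hs
  refine ⟨t, ht, ?_⟩
  have h2 : χ i (e i * t) = 0 := by
    have : ∀ t ∈ dpFil F z (0 + 1), χ i (e i * t) = 0 := by
      intro t ht
      induction ht using Submodule.span_induction with
      | mem s hs =>
        obtain ⟨l, hl, rfl⟩ := hs
        rw [hχ, if_neg]
        rintro ⟨-, rfl⟩
        simp at hl
      | zero => simp
      | add x y _ _ hx hy => rw [mul_add, map_add, hx, hy, add_zero]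
      | smul c x _ hx => rw [mul_smul_comm, map_smul, hx, smul_zero]
    exact this t ht
  have h3 : χ i (e i * x) = a := by
    rw [h1, mul_add, map_add, h2, mul_smul_comm, map_smul, hχ, if_pos ⟨rfl, rfl⟩]
    simp
  rw [map_mul, hx, mul_zero] at h3
  rw [h1, ← h3, zero_smul, zero_add]

theorem linearIndependent_loops {c : ℕ} (hq : q = c * κ + 1) (i : ZMod κ) :
    LinearIndependent F (fun t : Fin (c + 1) => e i * z (κ * t)) := by
  have hlt : ∀ t : Fin (c + 1), κ * t < q := by
    intro t
    have := Nat.mul_le_mul_left κ (Nat.lt_succ_iff.1 t.2)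
    rw [hq, mul_comm c]; omega
  refine h.linearIndependent.comp (fun t : Fin (c + 1) => (i, (⟨κ * t, hlt t⟩ : Fin q))) ?_
  intro s t hst
  simp only [Prod.mk.injEq, Fin.mk.injEq, true_and] at hst
  exact Fin.ext (Nat.eq_of_mul_eq_mul_left (Nat.pos_of_ne_zero (NeZero.ne κ)) hst)

/-- Two families of central elements are independent: `z (κ * t)` for t < c, which shift indices by
multiples of κ, and the top elements `e i * z (κ * c)`, which are killed by positive degree since κc
= q - 1. -/
theorem le_finrank_center {c : ℕ} (hq : q = c * κ + 1) :
    κ + c ≤ Module.finrank F (Subalgebra.center F B) := by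
  have hfin := h.finite
  have hcomm : ∀ y : B, (∀ j, ∀ m < q, e j * z m * y = y * (e j * z m)) →
      y ∈ Subalgebra.center F B := by
    intro y hy
    rw [Subalgebra.mem_center_iff]
    intro x
    induction x using h.induction_basis with
    | h0 => simp
    | hadd x y hx hy => rw [add_mul, hx, hy, mul_add]
    | hsmul c x hx => rw [smul_mul_assoc, hx, mul_smul_comm]
    | hb j m hm => exact hy j m hm
  let v : ZMod κ ⊕ Fin c → B := Sum.elim (fun i => e i * z (κ * c)) (fun t => z (κ * t))
  have hzz : ∀ m n, z m * z n = z n * z m := fun m n => by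
    rw [h.z_mul, h.z_mul, add_comm, Nat.choose_symm_add]
  have hv : ∀ x, v x ∈ Subalgebra.center F B := by
    rintro (i | t)
    · refine hcomm _ fun j m hm => ?_
      simp only [v, Sum.elim_inl]
      rw [h.mul_mul_e_z, h.mul_mul_e_z]
      rcases Nat.eq_zero_or_pos m with rfl | hm
      · simp only [Nat.cast_zero, add_zero, zero_add, Nat.choose_zero_right, Nat.cast_mul,
          CharP.cast_eq_zero, zero_mul, Nat.choose_self]
        split_ifs with h1 h2 h2
        · rw [h1]
        · exact absurd h1.symm h2
        · exact absurd h2.symm h1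
        · rfl
      · rw [h.z_eq_zero (m + κ * c) (by rw [hq, mul_comm c]; omega),
          h.z_eq_zero (κ * c + m) (by rw [hq, mul_comm c]; omega)]
        simp
    · refine hcomm _ fun j m hm => ?_
      simp only [v, Sum.elim_inr]
      rw [← mul_assoc, mul_assoc, hzz, ← mul_assoc, h.e_z]
      simp [mul_assoc]
  have hli : LinearIndependent F (fun x => (⟨v x, hv x⟩ : Subalgebra.center F B)) := by
    refine LinearIndependent.of_comp (Subalgebra.center F B).val.toLinearMap ?_
    change LinearIndependent F v
    rw [Fintype.linearIndependent_iff]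
    intro g hg
    have key : ∀ i, ∑ t : Fin (c + 1), (Fin.snoc (α := fun _ => F) (fun t : Fin c => g (Sum.inr t))
        (g (Sum.inl i)) : Fin (c + 1) → F) t • (e i * z (κ * t)) = 0 := by
      intro i
      have := congrArg (e i * ·) hg
      simp only [Fintype.sum_sum_type, v, Sum.elim_inl, Sum.elim_inr, mul_add, mul_sum,
        mul_zero, mul_smul_comm] at this
      rw [sum_eq_single i] at this
      · rw [Fin.sum_univ_castSucc, ← this, add_comm]
        simp [← mul_assoc, h.e_mul_self]
      · intro j _ hj
        rw [← mul_assoc, h.e_mul_ne hj.symm, zero_mul, smul_zero]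
      · simp
    have key2 := fun i => Fintype.linearIndependent_iff.1 (h.linearIndependent_loops hq i) _ (key i)
    rintro (i | t)
    · simpa using key2 i (Fin.last c)
    · simpa using key2 0 t.castSucc
  have := hli.fintype_card_le_finrank
  simpa [ZMod.card] using this

end DividedPowerBasis

end UniqueLifting

end

noncomputable section

namespace UniqueLifting

open Finset

set_option linter.unusedSectionVars false

/-! ### Binomial coefficients modulo p and numbers with equal digits. -/

section Binomials

variable {p : ℕ} [hp : Fact p.Prime]

/-- Lucas' theorem strips the j zero digits of p^j one by one and leaves the coefficient C(n / p^j,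
1). -/
theorem choose_prime_pow_modEq (n j : ℕ) : n.choose (p ^ j) ≡ n / p ^ j [MOD p] := by
  induction j generalizing n with
  | zero => simpa using Nat.ModEq.refl n
  | succ j ih =>
    have h := Choose.choose_modEq_choose_mod_mul_choose_div_nat (p := p) (n := n)
      (k := p ^ (j + 1))
    have h1 : p ^ (j + 1) % p = 0 := by rw [pow_succ]; simp
    have h2 : p ^ (j + 1) / p = p ^ j := by
      rw [pow_succ]; exact Nat.mul_div_cancel _ hp.out.pos
    rw [h1, h2, Nat.choose_zero_right, one_mul] at h
    refine h.trans ((ih (n / p)).trans ?_)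
    rw [Nat.div_div_eq_div_mul, pow_succ, mul_comm p]

theorem not_dvd_choose_prime_pow {n j s : ℕ} (h : s * p ^ j ≤ n) (h' : n < (s + 1) * p ^ j)
    (hs : ¬ p ∣ s) : ¬ p ∣ n.choose (p ^ j) := by
  rw [(choose_prime_pow_modEq n j).dvd_iff dvd_rfl]
  rwa [Nat.div_eq_of_lt_le h h']

/-- In Pascal's rule C(q, k+1) = C(q-1, k) + C(q-1, k+1) the left side is divisible by p, so
divisibility would descend to C(q-1, 0) = 1. -/
theorem not_dvd_choose_pow_sub_one (f : ℕ) {k : ℕ} (hk : k < p ^ f) :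
    ¬ p ∣ (p ^ f - 1).choose k := by
  induction k with
  | zero => simpa using hp.out.one_lt.ne'
  | succ k ih =>
    intro h
    refine ih (by omega) ((Nat.dvd_add_left h).1 ?_)
    have h1 : (p ^ f).choose (k + 1) = (p ^ f - 1).choose k + (p ^ f - 1).choose (k + 1) := by
      conv_lhs => rw [show p ^ f = (p ^ f - 1) + 1 by omega]
      exact Nat.choose_succ_succ _ _
    rw [← h1]
    exact hp.out.dvd_choose_pow (by omega) (by omega)

/-- The number with `n` digits all equal to `d` in base `p`. -/
def repdigit (p d n : ℕ) : ℕ := ∑ l ∈ range n, d * p ^ l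

theorem repdigit_succ (p d n : ℕ) : repdigit p d (n + 1) = d * p ^ n + repdigit p d n := by
  rw [repdigit, sum_range_succ, add_comm]; rfl

/-- A geometric sum. It identifies κ as the number whose f digits in base p are all d = (p - 1) / c.
-/
theorem mul_repdigit {c d : ℕ} (hcd : c * d = p - 1) (n : ℕ) :
    c * repdigit p d n + 1 = p ^ n := by
  induction n with
  | zero => simp [repdigit]
  | succ n ih =>
    have := hp.out.one_lt
    rw [repdigit_succ, mul_add, add_assoc, ih, ← mul_assoc, hcd, pow_succ, Nat.sub_mul, one_mul,
      mul_comm p]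
    have : p ^ n ≤ p ^ n * p := Nat.le_mul_of_pos_right _ hp.out.pos
    omega

theorem repdigit_lt {c d : ℕ} (hc : 0 < c) (hcd : c * d = p - 1) (n : ℕ) :
    repdigit p d n < p ^ n := by
  rw [← mul_repdigit hcd n]
  have := Nat.le_mul_of_pos_left (repdigit p d n) hc
  omega

/-- The quotient of a repdigit by a power of the base has last digit `d`. -/
theorem exists_repdigit_eq {d n j : ℕ} (hj : j < n) :
    ∃ s r, repdigit p d n = (d + p * s) * p ^ j + r ∧ r = repdigit p d j := by
  induction n, hj using Nat.le_induction with
  | base => exact ⟨0, _, by rw [repdigit_succ]; ring, rfl⟩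
  | succ n hn ih =>
    obtain ⟨s, r, h, rfl⟩ := ih
    obtain ⟨l, rfl⟩ := Nat.exists_eq_add_of_le hn
    refine ⟨s + d * p ^ l, _, ?_, rfl⟩
    rw [repdigit_succ, h, Nat.succ_eq_add_one, pow_add, pow_add]
    ring

end Binomials

/-! ### Paths and their leading terms. -/

/-- The product along a path given by a word of digits. -/
def pathProd {C : Type*} [Mul C] {κ : ℕ} {f : ℕ} (p : ℕ) (e : ZMod κ → C)
    (X : ZMod κ → Fin f → C) : ZMod κ → List (Fin f) → C
  | i, [] => e i
  | i, j :: w => X i j * pathProd p e X (i + (p ^ (j : ℕ) : ℕ)) w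

/-- The weight of a word of digits. -/
def wordWt {f : ℕ} (p : ℕ) (w : List (Fin f)) : ℕ := (w.map fun j : Fin f => p ^ (j : ℕ)).sum

theorem wordWt_nil {f : ℕ} (p : ℕ) : wordWt (f := f) p [] = 0 := rfl

theorem wordWt_cons {f : ℕ} (p : ℕ) (j : Fin f) (w : List (Fin f)) :
    wordWt p (j :: w) = p ^ (j : ℕ) + wordWt p w := by simp [wordWt]

theorem wordWt_replicate {f : ℕ} (p : ℕ) (j : Fin f) (n : ℕ) :
    wordWt p (List.replicate n j) = n * p ^ (j : ℕ) := by
  induction n with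
  | zero => simp [wordWt]
  | succ n ih => rw [List.replicate_succ, wordWt_cons, ih]; ring

theorem map_pathProd {C D F : Type*} [Mul C] [Mul D] [FunLike F C D] [MulHomClass F C D] (φ : F)
    {κ f : ℕ} (p : ℕ)
    (e : ZMod κ → C) (X : ZMod κ → Fin f → C) (i : ZMod κ) (w : List (Fin f)) :
    φ (pathProd p e X i w) =
      pathProd p (fun i => φ (e i)) (fun i j => φ (X i j)) i w := by
  induction w generalizing i with
  | nil => rfl
  | cons j w ih => rw [pathProd, pathProd, map_mul, ih]

/-- `x` is a homogeneous element of the row `i` with leading term of degree `m`. -/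
def Lead (F : Type*) {B : Type*} [Field F] [Ring B] [Algebra F B] {κ : ℕ}
    (e : ZMod κ → B) (z : ℕ → B) (i : ZMod κ) (m : ℕ) (x : B) : Prop :=
  x * e (i + m) = x ∧ ∃ d : F, d ≠ 0 ∧ ∃ t ∈ dpFil F z (m + 1), x = e i * (d • z m + t)

namespace DividedPowerBasis

variable {F B : Type*} [Field F] [Ring B] [Algebra F B] {q κ : ℕ} [NeZero κ]
  {e : ZMod κ → B} {z : ℕ → B} (h : DividedPowerBasis F q κ e z)

include h

theorem lead_e (i : ZMod κ) : Lead F e z i 0 (e i) := by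
  refine ⟨by simp [h.e_mul_self], 1, one_ne_zero, 0, Submodule.zero_mem _, ?_⟩
  simp [h.z_zero]

/-- The right idempotent of x absorbs the left idempotent of y, after which leading coefficients
multiply up to the binomial coefficient. Its nonvanishing is the only obstruction, hence the work on
digits. -/
theorem lead_mul {i : ZMod κ} {m n : ℕ} {x y : B} (hx : Lead F e z i m x)
    (hy : Lead F e z (i + m) n y) (hmn : ((m + n).choose m : F) ≠ 0) :
    Lead F e z i (m + n) (x * y) := by
  obtain ⟨hx1, d, hd, t, ht, hx2⟩ := hx
  obtain ⟨hy1, d', hd', t', ht', hy2⟩ := hy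
  refine ⟨?_, d * d' * ((m + n).choose m : F), mul_ne_zero (mul_ne_zero hd hd') hmn,
    d • (z m * t') + d' • (t * z n) + t * t', ?_, ?_⟩
  · rw [mul_assoc, Nat.cast_add, ← add_assoc, hy1]
  · refine Submodule.add_mem _ (Submodule.add_mem _ (Submodule.smul_mem _ _ ?_)
      (Submodule.smul_mem _ _ ?_)) ?_
    · rw [add_assoc]
      exact dpFil_mul h.z_mul (mem_dpFil le_rfl) ht'
    · rw [show m + n + 1 = m + 1 + n by ring]
      exact dpFil_mul h.z_mul ht (mem_dpFil le_rfl)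
    · exact dpFil_anti z (by omega) (dpFil_mul h.z_mul ht ht')
  · have h1 : x * y = x * (d' • z n + t') := by
      conv_lhs => rw [hy2, ← mul_assoc, hx1]
    rw [h1, hx2, mul_assoc]
    congr 1
    simp only [add_mul, mul_add, smul_mul_assoc, mul_smul_comm, h.z_mul, smul_smul, smul_add]
    rw [show d' * (d * ((m + n).choose m : F)) = d * d' * ((m + n).choose m : F) by ring]
    abel

/-- The family is triangular with respect to the degree filtration. -/
theorem span_of_lead {y : ZMod κ → ℕ → B} (hy : ∀ i, ∀ m < q, Lead F e z i m (y i m)) :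
    Submodule.span F (Set.range (fun x : ZMod κ × Fin q => y x.1 x.2)) = ⊤ := by
  set S := Submodule.span F (Set.range (fun x : ZMod κ × Fin q => y x.1 x.2)) with hS
  have hmem : ∀ i, ∀ m < q, y i m ∈ S := fun i m hm =>
    Submodule.subset_span ⟨(i, ⟨m, hm⟩), rfl⟩
  -- Descending induction on the degree m, with r bounding the distance to q, where the filtration
  -- vanishes.
  have key : ∀ r m, q ≤ m + r → ∀ i, ∀ t ∈ dpFil F z m, e i * t ∈ S := by
    intro r
    induction r with
    | zero =>
      intro m hm i t ht
      rw [dpFil_eq_bot h.z_eq_zero (by simpa using hm)] at ht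
      rw [(Submodule.mem_bot F).1 ht, mul_zero]
      exact S.zero_mem
    | succ r ih =>
      intro m hm i t ht
      by_cases hmq : q ≤ m
      · rw [dpFil_eq_bot h.z_eq_zero hmq] at ht
        rw [(Submodule.mem_bot F).1 ht, mul_zero]
        exact S.zero_mem
      obtain ⟨a, s, hs, rfl⟩ := exists_of_mem_dpFil ht
      rw [mul_add]
      refine S.add_mem ?_ (ih (m + 1) (by omega) i s hs)
      obtain ⟨-, d, hd, t', ht', h2⟩ := hy i m (by omega)
      have h3 : e i * z m = d⁻¹ • (y i m - e i * t') := by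
        rw [h2, mul_add, add_sub_cancel_right, mul_smul_comm, smul_smul, inv_mul_cancel₀ hd,
          one_smul]
      rw [mul_smul_comm, h3]
      exact S.smul_mem _ (S.smul_mem _ (S.sub_mem (hmem i m (by omega))
        (ih (m + 1) (by omega) i t' ht')))
  rw [eq_top_iff, ← h.span_eq_top, Submodule.span_le]
  rintro _ ⟨⟨i, m⟩, rfl⟩
  exact key q 0 (by omega) i _ (mem_dpFil (Nat.zero_le _))

/-- The homogeneous elements of degree `n` in a row. -/
theorem exists_homogeneous (i : ZMod κ) {n c : ℕ} (hn : n < κ) (hq : q ≤ c * κ + 1)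
    (hch : ∀ t < c, ((n + κ * t).choose n : F) ≠ 0) {x : B} (hex : e i * x = x)
    (hxe : x * e (i + n) = x) : ∃ w ∈ dpFil F z 0, x = e i * (z n * w) := by
  have key : ∀ x : B, ∃ w ∈ dpFil F z 0, e i * x * e (i + n) = e i * (z n * w) := by
    intro x
    induction x using h.induction_basis with
    | h0 => exact ⟨0, Submodule.zero_mem _, by simp⟩
    | hadd x y hx hy =>
      obtain ⟨s, hs, h1⟩ := hx
      obtain ⟨t, ht, h2⟩ := hy
      exact ⟨s + t, Submodule.add_mem _ hs ht, by rw [mul_add, add_mul, h1, h2, ← mul_add,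
        ← mul_add]⟩
    | hsmul c x hx =>
      obtain ⟨s, hs, h1⟩ := hx
      exact ⟨c • s, Submodule.smul_mem _ _ hs, by
        rw [mul_smul_comm, smul_mul_assoc, h1, mul_smul_comm, mul_smul_comm]⟩
    | hb j m hm =>
      rw [← mul_assoc, h.e_mul]
      split_ifs with h1
      swap
      · exact ⟨0, Submodule.zero_mem _, by simp⟩
      rw [h.e_z_e]
      split_ifs with h2
      swap
      · exact ⟨0, Submodule.zero_mem _, by simp⟩
      have h3 : m % κ = n := by
        have := (ZMod.natCast_eq_natCast_iff' m n κ).1 (add_left_cancel h2)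
        rwa [Nat.mod_eq_of_lt hn] at this
      have h4 : m = n + κ * (m / κ) := by rw [← h3]; exact (Nat.mod_add_div m κ).symm
      -- The degrees that occur are n + κt and at most cκ. The value t = c is possible only for n =
      -- 0, where the binomial coefficient is 1.
      have h5 : m / κ < c ∨ n = 0 ∧ m = κ * c := by
        have hκ : 0 < κ := Nat.pos_of_ne_zero (NeZero.ne κ)
        have h6 : m ≤ c * κ := by omega
        rcases lt_or_ge (m / κ) c with h | h
        · exact Or.inl h
        · right
          have := Nat.mul_le_mul_left κ h
          rw [mul_comm c] at h6
          omega
      have h7 : ((n + κ * (m / κ)).choose n : F) ≠ 0 := by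
        rcases h5 with h5 | ⟨rfl, -⟩
        · exact hch _ h5
        · simp
      refine ⟨((n + κ * (m / κ)).choose n : F)⁻¹ • z (κ * (m / κ)),
        Submodule.smul_mem _ _ (mem_dpFil (Nat.zero_le _)), ?_⟩
      rw [mul_smul_comm, h.z_mul, smul_smul, inv_mul_cancel₀ h7, one_smul, ← h4]
  obtain ⟨w, hw, h1⟩ := key x
  exact ⟨w, hw, by rw [← h1, hex, hxe]⟩

/-- Paths repeating one digit `p` times vanish. -/
theorem pathProd_replicate_eq_zero {p f : ℕ} [hp : Fact p.Prime] [CharP F p]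
    {X : ZMod κ → Fin f → B} (j : Fin f)
    (hX : ∀ i, ∃ w ∈ dpFil F z 0, X i j = e i * (z (p ^ (j : ℕ)) * w))
    (hXe : ∀ i, X i j * e (i + (p ^ (j : ℕ) : ℕ)) = X i j) (i : ZMod κ) :
    pathProd p e X i (List.replicate p j) = 0 := by
  set n := p ^ (j : ℕ) with hn
  -- All factors taken from the divided power algebra commute, so the leading powers `z n` can be
  -- collected.
  have key : ∀ r i, ∃ w ∈ dpFil F z 0, pathProd p e X i (List.replicate r j) =
      e i * (z n ^ r * w) := by
    intro r
    induction r with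
    | zero =>
      intro i
      exact ⟨z 0, mem_dpFil le_rfl, by simp [pathProd, h.z_zero]⟩
    | succ r ih =>
      intro i
      obtain ⟨w, hw, h1⟩ := ih (i + (n : ℕ))
      obtain ⟨v, hv, h2⟩ := hX i
      refine ⟨v * w, dpFil_anti z (Nat.zero_le _) (dpFil_mul h.z_mul hv hw), ?_⟩
      rw [List.replicate_succ, pathProd, ← hn, h1, ← mul_assoc, hXe, h2, mul_assoc, mul_assoc]
      congr 1
      have h3 : z n ^ r * v = v * z n ^ r :=
        (Commute.pow_left (dpFil_commute h.z_mul (mem_dpFil (Nat.zero_le n)) hv) r).eq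
      rw [← mul_assoc v, ← h3, pow_succ']
      simp only [mul_assoc]
  have hpow : ∀ r, ∃ a : F, z n ^ (r + 1) = a • z ((r + 1) * n) := by
    intro r
    induction r with
    | zero => exact ⟨1, by simp⟩
    | succ r ih =>
      obtain ⟨a, ha⟩ := ih
      exact ⟨_, by rw [pow_succ, ha, smul_mul_assoc, h.z_mul, smul_smul,
        show (r + 1) * n + n = (r + 1 + 1) * n by ring]⟩
  -- The last multiplication contributes a binomial coefficient C(p^(j+1), p^j), which p divides.
  have hzp : z n ^ p = 0 := by
    obtain ⟨r, hr⟩ : ∃ r, p = r + 1 + 1 := ⟨p - 2, by have := hp.out.two_le; omega⟩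
    obtain ⟨a, ha⟩ := hpow r
    rw [hr, pow_succ, ha, smul_mul_assoc, h.z_mul]
    have h1 : (((r + 1) * n + n).choose ((r + 1) * n) : F) = 0 := by
      rw [CharP.cast_eq_zero_iff F p, Nat.choose_symm_add,
        show (r + 1) * n + n = p ^ ((j : ℕ) + 1) by rw [pow_succ, ← hn, hr]; ring]
      have h2 : 0 < n := by rw [hn]; exact pow_pos hp.out.pos _
      refine hp.out.dvd_choose_pow (by omega) ?_
      rw [hn]
      exact (Nat.pow_lt_pow_right hp.out.one_lt (Nat.lt_succ_self _)).ne
    rw [h1, zero_smul, smul_zero]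
  obtain ⟨w, -, h1⟩ := key p i
  rw [h1, hzp, zero_mul, mul_zero]

variable {p f : ℕ} [hp : Fact p.Prime] [CharP F p]

/-- The word is the base p expansion of m, peeled off from the top. The binomial coefficient C(m,
p^j) is congruent to the leading digit, which is nonzero. -/
theorem exists_word {X : ZMod κ → Fin f → B}
    (hX : ∀ i (j : Fin f), Lead F e z i (p ^ (j : ℕ)) (X i j)) (m : ℕ) (hm : m < p ^ f) :
    ∃ w : List (Fin f), wordWt p w = m ∧ ∀ i, Lead F e z i m (pathProd p e X i w) := by
  induction m using Nat.strong_induction_on with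
  | _ m ih =>
    rcases Nat.eq_zero_or_pos m with rfl | hm0
    · exact ⟨[], rfl, fun i => h.lead_e i⟩
    set j := Nat.log p m with hj
    have hjm : p ^ j ≤ m := Nat.pow_log_le_self p hm0.ne'
    have hmj : m < p ^ (j + 1) := Nat.lt_pow_succ_log_self hp.out.one_lt m
    have hjf : j < f := (Nat.pow_lt_pow_iff_right hp.out.one_lt).1 (hjm.trans_lt hm)
    have hpj : 0 < p ^ j := pow_pos hp.out.pos j
    obtain ⟨w, hw, hl⟩ := ih (m - p ^ j) (by omega) (by omega)
    refine ⟨⟨j, hjf⟩ :: w, by rw [wordWt_cons, hw]; simp only; omega, fun i => ?_⟩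
    have h1 := h.lead_mul (hX i ⟨j, hjf⟩) (hl (i + (p ^ j : ℕ))) (by
      simp only
      rw [show p ^ j + (m - p ^ j) = m by omega, Ne, CharP.cast_eq_zero_iff F p]
      have h2 : m / p ^ j < p := by
        rw [Nat.div_lt_iff_lt_mul hpj, mul_comm, ← pow_succ]; exact hmj
      have h3 : 0 < m / p ^ j := Nat.div_pos hjm hpj
      exact not_dvd_choose_prime_pow (s := m / p ^ j) (Nat.div_mul_le_self m _)
        (by rw [add_mul, one_mul]; exact Nat.lt_div_mul_add hpj)
        (fun h => absurd (Nat.le_of_dvd h3 h) (by omega)))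
    simp only at h1
    rwa [show p ^ j + (m - p ^ j) = m by omega] at h1

/-- The letter of each position is used d times. The binomial coefficients met on the way are
congruent to s + 1 with 0 < s + 1 ≤ d < p. Equal counts of all letters will make any two such words
permutations of each other. -/
theorem exists_repdigit_word {X : ZMod κ → Fin f → B}
    (hX : ∀ i (j : Fin f), Lead F e z i (p ^ (j : ℕ)) (X i j)) {c d : ℕ} (hc : 0 < c)
    (hcd : c * d = p - 1) (n : ℕ) (hn : n ≤ f) :
    ∃ w : List (Fin f), wordWt p w = repdigit p d n ∧
      (∀ j : Fin f, w.count j = if (j : ℕ) < n then d else 0) ∧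
      ∀ i, Lead F e z i (repdigit p d n) (pathProd p e X i w) := by
  induction n with
  | zero => exact ⟨[], by simp [wordWt, repdigit], by simp, fun i => by
      simpa [repdigit, pathProd] using h.lead_e i⟩
  | succ n ih =>
    obtain ⟨w, hw, hcount, hl⟩ := ih (by omega)
    have hpn : 0 < p ^ n := pow_pos hp.out.pos n
    have hdp : d < p := by
      have := Nat.le_mul_of_pos_left d hc
      have := hp.out.pos
      omega
    have key : ∀ s ≤ d, ∀ i, Lead F e z i (s * p ^ n + repdigit p d n)
        (pathProd p e X i (List.replicate s (⟨n, by omega⟩ : Fin f) ++ w)) := by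
      intro s
      induction s with
      | zero => intro _ i; simpa using hl i
      | succ s ihs =>
        intro hs i
        have h0 := repdigit_lt hc hcd n
        have h1 := h.lead_mul (hX i ⟨n, by omega⟩) (ihs (by omega) (i + (p ^ n : ℕ))) (by
          simp only
          rw [Ne, CharP.cast_eq_zero_iff F p]
          refine not_dvd_choose_prime_pow (s := s + 1) ?_ ?_ ?_
          · rw [add_mul]; omega
          · rw [add_mul, add_mul]; omega
          · exact fun h => absurd (Nat.le_of_dvd (by omega) h) (by omega))
        simp only at h1
        rw [show (s + 1) * p ^ n + repdigit p d n = p ^ n + (s * p ^ n + repdigit p d n) by ring]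
        exact h1
    refine ⟨List.replicate d (⟨n, by omega⟩ : Fin f) ++ w, ?_, ?_, ?_⟩
    · rw [repdigit_succ, ← hw]
      simp [wordWt]
    · intro j
      rw [List.count_append, hcount, List.count_replicate]
      by_cases hj : (j : ℕ) = n
      · rw [if_pos, if_neg, if_pos]
        · rfl
        · omega
        · omega
        · simp [Fin.ext_iff, hj]
      · rw [if_neg]
        · split_ifs <;> omega
        · simp [Fin.ext_iff, Ne.symm hj]
    · rw [repdigit_succ]
      exact key d le_rfl

end DividedPowerBasis

end UniqueLifting

end

noncomputable section

namespace UniqueLifting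

open Finset

set_option linter.unusedSectionVars false

/-! ### Lifting idempotents by Newton iteration. -/

section Newton

open Polynomial

/-- The iterates of the idempotent refinement `x ↦ 3x² - 2x³`. -/
def newtonPoly : ℕ → ℤ[X]
  | 0 => X
  | n + 1 => 3 * newtonPoly n ^ 2 - 2 * newtonPoly n ^ 3

theorem X_dvd_newtonPoly (n : ℕ) : X ∣ newtonPoly n := by
  induction n with
  | zero => exact dvd_rfl
  | succ n ih =>
    exact dvd_sub ((ih.pow two_ne_zero).mul_left _) ((ih.pow three_ne_zero).mul_left _)

/-- Quadratic convergence: the refinement multiplies the error x² - x by itself and by a further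
factor. -/
theorem dvd_newtonPoly_sq_sub (n : ℕ) :
    (X ^ 2 - X : ℤ[X]) ^ 2 ^ n ∣ newtonPoly n ^ 2 - newtonPoly n := by
  induction n with
  | zero => simp [newtonPoly]
  | succ n ih =>
    have : newtonPoly (n + 1) ^ 2 - newtonPoly (n + 1) = (newtonPoly n ^ 2 - newtonPoly n) ^ 2 *
        (4 * (newtonPoly n ^ 2 - newtonPoly n) - 3) := by rw [newtonPoly]; ring
    rw [this, pow_succ 2 n, pow_mul]
    exact (pow_dvd_pow_of_dvd ih 2).mul_right _

theorem dvd_newtonPoly_sub {m n : ℕ} (hmn : m ≤ n) :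
    (X ^ 2 - X : ℤ[X]) ^ 2 ^ m ∣ newtonPoly n - newtonPoly m := by
  induction n, hmn using Nat.le_induction with
  | base => simp
  | succ n hmn ih =>
    have : newtonPoly (n + 1) - newtonPoly m = (newtonPoly n - newtonPoly m) -
        (2 * newtonPoly n - 1) * (newtonPoly n ^ 2 - newtonPoly n) := by rw [newtonPoly]; ring
    rw [this]
    refine dvd_sub ih (((pow_dvd_pow _ ?_).trans (dvd_newtonPoly_sq_sub n)).mul_left _)
    exact Nat.pow_le_pow_right two_pos hmn

end Newton

section Adic

variable {O : Type*} [CommRing O] [IsDomain O] [IsDiscreteValuationRing O]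
  [IsAdicComplete (IsLocalRing.maximalIdeal O) O] {p : ℕ}
  (hp : IsLocalRing.maximalIdeal O = Ideal.span {(p : O)})

include hp

theorem eq_zero_of_forall_pow_dvd {o : O} (h : ∀ n, (p : O) ^ n ∣ o) : o = 0 := by
  refine IsHausdorff.haus' (I := IsLocalRing.maximalIdeal O) o fun n => ?_
  rw [SModEq.zero, hp, Ideal.span_singleton_pow, smul_eq_mul, Ideal.mul_top,
    Ideal.mem_span_singleton]
  exact h n

theorem exists_limit {a : ℕ → O} (h : ∀ m n, m ≤ n → (p : O) ^ m ∣ a n - a m) :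
    ∃ l, ∀ n, (p : O) ^ n ∣ l - a n := by
  obtain ⟨l, hl⟩ := IsPrecomplete.prec' (I := IsLocalRing.maximalIdeal O) a (fun {m n} hmn => by
    rw [SModEq.comm, SModEq.sub_mem, hp, Ideal.span_singleton_pow, smul_eq_mul, Ideal.mul_top,
      Ideal.mem_span_singleton]
    exact h m n hmn)
  refine ⟨l, fun n => ?_⟩
  have := (hl n).symm
  rwa [SModEq.sub_mem, hp, Ideal.span_singleton_pow, smul_eq_mul, Ideal.mul_top,
      Ideal.mem_span_singleton] at this

variable {S : Type*}

theorem module_eq_zero_of_forall [AddCommGroup S] [Module O S] [Module.Finite O S]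
    [Module.Free O S] {x : S} (h : ∀ n, ∃ y, x = (p : O) ^ n • y) : x = 0 := by
  let b := Module.Free.chooseBasis O S
  refine b.ext_elem fun i => ?_
  rw [map_zero]
  refine eq_zero_of_forall_pow_dvd hp fun n => ?_
  obtain ⟨y, hy⟩ := h n
  exact ⟨b.repr y i, by rw [hy]; simp⟩

theorem module_exists_limit [AddCommGroup S] [Module O S] [Module.Finite O S]
    [Module.Free O S] {x : ℕ → S} (h : ∀ m n, m ≤ n → ∃ y, x n - x m = (p : O) ^ m • y) :
    ∃ l, ∀ n, ∃ y, l - x n = (p : O) ^ n • y := by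
  classical
  let b := Module.Free.chooseBasis O S
  have h1 : ∀ i, ∃ l, ∀ n, (p : O) ^ n ∣ l - b.repr (x n) i := by
    intro i
    refine exists_limit hp fun m n hmn => ?_
    obtain ⟨y, hy⟩ := h m n hmn
    refine ⟨b.repr y i, ?_⟩
    have := congrArg (fun v => b.repr v i) hy
    simpa using this
  choose l hl using h1
  refine ⟨∑ i, l i • b i, fun n => ?_⟩
  choose w hw using fun i => hl i n
  refine ⟨∑ i, w i • b i, b.ext_elem fun i => ?_⟩
  simp [hw, Finsupp.single_apply]

/-- The element a² - a is nilpotent modulo p, so the Newton iterates in a converge p-adically. Since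
the polynomials have no constant term, whatever a annihilates is annihilated by the limit; this
keeps idempotents orthogonal when they are lifted one after another. -/
theorem exists_idempotent_lift [Ring S] [Algebra O S] [Module.Finite O S] [Module.Free O S]
    (a : S) (N : ℕ) (b : S) (hab : (a ^ 2 - a) ^ N = (p : O) • b) :
    ∃ e : S, e * e = e ∧ (∃ x y, e - a = (a ^ 2 - a) * x + (p : O) • y) ∧
      (∀ E, E * a = 0 → E * e = 0) ∧ (∀ E, a * E = 0 → e * E = 0) := by
  set d := a ^ 2 - a with hd
  -- The index N * m guarantees 2^(Nm) ≥ Nm, so the m-th error is divisible by p^m.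
  let s : ℕ → S := fun m => Polynomial.aeval a (newtonPoly (N * m))
  have hdm : ∀ m n, N * m ≤ n → ∃ y, d ^ n = (p : O) ^ m • y := by
    intro m n hmn
    refine ⟨b ^ m * d ^ (n - N * m), ?_⟩
    conv_lhs => rw [← Nat.add_sub_of_le hmn, pow_add, pow_mul, hab, smul_pow, smul_mul_assoc]
  have hpd : ∀ (P : Polynomial ℤ) m, (Polynomial.X ^ 2 - Polynomial.X) ^ 2 ^ (N * m) ∣ P →
      ∃ y, Polynomial.aeval a P = (p : O) ^ m • y := by
    rintro _ m ⟨Q, rfl⟩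
    obtain ⟨y, hy⟩ := hdm m (2 ^ (N * m)) Nat.lt_two_pow_self.le
    refine ⟨y * Polynomial.aeval a Q, ?_⟩
    rw [map_mul, map_pow, map_sub, map_pow, Polynomial.aeval_X, ← hd, hy, smul_mul_assoc]
  obtain ⟨e, he⟩ := module_exists_limit hp (x := s) (fun m n hmn => by
    obtain ⟨y, hy⟩ := hpd _ m (dvd_newtonPoly_sub (Nat.mul_le_mul_left N hmn))
    exact ⟨y, by rw [← hy, map_sub]⟩)
  refine ⟨e, ?_, ?_, ?_, ?_⟩
  · refine sub_eq_zero.1 (module_eq_zero_of_forall hp fun n => ?_)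
    obtain ⟨y, hy⟩ := he n
    obtain ⟨y', hy'⟩ := hpd _ n (dvd_newtonPoly_sq_sub (N * n))
    rw [map_sub, map_pow] at hy'
    refine ⟨y * e + s n * y + y' - y, ?_⟩
    have h1 : e = s n + (p : O) ^ n • y := by rw [← hy]; abel
    calc e * e - e = (e - s n) * e + s n * (e - s n) + (s n ^ 2 - s n) - (e - s n) := by
          noncomm_ring
      _ = _ := by
          rw [hy, hy', smul_mul_assoc, mul_smul_comm, smul_sub, smul_add, smul_add]
  · obtain ⟨y, hy⟩ := he 1
    obtain ⟨Q, hQ⟩ := (dvd_pow_self (Polynomial.X ^ 2 - Polynomial.X)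
      (pow_ne_zero 0 two_ne_zero)).trans (dvd_newtonPoly_sub (Nat.zero_le (N * 1)))
    refine ⟨Polynomial.aeval a Q, y, ?_⟩
    have h2 := congrArg (Polynomial.aeval a) hQ
    simp only [map_sub, map_mul, map_pow, newtonPoly, Polynomial.aeval_X] at h2
    rw [pow_one] at hy
    rw [← hy, hd, ← h2]
    abel
  · intro E hE
    refine module_eq_zero_of_forall hp fun n => ?_
    obtain ⟨y, hy⟩ := he n
    obtain ⟨Q, hQ⟩ := X_dvd_newtonPoly (N * n)
    refine ⟨E * y, ?_⟩
    have h1 : E * s n = 0 := by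
      simp only [s, hQ, map_mul, Polynomial.aeval_X]
      rw [← mul_assoc, hE, zero_mul]
    rw [← mul_smul_comm, ← hy, mul_sub, h1, sub_zero]
  · intro E hE
    refine module_eq_zero_of_forall hp fun n => ?_
    obtain ⟨y, hy⟩ := he n
    obtain ⟨Q, hQ⟩ := X_dvd_newtonPoly (N * n)
    refine ⟨y * E, ?_⟩
    have h1 : s n * E = 0 := by
      simp only [s, hQ, mul_comm Polynomial.X, map_mul, Polynomial.aeval_X]
      rw [mul_assoc, hE, mul_zero]
    rw [← smul_mul_assoc, ← hy, sub_mul, h1, sub_zero]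

end Adic

end UniqueLifting

end

noncomputable section

namespace UniqueLifting

open Finset TensorProduct

set_option linter.unusedSectionVars false

variable {O : Type*} [CommRing O] [IsDomain O] [IsDiscreteValuationRing O] {p : ℕ}
  (hp : IsLocalRing.maximalIdeal O = Ideal.span {(p : O)})

local notation "𝕜" => IsLocalRing.ResidueField

/-- A reduction map from an order to an algebra over an extension of the residue field. -/
structure IsReduction (p : ℕ) {F S B : Type*} [Field F] [Algebra (IsLocalRing.ResidueField O) F]
    [Ring S] [Algebra O S] [Ring B] [Algebra F B] (ψ : S →+* B) : Prop where
  smul : ∀ (o : O) a, ψ (o • a) =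
    algebraMap (IsLocalRing.ResidueField O) F (IsLocalRing.residue O o) • ψ a
  ker : ∀ a, ψ a = 0 → ∃ b, a = (p : O) • b
  span : Submodule.span F (Set.range ψ) = ⊤
  finrank : Module.finrank O S = Module.finrank F B

/-! ### Reduction of an order modulo p. -/

section Existence

variable {S : Type*} [Ring S] [Algebra O S] [Module.Finite O S] [Module.Free O S]

include hp in
theorem exists_smul_of_one_tmul_eq_zero {a : S}
    (h : (1 : 𝕜 O) ⊗ₜ[O] a = 0) : ∃ b, a = (p : O) • b := by
  classical
  let b := Module.Free.chooseBasis O S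
  have h1 : ∀ i, (p : O) ∣ b.repr a i := by
    intro i
    have := congrArg (fun v => (b.baseChange (𝕜 O)).repr v i) h
    simp only [Module.Basis.baseChange_repr_tmul, map_zero, Finsupp.coe_zero, Pi.zero_apply] at this
    rw [← Ideal.mem_span_singleton, ← hp, ← IsLocalRing.residue_eq_zero_iff,
      ← IsLocalRing.ResidueField.algebraMap_eq, Algebra.algebraMap_eq_smul_one, this]
  choose w hw using h1
  refine ⟨∑ i, w i • b i, b.ext_elem fun i => ?_⟩
  simp [hw, Finsupp.single_apply]

/-- The reduction map attached to a form of an algebra. -/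
def formReduction {F B : Type*} [Field F] [Algebra (𝕜 O) F] [Ring B]
    [Algebra F B] (Φ : (F ⊗[𝕜 O] (𝕜 O ⊗[O] S)) ≃ₐ[F] B) : S →+* B :=
  (Φ.toAlgHom.toRingHom.comp
    (Algebra.TensorProduct.includeRight (R := 𝕜 O) (A := F) (B := 𝕜 O ⊗[O] S)).toRingHom).comp
    (Algebra.TensorProduct.includeRight (R := O) (A := 𝕜 O) (B := S)).toRingHom

theorem formReduction_apply {F B : Type*} [Field F] [Algebra (𝕜 O) F] [Ring B]
    [Algebra F B] (Φ : (F ⊗[𝕜 O] (𝕜 O ⊗[O] S)) ≃ₐ[F] B) (a : S) :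
    formReduction Φ a = Φ ((1 : F) ⊗ₜ[𝕜 O] ((1 : 𝕜 O) ⊗ₜ[O] a)) := rfl

include hp in
theorem isReduction_formReduction {F B : Type*} [Field F] [Algebra (𝕜 O) F] [Ring B]
    [Algebra F B] (Φ : (F ⊗[𝕜 O] (𝕜 O ⊗[O] S)) ≃ₐ[F] B) :
    IsReduction (O := O) p (F := F) (formReduction Φ) where
  smul o a := by
    rw [formReduction_apply, formReduction_apply, ← TensorProduct.smul_tmul,
      ← map_smul, TensorProduct.smul_tmul', ← Algebra.algebraMap_eq_smul_one,
      IsLocalRing.ResidueField.algebraMap_eq, smul_eq_mul, mul_one,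
      Algebra.algebraMap_eq_smul_one, TensorProduct.smul_tmul, TensorProduct.smul_tmul',
      smul_eq_mul, mul_one]
  ker a ha := by
    rw [formReduction_apply, EmbeddingLike.map_eq_zero_iff] at ha
    refine exists_smul_of_one_tmul_eq_zero hp ?_
    exact Algebra.TensorProduct.includeRight_injective (R := 𝕜 O) (A := F)
      (B := 𝕜 O ⊗[O] S) (algebraMap (𝕜 O) F).injective (ha.trans (by simp))
  span := by
    rw [eq_top_iff]
    intro x _
    obtain ⟨x, rfl⟩ := Φ.surjective x
    induction x with
    | zero => simp
    | add x y hx hy => rw [map_add]; exact Submodule.add_mem _ (hx trivial) (hy trivial)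
    | tmul c x =>
      induction x with
      | zero => simp
      | add x y hx hy =>
        rw [TensorProduct.tmul_add, map_add]
        exact Submodule.add_mem _ (hx trivial) (hy trivial)
      | tmul d a =>
        have : c ⊗ₜ[𝕜 O] (d ⊗ₜ[O] a) =
            (c * algebraMap (𝕜 O) F d) • ((1 : F) ⊗ₜ[𝕜 O] ((1 : 𝕜 O) ⊗ₜ[O] a)) := by
          rw [TensorProduct.smul_tmul', smul_eq_mul, mul_one, mul_comm, ← Algebra.smul_def,
            TensorProduct.smul_tmul, TensorProduct.smul_tmul', smul_eq_mul, mul_one]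
        rw [this, map_smul]
        exact Submodule.smul_mem _ _ (Submodule.subset_span ⟨a, rfl⟩)
  finrank := by
    rw [← Φ.toLinearEquiv.finrank_eq, Module.finrank_baseChange, Module.finrank_baseChange]

end Existence

/-! ### Rationality of characters of split algebras. -/

section Split

variable {k B : Type*} [Field k] [Ring B] [Algebra k B]

/-- The characters of a split algebra with values in an algebraic extension are rational. -/
theorem IsSplit.exists_eq_algebraMap (h : IsSplit k B) {F : Type*} [Field F] [Algebra k F]
    [Algebra.IsAlgebraic k F] (θ : B →ₐ[k] F) (a : B) : ∃ c : k, θ a = algebraMap k F c := by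
  let I : Submodule B B := RingHom.ker θ.toRingHom
  have hI : ∀ x, x ∈ I ↔ θ x = 0 := fun x => Iff.rfl
  have hco : IsCoatom I := by
    constructor
    · intro h
      have : (1 : B) ∈ I := by rw [h]; trivial
      rw [hI, map_one] at this
      exact one_ne_zero this
    · intro J hJ
      obtain ⟨x, hxJ, hxI⟩ := SetLike.exists_of_lt hJ
      rw [hI] at hxI
      -- The image of θ is a subalgebra of an algebraic extension, hence a field. So the kernel is
      -- maximal even as a left ideal.
      have hinv : (θ x)⁻¹ ∈ θ.range := by
        exact Subalgebra.inv_mem_of_algebraic (A := θ.range) (x := ⟨θ x, ⟨x, rfl⟩⟩)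
          (Algebra.IsAlgebraic.isAlgebraic (R := k) (θ x))
      obtain ⟨y, hy⟩ := hinv
      change θ y = _ at hy
      rw [Ideal.eq_top_iff_one J]
      have h1 : y * x - 1 ∈ J := hJ.le (by
        rw [hI, map_sub, map_mul, hy, inv_mul_cancel₀ hxI, map_one, sub_self])
      have h2 : y * x ∈ J := J.smul_mem y hxJ
      have := J.sub_mem h2 h1
      rwa [sub_sub_cancel] at this
  -- Right multiplication by a descends to B ⧸ I because the kernel is two-sided. Splitness makes it
  -- a scalar, which is then evaluated at 1.
  let φ : (B ⧸ I) →ₗ[B] (B ⧸ I) := I.mapQ I (LinearMap.toSpanSingleton B B a) (by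
    intro x hx
    rw [Submodule.mem_comap, hI, LinearMap.toSpanSingleton_apply, smul_eq_mul, map_mul,
      (hI x).1 hx, zero_mul])
  obtain ⟨c, hc⟩ := h I hco φ
  refine ⟨c, ?_⟩
  have h1 := hc (Submodule.Quotient.mk 1)
  rw [Submodule.mapQ_apply, LinearMap.toSpanSingleton_apply, smul_eq_mul, one_mul,
    ← Submodule.Quotient.mk_smul, smul_eq_mul, mul_one, Submodule.Quotient.eq, hI, map_sub,
    sub_eq_zero, AlgHom.commutes] at h1
  exact h1

end Split

/-! ### Orthogonal idempotents of the order. -/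

section Lift

variable {F S B : Type*} [Field F] [Algebra (𝕜 O) F] [Ring S] [Algebra O S] [Module.Finite O S]
  [Module.Free O S] [Ring B] [Algebra F B] {q κ : ℕ} [NeZero κ]
  {e : ZMod κ → B} {z : ℕ → B}

namespace IsReduction

/-- Conjugates of reduction maps are reduction maps. -/
theorem conj {ψ : S →+* B} (h : IsReduction (O := O) p (F := F) ψ) (g : Bˣ) :
    IsReduction (O := O) p (F := F)
      ((MulSemiringAction.toRingHom (ConjAct Bˣ) B (ConjAct.toConjAct g)).comp ψ) := by
  have happ : ∀ a, (MulSemiringAction.toRingHom (ConjAct Bˣ) B (ConjAct.toConjAct g)).comp ψ a =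
      g * ψ a * (g⁻¹ : Bˣ) := fun a => rfl
  refine ⟨fun o a => ?_, fun a ha => h.ker a ?_, ?_, h.finrank⟩
  · rw [happ, happ, h.smul, mul_smul_comm, smul_mul_assoc]
  · rw [happ] at ha
    simpa using ha
  · rw [eq_top_iff]
    intro x _
    have hx : (g⁻¹ : Bˣ) * x * g ∈ Submodule.span F (Set.range ψ) := by rw [h.span]; trivial
    have key : ∀ y ∈ Submodule.span F (Set.range ψ), g * y * (g⁻¹ : Bˣ) ∈ Submodule.span F
        (Set.range ((MulSemiringAction.toRingHom (ConjAct Bˣ) B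
          (ConjAct.toConjAct g)).comp ψ)) := by
      intro y hy
      induction hy using Submodule.span_induction with
      | mem y hy => obtain ⟨a, rfl⟩ := hy; exact Submodule.subset_span ⟨a, happ a⟩
      | zero => simp
      | add x y _ _ hx hy => rw [mul_add, add_mul]; exact Submodule.add_mem _ hx hy
      | smul c x _ hx => rw [mul_smul_comm, smul_mul_assoc]; exact Submodule.smul_mem _ _ hx
    have := key _ hx
    simpa [mul_assoc] using this

variable {ψ : S →+* B} (h : IsReduction (O := O) p (F := F) ψ)
  (hB : DividedPowerBasis F q κ e z)
  {χ : ZMod κ → B →ₐ[F] F}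
  (hχ : ∀ i j m, χ i (e j * z m) = if j = i ∧ m = 0 then 1 else 0)
  (hrat : ∀ i a, ∃ o : O, χ i (ψ a) = algebraMap (𝕜 O) F (IsLocalRing.residue O o))

include hB hχ in
theorem chi_e (i j : ZMod κ) : χ i (e j) = if j = i then 1 else 0 := by
  have := hχ i j 0
  rw [hB.z_zero, mul_one] at this
  rw [this]
  simp

include h hB hχ hrat

/-- Distinct characters already differ on the image of ψ, because it spans. Their values come from
O, so the difference of the two values lifts to a unit of O and the element can be normalised inside
the order. -/
theorem exists_separating {i j : ZMod κ} (hij : i ≠ j) :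
    ∃ a, χ i (ψ a) = 1 ∧ χ j (ψ a) = 0 := by
  have h1 : ∃ a, χ i (ψ a) ≠ χ j (ψ a) := by
    by_contra! hcon
    have h2 : ∀ x, χ i x = χ j x := by
      intro x
      have hx : x ∈ Submodule.span F (Set.range ψ) := by rw [h.span]; trivial
      induction hx using Submodule.span_induction with
      | mem y hy => obtain ⟨a, rfl⟩ := hy; exact hcon a
      | zero => simp
      | add x y _ _ hx hy => rw [map_add, hx, hy, map_add]
      | smul c x _ hx => rw [map_smul, hx, map_smul]
    have h3 := h2 (e i)
    rw [chi_e hB hχ, chi_e hB hχ, if_pos rfl, if_neg hij] at h3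
    exact one_ne_zero h3
  obtain ⟨a, ha⟩ := h1
  obtain ⟨o₁, ho₁⟩ := hrat i a
  obtain ⟨o₂, ho₂⟩ := hrat j a
  have hu : IsUnit (o₁ - o₂) := by
    rw [← IsLocalRing.notMem_maximalIdeal, ← IsLocalRing.residue_eq_zero_iff, map_sub, sub_eq_zero]
    intro h
    exact ha (by rw [ho₁, ho₂, h])
  obtain ⟨w, hw⟩ := hu.exists_right_inv
  have hsm : ∀ (l : ZMod κ) (o : O) (a : S), χ l (ψ (o • a)) =
      algebraMap (𝕜 O) F (IsLocalRing.residue O o) * χ l (ψ a) := by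
    intro l o a
    rw [h.smul, map_smul, smul_eq_mul]
  refine ⟨w • (a - o₂ • 1), ?_, ?_⟩
  · rw [hsm, map_sub, map_sub, hsm, map_one, map_one, mul_one, ho₁, ← map_sub, ← map_sub,
      ← map_mul, ← map_mul, mul_comm, hw, map_one, map_one]
  · rw [hsm, map_sub, map_sub, hsm, map_one, map_one, mul_one, ho₂, sub_self, mul_zero]

/-- Multiply the elements that separate i from every other index. -/
theorem exists_indicator (i : ZMod κ) :
    ∃ a, ∀ j, χ j (ψ a) = if j = i then 1 else 0 := by
  have key : ∀ s : Finset (ZMod κ), i ∉ s → ∃ a, χ i (ψ a) = 1 ∧ ∀ j ∈ s, χ j (ψ a) = 0 := by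
    intro s
    induction s using Finset.induction_on with
    | empty => exact fun _ => ⟨1, by simp, by simp⟩
    | insert j s hj ih =>
      intro hi
      simp only [mem_insert, not_or] at hi
      obtain ⟨a, ha, ha'⟩ := ih hi.2
      obtain ⟨b, hb, hb'⟩ := h.exists_separating hB hχ hrat hi.1
      refine ⟨a * b, by simp [ha, hb], ?_⟩
      intro l hl
      rcases mem_insert.1 hl with rfl | hl
      · simp [hb']
      · simp [ha' l hl]
  obtain ⟨a, ha, ha'⟩ := key (univ.erase i) (by simp)
  refine ⟨a, fun j => ?_⟩
  split_ifs with hj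
  · rw [hj, ha]
  · exact ha' j (by simp [hj])

variable [IsAdicComplete (IsLocalRing.maximalIdeal O) O]

-- Idempotents are added one at a time, each lifted inside the complement of the previous ones.
-- Elements on which all characters vanish are nilpotent modulo p, which supplies the hypothesis of
-- `exists_idempotent_lift`.
include hp in
theorem exists_orthogonalIdempotents :
    ∃ ε : ZMod κ → S, (∀ i j, ε i * ε j = if i = j then ε i else 0) ∧ ∑ i, ε i = 1 ∧
      ∀ i j, χ j (ψ (ε i)) = if j = i then 1 else 0 := by
  have hpzero : ∀ b, ψ ((p : O) • b) = 0 := by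
    intro b
    rw [h.smul, (IsLocalRing.residue_eq_zero_iff _).2, map_zero, zero_smul]
    rw [hp]
    exact Ideal.mem_span_singleton_self _
  have hnil : ∀ a, (∀ j, χ j (ψ a) = 0) → ∃ b, a ^ q = (p : O) • b := by
    intro a ha
    refine h.ker _ ?_
    rw [map_pow]
    exact hB.pow_eq_zero_of_chi hχ ha
  have key : ∀ s : Finset (ZMod κ), ∃ ε : ZMod κ → S, (∀ i ∈ s, ε i * ε i = ε i) ∧
      (∀ i ∈ s, ∀ j ∈ s, i ≠ j → ε i * ε j = 0) ∧
      ∀ i ∈ s, ∀ j, χ j (ψ (ε i)) = if j = i then 1 else 0 := by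
    intro s
    induction s using Finset.induction_on with
    | empty => exact ⟨0, by simp, by simp, by simp⟩
    | insert l s hl ih =>
      obtain ⟨ε, h1, h2, h3⟩ := ih
      obtain ⟨a₀, ha₀⟩ := h.exists_indicator hB hχ hrat l
      set E := ∑ i ∈ s, ε i with hE
      have hεE : ∀ i ∈ s, ε i * E = ε i := by
        intro i hi
        rw [hE, mul_sum, sum_eq_single i]
        · exact h1 i hi
        · exact fun j hj hji => h2 i hi j hj hji.symm
        · exact fun h => absurd hi h
      have hEε : ∀ i ∈ s, E * ε i = ε i := by
        intro i hi
        rw [hE, sum_mul, sum_eq_single i]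
        · exact h1 i hi
        · exact fun j hj hji => h2 j hj i hi hji
        · exact fun h => absurd hi h
      have hχE : ∀ j, χ j (ψ E) = if j ∈ s then 1 else 0 := by
        intro j
        rw [hE, map_sum, map_sum, sum_congr rfl fun i hi => h3 i hi j]
        simp
      -- Cutting down by 1 - E makes a, and hence its lift, orthogonal to the idempotents already
      -- found. Character values are unchanged, since E vanishes under the character of the new
      -- index.
      set a := (1 - E) * a₀ * (1 - E) with ha
      have hχa : ∀ j, χ j (ψ a) = if j = l then 1 else 0 := by
        intro j
        simp only [ha, map_mul, map_sub, map_one, hχE, ha₀]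
        by_cases hj : j = l
        · rw [if_pos hj, if_neg (hj ▸ hl)]; simp
        · rw [if_neg hj]; simp
      have hχa2 : ∀ j, χ j (ψ (a ^ 2 - a)) = 0 := by
        intro j
        rw [map_sub, map_sub, map_pow, map_pow, hχa]
        split_ifs <;> simp
      obtain ⟨b, hb⟩ := hnil _ hχa2
      obtain ⟨g, hg1, ⟨x, y, hxy⟩, hg2, hg3⟩ := exists_idempotent_lift hp a q b hb
      have hl1 : ∀ i ∈ s, ε i * g = 0 := fun i hi => hg2 _ (by
        rw [ha, ← mul_assoc, ← mul_assoc, mul_sub (ε i) 1 E, mul_one, hεE i hi, sub_self, zero_mul,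
          zero_mul])
      have hl2 : ∀ i ∈ s, g * ε i = 0 := fun i hi => hg3 _ (by
        rw [ha, mul_assoc, sub_mul 1 E (ε i), one_mul, hEε i hi, sub_self, mul_zero])
      have hne : ∀ i ∈ s, i ≠ l := fun i hi h => hl (h ▸ hi)
      refine ⟨Function.update ε l g, ?_, ?_, ?_⟩
      · intro i hi
        rcases mem_insert.1 hi with rfl | hi
        · simpa using hg1
        · rw [Function.update_of_ne (hne i hi)]; exact h1 i hi
      · intro i hi j hj hij
        rcases mem_insert.1 hi with hi' | hi' <;> rcases mem_insert.1 hj with hj' | hj'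
        · exact absurd (hi'.trans hj'.symm) hij
        · rw [hi', Function.update_self, Function.update_of_ne (hne j hj')]; exact hl2 j hj'
        · rw [hj', Function.update_self, Function.update_of_ne (hne i hi')]; exact hl1 i hi'
        · rw [Function.update_of_ne (hne i hi'), Function.update_of_ne (hne j hj')]
          exact h2 i hi' j hj' hij
      · intro i hi j
        rcases mem_insert.1 hi with rfl | hi
        · rw [Function.update_self, ← hχa j, ← sub_eq_zero, ← map_sub, ← map_sub, hxy, map_add,
            map_add, map_mul, map_mul, hχa2, hpzero, zero_mul, map_zero, add_zero]
        · rw [Function.update_of_ne (hne i hi)]; exact h3 i hi j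
  obtain ⟨ε, h1, h2, h3⟩ := key univ
  have horth : ∀ i j, ε i * ε j = if i = j then ε i else 0 := by
    intro i j
    split_ifs with hij
    · rw [← hij]; exact h1 i (mem_univ i)
    · exact h2 i (mem_univ i) j (mem_univ j) hij
  refine ⟨ε, horth, ?_, fun i j => h3 i (mem_univ i) j⟩
  -- The defect 1 - Σ ε_i is idempotent and nilpotent modulo p, so it is divisible by all powers of
  -- p.
  have hid : (1 - ∑ i, ε i) * (1 - ∑ i, ε i) = 1 - ∑ i, ε i := by
    have : (∑ i, ε i) * ∑ i, ε i = ∑ i, ε i := by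
      rw [sum_mul_sum]
      simp [horth]
    rw [mul_sub, sub_mul, sub_mul, this]
    simp
  obtain ⟨b, hb⟩ := hnil (1 - ∑ i, ε i) (fun j => by
    rw [map_sub, map_sub, map_sum, map_sum, sum_congr rfl fun i hi => h3 i hi j]
    simp)
  have hpow : ∀ n, (1 - ∑ i, ε i) ^ (n + 1) = 1 - ∑ i, ε i := by
    intro n
    induction n with
    | zero => simp
    | succ n ih => rw [pow_succ, ih, hid]
  refine (sub_eq_zero.1 (module_eq_zero_of_forall hp fun n => ?_)).symm
  refine ⟨b ^ n * (1 - ∑ i, ε i), ?_⟩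
  rw [← smul_mul_assoc, ← smul_pow, ← hb, ← pow_mul, ← pow_succ, hpow]

include hp in
/-- After a conjugation the idempotents lift. -/
theorem exists_lift : ∃ (ψ' : S →+* B) (ε : ZMod κ → S), IsReduction (O := O) p (F := F) ψ' ∧
    (∀ i j, ε i * ε j = if i = j then ε i else 0) ∧ ∑ i, ε i = 1 ∧ ∀ i, ψ' (ε i) = e i := by
  obtain ⟨ε, h1, h2, h3⟩ := h.exists_orthogonalIdempotents hp hB hχ hrat
  -- The usual element intertwining two complete families of orthogonal idempotents. It is congruent
  -- to 1 modulo the radical, hence a unit.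
  set g := ∑ i, e i * ψ (ε i) with hg
  have hgu : IsUnit g := by
    have : (g - 1) ^ q = 0 := by
      refine hB.pow_eq_zero_of_chi hχ fun j => ?_
      rw [map_sub, map_one, hg, map_sum]
      simp only [map_mul, chi_e hB hχ, h3]
      simp
    have h4 := IsNilpotent.isUnit_add_one (r := g - 1) ⟨q, this⟩
    simpa using h4
  obtain ⟨g', hg'⟩ := hgu
  refine ⟨_, ε, h.conj g', h1, h2, fun i => ?_⟩
  change g' * ψ (ε i) * (g'⁻¹ : Bˣ) = e i
  have h4 : (g' : B) * ψ (ε i) = e i * g' := by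
    rw [hg', hg, sum_mul, mul_sum, sum_eq_single i, sum_eq_single i]
    · rw [mul_assoc, ← map_mul, h1, if_pos rfl, ← mul_assoc, hB.e_mul_self]
    · intro j _ hj
      rw [← mul_assoc, hB.e_mul_ne hj.symm, zero_mul]
    · simp
    · intro j _ hj
      rw [mul_assoc, ← map_mul, h1, if_neg hj, map_zero, mul_zero]
    · simp
  rw [h4, mul_assoc, Units.mul_inv, mul_one]

end IsReduction

end Lift

end UniqueLifting

end

noncomputable section

namespace UniqueLifting

open Finset

set_option linter.unusedSectionVars false

section Paths

variable {S : Type*} [Ring S] {κ f p : ℕ} {ε : ZMod κ → S} {X : ZMod κ → Fin f → S}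
  (hε : ∀ i, ε i * ε i = ε i) (hεX : ∀ (i : ZMod κ) (j : Fin f), ε i * X i j = X i j)

include hε hεX in
theorem idem_mul_pathProd (i : ZMod κ) (w : List (Fin f)) :
    ε i * pathProd p ε X i w = pathProd p ε X i w := by
  cases w with
  | nil => exact hε i
  | cons j w => rw [pathProd, ← mul_assoc, hεX]

include hε in
theorem pathProd_mul_idem (i : ZMod κ) (w : List (Fin f)) :
    pathProd p ε X i w * ε (i + (wordWt p w : ℕ)) = pathProd p ε X i w := by
  induction w generalizing i with
  | nil => simp [pathProd, wordWt_nil, hε]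
  | cons j w ih =>
    rw [pathProd, mul_assoc, wordWt_cons]
    congr 1
    have := ih (i + (p ^ (j : ℕ) : ℕ))
    rwa [add_assoc, ← Nat.cast_add] at this

end Paths

/-- An order presented by arrows which shift a cyclic family of idempotents. -/
structure IsCyclicOrder (O : Type*) {S : Type*} [CommRing O] [Ring S] [Algebra O S]
    (p f κ c d : ℕ) (ε : ZMod κ → S) (X : ZMod κ → Fin f → S) (w₀ : List (Fin f)) : Prop where
  idem_mul : ∀ i j, ε i * ε j = if i = j then ε i else 0
  idem_sum : ∀ [NeZero κ], ∑ i, ε i = 1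
  idem_mul_arrow : ∀ i (j : Fin f), ε i * X i j = X i j
  arrow_mul_idem : ∀ (i : ZMod κ) (j : Fin f), X i j * ε (i + (p ^ (j : ℕ) : ℕ)) = X i j
  paths : ∀ (i l : ZMod κ) a, ε i * a * ε l ∈
    Submodule.span O {x | ∃ w, i + (wordWt p w : ℕ) = l ∧ x = pathProd p ε X i w}
  factor : ∀ (i : ZMod κ) (j : Fin f) a, ∃ b, ε i * a * ε (i + (p ^ (j : ℕ) : ℕ)) = X i j * b
  pow : ∀ (i : ZMod κ) (j : Fin f), ∃ b, pathProd p ε X i (List.replicate p j) = (p : O) • b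
  weight : wordWt p w₀ = κ
  count : ∀ j, w₀.count j = d
  loops : ∀ (i : ZMod κ) a, ∃ g : ℕ → O, ε i * a * ε i =
    ∑ t ∈ range (c + 1), g t • (ε i * pathProd p ε X i w₀ ^ t)
  generators : ∀ i l : ZMod κ, i ≠ l → ∃ v : ℕ → S, ∀ a, ∃ g : ℕ → O, ε i * a * ε l =
    ∑ t ∈ range c, g t • v t

/-! ### Arrows and paths generating the order. -/

section Output

variable {O : Type*} [CommRing O] [IsDomain O] [IsDiscreteValuationRing O] {p : ℕ}

local notation "𝕜" => IsLocalRing.ResidueField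

variable {F S B : Type*} [Field F] [Algebra (𝕜 O) F] [Ring S] [Algebra O S] [Module.Finite O S]
  [Module.Free O S] [Ring B] [Algebra F B] {q κ : ℕ} [NeZero κ]
  {e : ZMod κ → B} {z : ℕ → B}

namespace IsReduction

variable {ψ : S →+* B} (h : IsReduction (O := O) p (F := F) ψ)
  (hB : DividedPowerBasis F q κ e z)

include h hB in
/-- Elements with all possible leading terms generate. -/
theorem span_eq_top_of_lead {y : ZMod κ → ℕ → S}
    (hy : ∀ i, ∀ m < q, Lead F e z i m (ψ (y i m))) :
    Submodule.span O (Set.range (fun x : ZMod κ × Fin q => y x.1 x.2)) = ⊤ := by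
  classical
  have hfin := hB.finite
  have hcard : Fintype.card (ZMod κ × Fin q) = Module.finrank F B := by
    rw [hB.finrank_eq]; simp [ZMod.card]
  let b : Module.Basis (ZMod κ × Fin q) O S :=
    (Module.finBasisOfFinrankEq O S (h.finrank.trans hcard.symm)).reindex
      (Fintype.equivFin _).symm
  have hψ : ∀ a : S, ψ a = ∑ l, algebraMap (𝕜 O) F (IsLocalRing.residue O (b.repr a l)) •
      ψ (b l) := by
    intro a
    conv_lhs => rw [← b.sum_repr a, map_sum]
    exact sum_congr rfl fun l _ => h.smul _ _
  have hspan : Submodule.span F (Set.range (ψ ∘ b)) = ⊤ := by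
    rw [eq_top_iff, ← h.span, Submodule.span_le]
    rintro _ ⟨a, rfl⟩
    rw [hψ]
    exact Submodule.sum_mem _ fun l _ => Submodule.smul_mem _ _ (Submodule.subset_span ⟨l, rfl⟩)
  let bF : Module.Basis (ZMod κ × Fin q) F B :=
    basisOfTopLeSpanOfCardEqFinrank (ψ ∘ b) hspan.ge hcard
  have hbF : ∀ l, bF l = ψ (b l) := fun l => by simp [bF]
  set v : ZMod κ × Fin q → S := fun x => y x.1 x.2 with hv
  have hspan' := hB.span_of_lead (y := fun i m => ψ (y i m)) hy
  have hli := linearIndependent_of_top_le_span_of_card_eq_finrank hspan'.ge hcard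
  have hdet := Module.Basis.is_basis_iff_det bF |>.1 ⟨hli, hspan'⟩
  -- Nakayama's lemma in determinant form: the transition determinant over O maps to a nonzero
  -- element of F, so it is a unit of O.
  have hmat : bF.toMatrix (fun x => ψ (v x)) =
      ((algebraMap (𝕜 O) F).comp (IsLocalRing.residue O)).mapMatrix (b.toMatrix v) := by
    ext l x
    rw [Module.Basis.toMatrix_apply, hψ (v x)]
    simp_rw [← hbF]
    rw [bF.repr_sum_self]
    rfl
  refine ((Module.Basis.is_basis_iff_det b (v := v)).2 ?_).2
  rw [Module.Basis.det_apply] at hdet ⊢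
  change IsUnit (bF.toMatrix (fun x => ψ (v x))).det at hdet
  rw [hmat, ← RingHom.map_det, RingHom.comp_apply, isUnit_iff_ne_zero, Ne,
    FaithfulSMul.algebraMap_eq_zero_iff, IsLocalRing.residue_eq_zero_iff] at hdet
  exact IsLocalRing.notMem_maximalIdeal.1 hdet

variable {ε : ZMod κ → S} (hε : ∀ i j, ε i * ε j = if i = j then ε i else 0)

-- Each y i m lies in a single Peirce component, so only the members of row i with m ≡ r modulo κ
-- survive, that is, m = r + κt.
include hε in
theorem exists_coeff_of_span {y : ZMod κ → ℕ → S}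
    (hy : Submodule.span O (Set.range (fun x : ZMod κ × Fin q => y x.1 x.2)) = ⊤)
    (hl : ∀ i m, ε i * y i m = y i m) (hr : ∀ i (m : ℕ), y i m * ε (i + m) = y i m)
    (i : ZMod κ) {r N : ℕ} (hrκ : r < κ) (hN : ∀ t, r + κ * t < q ↔ t < N) (a : S) :
    ∃ g : ℕ → O, ε i * a * ε (i + r) = ∑ t ∈ range N, g t • y i (r + κ * t) := by
  have ha : a ∈ Submodule.span O (Set.range (fun x : ZMod κ × Fin q => y x.1 x.2)) := by
    rw [hy]; trivial
  induction ha using Submodule.span_induction with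
  | mem a ha =>
    obtain ⟨⟨j, m⟩, rfl⟩ := ha
    simp only
    by_cases hij : i = j
    swap
    · exact ⟨0, by rw [← hl j m, ← mul_assoc, hε, if_neg hij]; simp⟩
    subst hij
    rw [hl]
    by_cases hm : i + ((m : ℕ) : ZMod κ) = i + r
    swap
    · exact ⟨0, by rw [← hr i m, mul_assoc, hε, if_neg hm]; simp⟩
    have h3 : (m : ℕ) % κ = r := by
      have := (ZMod.natCast_eq_natCast_iff' m r κ).1 (add_left_cancel hm)
      rwa [Nat.mod_eq_of_lt hrκ] at this
    have h4 : (m : ℕ) = r + κ * (m / κ) := by rw [← h3]; exact (Nat.mod_add_div m κ).symm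
    refine ⟨fun t => if t = m / κ then 1 else 0, ?_⟩
    rw [← hm, hr, sum_eq_single ((m : ℕ) / κ)]
    · simp only [if_true, one_smul, ← h4]
    · intro t _ ht
      simp only [if_neg ht, zero_smul]
    · intro ht
      rw [mem_range, ← hN, ← h4] at ht
      exact absurd m.2 ht
  | zero => exact ⟨0, by simp⟩
  | add a b _ _ ha hb =>
    obtain ⟨g, hg⟩ := ha
    obtain ⟨g', hg'⟩ := hb
    exact ⟨g + g', by rw [mul_add, add_mul, hg, hg', ← sum_add_distrib]; simp [add_smul]⟩
  | smul o a _ ha =>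
    obtain ⟨g, hg⟩ := ha
    exact ⟨o • g, by rw [mul_smul_comm, smul_mul_assoc, hg, smul_sum]; simp [mul_smul]⟩

variable (hψ : ∀ i, ψ (ε i) = e i)

-- The image of ψ spans, so some a has a nonzero coefficient at `e i * z n`. Cutting a down by the
-- idempotents on both sides keeps this coefficient, and homogeneous elements of the Peirce
-- component start in degree n.
include h hB hψ hε in
theorem exists_arrow {c : ℕ} (i : ZMod κ) {n : ℕ}
    (hnq : n < q) (hnκ : n < κ) (hq : q ≤ c * κ + 1)
    (hch : ∀ t < c, ((n + κ * t).choose n : F) ≠ 0) :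
    ∃ x, ε i * x = x ∧ x * ε (i + n) = x ∧ Lead F e z i n (ψ x) := by
  classical
  have h1 : ∃ a, hB.basis.repr (ψ a) (i, ⟨n, hnq⟩) ≠ 0 := by
    by_contra! hcon
    have h2 : ∀ x, hB.basis.repr x (i, ⟨n, hnq⟩) = 0 := by
      intro x
      have hx : x ∈ Submodule.span F (Set.range ψ) := by rw [h.span]; trivial
      induction hx using Submodule.span_induction with
      | mem y hy => obtain ⟨a, rfl⟩ := hy; exact hcon a
      | zero => simp
      | add x y _ _ hx hy => simp [hx, hy]
      | smul c x _ hx => simp [hx]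
    have := h2 (hB.basis (i, ⟨n, hnq⟩))
    simp at this
  obtain ⟨a, ha⟩ := h1
  have hrepr : ∀ x, hB.basis.repr (e i * x * e (i + n)) (i, ⟨n, hnq⟩) =
      hB.basis.repr x (i, ⟨n, hnq⟩) := by
    intro x
    induction x using hB.induction_basis with
    | h0 => simp
    | hadd x y hx hy => rw [mul_add, add_mul, map_add, map_add, Finsupp.add_apply,
        Finsupp.add_apply, hx, hy]
    | hsmul c x hx => rw [mul_smul_comm, smul_mul_assoc, map_smul, map_smul, Finsupp.smul_apply,
        Finsupp.smul_apply, hx]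
    | hb j m hm =>
      have hself : hB.basis.repr (e j * z m) = Finsupp.single (j, ⟨m, hm⟩) 1 := by
        rw [← hB.basis.repr_self, hB.basis_apply]
      by_cases hjm : j = i ∧ m = n
      · obtain ⟨rfl, rfl⟩ := hjm
        rw [← mul_assoc, hB.e_mul_self, hB.e_z_e, if_pos rfl]
      · have h3 : hB.basis.repr (e j * z m) (i, ⟨n, hnq⟩) = 0 := by
          rw [hself, Finsupp.single_apply, if_neg]
          simpa using hjm
        rw [h3, ← mul_assoc, hB.e_mul]
        split_ifs with h4
        · rw [hB.e_z_e]
          split_ifs with h5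
          · subst h4; exact h3
          · simp
        · simp
  refine ⟨ε i * a * ε (i + n), ?_, ?_, ?_⟩
  · rw [← mul_assoc, ← mul_assoc, hε, if_pos rfl]
  · rw [mul_assoc, hε, if_pos rfl]
  · have h3 : ψ (ε i * a * ε (i + n)) = e i * ψ a * e (i + n) := by
      rw [map_mul, map_mul, hψ, hψ]
    obtain ⟨w, hw, h4⟩ := hB.exists_homogeneous i hnκ hq hch (x := e i * ψ a * e (i + n))
      (by rw [← mul_assoc, ← mul_assoc, hB.e_mul_self])
      (by rw [mul_assoc, hB.e_mul_self])
    have hzw : z n * w ∈ dpFil F z (n + 0) :=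
      dpFil_mul hB.z_mul (mem_dpFil le_rfl) hw
    rw [add_zero] at hzw
    obtain ⟨d, t, ht, h5⟩ := exists_of_mem_dpFil hzw
    rw [h3]
    refine ⟨by rw [mul_assoc, hB.e_mul_self], d, ?_, t, ht, by rw [h4, h5]⟩
    rintro rfl
    refine ha ?_
    rw [← hrepr, h4, h5, zero_smul, zero_add]
    have key : ∀ t ∈ dpFil F z (n + 1), hB.basis.repr (e i * t) (i, ⟨n, hnq⟩) = 0 := by
      intro t ht
      induction ht using Submodule.span_induction with
      | mem x hx =>
        obtain ⟨l, hl, rfl⟩ := hx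
        by_cases hlq : l < q
        · have hself : hB.basis.repr (e i * z l) = Finsupp.single (i, ⟨l, hlq⟩) 1 := by
            rw [← hB.basis.repr_self, hB.basis_apply]
          rw [hself, Finsupp.single_apply, if_neg]
          simp only [Prod.mk.injEq, Fin.mk.injEq, true_and]
          have : n + 1 ≤ l := hl
          omega
        · rw [hB.z_eq_zero l (not_lt.1 hlq)]; simp
      | zero => simp
      | add x y _ _ hx hy => rw [mul_add, map_add, Finsupp.add_apply, hx, hy, add_zero]
      | smul c x _ hx => rw [mul_smul_comm, map_smul, Finsupp.smul_apply, hx, smul_zero]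
    exact key t ht

-- The arrows lift the elements z_{p^j}. Paths along base p expansions have leading terms in all
-- degrees and therefore generate over O. Within one Peirce component any other family with the same
-- leading degrees does as well (`hmod`), and suitable choices of that family give the factorisation
-- through an arrow and the description by powers of a loop.
include h hB hψ hε in
theorem exists_isCyclicOrder {f c d : ℕ} [hp : Fact p.Prime] [CharP F p]
    (hsum : ∑ i, ε i = 1) (hqf : q = p ^ f)
    (hq : q = c * κ + 1) (hc : 0 < c) (hcd : c * d = p - 1)
    (hκ : ∀ j < f, p ^ j < κ)
    (hch : ∀ j < f, ∀ t < c, ((p ^ j + κ * t).choose (p ^ j) : F) ≠ 0)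
    (hch' : ∀ t < c, ((κ + κ * t).choose κ : F) ≠ 0) :
    ∃ X w₀, IsCyclicOrder O p f κ c d ε X w₀ := by
  classical
  have hκ0 : 0 < κ := Nat.pos_of_ne_zero (NeZero.ne κ)
  have hidem : ∀ i, ε i * ε i = ε i := fun i => by rw [hε, if_pos rfl]
  have hpq : ∀ j < f, p ^ j < q := fun j hj => by
    rw [hqf]; exact Nat.pow_lt_pow_right hp.out.one_lt hj
  choose X hX1 hX2 hX3 using fun (i : ZMod κ) (j : Fin f) =>
    h.exists_arrow hB hε hψ i (hpq j j.2) (hκ j j.2) hq.le (hch j j.2)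
  have hψp : ∀ i w, ψ (pathProd p ε X i w) = pathProd p e (fun i j => ψ (X i j)) i w := by
    intro i w
    rw [map_pathProd]
    simp_rw [hψ]
  choose! W hW1 hW2 using fun m hm => hB.exists_word hX3 m hm
  have hpl := idem_mul_pathProd (p := p) hidem hX1
  have hpr := pathProd_mul_idem (p := p) (X := X) hidem
  have hrep : repdigit p d f = κ := by
    have h1 := mul_repdigit hcd f
    have h2 : c * repdigit p d f = c * κ := by omega
    exact Nat.eq_of_mul_eq_mul_left hc h2
  obtain ⟨w₀, hw1, hw2, hw3⟩ := hB.exists_repdigit_word hX3 hc hcd f le_rfl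
  rw [hrep] at hw1 hw3
  -- the standard family
  set y : ZMod κ → ℕ → S := fun i m => if m < q then pathProd p ε X i (W m) else 0 with hy
  have hylead : ∀ i, ∀ m < q, Lead F e z i m (ψ (y i m)) := by
    intro i m hm
    simp only [hy, if_pos hm, hψp]
    exact hW2 m (hqf ▸ hm) i
  have hyl : ∀ i m, ε i * y i m = y i m := by
    intro i m
    simp only [hy]
    split_ifs
    · exact hpl i _
    · exact mul_zero _
  have hyr : ∀ i (m : ℕ), y i m * ε (i + m) = y i m := by
    intro i m
    simp only [hy]
    split_ifs with hm
    · have := hpr i (W m)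
      rwa [hW1 m (hqf ▸ hm)] at this
    · exact zero_mul _
  have hyspan := h.span_eq_top_of_lead hB hylead
  -- a modified family
  have hmod : ∀ (i : ZMod κ) (r N : ℕ), r < κ → (∀ t, r + κ * t < q ↔ t < N) → ∀ v : ℕ → S,
      (∀ t, ε i * v t = v t) → (∀ t, v t * ε (i + r) = v t) →
      (∀ t < N, Lead F e z i (r + κ * t) (ψ (v t))) →
      ∀ a, ∃ g : ℕ → O, ε i * a * ε (i + r) = ∑ t ∈ range N, g t • v t := by
    intro i r N hr hN v hv1 hv2 hv3 a
    set y' : ZMod κ → ℕ → S := fun l m =>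
      if l = i ∧ m % κ = r then v (m / κ) else y l m with hy'
    have h4 : ∀ t, (r + κ * t) % κ = r ∧ (r + κ * t) / κ = t := by
      intro t
      constructor
      · rw [Nat.add_mul_mod_self_left, Nat.mod_eq_of_lt hr]
      · rw [Nat.add_mul_div_left _ _ hκ0, Nat.div_eq_of_lt hr, zero_add]
    have h5 : ∀ m : ℕ, m % κ = r → m = r + κ * (m / κ) := fun m hm => by
      rw [← hm]; exact (Nat.mod_add_div m κ).symm
    have h7 : ∀ l, ∀ m < q, Lead F e z l m (ψ (y' l m)) := by
      intro l m hm
      simp only [hy']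
      split_ifs with hlm
      · obtain ⟨rfl, hm'⟩ := hlm
        have h6 := h5 m hm'
        have := hv3 (m / κ) ((hN _).1 (h6 ▸ hm))
        rwa [← h6] at this
      · exact hylead l m hm
    have h8 : ∀ l m, ε l * y' l m = y' l m := by
      intro l m
      simp only [hy']
      split_ifs with hlm
      · rw [hlm.1, hv1]
      · exact hyl l m
    have h9 : ∀ l (m : ℕ), y' l m * ε (l + m) = y' l m := by
      intro l m
      simp only [hy']
      split_ifs with hlm
      · have : ((m : ℕ) : ZMod κ) = r := by
          rw [h5 m hlm.2]; simp
        rw [hlm.1, this, hv2]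
      · exact hyr l m
    obtain ⟨g, hg⟩ := exists_coeff_of_span (q := q) (y := y') hε (h.span_eq_top_of_lead hB h7)
      h8 h9 i hr hN a
    refine ⟨g, hg.trans (sum_congr rfl fun t _ => ?_)⟩
    rw [show y' i (r + κ * t) = v t by
      simp only [hy']
      rw [if_pos ⟨trivial, (h4 t).1⟩, (h4 t).2]]
  -- Since q = cκ + 1, a nonzero residue occurs in c degrees below q, while the residue 0 occurs in
  -- c + 1.
  have hN1 : ∀ r, 0 < r → r < κ → ∀ t, r + κ * t < q ↔ t < c := by
    intro r h0 hr t
    rw [hq, mul_comm c]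
    constructor
    · intro h1
      by_contra h2
      have := Nat.mul_le_mul_left κ (not_lt.1 h2)
      omega
    · intro h1
      have := Nat.mul_le_mul_left κ (show t + 1 ≤ c from h1)
      rw [mul_add, mul_one] at this
      omega
  have hN0 : ∀ t, 0 + κ * t < q ↔ t < c + 1 := by
    intro t
    rw [hq, mul_comm c, zero_add, Nat.lt_succ_iff, Nat.lt_succ_iff, Nat.mul_le_mul_left_iff hκ0]
  refine ⟨X, w₀, hε, ?_, hX1, hX2, ?_, ?_, ?_, hw1, ?_, ?_, ?_⟩
  · intro inst
    convert hsum
  · intro i l a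
    have ha : a ∈ Submodule.span O (Set.range (fun x : ZMod κ × Fin q => y x.1 x.2)) := by
      rw [hyspan]; trivial
    induction ha using Submodule.span_induction with
    | mem a ha =>
      obtain ⟨⟨j, m⟩, rfl⟩ := ha
      simp only
      by_cases hij : i = j
      swap
      · rw [← hyl j m, ← mul_assoc, hε, if_neg hij]; simp
      subst hij
      rw [hyl]
      by_cases hm : i + ((m : ℕ) : ZMod κ) = l
      swap
      · rw [← hyr i m, mul_assoc, hε, if_neg hm]; simp
      rw [← hm, hyr]
      refine Submodule.subset_span ⟨W m, ?_, ?_⟩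
      · rw [hW1 m (hqf ▸ m.2)]
      · simp only [hy]; rw [if_pos m.2]
    | zero => simp
    | add a b _ _ ha hb => rw [mul_add, add_mul]; exact Submodule.add_mem _ ha hb
    | smul o a _ ha => rw [mul_smul_comm, smul_mul_assoc]; exact Submodule.smul_mem _ _ ha
  · intro i j a
    have hpj : 0 < p ^ (j : ℕ) := pow_pos hp.out.pos _
    -- The arrow times elements of degrees κt has leading degrees p^j + κt, which are all the
    -- degrees of this component. So the whole component is left divisible by the arrow.
    obtain ⟨g, hg⟩ := hmod i (p ^ (j : ℕ)) c (hκ j j.2) (hN1 _ hpj (hκ j j.2))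
      (fun t => X i j * (y (i + (p ^ (j : ℕ) : ℕ)) (κ * t)))
      (fun t => by rw [← mul_assoc, hX1])
      (fun t => by
        rw [mul_assoc]
        have := hyr (i + (p ^ (j : ℕ) : ℕ)) (κ * t)
        rw [Nat.cast_mul, ZMod.natCast_self, zero_mul, add_zero] at this
        rw [this])
      (fun t ht => by
        have h1 := (hN1 _ hpj (hκ j j.2) t).2 ht
        rw [map_mul]
        exact hB.lead_mul (hX3 i j) (hylead _ _ (by omega)) (hch j j.2 t ht)) a
    refine ⟨∑ t ∈ range c, g t • y (i + (p ^ (j : ℕ) : ℕ)) (κ * t), ?_⟩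
    rw [hg, mul_sum]
    simp_rw [mul_smul_comm]
  · intro i j
    refine h.ker _ ?_
    rw [hψp]
    refine hB.pathProd_replicate_eq_zero j (fun i => ?_) (fun i => ?_) i
    · refine hB.exists_homogeneous i (hκ j j.2) hq.le (hch j j.2) ?_ ?_
      · rw [← hψ, ← map_mul, hX1]
      · rw [← hψ, ← map_mul, hX2]
    · rw [← hψ, ← map_mul, hX2]
  · intro j
    rw [hw2, if_pos j.2]
  · intro i a
    set Y := pathProd p ε X i w₀ with hY
    have hYr : Y * ε i = Y := by
      have := hpr i w₀
      rwa [hw1, ZMod.natCast_self, add_zero] at this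
    have hYl : ε i * Y = Y := hpl i w₀
    have hcomm : ∀ t, ε i * Y ^ t * ε i = ε i * Y ^ t := by
      intro t
      cases t with
      | zero => rw [pow_zero, mul_one, hidem]
      | succ t => rw [pow_succ, mul_assoc, mul_assoc, hYr]
    -- The powers of the loop have leading degrees κt, since the binomial coefficients C(κ + κt, κ)
    -- do not vanish in F for t < c.
    obtain ⟨g, hg⟩ := hmod i 0 (c + 1) hκ0 hN0 (fun t => ε i * Y ^ t)
      (fun t => by rw [← mul_assoc, hidem])
      (fun t => by rw [Nat.cast_zero, add_zero, hcomm])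
      (fun t ht => by
        rw [zero_add]
        induction t with
        | zero => simpa [hψ] using hB.lead_e i
        | succ t ih =>
          have h1 : ψ (ε i * Y ^ (t + 1)) = ψ Y * ψ (ε i * Y ^ t) := by
            rw [← map_mul, ← mul_assoc, hYr, pow_succ', ← mul_assoc, hYl]
          have h2 : Lead F e z i κ (ψ Y) := by rw [hY, hψp]; exact hw3 i
          have h3 := ih (by omega)
          rw [h1, show κ * (t + 1) = κ + κ * t by ring]
          refine hB.lead_mul h2 ?_ (hch' t (by omega))
          rwa [ZMod.natCast_self, add_zero]) a
    rw [Nat.cast_zero, add_zero] at hg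
    exact ⟨g, hg⟩
  · intro i l hil
    have h1 : (((l - i).val : ℕ) : ZMod κ) = l - i := by rw [ZMod.natCast_val, ZMod.cast_id]
    have h2 : 0 < (l - i).val := by
      rw [Nat.pos_iff_ne_zero, Ne, ZMod.val_eq_zero, sub_eq_zero]
      exact fun h => hil h.symm
    refine ⟨fun t => y i ((l - i).val + κ * t), fun a => ?_⟩
    obtain ⟨g, hg⟩ := exists_coeff_of_span (q := q) hε hyspan hyl hyr i (ZMod.val_lt (l - i))
      (hN1 _ h2 (ZMod.val_lt _)) a
    rw [h1, add_sub_cancel] at hg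
    exact ⟨g, hg⟩

end IsReduction

end Output

end UniqueLifting

end

noncomputable section

namespace UniqueLifting

open Finset TensorProduct

set_option linter.unusedSectionVars false

local notation "𝕜" => IsLocalRing.ResidueField

/-! ### Full orders and bases of the ambient algebra. -/

section Orders

variable {O K A : Type*} [CommRing O] [IsDomain O] [IsDiscreteValuationRing O]
  [Field K] [Algebra O K] [IsFractionRing O K] [Ring A] [Algebra K A] [Algebra O A]
  [IsScalarTower O K A]

theorem isTorsionFree_of_isFractionRing (O K A : Type*) [CommRing O] [IsDomain O]
    [Field K] [Algebra O K] [IsFractionRing O K] [Ring A] [Algebra K A] [Algebra O A]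
    [IsScalarTower O K A] : Module.IsTorsionFree O A := by
  rw [Module.isTorsionFree_iff_smul_eq_zero]
  intro o a h
  rw [← algebraMap_smul K o a, smul_eq_zero] at h
  rcases h with h | h
  · exact Or.inl ((FaithfulSMul.algebraMap_eq_zero_iff O K).1 h)
  · exact Or.inr h

theorem IsFullOrder.finite {Λ : Subalgebra O A} (h : IsFullOrder O K Λ) : Module.Finite O Λ :=
  Module.Finite.iff_fg.2 h.fg

theorem IsFullOrder.free {Λ : Subalgebra O A} (h : IsFullOrder O K Λ) : Module.Free O Λ := by
  have := h.finite
  have := isTorsionFree_of_isFractionRing O K A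
  infer_instance

theorem IsFullOrder.exists_basis {Λ : Subalgebra O A} (h : IsFullOrder O K Λ) {ι : Type*}
    [Fintype ι] (b : Module.Basis ι O Λ) : ∃ b' : Module.Basis ι K A, ∀ i, b' i = b i := by
  have h1 : LinearIndependent O (fun i => (b i : A)) :=
    b.linearIndependent.map' Λ.val.toLinearMap (LinearMap.ker_eq_bot.2 Subtype.val_injective)
  have h2 : LinearIndependent K (fun i => (b i : A)) :=
    (LinearIndependent.iff_fractionRing O K).1 h1
  have h3 : Submodule.span K (Set.range fun i => (b i : A)) = ⊤ := by
    rw [eq_top_iff, ← h.span_eq_top, Submodule.span_le]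
    intro a ha
    have h4 := b.sum_repr ⟨a, ha⟩
    have h5 : a = ∑ i, b.repr ⟨a, ha⟩ i • (b i : A) := by
      have := congrArg (Λ.val) h4
      rw [map_sum] at this
      simpa using this.symm
    rw [h5]
    refine Submodule.sum_mem _ fun i _ => ?_
    rw [← algebraMap_smul K]
    exact Submodule.smul_mem _ _ (Submodule.subset_span ⟨i, rfl⟩)
  exact ⟨Module.Basis.mk h2 h3.ge, fun i => by rw [Module.Basis.mk_apply]⟩

theorem IsFullOrder.finrank_eq {Λ : Subalgebra O A} (h : IsFullOrder O K Λ) :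
    Module.finrank K A = Module.finrank O Λ := by
  have := h.finite
  have := h.free
  let b := Module.Free.chooseBasis O Λ
  obtain ⟨b', -⟩ := h.exists_basis b
  rw [Module.finrank_eq_card_basis b', Module.finrank_eq_card_basis b]

end Orders

/-! ### Arithmetic of q = cκ + 1. -/

section Numbers

variable {p f c κ : ℕ} [hpr : Fact p.Prime] (hq : p ^ f = c * κ + 1)
  (hc : c = 1 ∧ p = 2 ∨ c = 2 ∧ p ≠ 2)

include hq hc

/-- From p · p^j ≤ q = cκ + 1 and c < p. The hypothesis κ ≥ 2 excludes exactly q = 2 and q = 3,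
where p^0 = κ. -/
theorem pow_lt_of_two_le (hκ : 2 ≤ κ) {j : ℕ} (hj : j < f) : p ^ j < κ := by
  have h0 : 0 < p ^ j := pow_pos hpr.out.pos j
  have h1 : p * p ^ j ≤ p ^ f := by
    rw [← pow_succ']; exact Nat.pow_le_pow_right hpr.out.pos hj
  rcases hc with ⟨rfl, rfl⟩ | ⟨rfl, hp2⟩
  · omega
  · have h2 : 3 * p ^ j ≤ p * p ^ j :=
      Nat.mul_le_mul_right _ (by have := hpr.out.two_le; omega)
    omega

theorem exists_mul_eq_pred : ∃ d, c * d = p - 1 ∧ d < p ∧ (c = 2 → d + 1 < p) := by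
  rcases hc with ⟨rfl, rfl⟩ | ⟨rfl, hp2⟩
  · exact ⟨1, rfl, by omega, by omega⟩
  · obtain ⟨r, hr⟩ := hpr.out.odd_of_ne_two hp2
    have := hpr.out.two_le
    exact ⟨r, by omega, by omega, by omega⟩

/-- All digits of κ equal d, so for t = 1 the sum p^j + κ has digit d + 1 < p in position j, without
a carry. -/
theorem not_dvd_choose_digit {d : ℕ} (hcd : c * d = p - 1) (hd : c = 2 → d + 1 < p)
    {j : ℕ} (hj : j < f) {t : ℕ} (ht : t < c) : ¬ p ∣ (p ^ j + κ * t).choose (p ^ j) := by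
  have hc0 : 0 < c := by omega
  have hrep : repdigit p d f = κ := by
    have h1 := mul_repdigit hcd f
    have h2 : c * repdigit p d f = c * κ := by omega
    exact Nat.eq_of_mul_eq_mul_left hc0 h2
  have h1 := hpr.out.one_lt
  rcases Nat.eq_zero_or_pos t with rfl | ht0
  · rw [mul_zero, add_zero, Nat.choose_self, Nat.dvd_one]; exact h1.ne'
  · have ht1 : t = 1 := by omega
    have hc2 : c = 2 := by omega
    subst ht1
    obtain ⟨s, r, h2, h3⟩ := exists_repdigit_eq (p := p) (d := d) hj
    have h4 : r < p ^ j := h3 ▸ repdigit_lt hc0 hcd j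
    rw [mul_one, ← hrep, h2]
    refine not_dvd_choose_prime_pow (s := d + 1 + p * s) ?_ ?_ ?_
    · nlinarith
    · nlinarith
    · rw [Nat.dvd_add_left (dvd_mul_right p s)]
      intro h
      exact absurd (Nat.le_of_dvd (by omega) h) (not_le.2 (hd hc2))

/-- The only nontrivial coefficient is C(2κ, κ) with 2κ = q - 1. -/
theorem not_dvd_choose_loop {t : ℕ} (ht : t < c) : ¬ p ∣ (κ + κ * t).choose κ := by
  have h1 := hpr.out.one_lt
  rcases Nat.eq_zero_or_pos t with rfl | ht0
  · rw [mul_zero, add_zero, Nat.choose_self, Nat.dvd_one]; exact h1.ne'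
  · have ht1 : t = 1 := by omega
    have hc2 : c = 2 := by omega
    subst ht1 hc2
    rw [mul_one, show κ + κ = p ^ f - 1 by omega]
    exact not_dvd_choose_pow_sub_one f (by omega)

end Numbers

/-! ### Orders whose reduction is a split form of the block. -/

section Delta

variable {p f : ℕ} [Fact p.Prime] {O : Type*} [CommRing O] [IsDomain O] [IsDiscreteValuationRing O]
  (hp : IsLocalRing.maximalIdeal O = Ideal.span {(p : O)})

include hp in
theorem charP_residueField : CharP (𝕜 O) p := by
  refine (CharP.charP_iff_prime_eq_zero Fact.out).2 ?_
  rw [← map_natCast (IsLocalRing.residue O), IsLocalRing.residue_eq_zero_iff, hp]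
  exact Ideal.mem_span_singleton_self _

variable {S : Type*} [Ring S] [Algebra O S] [Module.Finite O S] [Module.Free O S]
  (hS : IsSplitFormDelta2 p f (𝕜 O) (𝕜 O ⊗[O] S)) (hf : 1 ≤ f)
  {c κ : ℕ} [NeZero κ] (hq : p ^ f = c * κ + 1) (hc : c = 1 ∧ p = 2 ∨ c = 2 ∧ p ≠ 2)

include hp hS hf hq hc

theorem exists_reduction : ∃ (e : ZMod κ → PrincipalBlock (AlgebraicClosure (𝕜 O)) (Delta2 p f))
    (z : ℕ → PrincipalBlock (AlgebraicClosure (𝕜 O)) (Delta2 p f))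
    (_ : DividedPowerBasis (AlgebraicClosure (𝕜 O)) (p ^ f) κ e z)
    (χ : ZMod κ → PrincipalBlock (AlgebraicClosure (𝕜 O)) (Delta2 p f) →ₐ[AlgebraicClosure (𝕜 O)]
      AlgebraicClosure (𝕜 O))
    (ψ : S →+* PrincipalBlock (AlgebraicClosure (𝕜 O)) (Delta2 p f)),
    (∀ i j m, χ i (e j * z m) = if j = i ∧ m = 0 then 1 else 0) ∧
    IsReduction (O := O) p (F := AlgebraicClosure (𝕜 O)) ψ ∧
    ∀ i a, ∃ o : O, χ i (ψ a) = algebraMap (𝕜 O) _ (IsLocalRing.residue O o) := by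
  have := charP_residueField hp
  have : CharP (AlgebraicClosure (𝕜 O)) p := charP_of_injective_algebraMap
    (algebraMap (𝕜 O) _).injective p
  obtain ⟨e, z, hB⟩ := exists_dividedPowerBasis_delta2 p hf rfl hq hc (AlgebraicClosure (𝕜 O))
  choose χ hχ using hB.exists_chi (by omega)
  obtain ⟨hsp, ⟨Φ⟩⟩ := hS
  refine ⟨e, z, hB, χ, formReduction Φ, hχ, isReduction_formReduction hp Φ, fun i a => ?_⟩
  let θ : (𝕜 O ⊗[O] S) →ₐ[𝕜 O] AlgebraicClosure (𝕜 O) :=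
    (((χ i).comp Φ.toAlgHom).restrictScalars (𝕜 O)).comp Algebra.TensorProduct.includeRight
  obtain ⟨x, hx⟩ := hsp.exists_eq_algebraMap θ (1 ⊗ₜ a)
  obtain ⟨o, rfl⟩ := IsLocalRing.residue_surjective x
  exact ⟨o, hx⟩

theorem finrank_of_form : Module.finrank O S = κ * p ^ f := by
  obtain ⟨e, z, hB, χ, ψ, -, h, -⟩ := exists_reduction hp hS hf hq hc
  rw [h.finrank, hB.finrank_eq]

theorem exists_isCyclicOrder_of_form [IsAdicComplete (IsLocalRing.maximalIdeal O) O]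
    (hκ : 2 ≤ κ) : ∃ d, d < p ∧ c * d = p - 1 ∧ ∃ (ε : ZMod κ → S) (X : ZMod κ → Fin f → S)
      (w₀ : List (Fin f)), IsCyclicOrder O p f κ c d ε X w₀ := by
  have := charP_residueField hp
  have : CharP (AlgebraicClosure (𝕜 O)) p := charP_of_injective_algebraMap
    (algebraMap (𝕜 O) _).injective p
  obtain ⟨e, z, hB, χ, ψ, hχ, h, hrat⟩ := exists_reduction hp hS hf hq hc
  obtain ⟨ψ', ε, h', h1, h2, h3⟩ := h.exists_lift hp hB hχ hrat
  obtain ⟨d, hcd, hdp, hd⟩ := exists_mul_eq_pred hq hc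
  obtain ⟨X, w₀, h4⟩ := h'.exists_isCyclicOrder hB h1 h3 h2 rfl hq (by omega) hcd
    (fun j hj => pow_lt_of_two_le hq hc hκ hj)
    (fun j hj t ht => by
      rw [Ne, CharP.cast_eq_zero_iff _ p]; exact not_dvd_choose_digit hq hc hcd hd hj ht)
    (fun t ht => by
      rw [Ne, CharP.cast_eq_zero_iff _ p]; exact not_dvd_choose_loop hq hc ht)
  exact ⟨d, hdp, hcd, ε, X, w₀, h4⟩

/-- With κ = 1 there is a single character, and subtracting a lift of its value leaves an element
that is nilpotent modulo p. The order is local. -/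
theorem exists_nilpotent_of_form (hκ : κ = 1) (a : S) :
    ∃ (o : O) (b : S), (a - o • (1 : S)) ^ p ^ f = (p : O) • b := by
  obtain ⟨e, z, hB, χ, ψ, hχ, h, hrat⟩ := exists_reduction hp hS hf hq hc
  subst hκ
  obtain ⟨o, ho⟩ := hrat 0 a
  obtain ⟨b, hb⟩ := h.ker ((a - o • (1 : S)) ^ p ^ f) (by
    rw [map_pow]
    refine hB.pow_eq_zero_of_chi hχ fun i => ?_
    rw [Subsingleton.elim i 0, map_sub, map_sub, ho, h.smul, map_one, map_smul, map_one,
      smul_eq_mul, mul_one, sub_self])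
  exact ⟨o, b, hb⟩

end Delta

/-- The centre of the principal block is large. -/
theorem le_finrank_center_principalBlock (p : ℕ) [Fact p.Prime] {f : ℕ} (hf : 1 ≤ f)
    {c κ : ℕ} [NeZero κ] (hq : p ^ f = c * κ + 1) (hc : c = 1 ∧ p = 2 ∨ c = 2 ∧ p ≠ 2)
    (F : Type*) [Field F] [CharP F p] [IsAlgClosed F] :
    κ + c ≤ Module.finrank F (Subalgebra.center F (PrincipalBlock F (Delta2 p f))) := by
  obtain ⟨e, z, hB⟩ := exists_dividedPowerBasis_delta2 p hf rfl hq hc F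
  exact hB.le_finrank_center hq

end UniqueLifting

end

noncomputable section

namespace UniqueLifting

open Finset

set_option linter.unusedSectionVars false

/-! ### Ranks of ideals generated by idempotents. -/

section Counting

variable {K Z : Type*} [Field K] [CommRing Z] [Algebra K Z] [FiniteDimensional K Z]

/-- The dimension of a principal ideal. -/
def idealRank (K : Type*) {Z : Type*} [Field K] [CommRing Z] [Algebra K Z] (x : Z) : ℕ :=
  Module.finrank K (LinearMap.range (LinearMap.mulLeft K x))

theorem idealRank_eq_add {x s : Z} (hs : s * s = s) :
    idealRank K x = idealRank K (x * s) + idealRank K (x * (1 - s)) := by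
  have h1 : LinearMap.range (LinearMap.mulLeft K x) = LinearMap.range (LinearMap.mulLeft K (x * s))
      ⊔ LinearMap.range (LinearMap.mulLeft K (x * (1 - s))) := by
    apply le_antisymm
    · rintro _ ⟨y, rfl⟩
      refine Submodule.mem_sup.2 ⟨_, ⟨y, rfl⟩, _, ⟨y, rfl⟩, ?_⟩
      simp only [LinearMap.mulLeft_apply]
      ring
    · refine sup_le ?_ ?_
      · rintro _ ⟨y, rfl⟩
        exact ⟨s * y, by simp only [LinearMap.mulLeft_apply]; ring⟩
      · rintro _ ⟨y, rfl⟩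
        exact ⟨(1 - s) * y, by simp only [LinearMap.mulLeft_apply]; ring⟩
  have h2 : LinearMap.range (LinearMap.mulLeft K (x * s)) ⊓
      LinearMap.range (LinearMap.mulLeft K (x * (1 - s))) = ⊥ := by
    rw [eq_bot_iff]
    rintro _ ⟨⟨y, rfl⟩, ⟨w, hw⟩⟩
    simp only [LinearMap.mulLeft_apply] at hw ⊢
    rw [Submodule.mem_bot]
    have h3 : s * (x * (1 - s) * w) = 0 := by
      rw [show s * (x * (1 - s) * w) = x * w * (s - s * s) by ring, hs, sub_self, mul_zero]
    rw [hw, show s * (x * s * y) = x * y * (s * s) by ring, hs] at h3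
    rw [← h3]; ring
  have h3 := Submodule.finrank_sup_add_finrank_inf_eq (LinearMap.range (LinearMap.mulLeft K (x * s)))
    (LinearMap.range (LinearMap.mulLeft K (x * (1 - s))))
  rw [h2, finrank_bot, add_zero, ← h1] at h3
  exact h3

theorem idealRank_eq_zero {x : Z} (h : idealRank K x = 0) : x = 0 := by
  rw [idealRank, Submodule.finrank_eq_zero] at h
  have : x ∈ LinearMap.range (LinearMap.mulLeft K x) := ⟨1, by simp⟩
  rwa [h, Submodule.mem_bot] at this

theorem finrank_le_sum_idealRank {ι : Type*} [Fintype ι] {g : ι → Z}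
    (hg : Ideal.span (Set.range g) = ⊤) : Module.finrank K Z ≤ ∑ i, idealRank K (g i) := by
  classical
  let Φ : (∀ i, LinearMap.range (LinearMap.mulLeft K (g i))) →ₗ[K] Z :=
    ∑ i, (Submodule.subtype _).comp (LinearMap.proj i)
  have h1 : Function.Surjective Φ := by
    intro x
    have hx : x ∈ Ideal.span (Set.range g) := by rw [hg]; trivial
    obtain ⟨c, rfl⟩ := (Submodule.mem_span_range_iff_exists_fun Z).1 hx
    refine ⟨fun i => ⟨c i • g i, c i, by simp [mul_comm]⟩, ?_⟩
    simp [Φ]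
  have h2 := LinearMap.finrank_le_finrank_of_surjective h1
  rwa [Module.finrank_pi_fintype] at h2

/-- For i ≠ a the part of η_i outside η_a has rank one. If that part of η_l met η_b, it would lie
under η_b and be redundant, and the algebra would be generated by ideals of total rank at most (c +
1) + (number of indices - 2), less than its dimension. -/
theorem mul_eq_mul_of_idealRank {ι : Type*} [Fintype ι] [DecidableEq ι] {η : ι → Z} {c : ℕ}
    (hη : ∀ i, η i * η i = η i) (h1 : ∀ i, idealRank K (η i) = c + 1)
    (h2 : ∀ i j, i ≠ j → idealRank K (η i * η j) = c)
    (hZ : Fintype.card ι + c ≤ Module.finrank K Z) (hprod : ∏ i, (1 - η i) = 0)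
    {l a b : ι} (hla : l ≠ a) (hlb : l ≠ b) (hab : a ≠ b) : η l * η b * (1 - η a) = 0 := by
  have h3 : ∀ i, i ≠ a → idealRank K (η i * (1 - η a)) = 1 := by
    intro i hi
    have := idealRank_eq_add (K := K) (x := η i) (hη a)
    rw [h1, h2 i a hi] at this
    omega
  -- These elements generate the unit ideal: modulo them all η_i vanish one after another, and then
  -- `hprod` reads 1 = 0. The entry at l is the one whose rank has to be shown nonzero.
  set g : ι → Z := fun i => if i = a then η a else if i = b then η b * (1 - η a) else
    if i = l then η l * (1 - η a) * (1 - η b) else η i * (1 - η a) with hg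
  have ga : g a = η a := by simp [hg]
  have gb : g b = η b * (1 - η a) := by simp [hg, hab.symm]
  have gl : g l = η l * (1 - η a) * (1 - η b) := by simp [hg, hla, hlb]
  have gi : ∀ i, i ≠ a → i ≠ b → i ≠ l → g i = η i * (1 - η a) := by
    intro i h1 h2 h3; simp [hg, h1, h2, h3]
  have hspan : Ideal.span (Set.range g) = ⊤ := by
    set I := Ideal.span (Set.range g) with hI
    have hgI : ∀ i, Ideal.Quotient.mk I (g i) = 0 := fun i =>
      Ideal.Quotient.eq_zero_iff_mem.2 (Ideal.subset_span ⟨i, rfl⟩)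
    have ha : Ideal.Quotient.mk I (η a) = 0 := ga ▸ hgI a
    have hb : Ideal.Quotient.mk I (η b) = 0 := by
      have := hgI b
      rwa [gb, map_mul, map_sub, ha, map_one, sub_zero, mul_one] at this
    have hall : ∀ i, Ideal.Quotient.mk I (η i) = 0 := by
      intro i
      by_cases h1 : i = a
      · rw [h1, ha]
      by_cases h2 : i = b
      · rw [h2, hb]
      by_cases h3 : i = l
      · have := hgI l
        rwa [gl, map_mul, map_mul, map_sub, map_sub, ha, hb, map_one, sub_zero, mul_one, mul_one,
          ← h3] at this
      · have := hgI i
        rwa [gi i h1 h2 h3, map_mul, map_sub, ha, map_one, sub_zero, mul_one] at this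
    have h4 := congrArg (Ideal.Quotient.mk I) hprod
    rw [map_prod, map_zero] at h4
    simp only [map_sub, map_one, hall, sub_zero, prod_const_one] at h4
    rw [Ideal.eq_top_iff_one, ← Ideal.Quotient.eq_zero_iff_mem, map_one, h4]
  have h4 := finrank_le_sum_idealRank (K := K) hspan
  have h5 := idealRank_eq_add (K := K) (x := η l * (1 - η a)) (hη b)
  rw [h3 l hla, ← gl] at h5
  have h6 : idealRank K (g l) ≠ 0 := by
    intro h0
    have h7 : ∀ i, idealRank K (g i) + (if i = l then 1 else 0) ≤ 1 + if i = a then c else 0 := by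
      intro i
      by_cases hi1 : i = a
      · subst hi1
        rw [ga, h1, if_pos rfl, if_neg hla.symm]; omega
      rw [if_neg hi1]
      by_cases hi2 : i = b
      · subst hi2
        rw [gb, h3 i hi1, if_neg hlb.symm]
      by_cases hi3 : i = l
      · subst hi3
        rw [h0, if_pos rfl]
      · rw [gi i hi1 hi2 hi3, h3 i hi1, if_neg hi3]
    have h8 := sum_le_sum fun i (_ : i ∈ univ) => h7 i
    rw [sum_add_distrib, sum_add_distrib] at h8
    simp at h8
    omega
  have h7 : idealRank K (η l * (1 - η a) * η b) = 0 := by omega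
  rw [← idealRank_eq_zero h7]
  ring

end Counting

/-! ### Central supports and partial isometries in semisimple rings. -/

section Semisimple

variable {A : Type*} [Ring A] [IsSemisimpleRing A]

/-- The left ideal of x is generated by an idempotent g = ax, and then g = g² = axax = 0. -/
theorem eq_zero_of_mul_mul_self {x : A} (h : ∀ b, x * b * x = 0) : x = 0 := by
  obtain ⟨g, hg, h1⟩ := IsSemisimpleRing.ideal_eq_span_idempotent (Ideal.span {x})
  have h2 : g ∈ Ideal.span {x} := h1 ▸ Ideal.subset_span rfl
  have h3 : x ∈ Ideal.span {g} := h1 ▸ Ideal.subset_span rfl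
  obtain ⟨a, rfl⟩ := Ideal.mem_span_singleton'.1 h2
  obtain ⟨b, h4⟩ := Ideal.mem_span_singleton'.1 h3
  have h5 : a * x = 0 := by
    rw [← hg.eq, mul_assoc, ← mul_assoc x, h, mul_zero]
  rw [← h4, h5, mul_zero]

/-- An idempotent generator g of the left ideal I is a right identity of I. As I is two-sided, x =
(1 - g)ag satisfies xbx = 0 for all b, so x = 0 by semiprimeness and g is central. -/
theorem exists_central_idempotent (I : Ideal A) (hI : ∀ x ∈ I, ∀ b, x * b ∈ I) :
    ∃ g : A, (∀ a, a * g = g * a) ∧ g * g = g ∧ ∀ x, x ∈ I ↔ g * x = x := by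
  obtain ⟨g, hg, h1⟩ := IsSemisimpleRing.ideal_eq_span_idempotent I
  have hgI : g ∈ I := h1 ▸ Ideal.subset_span rfl
  have hright : ∀ x ∈ I, x * g = x := by
    intro x hx
    rw [h1] at hx
    obtain ⟨a, rfl⟩ := Ideal.mem_span_singleton'.1 hx
    rw [mul_assoc, hg.eq]
  have hz : ∀ x ∈ I, x * (1 - g) = 0 := fun x hx => by rw [mul_sub, mul_one, hright x hx, sub_self]
  have hcen : ∀ a, a * g = g * a := by
    intro a
    have h2 : (1 - g) * a * g = 0 := by
      refine eq_zero_of_mul_mul_self fun b => ?_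
      have h3 : g * b * (1 - g) = 0 := hz _ (hI g hgI b)
      calc (1 - g) * a * g * b * ((1 - g) * a * g)
          = (1 - g) * a * (g * b * (1 - g)) * (a * g) := by simp only [mul_assoc]
        _ = 0 := by rw [h3, mul_zero, zero_mul]
    rw [sub_mul, sub_mul, one_mul, sub_eq_zero] at h2
    rw [h2, hright _ (hI g hgI a)]
  refine ⟨g, hcen, hg, fun x => ⟨fun hx => ?_, fun hx => ?_⟩⟩
  · rw [← hcen, hright x hx]
  · rw [← hx]; exact hI g hgI x

/-- `η` is the central support of `e`. -/
structure IsCentralSupport (e η : A) : Prop where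
  comm : ∀ a, a * η = η * a
  idem : η * η = η
  mul : η * e = e
  exists_sum : ∃ (s : Finset A) (c : A → A), η = ∑ b ∈ s, c b * (e * b)

theorem exists_isCentralSupport (e : A) : ∃ η, IsCentralSupport e η := by
  obtain ⟨g, h1, h2, h3⟩ := exists_central_idempotent
    (Ideal.span (Set.range fun b => e * b)) (by
      intro x hx b
      induction hx using Submodule.span_induction with
      | mem x hx =>
        obtain ⟨y, rfl⟩ := hx
        exact Ideal.subset_span ⟨y * b, by simp only [mul_assoc]⟩
      | zero => rw [zero_mul]; exact Ideal.zero_mem _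
      | add x y _ _ hx hy => rw [add_mul]; exact Ideal.add_mem _ hx hy
      | smul a x _ hx => rw [smul_eq_mul, mul_assoc]; exact Ideal.mul_mem_left _ _ hx)
  obtain ⟨c, hc⟩ := (Finsupp.mem_span_range_iff_exists_finsupp).1 ((h3 g).2 h2)
  exact ⟨g, h1, h2, (h3 e).1 (Ideal.subset_span ⟨1, mul_one e⟩), c.support, c, hc.symm⟩

namespace IsCentralSupport

variable {e η : A} (h : IsCentralSupport e η)

include h

theorem mul_eq_zero {d : A} (hd : ∀ a, a * d = d * a) (hde : d * e = 0) : d * η = 0 := by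
  obtain ⟨s, c, hs⟩ := h.exists_sum
  rw [hs, mul_sum]
  refine sum_eq_zero fun b _ => ?_
  rw [← mul_assoc, ← hd, mul_assoc, ← mul_assoc d, hde, zero_mul, mul_zero]

theorem eq_zero_of_corner {w : A} (hw : η * w = w) (h0 : ∀ u v, e * u * w * v * e = 0) :
    w = 0 := by
  obtain ⟨s, c, hs⟩ := h.exists_sum
  have h1 : η * w * η = w := by rw [hw, h.comm, hw]
  rw [← h1, hs, sum_mul, sum_mul]
  refine sum_eq_zero fun b _ => ?_
  rw [mul_sum]
  refine sum_eq_zero fun b' _ => ?_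
  calc c b * (e * b) * w * (c b' * (e * b')) = c b * (e * b * w * c b' * e) * b' := by
        simp only [mul_assoc]
    _ = 0 := by rw [h0, mul_zero, zero_mul]

/-- A commutative corner consists of multiples by central elements. -/
theorem exists_central (he : e * e = e)
    (hcomm : ∀ x y, (e * x * e) * (e * y * e) = (e * y * e) * (e * x * e)) (x : A) :
    ∃ z : A, (∀ a, a * z = z * a) ∧ e * x * e = z * e := by
  obtain ⟨s, c, hs⟩ := h.exists_sum
  set k := e * x * e with hk
  have hek : e * k = k := by rw [hk, ← mul_assoc, ← mul_assoc, he]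
  have hke : k * e = k := by rw [hk, mul_assoc, he]
  -- Writing the support as η = Σ c_b e b and inserting k next to e spreads the corner element over
  -- the whole block. Commutativity of the corner lets k move out of every product, which makes z
  -- central.
  set z := ∑ b ∈ s, c b * (k * b) with hz
  have hsum1 : ∀ u v, e * u * z * v * e = k * (e * u * v * e) := by
    intro u v
    have h1 : e * u * v * e = ∑ b ∈ s, (e * (u * c b) * e) * (e * (b * v) * e) := by
      calc e * u * v * e = e * u * η * v * e := by
            rw [h.comm (e * u), ← mul_assoc, h.mul]
        _ = _ := by
            rw [hs, mul_sum, sum_mul, sum_mul]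
            refine sum_congr rfl fun b _ => ?_
            have : e * (u * c b) * e * (e * (b * v) * e) = e * u * c b * (e * e) * b * v * e := by
              simp only [mul_assoc]
            rw [this, he]
            simp only [mul_assoc]
    rw [h1, hz, mul_sum, sum_mul, sum_mul, mul_sum]
    refine sum_congr rfl fun b _ => ?_
    rw [← mul_assoc k, hk, hcomm x (u * c b), ← hk]
    calc e * u * (c b * (k * b)) * v * e = e * (u * c b) * k * (b * v) * e := by
          simp only [mul_assoc]
      _ = e * (u * c b) * (e * k * e) * (b * v) * e := by rw [hek, hke]
      _ = e * (u * c b) * e * k * (e * (b * v) * e) := by simp only [mul_assoc]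
  have hηz : η * z = z := by
    rw [hz, mul_sum]
    refine sum_congr rfl fun b _ => ?_
    rw [← mul_assoc, ← h.comm, mul_assoc, ← mul_assoc η, ← hek, ← mul_assoc η, h.mul]
  have hcen : ∀ a, a * z = z * a := by
    intro a
    refine sub_eq_zero.1 (h.eq_zero_of_corner ?_ fun u v => ?_)
    · rw [mul_sub, ← mul_assoc, ← h.comm a, mul_assoc, hηz, ← mul_assoc, hηz]
    · rw [mul_sub, sub_mul, sub_mul]
      have h1 := hsum1 (u * a) v
      have h2 := hsum1 u (a * v)
      rw [show e * u * (a * z) * v * e = e * (u * a) * z * v * e by simp only [mul_assoc], h1,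
        show e * u * (z * a) * v * e = e * u * z * (a * v) * e by simp only [mul_assoc], h2]
      simp only [mul_assoc, sub_self]
  refine ⟨z, hcen, ?_⟩
  have h1 := hsum1 1 1
  simp only [mul_one] at h1
  rw [he, hke] at h1
  rw [← h1, hcen, mul_assoc, he]

end IsCentralSupport

/-- A central element generates an ideal with a central idempotent d and is invertible on the part
cut out by d. -/
theorem exists_central_inverse {z : A} (hz : ∀ a, a * z = z * a) :
    ∃ d y : A, (∀ a, a * d = d * a) ∧ d * d = d ∧ (∀ a, a * y = y * a) ∧ y * z = d ∧
      d * y = y ∧ d * z = z := by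
  obtain ⟨d, h1, h2, h3⟩ := exists_central_idempotent (Ideal.span {z}) (by
    intro x hx b
    obtain ⟨a, rfl⟩ := Ideal.mem_span_singleton'.1 hx
    rw [mul_assoc, ← hz, ← mul_assoc]
    exact Ideal.mul_mem_left _ _ (Ideal.subset_span rfl))
  obtain ⟨y, hy⟩ := Ideal.mem_span_singleton'.1 ((h3 d).2 h2)
  have hdz : d * z = z := (h3 z).1 (Ideal.subset_span rfl)
  have hinj : ∀ w, d * w = w → z * w = 0 → w = 0 := by
    intro w hw h0
    rw [← hw, ← hy, mul_assoc, h0, mul_zero]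
  refine ⟨d, d * y, h1, h2, fun a => ?_, by rw [mul_assoc, hy, h2], by rw [← mul_assoc, h2], hdz⟩
  refine sub_eq_zero.1 (hinj _ ?_ ?_)
  · rw [mul_sub, ← mul_assoc, ← h1 a, mul_assoc, ← mul_assoc d d, h2, ← mul_assoc d, ← mul_assoc d,
      h2]
  · have h4 : z * (d * y) = d := by rw [← hz, mul_assoc, hy, h2]
    rw [mul_sub, ← mul_assoc, ← hz a, mul_assoc, h4, ← mul_assoc, h4, h1, sub_self]

/-- Between idempotents with commutative corners there is a partial isometry which is as large
as possible. -/
theorem exists_partial_isometry (K : Type*) [Field K] [Algebra K A] [FiniteDimensional K A]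
    {e e' η η' : A} (h : IsCentralSupport e η) (h' : IsCentralSupport e' η')
    (he : e * e = e) (he' : e' * e' = e')
    (hc : ∀ x, ∃ z : A, (∀ a, a * z = z * a) ∧ e * x * e = z * e)
    (hc' : ∀ x, ∃ z : A, (∀ a, a * z = z * a) ∧ e' * x * e' = z * e') :
    ∃ v w, e * v = v ∧ v * e' = v ∧ e' * w = w ∧ w * e = w ∧ v * w = η * η' * e ∧
      w * v = η * η' * e' := by
  -- Partial isometries over a central idempotent π below ηη'. One with the ideal of π as large as
  -- possible is chosen; on any nonzero remainder σ a further piece can be added orthogonally.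
  set P : A → Prop := fun π => (∀ a, a * π = π * a) ∧ π * π = π ∧ π * (η * η') = π ∧
    ∃ v w, e * v = v ∧ v * e' = v ∧ e' * w = w ∧ w * e = w ∧ v * w = π * e ∧ w * v = π * e' ∧
      π * v = v ∧ π * w = w with hP
  obtain ⟨I, ⟨π, hπ, rfl⟩, hmax⟩ := WellFounded.has_min
    (wellFounded_gt (α := Submodule K A))
    {I | ∃ π, P π ∧ I = LinearMap.range (LinearMap.mulLeft K π)}
    ⟨_, 0, ⟨by simp, by simp, by simp, 0, 0, by simp⟩, rfl⟩
  obtain ⟨hπ1, hπ2, hπ3, v, w, hv1, hv2, hw1, hw2, hvw, hwv, hπv, hπw⟩ := hπ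
  have hηη : ∀ a, a * (η * η') = η * η' * a := by
    intro a; rw [← mul_assoc, h.comm, mul_assoc, h'.comm, mul_assoc]
  have hηη2 : η * η' * (η * η') = η * η' := by
    rw [mul_assoc, ← mul_assoc η' η, h.comm, mul_assoc η η', h'.idem, ← mul_assoc, h.idem]
  by_cases hπη : π = η * η'
  · exact ⟨v, w, hv1, hv2, hw1, hw2, hπη ▸ hvw, hπη ▸ hwv⟩
  exfalso
  set σ := η * η' - π with hσ
  have hσ0 : σ ≠ 0 := fun h0 => hπη (sub_eq_zero.1 h0).symm
  have hσ1 : ∀ a, a * σ = σ * a := fun a => by rw [hσ, mul_sub, hηη, hπ1, sub_mul]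
  have hπσ : π * σ = 0 := by rw [hσ, mul_sub, hπ3, hπ2, sub_self]
  have hση : σ * (η * η') = σ := by rw [hσ, sub_mul, hηη2, hπ3]
  have hση1 : σ * η = σ := by
    conv_lhs => rw [← hση]
    rw [mul_assoc, h.comm, ← mul_assoc η η, h.idem, hση]
  have hση2 : σ * η' = σ := by
    conv_lhs => rw [← hση]
    rw [mul_assoc, mul_assoc, h'.idem, hση]
  -- a nonzero element of the corner
  obtain ⟨a, ha⟩ : ∃ a, σ * e * a * e' ≠ 0 := by
    by_contra! hcon
    obtain ⟨s, c, hs⟩ := h'.exists_sum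
    have h1 : σ * e = 0 := by
      have : σ * e * η' = 0 := by
        rw [hs, mul_sum]
        refine sum_eq_zero fun b _ => ?_
        rw [← mul_assoc, ← mul_assoc, hcon, zero_mul]
      rwa [h'.comm, ← mul_assoc, hσ1 η', hση2] at this
    exact hσ0 (by rw [← hση1, h.mul_eq_zero hσ1 h1])
  set x := σ * e * a * e' with hx
  have hex : e * x = x := by
    rw [hx, ← mul_assoc, ← mul_assoc, ← mul_assoc, hσ1, mul_assoc σ e e, he]
  have hxe : x * e' = x := by rw [hx, mul_assoc, he']
  have hσx : σ * x = x := by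
    rw [hx, ← mul_assoc, ← mul_assoc, ← mul_assoc]
    congr 3
    rw [hσ, sub_mul, mul_sub, mul_sub, hηη2, hπ3, ← hηη, hπ3, hπ2, sub_self, sub_zero]
  -- Semiprimeness provides a return path b. The corner element x e' b e is then a nonzero central
  -- multiple of e, invertible on its support d.
  obtain ⟨b, hb⟩ : ∃ b, x * b * x ≠ 0 := by
    by_contra! hcon
    exact ha (eq_zero_of_mul_mul_self hcon)
  obtain ⟨z, hz, hz'⟩ := hc (x * (e' * b))
  have hz'' : x * (e' * b * e) = z * e := by
    rw [← hz', ← mul_assoc e x, hex]; simp only [mul_assoc]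
  obtain ⟨d, y, hd1, hd2, hy1, hyz, hdy, hdz⟩ := exists_central_inverse
    (show ∀ a, a * (σ * z) = σ * z * a from fun a => by
      rw [← mul_assoc, hσ1, mul_assoc, hz, ← mul_assoc])
  have hσσ : σ * σ = σ := by
    rw [hσ, sub_mul, mul_sub, mul_sub, hηη2, hπ3, ← hηη, hπ3, hπ2, sub_self, sub_zero]
  have hdσ : d * σ = d := by
    rw [← hyz, mul_assoc, hσ1, ← mul_assoc σ σ, hσσ]
  have hd0 : d ≠ 0 := by
    intro h0
    have h1 : σ * z = 0 := by rw [← hdz, h0, zero_mul]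
    apply hb
    calc x * b * x = (x * e') * b * (e * x) := by rw [hxe, hex]
      _ = x * (e' * b * e) * x := by simp only [mul_assoc]
      _ = σ * z * e * x := by
          rw [hz'', mul_assoc σ z e, ← hσ1 (z * e), mul_assoc (z * e) σ x, hσx]
      _ = 0 := by rw [h1, zero_mul, zero_mul]
  -- the new partial isometry
  set v' := d * x with hv'
  set w' := y * (e' * b * e) with hw'
  clear_value v' w'
  have hev' : e * v' = v' := by rw [hv', ← mul_assoc, hd1, mul_assoc, hex]
  have hv'e : v' * e' = v' := by rw [hv', mul_assoc, hxe]
  have hew' : e' * w' = w' := by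
    rw [hw', ← mul_assoc, hy1, mul_assoc, ← mul_assoc e', ← mul_assoc e', he']
  have hw'e : w' * e = w' := by rw [hw', mul_assoc, mul_assoc (e' * b), he]
  have hdv' : d * v' = v' := by rw [hv', ← mul_assoc, hd2]
  have hdw' : d * w' = w' := by rw [hw', ← mul_assoc, hdy]
  have hσσz : d * z = σ * z := by
    rw [← hdz, ← mul_assoc, hdσ]
  have hv'w' : v' * w' = d * e := by
    calc v' * w' = d * (x * y) * (e' * b * e) := by rw [hv', hw']; simp only [mul_assoc]
      _ = d * y * (x * (e' * b * e)) := by rw [hy1]; simp only [mul_assoc]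
      _ = y * (d * z) * e := by rw [hz'', ← hd1 y]; simp only [mul_assoc]
      _ = d * e := by rw [hσσz, hyz]
  obtain ⟨z₂, hz₂, hz₂'⟩ := hc' (w' * v')
  have hw'v'1 : w' * v' = z₂ * e' := by
    rw [← hz₂', ← mul_assoc e' w' v', hew', mul_assoc w' v' e', hv'e]
  -- The product in the other order is a central multiple z₂ of e'. Below the support of e a central
  -- element is determined by its effect on e, which identifies z₂ with d on the part cut out by d.
  have hw'v' : w' * v' = d * e' := by
    have hdz₂ : ∀ a, a * (d - z₂) = (d - z₂) * a := fun a => by rw [mul_sub, sub_mul, hd1, hz₂]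
    have hdd : ∀ a, a * ((d - z₂) * d) = (d - z₂) * d * a := fun a => by
      rw [← mul_assoc, hdz₂, mul_assoc, hd1, ← mul_assoc]
    have h1 : (d - z₂) * v' = 0 := by
      have h2 : v' * (w' * v') = d * v' := by rw [← mul_assoc, hv'w', mul_assoc, hev']
      rw [hw'v'1, ← mul_assoc, hz₂, mul_assoc, hv'e] at h2
      rw [sub_mul, h2, sub_self]
    have h2 : (d - z₂) * d * e = 0 := by rw [mul_assoc, ← hv'w', ← mul_assoc, h1, zero_mul]
    have h3 := h.mul_eq_zero hdd h2
    have hdη : d * η = d := by rw [← hdσ, mul_assoc, hση1]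
    rw [mul_assoc, hdη, sub_mul, hd2, sub_eq_zero] at h3
    have h4 : w' * v' = d * (w' * v') := by rw [← mul_assoc, hdw']
    rw [h4, hw'v'1, ← mul_assoc, hz₂, ← h3]
  have hπd : π * d = 0 := by
    rw [← hdσ, hσ1, ← mul_assoc, hπσ, zero_mul]
  have hdπ : d * π = 0 := by rw [← hd1, hπd]
  have hPd : P (π + d) := by
    refine ⟨fun a => by rw [mul_add, add_mul, hπ1, hd1], ?_, ?_, v + v', w + w', ?_⟩
    · rw [add_mul, mul_add, mul_add, hπ2, hd2, hπd, hdπ, add_zero, zero_add]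
    · rw [add_mul, hπ3]
      congr 1
      rw [← hdσ, mul_assoc, hση]
    · have c1 : v * w' = 0 := by
        rw [← hπv, ← hdw', ← mul_assoc, mul_assoc π v d, hd1 v, ← mul_assoc, hπd, zero_mul,
          zero_mul]
      have c2 : v' * w = 0 := by
        rw [← hdv', ← hπw, ← mul_assoc, mul_assoc d v' π, hπ1 v', ← mul_assoc, hdπ, zero_mul,
          zero_mul]
      have c3 : w * v' = 0 := by
        rw [← hπw, ← hdv', ← mul_assoc, mul_assoc π w d, hd1 w, ← mul_assoc, hπd, zero_mul,
          zero_mul]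
      have c4 : w' * v = 0 := by
        rw [← hdw', ← hπv, ← mul_assoc, mul_assoc d w' π, hπ1 w', ← mul_assoc, hdπ, zero_mul,
          zero_mul]
      have c5 : π * v' = 0 := by rw [← hdv', ← mul_assoc, hπd, zero_mul]
      have c6 : d * v = 0 := by rw [← hπv, ← mul_assoc, hdπ, zero_mul]
      have c7 : π * w' = 0 := by rw [← hdw', ← mul_assoc, hπd, zero_mul]
      have c8 : d * w = 0 := by rw [← hπw, ← mul_assoc, hdπ, zero_mul]
      refine ⟨by rw [mul_add, hv1, hev'], by rw [add_mul, hv2, hv'e], by rw [mul_add, hw1, hew'],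
        by rw [add_mul, hw2, hw'e], ?_, ?_, ?_, ?_⟩
      · rw [add_mul, mul_add, mul_add, c1, c2, hvw, hv'w', add_zero, zero_add, add_mul]
      · rw [add_mul, mul_add, mul_add, c3, c4, hwv, hw'v', add_zero, zero_add, add_mul]
      · rw [add_mul, mul_add, mul_add, c5, c6, hπv, hdv', add_zero, zero_add]
      · rw [add_mul, mul_add, mul_add, c7, c8, hπw, hdw', add_zero, zero_add]
  refine hmax _ ⟨π + d, hPd, rfl⟩ (lt_of_le_of_ne ?_ ?_)
  · rintro _ ⟨a, rfl⟩
    refine ⟨π * a, ?_⟩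
    simp only [LinearMap.mulLeft_apply]
    rw [← mul_assoc, add_mul, hπ2, hdπ, add_zero]
  · intro heq
    have h1 : d ∈ LinearMap.range (LinearMap.mulLeft K (π + d)) :=
      ⟨d, by simp [add_mul, hπd, hd2]⟩
    rw [← heq] at h1
    obtain ⟨a, ha⟩ := h1
    rw [LinearMap.mulLeft_apply] at ha
    have h2 : π * d = d := by rw [← ha, ← mul_assoc, hπ2]
    exact hd0 (h2.symm.trans hπd)

end Semisimple

end UniqueLifting

end

noncomputable section

namespace UniqueLifting

open Finset

set_option linter.unusedSectionVars false

/-! ### Dimensions of Peirce components. -/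

section Corners

variable {K A : Type*} [Field K] [Ring A] [Algebra K A] [FiniteDimensional K A]

/-- The subspace `e A e'`. -/
def peirce (K : Type*) {A : Type*} [Field K] [Ring A] [Algebra K A] (e e' : A) : Submodule K A :=
  LinearMap.range (LinearMap.mulLeftRight K (e, e'))

theorem mem_peirce {e e' x : A} : x ∈ peirce K e e' ↔ ∃ a, e * a * e' = x := by
  simp [peirce, LinearMap.mulLeftRight_apply]

/-- The algebra embeds in the product of its Peirce components, so upper bounds that add up to its
dimension are all attained. -/
theorem finrank_peirce_eq {ι : Type*} [Fintype ι] {e : ι → A} (hsum : ∑ i, e i = 1) {n : ι → ι → ℕ}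
    (hle : ∀ i j, Module.finrank K (peirce K (e i) (e j)) ≤ n i j)
    (hA : Module.finrank K A = ∑ i, ∑ j, n i j) (i j : ι) :
    Module.finrank K (peirce K (e i) (e j)) = n i j := by
  classical
  let Φ : A →ₗ[K] (∀ x : ι × ι, peirce K (e x.1) (e x.2)) :=
    LinearMap.pi fun x => (LinearMap.mulLeftRight K (e x.1, e x.2)).rangeRestrict
  have hΦ : Function.Injective Φ := by
    rw [← LinearMap.ker_eq_bot, LinearMap.ker_eq_bot']
    intro a ha
    have h1 : ∀ i j, e i * a * e j = 0 := by
      intro i j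
      have := congrArg Subtype.val (congrFun ha (i, j))
      exact this
    calc a = (∑ i, e i) * a * ∑ j, e j := by rw [hsum, one_mul, mul_one]
      _ = 0 := by
        rw [sum_mul, sum_mul]
        refine sum_eq_zero fun i _ => ?_
        rw [mul_sum]
        exact sum_eq_zero fun j _ => h1 i j
  have h1 := LinearMap.finrank_le_finrank_of_injective hΦ
  rw [Module.finrank_pi_fintype, hA, Fintype.sum_prod_type] at h1
  have h2 : ∀ i, ∑ j, Module.finrank K (peirce K (e i) (e j)) ≤ ∑ j, n i j :=
    fun i => sum_le_sum fun j _ => hle i j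
  have h3 := (sum_eq_sum_iff_of_le fun i _ => h2 i).1
    (le_antisymm (sum_le_sum fun i _ => h2 i) h1) i (mem_univ i)
  exact (sum_eq_sum_iff_of_le fun j _ => hle i j).1 h3 j (mem_univ j)

end Corners

section Blocks

variable {K A : Type*} [Field K] [Ring A] [Algebra K A] [FiniteDimensional K A]
  [IsSemisimpleRing A]

variable {Z : Type*} [CommRing Z] [Algebra K Z] [FiniteDimensional K Z]

/-- The map `ζ` identifies a commutative algebra with the centre. -/
structure IsCentre (ζ : Z →ₐ[K] A) : Prop where
  injective : Function.Injective ζ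
  comm : ∀ z a, a * ζ z = ζ z * a
  exists_eq : ∀ a : A, (∀ b, b * a = a * b) → ∃ z, ζ z = a

variable {ζ : Z →ₐ[K] A} (hζ : IsCentre ζ)

include hζ

/-- A maximal partial isometry v generates the component over the centre: z ↦ zv is onto, with
kernel the annihilator of ηη'. -/
theorem finrank_peirce_eq_idealRank {e e' : A} {η η' : Z}
    (h : IsCentralSupport e (ζ η)) (h' : IsCentralSupport e' (ζ η'))
    (he : e * e = e) (he' : e' * e' = e')
    (hc : ∀ x, ∃ z : A, (∀ a, a * z = z * a) ∧ e * x * e = z * e)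
    (hc' : ∀ x, ∃ z : A, (∀ a, a * z = z * a) ∧ e' * x * e' = z * e') :
    Module.finrank K (peirce K e e') = idealRank K (η * η') := by
  obtain ⟨v, w, hv1, hv2, hw1, hw2, hvw, hwv⟩ := exists_partial_isometry K h h' he he' hc hc'
  let φ : Z →ₗ[K] A := (LinearMap.mulRight K v).comp ζ.toLinearMap
  have hφ : ∀ z, φ z = ζ z * v := fun z => rfl
  have h1 : LinearMap.range φ = peirce K e e' := by
    ext x
    rw [mem_peirce]
    constructor
    · rintro ⟨z, rfl⟩
      refine ⟨ζ z * v, ?_⟩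
      rw [hφ, ← mul_assoc, hζ.comm, mul_assoc (ζ z), hv1, mul_assoc, hv2]
    · rintro ⟨a, rfl⟩
      set x := e * a * e' with hx
      have hex : e * x = x := by rw [hx, ← mul_assoc, ← mul_assoc, he]
      have hxe : x * e' = x := by rw [hx, mul_assoc, he']
      obtain ⟨z, hz, hz'⟩ := hc' (w * x)
      obtain ⟨z, rfl⟩ := hζ.exists_eq z hz
      refine ⟨z, ?_⟩
      rw [hφ]
      have h2 : ζ η * ζ η' * x = x := by
        have h3 : ζ η' * x = x := by rw [← hζ.comm, ← hxe, mul_assoc, hζ.comm, h'.mul]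
        rw [mul_assoc, h3, ← hex, ← mul_assoc, h.mul]
      have h3 : v * (w * x) = x := by
        rw [← mul_assoc, hvw, mul_assoc, hex, h2]
      have h4 : w * x = ζ z * e' := by
        rw [← hz', ← mul_assoc e', hw1, mul_assoc, hxe]
      rw [h4, ← mul_assoc, hz, mul_assoc, hv2] at h3
      exact h3
  have h2 : LinearMap.ker φ = LinearMap.ker (LinearMap.mulLeft K (η * η')) := by
    ext z
    rw [LinearMap.mem_ker, LinearMap.mem_ker, hφ, LinearMap.mulLeft_apply]
    have hηη : η * η = η := hζ.injective (by rw [map_mul]; exact h.idem)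
    constructor
    · intro h0
      have h4 : ζ (z * (η * η')) * e = 0 := by
        rw [map_mul, map_mul, mul_assoc, ← hvw, ← mul_assoc, h0, zero_mul]
      have h5 : z * (η * η') * η = 0 := hζ.injective (by
        rw [map_mul, map_zero]; exact h.mul_eq_zero (hζ.comm _) h4)
      linear_combination h5 - z * η' * hηη
    · intro h0
      have h4 : v = ζ η * ζ η' * v := by
        have h3 : ζ η' * v = v := by rw [← hζ.comm, ← hv2, mul_assoc, hζ.comm, h'.mul]
        rw [mul_assoc, h3]
        conv_rhs => rw [← hv1, ← mul_assoc, h.mul]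
        exact hv1.symm
      rw [h4, ← mul_assoc, ← map_mul, ← map_mul, mul_comm z, h0, map_zero, zero_mul]
  have h3 := LinearMap.finrank_range_add_finrank_ker φ
  have h4 := LinearMap.finrank_range_add_finrank_ker (LinearMap.mulLeft K (η * η'))
  rw [h2, h1] at h3
  rw [idealRank]
  omega

/-- The block structure forced by the dimensions of the Peirce components. -/
theorem exists_blocks {κ c : ℕ} [NeZero κ] (hκ : 2 ≤ κ) {e : ZMod κ → A}
    (he : ∀ i j, e i * e j = if i = j then e i else 0) (hsum : ∑ i, e i = 1)
    (hc : ∀ i x, ∃ z : A, (∀ a, a * z = z * a) ∧ e i * x * e i = z * e i)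
    (hdim : ∀ i j, Module.finrank K (peirce K (e i) (e j)) = c + if i = j then 1 else 0)
    (hZ : κ + c ≤ Module.finrank K Z) :
    ∃ (η : Z) (π : ZMod κ → Z), η * η = η ∧ (∀ i j, π i * π j = if i = j then π i else 0) ∧
      (∀ i, η * π i = 0) ∧ η + ∑ i, π i = 1 ∧ idealRank K η = c ∧ (∀ i, idealRank K (π i) = 1) ∧
      (∀ i j, e i * ζ (π j) = if i = j then ζ (π i) else 0) ∧
      ∀ i, IsCentralSupport (e i) (ζ (η + π i)) := by
  have hid : ∀ i, e i * e i = e i := fun i => by rw [he, if_pos rfl]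
  choose θ' hθ' using fun i => exists_isCentralSupport (e i)
  choose θ hθθ using fun i => hζ.exists_eq (θ' i) (hθ' i).comm
  have hθ : ∀ i, IsCentralSupport (e i) (ζ (θ i)) := fun i => hθθ i ▸ hθ' i
  have hθid : ∀ i, θ i * θ i = θ i := fun i => hζ.injective (by rw [map_mul]; exact (hθ i).idem)
  have hrank : ∀ i j, idealRank K (θ i * θ j) = c + if i = j then 1 else 0 := by
    intro i j
    rw [← hdim, finrank_peirce_eq_idealRank hζ (hθ i) (hθ j) (hid i) (hid j) (hc i) (hc j)]
  have hθe : ∀ i, ζ (θ i) * e i = e i := fun i => (hθ i).mul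
  have hzero : ∀ z : Z, (∀ i, ζ z * e i = 0) → z = 0 := by
    intro z hz
    refine hζ.injective ?_
    rw [map_zero, ← mul_one (ζ z), ← hsum, mul_sum]
    exact sum_eq_zero fun i _ => hz i
  have hprod : ∏ i, (1 - θ i) = 0 := by
    refine hzero _ fun i => ?_
    have h1 : ζ (1 - θ i) * e i = 0 := by rw [map_sub, map_one, sub_mul, one_mul, hθe, sub_self]
    rw [← mul_prod_erase univ _ (mem_univ i), mul_comm, map_mul, mul_assoc, h1, mul_zero]
  -- Products of two supports lie below every third one. Hence all of them coincide with one
  -- idempotent η, the shared block, and the rest of each support has rank one.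
  have hkey : ∀ l a b, l ≠ a → l ≠ b → a ≠ b → θ l * θ b = θ l * θ b * θ a := by
    intro l a b hla hlb hab
    have := mul_eq_mul_of_idealRank (K := K) (c := c) hθid
      (fun i => by have := hrank i i; rwa [hθid, if_pos rfl] at this)
      (fun i j hij => by rw [hrank, if_neg hij, add_zero]) (by rwa [ZMod.card]) hprod hla hlb hab
    rw [mul_sub, mul_one, sub_eq_zero] at this
    exact this
  have hkey2 : ∀ l a b, l ≠ a → l ≠ b → θ l * θ b = θ l * θ a := by
    intro l a b hla hlb
    by_cases hab : a = b
    · rw [hab]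
    · rw [hkey l a b hla hlb hab, hkey l b a hlb hla (Ne.symm hab)]
      ring
  have : Fact (1 < κ) := ⟨hκ⟩
  set η := θ 0 * θ 1 with hη
  have hall : ∀ i j, i ≠ j → θ i * θ j = η := by
    intro i j hij
    by_cases hi : i = 0
    · subst hi
      exact hkey2 0 1 j zero_ne_one hij
    · rw [hkey2 i 0 j hi hij, mul_comm]
      exact hkey2 0 1 i zero_ne_one (Ne.symm hi)
  have hηθ : ∀ i, η * θ i = η := by
    intro i
    obtain ⟨j, hj⟩ : ∃ j : ZMod κ, i ≠ j := by
      by_cases hi : i = 0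
      · exact ⟨1, hi ▸ zero_ne_one⟩
      · exact ⟨0, hi⟩
    rw [← hall i j hj, mul_right_comm, hθid]
  have hηid : η * η = η := by
    rw [hη, show θ 0 * θ 1 * (θ 0 * θ 1) = (θ 0 * θ 0) * (θ 1 * θ 1) by ring, hθid, hθid]
  have hθπ : ∀ i, η + (θ i - η) = θ i := fun i => add_sub_cancel _ _
  have hππ : ∀ i j, (θ i - η) * (θ j - η) = if i = j then θ i - η else 0 := by
    intro i j
    have h1 : (θ i - η) * (θ j - η) = θ i * θ j - η * θ i - η * θ j + η * η := by ring
    rw [h1, hηθ, hηθ, hηid]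
    split_ifs with hij
    · rw [hij, hθid]; ring
    · rw [hall i j hij]; ring
  have hπη : ∀ i, η * (θ i - η) = 0 := fun i => by rw [mul_sub, hηθ, hηid, sub_self]
  have heπ : ∀ i j, i ≠ j → e i * ζ (θ j - η) = 0 := by
    intro i j hij
    have h1 : θ i * (θ j - η) = 0 := by
      rw [mul_sub, hall i j hij, mul_comm, hηθ, sub_self]
    rw [← hθe i, mul_assoc, hζ.comm, ← mul_assoc, ← map_mul, h1, map_zero, zero_mul]
  have hsum1 : η + ∑ i, (θ i - η) = 1 := by
    refine (sub_eq_zero.1 (hzero (1 - (η + ∑ i, (θ i - η))) fun j => ?_)).symm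
    have h1 : (1 - (η + ∑ i, (θ i - η))) * θ j = 0 := by
      rw [sub_mul, add_mul, sum_mul, one_mul, sum_eq_single j]
      · rw [hηθ, sub_mul, hθid, hηθ]; ring
      · intro i _ hij
        rw [sub_mul, hall i j hij, hηθ, sub_self]
      · simp
    rw [← hθe j, ← mul_assoc, ← map_mul, h1, map_zero, zero_mul]
  refine ⟨η, fun i => θ i - η, hηid, hππ, hπη, hsum1, ?_, ?_, ?_, fun i => by rw [hθπ]; exact hθ i⟩
  · have := hrank 0 1
    rwa [if_neg zero_ne_one, add_zero] at this
  · intro i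
    have h1 := idealRank_eq_add (K := K) (x := θ i) hηid
    have h2 := hrank i i
    obtain ⟨j, hj⟩ : ∃ j : ZMod κ, i ≠ j := by
      by_cases hi : i = 0
      · exact ⟨1, hi ▸ zero_ne_one⟩
      · exact ⟨0, hi⟩
    have h3 := hrank i j
    rw [hall i j hj, if_neg hj] at h3
    rw [hθid, if_pos rfl] at h2
    rw [mul_comm (θ i) η, hηθ, mul_sub, mul_one, mul_comm (θ i) η, hηθ] at h1
    change idealRank K (θ i - η) = 1
    omega
  · intro i j
    split_ifs with hij
    · subst hij
      have h1 : ∑ l, e l * ζ (θ i - η) = ζ (θ i - η) := by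
        rw [← sum_mul, hsum, one_mul]
      rw [sum_eq_single i] at h1
      · exact h1
      · exact fun l _ hl => heπ l i hl
      · simp
    · exact heπ i j hij

end Blocks

end UniqueLifting

end

noncomputable section

namespace UniqueLifting

open Finset

set_option linter.unusedSectionVars false

/-! ### Coordinates K^κ × M_κ(R). -/

section Coordinates

variable {K A : Type*} [Field K] [Ring A] [Algebra K A] [FiniteDimensional K A]
  [IsSemisimpleRing A] {Z : Type*} [CommRing Z] [Algebra K Z] [FiniteDimensional K Z]
  {ζ : Z →ₐ[K] A} (hζ : IsCentre ζ)

theorem finrank_quotient_eq_idealRank {η : Z} (hη : η * η = η) :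
    Module.finrank K (Z ⧸ Ideal.span {1 - η}) = idealRank K η := by
  have h1 : (Ideal.span {1 - η}).restrictScalars K = LinearMap.ker (LinearMap.mulLeft K η) := by
    ext z
    rw [Submodule.restrictScalars_mem, LinearMap.mem_ker, LinearMap.mulLeft_apply,
      Ideal.mem_span_singleton']
    constructor
    · rintro ⟨a, rfl⟩
      linear_combination - a * hη
    · intro h
      exact ⟨z, by linear_combination - h⟩
  rw [idealRank, ← (LinearMap.quotKerEquivRange (LinearMap.mulLeft K η)).finrank_eq, ← h1]
  exact (LinearEquiv.finrank_eq (Submodule.Quotient.restrictScalarsEquiv K _)).symm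

include hζ

/-- The character attached to a one-dimensional block. -/
theorem exists_character {π : Z} (hπ : π * π = π) (hrank : idealRank K π = 1)
    (h : ∀ a, ∃ z, ζ π * a = ζ z) :
    ∃ χ : A →ₐ[K] K, ∀ a, ζ π * a = χ a • ζ π := by
  have hπ0 : ζ π ≠ 0 := by
    intro h0
    have : π = 0 := hζ.injective (by rw [h0, map_zero])
    rw [this, idealRank, LinearMap.mulLeft_zero_eq_zero, LinearMap.range_zero, finrank_bot] at hrank
    exact zero_ne_one hrank
  have hex : ∀ a, ∃ c : K, ζ π * a = c • ζ π := by
    intro a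
    obtain ⟨z, hz⟩ := h a
    have h1 : π * z = z := hζ.injective (by
      rw [map_mul, ← hz, ← mul_assoc, ← map_mul, hπ])
    have h2 : z ∈ LinearMap.range (LinearMap.mulLeft K π) := ⟨z, h1⟩
    have h3 : π ∈ LinearMap.range (LinearMap.mulLeft K π) := ⟨π, hπ⟩
    obtain ⟨c, hc⟩ := (finrank_eq_one_iff_of_nonzero' (⟨π, h3⟩ : LinearMap.range
      (LinearMap.mulLeft K π)) (fun h0 => hπ0 (by
        rw [show π = 0 from congrArg Subtype.val h0, map_zero]))).1 hrank ⟨z, h2⟩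
    have h4 : c • π = z := congrArg Subtype.val hc
    exact ⟨c, by rw [hz, ← h4, map_smul]⟩
  choose χ hχ using hex
  have huniq : ∀ {c c' : K}, c • ζ π = c' • ζ π → c = c' := fun h =>
    smul_left_injective K hπ0 h
  let φ : A →ₗ[K] K :=
    { toFun := χ
      map_add' := fun a b => huniq (by rw [← hχ, mul_add, hχ, hχ, add_smul])
      map_smul' := fun c a => huniq (by
        rw [← hχ, mul_smul_comm, hχ, smul_smul, RingHom.id_apply, smul_eq_mul]) }
  refine ⟨AlgHom.ofLinearMap φ (huniq (by
    change χ 1 • _ = _; rw [← hχ, mul_one, one_smul])) fun a b => huniq ?_, hχ⟩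
  change χ (a * b) • _ = (χ a * χ b) • _
  rw [← hχ, ← mul_assoc, hχ a, smul_mul_assoc, hχ b, smul_smul]

/-- Matrix coordinates attached to matrix units. -/
theorem exists_matrix_coordinates {ι : Type*} [Fintype ι] [DecidableEq ι] {η : Z} {E : A}
    {g h : ι → A} (hE : ∀ a, ∃ z, E * a * E = ζ z * E) (hEη : ∀ z, ζ z * E = 0 → z * η = 0)
    (hEE : E * E = E)
    (hηE : ζ η * E = E) (hg : ∀ i, E * g i = g i) (hh : ∀ i, h i * E = h i)
    (hgh : ∀ i j, g i * h j = if i = j then E else 0) (hsum : ∑ i, h i * g i = ζ η) :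
    ∃ C : A →ₐ[K] Matrix ι ι (Z ⧸ Ideal.span {1 - η}),
      ∀ a i j z, g i * a * h j = ζ z * E ↔ C a i j = Ideal.Quotient.mk _ z := by
  have hmk : ∀ z z' : Z, ζ z * E = ζ z' * E ↔ Ideal.Quotient.mk (Ideal.span {1 - η}) z =
      Ideal.Quotient.mk _ z' := by
    intro z z'
    rw [Ideal.Quotient.eq, Ideal.mem_span_singleton', ← sub_eq_zero, ← sub_mul, ← map_sub]
    constructor
    · intro h0
      exact ⟨z - z', by linear_combination - hEη _ h0⟩
    · rintro ⟨y, hy⟩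
      rw [← hy, map_mul, map_sub, map_one, mul_assoc, sub_mul, one_mul, hηE, sub_self, mul_zero]
  have hex : ∀ a i j, ∃ z, g i * a * h j = ζ z * E := by
    intro a i j
    obtain ⟨z, hz⟩ := hE (g i * a * h j)
    refine ⟨z, ?_⟩
    rw [← hz]
    conv_lhs => rw [← hg, ← hh]
    simp only [mul_assoc]
  choose F hF using hex
  set C : A → Matrix ι ι (Z ⧸ Ideal.span {1 - η}) := fun a i j => Ideal.Quotient.mk _ (F a i j)
    with hC
  have hCz : ∀ a i j z, g i * a * h j = ζ z * E ↔ C a i j = Ideal.Quotient.mk _ z := by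
    intro a i j z
    rw [hF, hmk]
  have hsurj : ∀ r : Z ⧸ Ideal.span {1 - η}, ∃ z, r = Ideal.Quotient.mk _ z := fun r =>
    ⟨_, (Ideal.Quotient.mk_surjective r).choose_spec.symm⟩
  let φ : A →ₗ[K] Matrix ι ι (Z ⧸ Ideal.span {1 - η}) :=
    { toFun := C
      map_add' := fun a b => by
        ext i j
        rw [Matrix.add_apply, hC, ← map_add, ← hCz, map_add, add_mul, ← hF, ← hF, mul_add, add_mul]
      map_smul' := fun c a => by
        ext i j
        rw [RingHom.id_apply, Matrix.smul_apply, hC]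
        have h1 : c • (Ideal.Quotient.mk (Ideal.span {1 - η}) (F a i j)) =
          Ideal.Quotient.mk _ (c • F a i j) := rfl
        rw [h1, ← hCz, map_smul, smul_mul_assoc, ← hF, mul_smul_comm, smul_mul_assoc] }
  refine ⟨AlgHom.ofLinearMap φ ?_ ?_, hCz⟩
  · ext i j
    change C 1 i j = _
    rw [Matrix.one_apply]
    split_ifs with hij
    · rw [← map_one (Ideal.Quotient.mk _), ← hCz, mul_one, hgh, if_pos hij, map_one, one_mul]
    · rw [← map_zero (Ideal.Quotient.mk _), ← hCz, mul_one, hgh, if_neg hij, map_zero, zero_mul]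
  · intro a b
    ext i j
    change C (a * b) i j = (C a * C b) i j
    rw [Matrix.mul_apply, hC]
    simp only [← map_mul]
    rw [← map_sum, ← hCz, map_sum, sum_mul]
    have h1 : g i * (a * b) * h j = g i * (a * ζ η * b) * h j := by
      have h2 : ζ η * h j = h j := by rw [← hζ.comm, ← hh, mul_assoc, hζ.comm, hηE]
      rw [mul_assoc a, ← hζ.comm, ← mul_assoc a b, mul_assoc (g i), mul_assoc (g i),
        mul_assoc (a * b), h2]
    rw [h1, ← hsum, mul_sum, sum_mul, mul_sum, sum_mul]
    refine sum_congr rfl fun l _ => ?_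
    have h3 : g i * (a * (h l * g l) * b) * h j = (g i * a * h l) * (g l * b * h j) := by
      simp only [mul_assoc]
    rw [h3, hF, hF, map_mul, mul_assoc, ← mul_assoc E, hζ.comm, mul_assoc (ζ _) E E, hEE,
      ← mul_assoc]

/-- Coordinates on a semisimple algebra from its block structure. -/
theorem exists_coordinates {κ c : ℕ} [NeZero κ] {e : ZMod κ → A}
    (he : ∀ i j, e i * e j = if i = j then e i else 0) (hsum : ∑ i, e i = 1)
    (hc : ∀ i x, ∃ z : A, (∀ a, a * z = z * a) ∧ e i * x * e i = z * e i)
    (hA : Module.finrank K A = κ * (c * κ + 1))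
    {η : Z} {π : ZMod κ → Z} (hη : η * η = η) (hπ : ∀ i j, π i * π j = if i = j then π i else 0)
    (hηπ : ∀ i, η * π i = 0) (hηsum : η + ∑ i, π i = 1) (hrη : idealRank K η = c)
    (hrπ : ∀ i, idealRank K (π i) = 1)
    (heπ : ∀ i j, e i * ζ (π j) = if i = j then ζ (π i) else 0)
    (hsupp : ∀ i, IsCentralSupport (e i) (ζ (η + π i))) :
    ∃ Φ : A ≃ₐ[K] (ZMod κ → K) × Matrix (ZMod κ) (ZMod κ) (Z ⧸ Ideal.span {1 - η}),
      (∀ i, Φ (e i) = (Pi.single i 1, Matrix.single i i 1)) ∧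
      (∀ i, Φ (ζ (π i)) = (Pi.single i 1, 0)) ∧
      ∀ z, (Φ (ζ z)).2 = Matrix.scalar _ (Ideal.Quotient.mk _ z) := by
  have hid : ∀ i, e i * e i = e i := fun i => by rw [he, if_pos rfl]
  -- Partial isometries between the base idempotent e_0 and each e_i, cut by η, serve as first row
  -- and first column of matrix units.
  choose v w hv1 hv2 hw1 hw2 hvw hwv using fun i =>
    exists_partial_isometry K (hsupp 0) (hsupp i) (hid 0) (hid i) (hc 0) (hc i)
  have hηsupp : ∀ i j, η * ((η + π i) * (η + π j)) = η := by
    intro i j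
    linear_combination (η + 1) * hη + (η + π j) * hηπ i + η * hηπ j
  have hηsupp' : ∀ i, η * (η + π i) = η := fun i => by linear_combination hη + hηπ i
  set E := ζ η * e 0 with hE
  set g : ZMod κ → A := fun i => ζ η * v i with hg
  set h : ZMod κ → A := fun i => ζ η * w i with hh
  have hζη : ζ η * ζ η = ζ η := by rw [← map_mul, hη]
  have hswap : ∀ x y : A, ζ η * x * (ζ η * y) = ζ η * (x * y) := by
    intro x y
    rw [mul_assoc, ← mul_assoc x, hζ.comm, mul_assoc, ← mul_assoc, hζη]
  have hEE : E * E = E := by rw [hE, hswap, hid]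
  have hηE : ζ η * E = E := by rw [hE, ← mul_assoc, hζη]
  have hEa : ∀ a, ∃ z, E * a * E = ζ z * E := by
    intro a
    obtain ⟨z, hz, hz'⟩ := hc 0 a
    obtain ⟨z, rfl⟩ := hζ.exists_eq z hz
    refine ⟨z, ?_⟩
    rw [hE, mul_assoc (ζ η), hswap, hz', ← mul_assoc, ← mul_assoc, hz]
  have hEη : ∀ z, ζ z * E = 0 → z * η = 0 := by
    intro z hz
    rw [hE, ← mul_assoc, ← map_mul] at hz
    have := (hsupp 0).mul_eq_zero (hζ.comm _) hz
    rw [← map_mul, mul_assoc, hηsupp'] at this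
    exact hζ.injective (by rw [this, map_zero])
  have hgE : ∀ i, E * g i = g i := fun i => by rw [hE, hg]; simp only; rw [hswap, hv1]
  have hhE : ∀ i, h i * E = h i := fun i => by rw [hE, hh]; simp only; rw [hswap, hw2]
  have hge : ∀ i, g i * e i = g i := fun i => by rw [hg]; simp only; rw [mul_assoc, hv2]
  have heh : ∀ i, e i * h i = h i := fun i => by
    rw [hh]; simp only; rw [← mul_assoc, hζ.comm, mul_assoc, hw1]
  have hgh : ∀ i j, g i * h j = if i = j then E else 0 := by
    intro i j
    split_ifs with hij
    · subst hij
      rw [hg, hh]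
      simp only
      rw [hswap, hvw, ← mul_assoc, ← map_mul, ← map_mul, hηsupp]
    · rw [← hge, ← heh, mul_assoc, ← mul_assoc (e i), he, if_neg hij, zero_mul, mul_zero]
  have hhg : ∀ i, h i * g i = ζ η * e i := by
    intro i
    rw [hg, hh]
    simp only
    rw [hswap, hwv, ← mul_assoc, ← map_mul, ← map_mul, hηsupp]
  have hhgsum : ∑ i, h i * g i = ζ η := by
    simp_rw [hhg]
    rw [← mul_sum, hsum, mul_one]
  obtain ⟨C, hC⟩ := exists_matrix_coordinates hζ hEa hEη hEE hηE hgE hhE hgh hhgsum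
  have hex : ∀ i a, ∃ z, ζ (π i) * a = ζ z := by
    intro i a
    obtain ⟨z, hz, hz'⟩ := hc i a
    obtain ⟨z, rfl⟩ := hζ.exists_eq z hz
    have h1 : ζ (π i) * e i = ζ (π i) := by rw [← hζ.comm, heπ, if_pos rfl]
    have h2 : e i * ζ (π i) = ζ (π i) := by rw [heπ, if_pos rfl]
    refine ⟨z * π i, ?_⟩
    have h3 : ζ (π i) * ζ (π i) = ζ (π i) := by rw [← map_mul, hπ, if_pos rfl]
    calc ζ (π i) * a = ζ (π i) * ζ (π i) * a := by rw [h3]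
      _ = (ζ (π i) * e i) * a * (e i * ζ (π i)) := by rw [h1, h2, mul_assoc, ← hζ.comm, mul_assoc]
      _ = ζ (π i) * (e i * a * e i) * ζ (π i) := by simp only [mul_assoc]
      _ = ζ (z * π i) := by
        rw [hz', mul_assoc, mul_assoc (ζ z), h2, ← hz, ← mul_assoc, h3, ← map_mul, mul_comm]
  choose χ hχ using fun i => exists_character hζ (by rw [hπ, if_pos rfl] : π i * π i = π i)
    (hrπ i) (hex i)
  have hπ0 : ∀ i, ζ (π i) ≠ 0 := by
    intro i h0
    have : π i = 0 := hζ.injective (by rw [h0, map_zero])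
    have h1 := hrπ i
    rw [this, idealRank, LinearMap.mulLeft_zero_eq_zero, LinearMap.range_zero, finrank_bot] at h1
    exact zero_ne_one h1
  have hχu : ∀ i a (k : K), ζ (π i) * a = k • ζ (π i) → χ i a = k := fun i a k hk =>
    smul_left_injective K (hπ0 i) (by
      change χ i a • ζ (π i) = k • ζ (π i)
      rw [← hχ, hk])
  let Φ : A →ₐ[K] (ZMod κ → K) × Matrix (ZMod κ) (ZMod κ) (Z ⧸ Ideal.span {1 - η}) :=
    (AlgHom.pi χ).prod C
  have hinj : Function.Injective Φ := by
    rw [injective_iff_map_eq_zero]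
    intro a ha
    have h1 : ∀ i, χ i a = 0 := fun i => congrFun (congrArg Prod.fst ha) i
    have h2 : C a = 0 := congrArg Prod.snd ha
    have h3 : ∀ i, ζ (π i) * a = 0 := fun i => by rw [hχ, h1, zero_smul]
    have h4 : ∀ i j, g i * a * h j = 0 := by
      intro i j
      have := (hC a i j 0).2 (by rw [h2, map_zero]; rfl)
      rwa [map_zero, zero_mul] at this
    have h5 : ζ η * a = 0 := by
      calc ζ η * a = ζ η * a * ζ η := by rw [mul_assoc, hζ.comm, ← mul_assoc, hζη]
        _ = ∑ i, ∑ j, h i * (g i * a * h j) * g j := by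
          conv_lhs => rw [← hhgsum, sum_mul, sum_mul]
          refine sum_congr rfl fun i _ => ?_
          rw [mul_sum]
          exact sum_congr rfl fun j _ => by simp only [mul_assoc]
        _ = 0 := by simp [h4]
    rw [← one_mul a, ← map_one ζ, ← hηsum, map_add, add_mul, h5, map_sum, sum_mul]
    simp [h3]
  have hR : Module.finrank K (Z ⧸ Ideal.span {1 - η}) = c := by
    rw [finrank_quotient_eq_idealRank hη, hrη]
  -- Both sides are κ + cκ², which upgrades injectivity to bijectivity.
  have hdim : Module.finrank K A = Module.finrank K
      ((ZMod κ → K) × Matrix (ZMod κ) (ZMod κ) (Z ⧸ Ideal.span {1 - η})) := by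
    rw [Module.finrank_prod, Module.finrank_pi, Module.finrank_matrix, hR, hA, ZMod.card]
    ring
  have hbij : Function.Bijective Φ := ⟨hinj,
    (LinearMap.injective_iff_surjective_of_finrank_eq_finrank (f := Φ.toLinearMap) hdim).1 hinj⟩
  refine ⟨AlgEquiv.ofBijective Φ hbij, fun i => ?_, fun i => ?_, fun z => ?_⟩
  · refine Prod.ext ?_ ?_
    · ext j
      change χ j (e i) = _
      refine hχu j _ _ ?_
      rw [← hζ.comm, heπ]
      by_cases hij : i = j
      · subst hij; simp
      · change _ = (Pi.single i (1 : K) : ZMod κ → K) j • ζ (π j)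
        rw [if_neg hij, Pi.single_eq_of_ne (Ne.symm hij), zero_smul]
    · ext j l
      change C (e i) j l = Matrix.single i i (1 : Z ⧸ Ideal.span {1 - η}) j l
      rw [Matrix.single_apply]
      split_ifs with hij
      · obtain ⟨rfl, rfl⟩ := hij
        rw [← map_one (Ideal.Quotient.mk _), ← hC, hge, hgh, if_pos rfl, map_one, one_mul]
      · rw [← map_zero (Ideal.Quotient.mk _), ← hC, map_zero, zero_mul]
        by_cases hj : i = j
        · subst hj
          rw [hge, hgh, if_neg]
          exact fun h => hij ⟨rfl, h⟩
        · rw [← hge, mul_assoc (g j), he, if_neg (Ne.symm hj), mul_zero, zero_mul]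
  · refine Prod.ext ?_ ?_
    · ext j
      change χ j (ζ (π i)) = _
      refine hχu j _ _ ?_
      rw [← map_mul, hπ]
      by_cases hij : j = i
      · subst hij; simp
      · change _ = (Pi.single i (1 : K) : ZMod κ → K) j • ζ (π j)
        rw [if_neg hij, Pi.single_eq_of_ne hij, zero_smul, map_zero]
    · ext j l
      change C (ζ (π i)) j l = 0
      rw [← map_zero (Ideal.Quotient.mk _), ← hC, map_zero, zero_mul, hg]
      simp only
      rw [hζ.comm (π i) (ζ η * v j), ← mul_assoc (ζ (π i)), ← map_mul, mul_comm (π i), hηπ]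
      simp only [map_zero, zero_mul]
  · ext j l
    change C (ζ z) j l = Matrix.scalar _ (Ideal.Quotient.mk (Ideal.span {1 - η}) z) j l
    rw [Matrix.scalar_apply, Matrix.diagonal_apply]
    split_ifs with hij
    · subst hij
      rw [← hC, hζ.comm, mul_assoc, hgh, if_pos rfl]
    · rw [← map_zero (Ideal.Quotient.mk _), ← hC, hζ.comm, mul_assoc, hgh, if_neg hij, mul_zero,
        map_zero, zero_mul]

end Coordinates

end UniqueLifting

end

noncomputable section

namespace UniqueLifting

open Finset

set_option linter.unusedSectionVars false

section Uniqueness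

variable {K A : Type*} [Field K] [Ring A] [Algebra K A]
  {Z : Type*} [CommRing Z] [Algebra K Z] {ζ : Z →ₐ[K] A} {ι : Type*} [Fintype ι] [DecidableEq ι]

/-- Test linearity on a diagonal matrix unit: if ρ(π)E_ii is a multiple of ρ(π)·1, the entry at some
j ≠ i makes the multiple vanish. Two indices are needed. -/
theorem mul_eq_zero_of_linear [Nontrivial ι] {R : Type*} [CommRing R] [Algebra K R]
    {ρ : Z →ₐ[K] R} (Φ : A ≃ₐ[K] (ι → K) × Matrix ι ι R)
    (hΦ : ∀ z, (Φ (ζ z)).2 = Matrix.scalar ι (ρ z)) {π : Z} (hlin : IsLinear K (ζ π)) :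
    ρ π = 0 := by
  obtain ⟨i, j, hij⟩ := exists_pair_ne ι
  obtain ⟨c, hc⟩ := hlin (Φ.symm (0, Matrix.single i i 1))
  have h1 := congrArg (fun x => (Φ x).2) hc
  simp only [map_mul, map_smul, AlgEquiv.apply_symm_apply, Prod.snd_mul, Prod.smul_snd, hΦ] at h1
  have h2 := congrFun (congrFun h1 i) i
  have h3 := congrFun (congrFun h1 j) j
  simp [Matrix.scalar_apply, Matrix.diagonal_mul, hij] at h2 h3
  rw [h2, ← h3]

end Uniqueness

/-! ### Comparison of two coordinate systems. -/

section Conjugacy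

variable {K A : Type*} [Field K] [Ring A] [Algebra K A] [FiniteDimensional K A]
  [IsSemisimpleRing A] {Z : Type*} [CommRing Z] [Algebra K Z] [FiniteDimensional K Z]
  {ζ : Z →ₐ[K] A} (hζ : IsCentre ζ) {ι : Type*} [Fintype ι] [DecidableEq ι] 
  {R : Type*} [CommRing R] [Algebra K R] {ρ : Z →ₐ[K] R} (hρ : Function.Surjective ρ)

/-- Matrix units in an algebra with coordinates. -/
def matUnit (Φ : A ≃ₐ[K] (ι → K) × Matrix ι ι R) (i j : ι) : A :=
  Φ.symm (0, Matrix.single i j 1)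

theorem matUnit_mul_mul (Φ : A ≃ₐ[K] (ι → K) × Matrix ι ι R) (i j k l : ι) (a : A) :
    matUnit Φ i j * a * matUnit Φ k l = Φ.symm (0, Matrix.single i l ((Φ a).2 j k)) := by
  apply Φ.injective
  rw [map_mul, map_mul, matUnit, matUnit, AlgEquiv.apply_symm_apply, AlgEquiv.apply_symm_apply,
    AlgEquiv.apply_symm_apply]
  refine Prod.ext (by simp) ?_
  simp [Matrix.single_mul_mul_single]

theorem matUnit_mul (Φ : A ≃ₐ[K] (ι → K) × Matrix ι ι R) (i j k l : ι) :
    matUnit Φ i j * matUnit Φ k l = if j = k then matUnit Φ i l else 0 := by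
  have := matUnit_mul_mul Φ i j k l 1
  rw [mul_one, map_one, Prod.snd_one, Matrix.one_apply] at this
  rw [this]
  split_ifs
  · rfl
  · rw [Matrix.single_zero]; exact map_zero _

theorem sum_matUnit (Φ : A ≃ₐ[K] (ι → K) × Matrix ι ι R) :
    ∑ i, matUnit Φ i i = Φ.symm (0, 1) := by
  apply Φ.injective
  rw [map_sum]
  simp only [matUnit, AlgEquiv.apply_symm_apply]
  refine Prod.ext (by simp [Prod.fst_sum]) ?_
  rw [Prod.snd_sum]
  exact Matrix.sum_single_one

include hζ hρ

theorem isCentralSupport_matUnit (Φ : A ≃ₐ[K] (ι → K) × Matrix ι ι R)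
    (hΦ : ∀ z, (Φ (ζ z)).2 = Matrix.scalar ι (ρ z)) {η : Z} (hη : Φ (ζ η) = (0, 1)) (i : ι) :
    IsCentralSupport (matUnit Φ i i) (ζ η) ∧
      ∀ x, ∃ z : A, (∀ a, a * z = z * a) ∧ matUnit Φ i i * x * matUnit Φ i i =
        z * matUnit Φ i i := by
  have hmul : ∀ z : Z, ζ z * matUnit Φ i i = Φ.symm (0, Matrix.single i i (ρ z)) := by
    intro z
    apply Φ.injective
    rw [map_mul, matUnit, AlgEquiv.apply_symm_apply, AlgEquiv.apply_symm_apply]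
    refine Prod.ext (by simp) ?_
    rw [Prod.snd_mul, hΦ]
    ext j l
    simp [Matrix.scalar_apply, Matrix.diagonal_mul, Matrix.single_apply]
  have hρη : ρ η = 1 := by
    have h1 := hΦ η
    rw [hη] at h1
    have := congrFun (congrFun h1 i) i
    simpa [Matrix.scalar_apply] using this.symm
  obtain ⟨θ, hθ⟩ := exists_isCentralSupport (matUnit Φ i i)
  obtain ⟨z, rfl⟩ := hζ.exists_eq θ hθ.comm
  have h1 : ζ z = ζ η := by
    have h2 : (1 - ζ η) * ζ z = 0 := hθ.mul_eq_zero (fun a => by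
      rw [mul_sub, sub_mul, hζ.comm, mul_one, one_mul]) (by
      rw [sub_mul, one_mul, hmul, hρη]; exact sub_self _)
    rw [sub_mul, one_mul, sub_eq_zero] at h2
    have h3 := hθ.mul
    rw [hmul] at h3
    have h4 : ρ z = 1 := by
      have := congrFun (congrFun (congrArg Prod.snd (Φ.symm.injective h3)) i) i
      simpa using this
    apply Φ.injective
    rw [h2, map_mul, hη]
    refine Prod.ext (by simp) ?_
    simp only [Prod.snd_mul, hΦ, h4, map_one, mul_one]
  refine ⟨h1 ▸ hθ, fun x => ?_⟩
  obtain ⟨y, hy⟩ := hρ ((Φ x).2 i i)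
  exact ⟨ζ y, hζ.comm y, by rw [matUnit_mul_mul, hmul, hy]⟩

/-- Two systems of coordinates are conjugate. -/
theorem exists_conj_coordinates [Nonempty ι] (Φ Φ' : A ≃ₐ[K] (ι → K) × Matrix ι ι R)
    (hΦ : ∀ z, (Φ (ζ z)).2 = Matrix.scalar ι (ρ z))
    (hΦ' : ∀ z, (Φ' (ζ z)).2 = Matrix.scalar ι (ρ z))
    {η : Z} (hη : Φ (ζ η) = (0, 1)) (hη' : Φ' (ζ η) = (0, 1)) :
    ∃ (τ : A ≃ₐ[K] A) (y : Aˣ), (∀ a, Φ' (y * τ a * (y⁻¹ : Aˣ)) = Φ a) ∧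
      ∀ ε : A, IsCentralPrimitive ε → ¬ IsLinear K ε → ∀ a, τ (ε * a) = ε * a := by
  obtain ⟨o⟩ := ‹Nonempty ι›
  have hfst : ∀ a, ζ η * a = a → (Φ a).1 = 0 ∧ (Φ' a).1 = 0 := by
    intro a ha
    constructor
    · rw [← ha, map_mul, hη]; simp
    · rw [← ha, map_mul, hη']; simp
  -- the automorphism
  let φ : A →ₐ[K] (ι → K) × Matrix ι ι R :=
    ((AlgHom.fst K _ _).comp Φ.toAlgHom).prod ((AlgHom.snd K _ _).comp Φ'.toAlgHom)
  have hφ : ∀ a, φ a = ((Φ a).1, (Φ' a).2) := fun a => rfl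
  have hinj : Function.Injective φ := by
    rw [injective_iff_map_eq_zero]
    intro a ha
    rw [hφ] at ha
    have h1 : (Φ a).1 = 0 := congrArg Prod.fst ha
    have h2 : (Φ' a).2 = 0 := congrArg Prod.snd ha
    have h3 : ζ η * a = a := by
      apply Φ.injective
      rw [map_mul, hη]
      refine Prod.ext (by simp [h1]) (by simp)
    apply Φ'.injective
    rw [map_zero]
    exact Prod.ext (hfst a h3).2 h2
  have := Module.Finite.equiv Φ.toLinearEquiv
  have hbij : Function.Bijective φ := ⟨hinj,
    (LinearMap.injective_iff_surjective_of_finrank_eq_finrank (f := φ.toLinearMap)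
      Φ.toLinearEquiv.finrank_eq).1 hinj⟩
  let τ : A ≃ₐ[K] A := (AlgEquiv.ofBijective φ hbij).trans Φ'.symm
  have hτ : ∀ a, Φ' (τ a) = ((Φ a).1, (Φ' a).2) := fun a => Φ'.apply_symm_apply _
  -- the unit
  obtain ⟨hs, hc⟩ := isCentralSupport_matUnit hζ hρ Φ hΦ hη o
  obtain ⟨hs', hc'⟩ := isCentralSupport_matUnit hζ hρ Φ' hΦ' hη' o
  obtain ⟨v, w, hv1, hv2, hw1, hw2, hvw, hwv⟩ := exists_partial_isometry K hs hs'
    (by rw [matUnit_mul, if_pos rfl]) (by rw [matUnit_mul, if_pos rfl]) hc hc'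
  rw [mul_assoc, hs.mul, hs.mul] at hvw
  rw [mul_assoc, hs'.mul, hs'.mul] at hwv
  have hη1 : ζ η = Φ.symm (0, 1) := by rw [← hη, AlgEquiv.symm_apply_apply]
  have hη1' : ζ η = Φ'.symm (0, 1) := by rw [← hη', AlgEquiv.symm_apply_apply]
  -- An explicit Skolem–Noether element: V and W intertwine the two systems of matrix units and are
  -- mutually inverse on the matrix block.
  set V := ∑ i, matUnit Φ' i o * w * matUnit Φ o i with hV
  set W := ∑ i, matUnit Φ i o * v * matUnit Φ' o i with hW
  have hVW : V * W = ζ η := by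
    rw [hη1', ← sum_matUnit, hV, sum_mul]
    refine sum_congr rfl fun i _ => ?_
    rw [hW, mul_sum, sum_eq_single i]
    · calc matUnit Φ' i o * w * matUnit Φ o i * (matUnit Φ i o * v * matUnit Φ' o i)
          = matUnit Φ' i o * (w * (matUnit Φ o i * matUnit Φ i o) * v) * matUnit Φ' o i := by
            simp only [mul_assoc]
        _ = _ := by
          rw [matUnit_mul, if_pos rfl, hw2, hwv, matUnit_mul, if_pos rfl, matUnit_mul, if_pos rfl]
    · intro j _ hj
      calc matUnit Φ' i o * w * matUnit Φ o i * (matUnit Φ j o * v * matUnit Φ' o j)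
          = matUnit Φ' i o * (w * (matUnit Φ o i * matUnit Φ j o) * v) * matUnit Φ' o j := by
            simp only [mul_assoc]
        _ = _ := by rw [matUnit_mul, if_neg (Ne.symm hj)]; simp
    · simp
  have hWV : W * V = ζ η := by
    rw [hη1, ← sum_matUnit, hW, sum_mul]
    refine sum_congr rfl fun i _ => ?_
    rw [hV, mul_sum, sum_eq_single i]
    · calc matUnit Φ i o * v * matUnit Φ' o i * (matUnit Φ' i o * w * matUnit Φ o i)
          = matUnit Φ i o * (v * (matUnit Φ' o i * matUnit Φ' i o) * w) * matUnit Φ o i := by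
            simp only [mul_assoc]
        _ = _ := by
          rw [matUnit_mul, if_pos rfl, hv2, hvw, matUnit_mul, if_pos rfl, matUnit_mul, if_pos rfl]
    · intro j _ hj
      calc matUnit Φ i o * v * matUnit Φ' o i * (matUnit Φ' j o * w * matUnit Φ o j)
          = matUnit Φ i o * (v * (matUnit Φ' o i * matUnit Φ' j o) * w) * matUnit Φ o j := by
            simp only [mul_assoc]
        _ = _ := by rw [matUnit_mul, if_neg (Ne.symm hj)]; simp
    · simp
  have hηm : ∀ i j, ζ η * matUnit Φ i j = matUnit Φ i j := by
    intro i j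
    apply Φ.injective
    rw [map_mul, hη, matUnit, AlgEquiv.apply_symm_apply]
    exact Prod.ext (by simp) (by simp)
  have hηm' : ∀ i j, ζ η * matUnit Φ' i j = matUnit Φ' i j := by
    intro i j
    apply Φ'.injective
    rw [map_mul, hη', matUnit, AlgEquiv.apply_symm_apply]
    exact Prod.ext (by simp) (by simp)
  have hηV : ζ η * V = V := by
    rw [hV, mul_sum]
    exact sum_congr rfl fun i _ => by rw [← mul_assoc, ← mul_assoc, hηm']
  have hηW : ζ η * W = W := by
    rw [hW, mul_sum]
    exact sum_congr rfl fun i _ => by rw [← mul_assoc, ← mul_assoc, hηm]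
  have hηη : ζ η * ζ η = ζ η := hs.idem
  have hVη : V * ζ η = V := by rw [hζ.comm, hηV]
  have hWη : W * ζ η = W := by rw [hζ.comm, hηW]
  let y : Aˣ :=
    { val := 1 - ζ η + V
      inv := 1 - ζ η + W
      val_inv := by
        simp only [add_mul, mul_add, sub_mul, mul_sub, one_mul, mul_one, hVW, hηW, hVη, hηη]
        abel
      inv_val := by
        simp only [add_mul, mul_add, sub_mul, mul_sub, one_mul, mul_one, hWV, hηV, hWη, hηη]
        abel }
  have hy1 : Φ' (y : A) = (1, (Φ' V).2) := by
    change Φ' (1 - ζ η + V) = _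
    rw [map_add, map_sub, map_one, hη']
    exact Prod.ext (by simp [(hfst V hηV).2]) (by simp)
  have hy2 : Φ' ((y⁻¹ : Aˣ) : A) = (1, (Φ' W).2) := by
    change Φ' (1 - ζ η + W) = _
    rw [map_add, map_sub, map_one, hη']
    exact Prod.ext (by simp [(hfst W hηW).2]) (by simp)
  refine ⟨τ, y, fun a => ?_, fun ε hε hlin a => ?_⟩
  · rw [map_mul, map_mul, hτ, hy1, hy2]
    refine Prod.ext (by simp) ?_
    simp only [Prod.snd_mul]
    rw [← Prod.snd_mul, ← Prod.snd_mul, ← map_mul, ← map_mul]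
    ext i j
    have h1 := matUnit_mul_mul Φ' o i j o (V * a * W)
    obtain ⟨z, hz⟩ := hρ ((Φ a).2 i j)
    have h2 : matUnit Φ' o i * V = w * matUnit Φ o i := by
      rw [hV, mul_sum, sum_eq_single i]
      · rw [← mul_assoc, ← mul_assoc, matUnit_mul, if_pos rfl, hw1]
      · intro l _ hl
        rw [← mul_assoc, ← mul_assoc, matUnit_mul, if_neg (Ne.symm hl), zero_mul, zero_mul]
      · simp
    have h3 : W * matUnit Φ' j o = matUnit Φ j o * v := by
      rw [hW, sum_mul, sum_eq_single j]
      · rw [mul_assoc, matUnit_mul, if_pos rfl, mul_assoc, hv2]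
      · intro l _ hl
        rw [mul_assoc, matUnit_mul, if_neg hl, mul_zero]
      · simp
    have h4 : matUnit Φ' o i * (V * a * W) * matUnit Φ' j o =
        Φ'.symm (0, Matrix.single o o ((Φ a).2 i j)) := by
      calc matUnit Φ' o i * (V * a * W) * matUnit Φ' j o
          = (matUnit Φ' o i * V) * a * (W * matUnit Φ' j o) := by simp only [mul_assoc]
        _ = w * (matUnit Φ o i * a * matUnit Φ j o) * v := by rw [h2, h3]; simp only [mul_assoc]
        _ = w * (ζ z * matUnit Φ o o) * v := by
          rw [matUnit_mul_mul]
          congr 2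
          apply Φ.injective
          rw [map_mul, matUnit, AlgEquiv.apply_symm_apply, AlgEquiv.apply_symm_apply]
          refine Prod.ext (by simp) ?_
          rw [Prod.snd_mul, hΦ, hz]
          ext j l
          simp [Matrix.scalar_apply, Matrix.diagonal_mul, Matrix.single_apply]
        _ = ζ z * matUnit Φ' o o := by
          rw [← mul_assoc, hζ.comm, mul_assoc, mul_assoc, ← mul_assoc w, hw2, hwv]
        _ = _ := by
          apply Φ'.injective
          rw [map_mul, matUnit, AlgEquiv.apply_symm_apply, AlgEquiv.apply_symm_apply]
          refine Prod.ext (by simp) ?_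
          rw [Prod.snd_mul, hΦ', hz]
          ext j l
          simp [Matrix.scalar_apply, Matrix.diagonal_mul, Matrix.single_apply]
    rw [h4] at h1
    have h5 := congrFun (congrFun (congrArg Prod.snd (Φ'.symm.injective h1)) o) o
    simpa using h5.symm
  -- A primitive central idempotent outside the matrix block would lie under one of the
  -- one-dimensional factors and be linear. Hence the nonlinear ones lie in the block, where τ is
  -- the identity.
  · have hεη : ζ η * ε = ε := by
      have hεc : ∀ a, a * ε = ε * a := Subring.mem_center_iff.1 hε.central
      rcases hε.minimal (ζ η * ε) (Subring.mem_center_iff.2 fun a => by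
          rw [← mul_assoc, hζ.comm, mul_assoc, hεc, ← mul_assoc])
          (by
            change ζ η * ε * (ζ η * ε) = ζ η * ε
            rw [mul_assoc, ← mul_assoc ε, hζ.comm η ε, mul_assoc (ζ η) ε, hε.idem.eq, ← mul_assoc, hηη])
          (by rw [mul_assoc, hε.idem.eq]) with h0 | h1
      swap
      · exact h1
      exfalso
      have h2 : (Φ ε).2 = 0 := by
        have := congrArg (fun x => (Φ x).2) h0
        simpa [hη] using this
      have h3 : ∃ i, (Φ ε).1 i ≠ 0 := by
        by_contra! hcon
        apply hε.ne_zero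
        apply Φ.injective
        rw [map_zero]
        exact Prod.ext (funext hcon) h2
      obtain ⟨i, hi⟩ := h3
      set P := Φ.symm (Pi.single i 1, 0) with hP
      have hPc : ∀ a, a * P = P * a := by
        intro a
        apply Φ.injective
        rw [map_mul, map_mul, hP, AlgEquiv.apply_symm_apply]
        exact Prod.ext (mul_comm _ _) (by simp)
      have hPP : P * P = P := by
        apply Φ.injective
        rw [map_mul, hP, AlgEquiv.apply_symm_apply]
        refine Prod.ext ?_ (by simp)
        simp only [Prod.fst_mul, ← Pi.single_mul, mul_one]
      have hPε : P * ε = ε := by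
        rcases hε.minimal (P * ε) (Subring.mem_center_iff.2 fun a => by
          rw [← mul_assoc, hPc, mul_assoc, hεc, ← mul_assoc])
          (by
            change P * ε * (P * ε) = P * ε
            rw [mul_assoc, ← mul_assoc ε, hPc ε, mul_assoc P ε, hε.idem.eq, ← mul_assoc, hPP])
          (by rw [mul_assoc, hε.idem.eq]) with h4 | h4
        swap
        · exact h4
        exfalso
        have := congrFun (congrArg (fun x => (Φ x).1) h4) i
        simp [hP] at this
        exact hi this
      refine hlin fun a => ⟨(Φ a).1 i, ?_⟩
      apply Φ.injective
      rw [map_smul, ← hPε, map_mul, map_mul, hP, AlgEquiv.apply_symm_apply]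
      refine Prod.ext ?_ (by simp)
      ext j
      by_cases hj : j = i
      · subst hj; simp [mul_comm]
      · simp [hj]
    apply Φ'.injective
    rw [hτ]
    have := hfst (ε * a) (by rw [← mul_assoc, hεη])
    exact Prod.ext (this.1.trans this.2.symm) rfl

end Conjugacy

end UniqueLifting

end

noncomputable section

namespace UniqueLifting

open Finset TensorProduct

set_option linter.unusedSectionVars false

/-! ### Idempotents with commutative corner over a splitting field. -/

section MatrixTrace

variable {F : Type*} [Field F] {n : Type*} [Fintype n] [DecidableEq n]

/-- An idempotent matrix with commutative corner vanishes or has trace one. -/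
theorem eq_zero_or_trace_eq_one {E : Matrix n n F} (hE : E * E = E)
    (hcomm : ∀ X Y : Matrix n n F, E * X * E * Y * E = E * Y * E * X * E) : E = 0 ∨ E.trace = 1 := by
  -- The hypothesis is evaluated on pairs of matrix units. Contracting one index with E² = E gives
  -- E_ia E_bc tr E = E_ic E_ba, and a nonzero entry then forces trace one.
  have h1 : ∀ i a b c d j, E i a * E b c * E d j = E i c * E d a * E b j := by
    intro i a b c d j
    have := congrFun (congrFun (hcomm (Matrix.single a b 1) (Matrix.single c d 1)) i) j
    have key : ∀ a b c d, (E * Matrix.single a b 1 * E * Matrix.single c d 1 * E : Matrix n n F) i j =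
        E i a * E b c * E d j := by
      intro a b c d
      have : E * Matrix.single a b 1 * E * Matrix.single c d 1 * E =
          E * (Matrix.single a b 1 * E * Matrix.single c d 1) * E := by simp only [mul_assoc]
      rw [this, Matrix.single_mul_mul_single, Matrix.mul_apply]
      simp only [one_mul, mul_one]
      rw [sum_eq_single d]
      · rw [Matrix.mul_single_apply_same]
      · intro l _ hl
        rw [Matrix.mul_single_apply_of_ne (hbj := hl), zero_mul]
      · simp
    rw [key, key] at this
    exact this
  have h2 : ∀ i a b c, E i a * E b c * E.trace = E i c * E b a := by
    intro i a b c
    have h3 : E b a = ∑ d, E b d * E d a := by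
      conv_lhs => rw [← hE]
      rfl
    rw [Matrix.trace, mul_sum, h3, mul_sum]
    refine sum_congr rfl fun d _ => ?_
    rw [Matrix.diag_apply, h1 i a b c d d]
    ring
  by_cases h0 : E = 0
  · exact Or.inl h0
  right
  obtain ⟨i, a, hia⟩ : ∃ i a, E i a ≠ 0 := by
    by_contra! hcon
    exact h0 (by ext i a; exact hcon i a)
  have h3 := h2 i a i a
  exact mul_left_cancel₀ (mul_ne_zero hia hia) (by rw [h3, mul_one])

variable {m : ℕ} {d : Fin m → ℕ}

theorem trace_mulLeftRight (a b : ∀ i, Matrix (Fin (d i)) (Fin (d i)) F) :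
    LinearMap.trace F _ (LinearMap.mulLeftRight F (a, b)) =
      ∑ i, (a i).trace * (b i).trace := by
  classical
  let B := Pi.basis fun i => Matrix.stdBasis F (Fin (d i)) (Fin (d i))
  rw [LinearMap.trace_eq_matrix_trace F B, Matrix.trace, Fintype.sum_sigma]
  refine sum_congr rfl fun i _ => ?_
  rw [Fintype.sum_prod_type, Matrix.trace, Matrix.trace, sum_mul_sum]
  refine sum_congr rfl fun k _ => sum_congr rfl fun l _ => ?_
  rw [Matrix.diag_apply, LinearMap.toMatrix_apply, LinearMap.mulLeftRight_apply]
  rw [Pi.basis_repr, Pi.basis_apply]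
  simp only [Pi.mul_apply, Pi.single_eq_same]
  rw [Matrix.stdBasis_eq_single]
  have : ∀ M : Matrix (Fin (d i)) (Fin (d i)) F,
    (Matrix.stdBasis F (Fin (d i)) (Fin (d i))).repr M (k, l) = M k l := fun M => by
      simp [Matrix.stdBasis]
  have h : ∀ U V : Matrix (Fin (d i)) (Fin (d i)) F,
      (U * Matrix.single k l 1 * V : Matrix (Fin (d i)) (Fin (d i)) F) k l = U k k * V l l := by
    intro U V
    rw [Matrix.mul_apply, sum_eq_single l]
    · rw [Matrix.mul_single_apply_same, mul_one]
    · intro x _ hx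
      rw [Matrix.mul_single_apply_of_ne (hbj := hx), zero_mul]
    · simp
  rw [this]
  exact h _ _

end MatrixTrace

/-! ### The reduced trace in coordinates. -/

section ReducedTrace

variable {K A : Type*} [Field K] [Ring A] [Algebra K A] [FiniteDimensional K A]

/-- The trace attached to a splitting. -/
def Splitting.trace (s : Splitting K A) : A →ₗ[K] AlgebraicClosure K where
  toFun a := ∑ i, Matrix.trace (s.iso ((1 : AlgebraicClosure K) ⊗ₜ[K] a) i)
  map_add' a b := by
    simp only [TensorProduct.tmul_add, map_add, Pi.add_apply, Matrix.trace_add, sum_add_distrib]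
  map_smul' c a := by
    have : ∀ a : A, (1 : AlgebraicClosure K) ⊗ₜ[K] (c • a) =
        algebraMap K (AlgebraicClosure K) c • ((1 : AlgebraicClosure K) ⊗ₜ[K] a) := by
      intro a
      rw [TensorProduct.tmul_smul, algebraMap_smul]
    simp only [this, map_smul, Pi.smul_apply, Matrix.trace_smul, RingHom.id_apply]
    simp only [smul_eq_mul, ← mul_sum, Algebra.smul_def]

theorem Splitting.trace_mul_comm (s : Splitting K A) (a b : A) :
    s.trace (a * b) = s.trace (b * a) := by
  have : ∀ a b : A, (1 : AlgebraicClosure K) ⊗ₜ[K] (a * b) = (1 ⊗ₜ[K] a) * (1 ⊗ₜ[K] b) := by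
    intro a b
    rw [Algebra.TensorProduct.tmul_mul_tmul, one_mul]
  change ∑ i : Fin s.num, Matrix.trace _ = ∑ i : Fin s.num, Matrix.trace _
  simp only [this, map_mul, Pi.mul_apply]
  exact sum_congr rfl fun i _ => Matrix.trace_mul_comm _ _

/-- A commutative corner forces e to be zero or of trace one in each Wedderburn block. So tr a_i =
tr a_i · tr e_i, and the sum is the trace of x ↦ axe, which is defined over K. -/
theorem Splitting.trace_eq_of_corner (s : Splitting K A) {e a : A} (he : e * e = e)
    (hcomm : ∀ x y, e * x * e * y * e = e * y * e * x * e) (hea : e * a * e = a) :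
    s.trace a = algebraMap K _ (LinearMap.trace K A (LinearMap.mulLeftRight K (a, e))) := by
  set L := AlgebraicClosure K
  set E := s.iso ((1 : L) ⊗ₜ[K] e) with hE
  set a' := s.iso ((1 : L) ⊗ₜ[K] a) with ha'
  have hEE : E * E = E := by
    rw [hE, ← map_mul, Algebra.TensorProduct.tmul_mul_tmul, one_mul, he]
  have hEa : E * a' * E = a' := by
    rw [hE, ha', ← map_mul, ← map_mul, Algebra.TensorProduct.tmul_mul_tmul,
      Algebra.TensorProduct.tmul_mul_tmul, one_mul, one_mul, hea]
  have hc1 : ∀ X Y : L ⊗[K] A, (1 : L) ⊗ₜ[K] e * X * (1 : L) ⊗ₜ[K] e * Y * (1 : L) ⊗ₜ[K] e =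
      (1 : L) ⊗ₜ[K] e * Y * (1 : L) ⊗ₜ[K] e * X * (1 : L) ⊗ₜ[K] e := by
    intro X Y
    induction X with
    | zero => simp
    | add X X' h h' =>
      rw [mul_add, add_mul, add_mul, add_mul, h, h', mul_add, add_mul]
    | tmul c x =>
      induction Y with
      | zero => simp
      | add Y Y' h h' =>
        rw [mul_add, add_mul, h, h', mul_add, add_mul, add_mul, add_mul]
      | tmul d y =>
        simp only [Algebra.TensorProduct.tmul_mul_tmul, one_mul, mul_one]
        rw [hcomm, mul_comm]
  have hc2 : ∀ X Y, E * X * E * Y * E = E * Y * E * X * E := by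
    intro X Y
    have := congrArg s.iso (hc1 (s.iso.symm X) (s.iso.symm Y))
    simpa only [map_mul, AlgEquiv.apply_symm_apply] using this
  have h1 : ∀ i, E i = 0 ∨ (E i).trace = 1 := by
    intro i
    refine eq_zero_or_trace_eq_one (congrFun hEE i) fun X Y => ?_
    have := congrFun (hc2 (Pi.single i X) (Pi.single i Y)) i
    simpa using this
  have h2 : LinearMap.trace L _ (LinearMap.mulLeftRight L (a', E)) =
      algebraMap K L (LinearMap.trace K A (LinearMap.mulLeftRight K (a, e))) := by
    rw [← LinearMap.trace_baseChange, ← LinearMap.trace_conj' _ s.iso.toLinearEquiv]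
    congr 1
    apply LinearMap.ext
    intro x
    obtain ⟨x, rfl⟩ := s.iso.surjective x
    rw [LinearEquiv.conj_apply_apply]
    change a' * s.iso x * E = s.iso (LinearMap.baseChange L (LinearMap.mulLeftRight K (a, e))
      (s.iso.symm (s.iso x)))
    rw [AlgEquiv.symm_apply_apply, hE, ha', ← map_mul, ← map_mul]
    congr 1
    induction x with
    | zero => simp
    | add x y hx hy => rw [mul_add, add_mul, hx, hy, map_add]
    | tmul c x =>
      rw [LinearMap.baseChange_tmul, LinearMap.mulLeftRight_apply,
        Algebra.TensorProduct.tmul_mul_tmul, Algebra.TensorProduct.tmul_mul_tmul, one_mul, mul_one]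
  rw [← h2, trace_mulLeftRight]
  change ∑ i, Matrix.trace (a' i) = _
  refine sum_congr rfl fun i _ => ?_
  rcases h1 i with h3 | h3
  · have h4 : a' i = 0 := by
      rw [← hEa, Pi.mul_apply, h3, mul_zero]
    rw [h4, h3]; simp
  · rw [h3, mul_one]

variable {ι : Type*} [Fintype ι] [DecidableEq ι] {R : Type*} [CommRing R] [Algebra K R]
  [Module.Finite K R] [Module.Free K R]

/-- The trace in terms of coordinates. -/
theorem Splitting.trace_eq (s : Splitting K A) (Φ : A ≃ₐ[K] (ι → K) × Matrix ι ι R) (a : A) :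
    s.trace a = algebraMap K _ (∑ i, (Φ a).1 i + Algebra.trace K R (Φ a).2.trace) := by
  set e : ι → A := fun i => Φ.symm (Pi.single i 1, Matrix.single i i 1) with he
  have hΦe : ∀ i, Φ (e i) = (Pi.single i 1, Matrix.single i i 1) := fun i =>
    Φ.apply_symm_apply _
  have hemul : ∀ i j, e i * e j = if i = j then e i else 0 := by
    intro i j
    apply Φ.injective
    rw [map_mul, hΦe, hΦe]
    split_ifs with hij
    · subst hij
      rw [hΦe]
      exact Prod.ext (by simp [← Pi.single_mul]) (by simp)
    · rw [map_zero]
      refine Prod.ext ?_ ?_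
      · ext l
        by_cases hl : l = i
        · subst hl; simp [hij]
        · simp [hl]
      · change Matrix.single i i (1 : R) * Matrix.single j j 1 = 0
        rw [Matrix.single_mul_single_of_ne (h := hij)]
  have hesum : ∑ i, e i = 1 := by
    apply Φ.injective
    rw [map_sum, map_one]
    simp only [hΦe]
    refine Prod.ext ?_ ?_
    · rw [Prod.fst_sum]; exact Finset.univ_sum_single (1 : ι → K)
    · rw [Prod.snd_sum]; exact Matrix.sum_single_one
  have hcorner : ∀ i a, e i * a * e i = Φ.symm (Pi.single i ((Φ a).1 i),
      Matrix.single i i ((Φ a).2 i i)) := by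
    intro i a
    apply Φ.injective
    rw [map_mul, map_mul, hΦe, AlgEquiv.apply_symm_apply]
    refine Prod.ext ?_ ?_
    · ext l
      by_cases hl : l = i
      · subst hl; simp
      · simp [hl]
    · simp [Matrix.single_mul_mul_single]
  have h1 : ∀ i, s.trace (e i * a * e i) =
      algebraMap K _ ((Φ a).1 i + Algebra.trace K R ((Φ a).2 i i)) := by
    intro i
    have hee : e i * e i = e i := by rw [hemul, if_pos rfl]
    rw [s.trace_eq_of_corner (e := e i) hee]
    · congr 1
      let P : A →ₗ[K] K × R := LinearMap.prod
        ((LinearMap.proj i).comp ((LinearMap.fst K _ _).comp Φ.toLinearMap))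
        ((Matrix.entryLinearMap K R i i).comp ((LinearMap.snd K _ _).comp Φ.toLinearMap))
      have hP : ∀ x, P x = ((Φ x).1 i, (Φ x).2 i i) := fun x => rfl
      let I : K × R →ₗ[K] A := Φ.symm.toLinearMap.comp
        (LinearMap.prodMap (LinearMap.single K (fun _ => K) i) (Matrix.singleLinearMap K i i))
      have hI : ∀ x, I x = Φ.symm (Pi.single i x.1, Matrix.single i i x.2) := fun x => rfl
      let m : K × R →ₗ[K] K × R := LinearMap.prodMap (LinearMap.mulLeft K ((Φ a).1 i))
        (LinearMap.mulLeft K ((Φ a).2 i i))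
      -- The operator factors through the corner K × R, where it is multiplication by the
      -- coordinates of a, and a trace may be computed on that corner.
      have h2 : LinearMap.mulLeftRight K (e i * a * e i, e i) = I.comp (m.comp P) := by
        apply LinearMap.ext
        intro x
        rw [LinearMap.mulLeftRight_apply]
        have : e i * a * e i * x * e i = (e i * a * e i) * (e i * x * e i) := by
          rw [show (e i * a * e i) * (e i * x * e i) = e i * a * (e i * e i) * x * e i by
            simp only [mul_assoc], hee]
        rw [this, hcorner, hcorner, ← map_mul]
        change _ = Φ.symm (Pi.single i ((Φ a).1 i * (Φ x).1 i),
          Matrix.single i i ((Φ a).2 i i * (Φ x).2 i i))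
        congr 1
        refine Prod.ext ?_ ?_
        · simp [← Pi.single_mul]
        · simp
      have h3 : P.comp I = LinearMap.id := by
        apply LinearMap.ext
        intro x
        rw [LinearMap.comp_apply, hI, hP, AlgEquiv.apply_symm_apply]
        simp
      rw [h2, LinearMap.trace_comp_comm', LinearMap.comp_assoc, h3, LinearMap.comp_id,
        LinearMap.trace_prodMap']
      congr 1
      · have := Algebra.trace_self_apply (R := K) ((Φ a).1 i)
        rwa [Algebra.trace_apply] at this
    · intro x y
      have h4 : ∀ x y, e i * x * e i * y * e i = (e i * x * e i) * (e i * y * e i) := by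
        intro x y
        rw [show (e i * x * e i) * (e i * y * e i) = e i * x * (e i * e i) * y * e i by
          simp only [mul_assoc], hee]
      rw [h4, h4, hcorner, hcorner, ← map_mul, ← map_mul]
      congr 1
      refine Prod.ext ?_ ?_
      · exact mul_comm _ _
      · simp [mul_comm]
    · simp only [← mul_assoc, hee]
      rw [mul_assoc, hee]
  have h2 : a = ∑ i, ∑ j, e i * a * e j := by
    conv_lhs => rw [← one_mul a, ← mul_one (1 * a), ← hesum, sum_mul, sum_mul]
    exact sum_congr rfl fun i _ => mul_sum _ _ _
  conv_lhs => rw [h2]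
  rw [map_sum, Matrix.trace, map_sum, ← sum_add_distrib, map_sum]
  refine sum_congr rfl fun i _ => ?_
  rw [map_sum, sum_eq_single i]
  · exact h1 i
  · intro j _ hj
    rw [s.trace_mul_comm, ← mul_assoc, hemul, if_neg hj, zero_mul, map_zero]
  · simp

theorem reducedTrace_eq (h : Nonempty (Splitting K A)) (Φ : A ≃ₐ[K] (ι → K) × Matrix ι ι R)
    (a : A) : reducedTrace K a =
      algebraMap K _ (∑ i, (Φ a).1 i + Algebra.trace K R (Φ a).2.trace) := by
  rw [reducedTrace, dif_pos h]
  exact h.some.trace_eq Φ a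

end ReducedTrace

end UniqueLifting

end

noncomputable section

namespace UniqueLifting

open Finset Polynomial

set_option linter.unusedSectionVars false

/-! ### Orders in commutative algebras. -/

section CommutativeOrders

variable {O K R : Type*} [CommRing O] [IsDomain O] [IsDiscreteValuationRing O]
  [Field K] [Algebra O K] [IsFractionRing O K] [CommRing R] [Algebra K R] [Algebra O R]
  [IsScalarTower O K R]

theorem IsFullOrder.exists_leftMulMatrix {Γ : Subalgebra O R} (h : IsFullOrder O K Γ) {ι : Type*}
    [Fintype ι] [DecidableEq ι] (b : Module.Basis ι O Γ) : ∃ b' : Module.Basis ι K R,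
      ∀ g : Γ, Algebra.leftMulMatrix b' (g : R) =
        (Algebra.leftMulMatrix b g).map (algebraMap O K) := by
  obtain ⟨b', hb'⟩ := h.exists_basis b
  refine ⟨b', fun g => ?_⟩
  ext i j
  rw [Matrix.map_apply, Algebra.leftMulMatrix_eq_repr_mul, Algebra.leftMulMatrix_eq_repr_mul, hb']
  have h1 := congrArg Γ.val (b.sum_repr (g * b j))
  rw [map_sum] at h1
  have h2 : (g : R) * (b j : R) = ∑ k, algebraMap O K (b.repr (g * b j) k) • b' k := by
    simp only [hb', algebraMap_smul]
    exact h1.symm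
  rw [h2, b'.repr_sum_self]

/-- Multiplication by an element of the order has an integral matrix, so Cayley–Hamilton holds with
coefficients in O and the constant term is the norm up to sign. -/
theorem IsFullOrder.exists_charpoly {Γ : Subalgebra O R} (h : IsFullOrder O K Γ) {g : R}
    (hg : g ∈ Γ) : ∃ P : O[X], P.Monic ∧ P.natDegree = Module.finrank K R ∧ aeval g P = 0 ∧
      algebraMap O K (P.coeff 0) = (-1) ^ Module.finrank K R * Algebra.norm K g := by
  classical
  have := h.finite
  have := h.free
  let b := Module.Free.chooseBasis O Γ
  obtain ⟨b', hb'⟩ := h.exists_leftMulMatrix b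
  set M := Algebra.leftMulMatrix b ⟨g, hg⟩ with hM
  have hdim : Fintype.card (Module.Free.ChooseBasisIndex O Γ) = Module.finrank K R :=
    (Module.finrank_eq_card_basis b').symm
  refine ⟨M.charpoly, M.charpoly_monic, ?_, ?_, ?_⟩
  · rw [Matrix.charpoly_natDegree_eq_dim, hdim]
  · have h1 : Algebra.leftMulMatrix b (aeval (⟨g, hg⟩ : Γ) M.charpoly) = 0 := by
      rw [← aeval_algHom_apply, ← hM]
      exact Matrix.aeval_self_charpoly M
    have h2 := Algebra.leftMulMatrix_injective b (h1.trans (map_zero _).symm)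
    have h3 := congrArg Γ.val h2
    rw [← aeval_algHom_apply, map_zero] at h3
    exact h3
  · have h1 := hb' ⟨g, hg⟩
    rw [Algebra.norm_eq_matrix_det b', h1, ← hM, ← RingHom.mapMatrix_apply, ← RingHom.map_det,
      Matrix.det_eq_sign_charpoly_coeff, hdim, map_mul, map_pow, map_neg, map_one, ← mul_assoc,
      ← mul_pow]
    simp

/-- In its characteristic equation g divides the constant term, with a cofactor that is an integral
polynomial in g. -/
theorem IsFullOrder.exists_norm {Γ : Subalgebra O R} (h : IsFullOrder O K Γ) {g : R}
    (hg : g ∈ Γ) : ∃ o : O, algebraMap O K o = Algebra.norm K g ∧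
      ∃ s ∈ Γ, g * s = algebraMap O R o := by
  obtain ⟨P, hP, hdeg, h0, hn⟩ := h.exists_charpoly hg
  refine ⟨(-1) ^ Module.finrank K R * P.coeff 0, ?_, ?_⟩
  · rw [map_mul, hn, map_pow, map_neg, map_one, ← mul_assoc, ← mul_pow]
    simp
  · have h1 := congrArg (aeval g) (divX_mul_X_add P)
    rw [map_add, map_mul, aeval_X, aeval_C, h0] at h1
    refine ⟨-(-1) ^ Module.finrank K R * aeval g P.divX, ?_, ?_⟩
    · refine Γ.mul_mem (Γ.neg_mem (Γ.pow_mem (Γ.neg_mem Γ.one_mem) _)) ?_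
      exact aeval_mem_adjoin_singleton O g |> fun h => Algebra.adjoin_le (by simpa using hg) h
    · rw [map_mul, map_pow, map_neg, map_one]
      linear_combination (- (-1) ^ Module.finrank K R) * h1

theorem IsFullOrder.exists_inverse {Γ : Subalgebra O R} (h : IsFullOrder O K Γ) {g : R}
    (hg : g ∈ Γ) {o : O} (ho : IsUnit o) (hn : Algebra.norm K g = algebraMap O K o) :
    ∃ s ∈ Γ, g * s = 1 := by
  obtain ⟨o', ho', s, hs, hgs⟩ := h.exists_norm hg
  rw [hn] at ho'
  have := IsFractionRing.injective O K ho'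
  subst this
  obtain ⟨v, rfl⟩ := ho
  refine ⟨(↑v⁻¹ : O) • s, Γ.smul_mem hs _, ?_⟩
  rw [mul_smul_comm, hgs, Algebra.smul_def, ← map_mul, Units.inv_mul, map_one]

theorem exists_algebraMap_eq_of_isIntegral [Nontrivial R] {x : K}
    (h : IsIntegral O (algebraMap K R x)) : ∃ o, algebraMap O K o = x :=
  IsIntegrallyClosed.isIntegral_iff.1
    ((isIntegral_algHom_iff (IsScalarTower.toAlgHom O K R) (algebraMap K R).injective).1 h)

theorem IsFullOrder.isIntegral {Γ : Subalgebra O R} (h : IsFullOrder O K Γ) {g : R}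
    (hg : g ∈ Γ) : IsIntegral O g := by
  obtain ⟨P, hP, -, h0, -⟩ := h.exists_charpoly hg
  exact ⟨P, hP, h0⟩

/-- Orders in an algebra of dimension at most two form a chain. -/
theorem IsFullOrder.le_or_le [Nontrivial R] {Γ Γ' : Subalgebra O R} (h : IsFullOrder O K Γ)
    (h' : IsFullOrder O K Γ') [FiniteDimensional K R] (hR : Module.finrank K R ≤ 2) :
    Γ ≤ Γ' ∨ Γ' ≤ Γ := by
  -- If g' is a + og with o integral, then the scalar a is integral over O and so lies in O.
  have key : ∀ {Γ Γ' : Subalgebra O R}, IsFullOrder O K Γ → IsFullOrder O K Γ' →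
      ∀ g ∈ Γ, ∀ g' ∈ Γ', ∀ (a : K) (o : O), g' = algebraMap K R a + o • g → g' ∈ Γ := by
    intro Γ Γ' h h' g hg g' hg' a o he
    have h1 : IsIntegral O (algebraMap K R a) := by
      have : algebraMap K R a = g' - o • g := by rw [he]; ring
      rw [this]
      exact (h'.isIntegral hg').sub ((h.isIntegral hg).smul o)
    obtain ⟨o', rfl⟩ := exists_algebraMap_eq_of_isIntegral h1
    rw [he, ← IsScalarTower.algebraMap_apply]
    exact Γ.add_mem (Γ.algebraMap_mem _) (Γ.smul_mem hg _)
  by_contra! hcon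
  obtain ⟨g, hg, hg1⟩ := SetLike.not_le_iff_exists.1 hcon.1
  obtain ⟨g', hg', hg1'⟩ := SetLike.not_le_iff_exists.1 hcon.2
  -- In dimension at most two there is a relation between 1, g and g'. One of the two ratios of its
  -- coefficients lies in the valuation ring O, and `key` applies in that direction.
  have hdep : ¬ LinearIndependent K ![(1 : R), g, g'] := by
    intro hli
    have := hli.fintype_card_le_finrank
    simp at this
    omega
  rw [Fintype.not_linearIndependent_iff] at hdep
  obtain ⟨v, hv, i, hi⟩ := hdep
  rw [Fin.sum_univ_three] at hv
  replace hv : v 0 • 1 + v 1 • g + v 2 • g' = 0 := hv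
  have hsol : ∀ (x y : K) (s s' : R), y ≠ 0 → v 0 • 1 + x • s + y • s' = 0 →
      s' = algebraMap K R (- (v 0 / y)) + (-(x / y)) • s := by
    intro x y s s' hy h0
    have h1 : y⁻¹ • (v 0 • 1 + x • s + y • s') = 0 := by rw [h0, smul_zero]
    rw [smul_add, smul_add, smul_smul, smul_smul, smul_smul, inv_mul_cancel₀ hy, one_smul] at h1
    rw [Algebra.algebraMap_eq_smul_one]
    have h2 : s' = - ((y⁻¹ * v 0) • (1 : R)) - (y⁻¹ * x) • s := by linear_combination h1
    rw [h2, neg_smul, neg_smul, div_eq_inv_mul, div_eq_inv_mul]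
    ring
  have hcase : ∀ (x y : K) (s s' : R) (Γ Γ' : Subalgebra O R), IsFullOrder O K Γ →
      IsFullOrder O K Γ' → s ∈ Γ → s' ∈ Γ' → s' ∉ Γ → y ≠ 0 →
      v 0 • 1 + x • s + y • s' = 0 → ¬ IsLocalization.IsInteger O (x / y) := by
    intro x y s s' Γ Γ' h h' hs hs' hs1 hy h0 ⟨o, ho⟩
    refine hs1 (key h h' s hs s' hs' (-(v 0 / y)) (-o) ?_)
    have h1 : algebraMap O K (-o) = -(x / y) := by rw [map_neg, ho]
    rw [← algebraMap_smul K (-o), h1]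
    exact hsol x y s s' hy h0
  have hx : v 1 ≠ 0 ∨ v 2 ≠ 0 := by
    by_contra! h0
    rw [h0.1, h0.2, zero_smul, zero_smul, add_zero, add_zero, smul_eq_zero] at hv
    have h3 := hv.resolve_right one_ne_zero
    fin_cases i
    · exact hi h3
    · exact hi h0.1
    · exact hi h0.2
  have hv' : v 0 • 1 + v 2 • g' + v 1 • g = 0 := by rw [← hv]; ring
  by_cases h1 : v 1 = 0
  · refine hcase _ _ g g' Γ Γ' h h' hg hg' hg1' (hx.resolve_left (not_not.2 h1)) hv ?_
    rw [h1, zero_div]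
    exact ⟨0, map_zero _⟩
  by_cases h2 : v 2 = 0
  · refine hcase _ _ g' g Γ' Γ h' h hg' hg hg1 h1 hv' ?_
    rw [h2, zero_div]
    exact ⟨0, map_zero _⟩
  rcases ValuationRing.isInteger_or_isInteger O (v 1 / v 2) with h3 | h3
  · exact hcase _ _ g g' Γ Γ' h h' hg hg' hg1' h2 hv h3
  · rw [inv_div] at h3
    exact hcase _ _ g' g Γ' Γ h' h hg' hg hg1 h1 hv' h3

end CommutativeOrders

/-! ### Loops and duality. -/

section Loops

variable {O K R : Type*} [CommRing O] [IsDomain O] [IsDiscreteValuationRing O]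
  [Field K] [Algebra O K] [IsFractionRing O K] [CommRing R] [Algebra K R] [Algebra O R]
  [IsScalarTower O K R]

/-- The order `O[y]` with an ideal `y O[y]` dual to it under the linear form `T`. -/
structure IsLoop (π : O) (T : R →ₗ[K] K) (y : R) : Prop where
  full : IsFullOrder O K (Algebra.adjoin O {y})
  dual : ∀ r, (∃ h ∈ Algebra.adjoin O {y}, r = y * h) ↔
    ∀ g ∈ Algebra.adjoin O {y}, ∃ o : O, T (r * g) = algebraMap O K o
  dvd : ∀ o : O, (∃ h ∈ Algebra.adjoin O {y}, algebraMap O R o = y * h) ↔ π ∣ o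

variable {π : O} {T : R →ₗ[K] K} {y : R}

theorem exists_of_mem_adjoin {g : R} (hg : g ∈ Algebra.adjoin O {y}) :
    ∃ (o : O), ∃ h ∈ Algebra.adjoin O {y}, g = algebraMap O R o + y * h := by
  rw [Algebra.adjoin_singleton_eq_range_aeval] at hg
  obtain ⟨P, rfl⟩ := hg
  refine ⟨P.coeff 0, aeval y P.divX, aeval_mem_adjoin_singleton O y, ?_⟩
  have := congrArg (aeval y) (divX_mul_X_add P)
  rw [map_add, map_mul, aeval_X, aeval_C] at this
  change aeval y P = _
  rw [← this]; ring

/-- The powers of y below the degree of P span R over K, hence are independent. So a polynomial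
killing y has zero remainder modulo P. -/
theorem IsFullOrder.eq_zero_of_aeval {P Q : O[X]} (h : IsFullOrder O K (Algebra.adjoin O {y}))
    (hP : P.Monic) (hdeg : P.natDegree = Module.finrank K R) (hP0 : aeval y P = 0)
    (hQ : aeval y Q = 0) : P ∣ Q := by
  classical
  rcases subsingleton_or_nontrivial R with hR | hR
  · have h0 : P.natDegree = 0 := by rw [hdeg]; exact Module.finrank_zero_of_subsingleton
    rw [Polynomial.eq_one_of_monic_natDegree_zero hP h0]
    exact one_dvd _
  set n := Module.finrank K R with hn
  have hP1 : P ≠ 1 := by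
    rintro rfl
    rw [map_one] at hP0
    exact one_ne_zero hP0
  have hmod : ∀ Q : O[X], aeval y Q = ∑ i : Fin n, (Q %ₘ P).coeff i • y ^ (i : ℕ) := by
    intro Q
    conv_lhs => rw [← modByMonic_add_div Q P, map_add, map_mul, hP0, zero_mul, add_zero]
    rw [aeval_eq_sum_range' (n := n), Finset.sum_range]
    rw [← hdeg]
    exact natDegree_modByMonic_lt _ hP hP1
  have hspan : Submodule.span K (Set.range fun i : Fin n => y ^ (i : ℕ)) = ⊤ := by
    rw [eq_top_iff, ← h.span_eq_top, Submodule.span_le]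
    intro g hg
    rw [SetLike.mem_coe, Algebra.adjoin_singleton_eq_range_aeval] at hg
    obtain ⟨Q, rfl⟩ := hg
    change aeval y Q ∈ _
    rw [hmod]
    refine Submodule.sum_mem _ fun i _ => ?_
    rw [← algebraMap_smul K]
    exact Submodule.smul_mem _ _ (Submodule.subset_span ⟨i, rfl⟩)
  have hli : LinearIndependent K (fun i : Fin n => y ^ (i : ℕ)) :=
    linearIndependent_of_top_le_span_of_card_eq_finrank hspan.ge (by simp [hn])
  have hli' := (LinearIndependent.iff_fractionRing O K).2 hli
  rw [← modByMonic_eq_zero_iff_dvd hP]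
  have h0 := hmod Q
  rw [hQ] at h0
  have h1 := Fintype.linearIndependent_iff.1 hli' _ h0.symm
  ext i
  rw [coeff_zero]
  by_cases hi : i < n
  · exact h1 ⟨i, hi⟩
  · refine coeff_eq_zero_of_natDegree_lt ?_
    have := natDegree_modByMonic_lt Q hP hP1
    omega

/-- Let P be the characteristic polynomial of y. Its constant term lies in y O[y], hence is
divisible by π. Conversely π = yQ(y), so P divides π - XQ and its constant term divides π. -/
theorem IsLoop.norm (h : IsLoop π T y) :
    ∃ o : Oˣ, Algebra.norm K y = algebraMap O K (o * π) := by
  have hmem : y ∈ Algebra.adjoin O {y} := Algebra.self_mem_adjoin_singleton O y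
  obtain ⟨P, hP, hdeg, hP0, hn⟩ := h.full.exists_charpoly hmem
  have h1 : π ∣ P.coeff 0 := by
    rw [← h.dvd]
    refine ⟨-aeval y P.divX, Subalgebra.neg_mem _ (aeval_mem_adjoin_singleton O y), ?_⟩
    have := congrArg (aeval y) (divX_mul_X_add P)
    rw [map_add, map_mul, aeval_X, aeval_C, hP0] at this
    linear_combination this
  have h2 : P.coeff 0 ∣ π := by
    obtain ⟨s, hs, hπ⟩ := (h.dvd π).2 dvd_rfl
    rw [Algebra.adjoin_singleton_eq_range_aeval] at hs
    obtain ⟨Q, rfl⟩ := hs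
    have h3 : aeval y (C π - X * Q) = 0 := by
      rw [map_sub, map_mul, aeval_X, aeval_C, hπ]
      exact sub_self _
    obtain ⟨S, hS⟩ := h.full.eq_zero_of_aeval hP hdeg hP0 h3
    have h4 := congrArg (fun p => p.coeff 0) hS
    simp only [coeff_sub, coeff_C_zero, mul_coeff_zero, coeff_X_zero, zero_mul, sub_zero] at h4
    exact ⟨_, h4⟩
  obtain ⟨v, hv⟩ := associated_of_dvd_dvd h1 h2
  refine ⟨(-1) ^ Module.finrank K R * v, ?_⟩
  have h5 : Algebra.norm K y = (-1) ^ Module.finrank K R * algebraMap O K (P.coeff 0) := by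
    rw [hn, ← mul_assoc, ← mul_pow]; simp
  rw [h5, ← hv, Units.val_mul, Units.val_pow_eq_pow_val, Units.val_neg, Units.val_one]
  simp only [map_mul, map_pow, map_neg, map_one]
  ring

/-- Two loops with proportional dual forms generate the same order and differ by a unit of it. -/
theorem IsLoop.eq [Nontrivial R] [FiniteDimensional K R] (hR : Module.finrank K R ≤ 2) {y' : R}
    {T' : R →ₗ[K] K} (h : IsLoop π T y) (h' : IsLoop π T' y') (hπ : π ≠ 0) (w : Oˣ)
    (hw : ∀ r, T' r = (w : O) • T r) :
    Algebra.adjoin O {y} = Algebra.adjoin O {y'} ∧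
      ∃ g ∈ Algebra.adjoin O {y}, ∃ g' ∈ Algebra.adjoin O {y}, g * g' = 1 ∧ y' = y * g := by
  -- By the chain property one order may be assumed to contain the other. Duality reverses the
  -- inclusion, so y' = yg with g in the smaller order; equal norms up to units make g a unit there,
  -- and O[y'] = O + y'O[y'] falls back into O[y].
  have key : ∀ {y y' : R} {T T' : R →ₗ[K] K} (w : Oˣ), IsLoop π T y → IsLoop π T' y' →
      (∀ r, T' r = (w : O) • T r) → Algebra.adjoin O {y} ≤ Algebra.adjoin O {y'} →
      Algebra.adjoin O {y} = Algebra.adjoin O {y'} ∧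
      ∃ g ∈ Algebra.adjoin O {y}, ∃ g' ∈ Algebra.adjoin O {y}, g * g' = 1 ∧ y' = y * g := by
    intro y y' T T' w h h' hw hle
    have h1 : ∀ r, (∃ s ∈ Algebra.adjoin O {y'}, r = y' * s) →
        ∃ s ∈ Algebra.adjoin O {y}, r = y * s := by
      intro r hr
      rw [h'.dual] at hr
      rw [h.dual]
      intro g hg
      obtain ⟨o, ho⟩ := hr g (hle hg)
      refine ⟨(↑w⁻¹ : O) * o, ?_⟩
      rw [map_mul (algebraMap O K), ← ho, hw, Algebra.smul_def, ← mul_assoc, ← map_mul, Units.inv_mul, map_one,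
        one_mul]
    obtain ⟨g, hg, hyg⟩ := h1 y' ⟨1, Subalgebra.one_mem _, (mul_one _).symm⟩
    obtain ⟨o, ho⟩ := h.norm
    obtain ⟨o', ho'⟩ := h'.norm
    have h2 : Algebra.norm K g = algebraMap O K (↑(o⁻¹ * o') : O) := by
      have h3 : Algebra.norm K y' = Algebra.norm K y * Algebra.norm K g := by rw [hyg, map_mul]
      rw [ho, ho'] at h3
      have h4 : algebraMap O K (o * π) ≠ 0 := by
        rw [Ne, FaithfulSMul.algebraMap_eq_zero_iff]
        exact mul_ne_zero o.ne_zero hπ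
      refine mul_left_cancel₀ h4 ?_
      rw [← h3, ← map_mul]
      congr 1
      have := o.mul_inv
      push_cast
      linear_combination (-(π * o')) * this
    obtain ⟨g', hg', hgg⟩ := h.full.exists_inverse hg (o⁻¹ * o').isUnit h2
    refine ⟨le_antisymm hle ?_, g, hg, g', hg', hgg, hyg⟩
    intro r hr
    obtain ⟨a, s, hs, rfl⟩ := exists_of_mem_adjoin hr
    refine Subalgebra.add_mem _ (Subalgebra.algebraMap_mem _ _) ?_
    obtain ⟨s', hs', hss⟩ := h1 _ ⟨s, hs, rfl⟩
    rw [hss]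
    exact Subalgebra.mul_mem _ (Algebra.self_mem_adjoin_singleton O y) hs'
  rcases h.full.le_or_le h'.full hR with hle | hle
  · exact key w h h' hw hle
  · obtain ⟨h1, g, hg, g', hg', hgg, hy⟩ := key w⁻¹ h' h (fun r => by
      rw [hw, smul_smul, Units.inv_mul, one_smul]) hle
    rw [h1] at hg hg'
    exact ⟨h1.symm, g', hg', g, hg, by rw [mul_comm, hgg], by
      rw [hy, mul_assoc, hgg, mul_one]⟩

end Loops

end UniqueLifting

end

noncomputable section

namespace UniqueLifting

open Finset

set_option linter.unusedSectionVars false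

/-! ### Paths with values in an abelian group. -/

section CommutativePaths

theorem prod_range_mul_of_add {G : Type*} [CommMonoid G] {κ : ℕ} (x : ZMod κ → G) (i : ZMod κ)
    (m n : ℕ) : ∏ s ∈ range (m + n), x (i + s) =
      (∏ s ∈ range m, x (i + s)) * ∏ s ∈ range n, x (i + m + s) := by
  rw [prod_range_add]
  congr 1
  refine prod_congr rfl fun s _ => ?_
  rw [Nat.cast_add, add_assoc]

variable {G : Type*} [CommGroup G] {κ n p : ℕ} {X X' : ZMod κ → Fin (n + 1) → G} {P : G}

/-- The exponent of `P` which occurs when the arrows of a word are expressed by the first ones. -/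
def wordExp (p : ℕ) (w : List (Fin (n + 1))) : ℕ :=
  (w.map fun j : Fin (n + 1) => ∑ l ∈ range (j : ℕ), p ^ l).sum

/-- The product along a path is determined by the arrows of weight one. -/
theorem pow_wordExp_mul_pathProd
    (hpow : ∀ i (j : Fin (n + 1)), pathProd p (fun _ => 1) X i (List.replicate p j) =
      P * X i (j + 1)) (i : ZMod κ) (w : List (Fin (n + 1))) :
    P ^ wordExp p w * pathProd p (fun _ => 1) X i w = ∏ s ∈ range (wordWt p w), X (i + s) 0 := by
  have hstep : ∀ w : List (Fin (n + 1)), (∀ j ∈ w, ∀ i, P ^ (∑ l ∈ range (j : ℕ), p ^ l) * X i j =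
      ∏ s ∈ range (p ^ (j : ℕ)), X (i + s) 0) → ∀ i, P ^ wordExp p w *
        pathProd p (fun _ => 1) X i w = ∏ s ∈ range (wordWt p w), X (i + s) 0 := by
    intro w
    induction w with
    | nil => intro _ i; simp [wordExp, pathProd, wordWt]
    | cons j w ih =>
      intro hw i
      rw [wordWt_cons, prod_range_mul_of_add (fun i => X i 0), ← hw j (by simp),
        ← ih (fun j hj => hw j (by simp [hj]))]
      simp only [wordExp, List.map_cons, List.sum_cons, pathProd, pow_add]
      rw [mul_mul_mul_comm]
  -- Induction on the letter: p repetitions of letter m give P times letter m + 1, so the exponent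
  -- of P grows to 1 + p + ... + p^(m-1). The cyclic wrap of the last letter is not used.
  have hletter : ∀ m (hm : m < n + 1) (i : ZMod κ), P ^ (∑ l ∈ range m, p ^ l) * X i ⟨m, hm⟩ =
      ∏ s ∈ range (p ^ m), X (i + s) 0 := by
    intro m
    induction m with
    | zero => intro hm i; simp
    | succ m ih =>
      intro hm i
      have h1 := hstep (List.replicate p ⟨m, by omega⟩) (fun j hj i => by
        rw [List.eq_of_mem_replicate hj]; exact ih _ i) i
      rw [wordWt_replicate, ← pow_succ'] at h1
      rw [← h1, hpow]
      have h2 : (⟨m, by omega⟩ + 1 : Fin (n + 1)) = ⟨m + 1, hm⟩ := by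
        ext
        rw [Fin.val_add_one_of_lt]
        rw [Fin.lt_def, Fin.val_last]; simpa using hm
      rw [h2, ← mul_assoc, ← pow_succ]
      congr 2
      simp only [wordExp, List.map_replicate, List.sum_replicate, smul_eq_mul]
      rw [sum_range_succ', mul_sum, pow_zero]
      congr 1
      exact sum_congr rfl fun l _ => pow_succ' _ _
  exact hstep w (fun j _ i => hletter j j.2 i) i

/-- Two families of arrows with the same relations and the same loops differ by a change of
frame. -/
theorem exists_frame [NeZero κ]
    (hpow : ∀ i (j : Fin (n + 1)), pathProd p (fun _ => 1) X i (List.replicate p j) =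
      P * X i (j + 1))
    (hpow' : ∀ i (j : Fin (n + 1)), pathProd p (fun _ => 1) X' i (List.replicate p j) =
      P * X' i (j + 1))
    {w₀ w₀' : List (Fin (n + 1))} (hw : w₀.Perm w₀') (hwt : wordWt p w₀ = κ)
    (hloop : pathProd p (fun _ => 1) X' 0 w₀' = pathProd p (fun _ => 1) X 0 w₀) :
    ∃ r : ZMod κ → G, ∀ i w, pathProd p (fun _ => 1) X' i w =
      r i * pathProd p (fun _ => 1) X i w * (r (i + (wordWt p w : ℕ)))⁻¹ := by
  have hexp : wordExp p w₀' = wordExp p w₀ := (hw.map _).sum_eq.symm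
  have hwt' : wordWt p w₀' = κ := by rw [← hwt]; exact (hw.map _).sum_eq.symm
  have h1 := pow_wordExp_mul_pathProd hpow 0 w₀
  have h2 := pow_wordExp_mul_pathProd hpow' 0 w₀'
  rw [hloop, hexp, h1, hwt, hwt'] at h2
  simp only [zero_add] at h2
  -- Inverse partial products of the ratios of weight-one arrows. They close up around ℤ/κ because
  -- the two full products agree, which is what the equality of the loops gives.
  let r : ZMod κ → G := fun i => (∏ s ∈ range i.val, X' s 0 / X s 0)⁻¹
  have hr : ∀ i, r i / r (i + 1) = X' i 0 / X i 0 := by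
    intro i
    have hval : ((i.val : ℕ) : ZMod κ) = i := ZMod.natCast_zmod_val i
    have h3 : (∏ s ∈ range (i.val + 1), X' (s : ZMod κ) 0 / X s 0) = (r (i + 1))⁻¹ := by
      have hlt := ZMod.val_lt i
      have h4 : (i + 1).val = (i.val + 1) % κ := by
        rw [← ZMod.val_natCast, Nat.cast_add, hval, Nat.cast_one]
      rcases Nat.lt_or_ge (i.val + 1) κ with h5 | h5
      · rw [Nat.mod_eq_of_lt h5] at h4
        simp only [r]
        rw [h4, inv_inv]
      · have h6 : i.val + 1 = κ := by omega
        rw [h6, Nat.mod_self] at h4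
        simp only [r]
        rw [h4, h6, range_zero, prod_empty, inv_one, inv_one, prod_div_distrib, ← h2, div_self']
    rw [prod_range_succ, hval] at h3
    simp only [r] at h3 ⊢
    rw [div_eq_mul_inv, ← h3, inv_mul_cancel_left]
  have hrange : ∀ (N : ℕ) i, ∏ s ∈ range N, X' (i + s) 0 =
      r i * (∏ s ∈ range N, X (i + s) 0) * (r (i + N))⁻¹ := by
    intro N
    induction N with
    | zero => intro i; simp
    | succ N ih =>
      intro i
      rw [prod_range_succ, ih, prod_range_succ, Nat.cast_succ, ← add_assoc]
      have h3 : X' (i + N) 0 = r (i + N) / r (i + N + 1) * X (i + N) 0 := by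
        rw [hr, div_mul_cancel]
      rw [h3, div_eq_mul_inv]
      simp only [mul_assoc]
      rw [inv_mul_cancel_left, mul_comm (r (i + N + 1))⁻¹]
  refine ⟨r, fun i w => ?_⟩
  have h3 := pow_wordExp_mul_pathProd hpow i w
  have h4 := pow_wordExp_mul_pathProd hpow' i w
  rw [hrange, ← h3] at h4
  apply mul_left_cancel (a := P ^ wordExp p w)
  rw [h4]
  simp only [mul_assoc]
  rw [mul_left_comm]

/-- Multiplying over all starting points makes the position of a letter in the word irrelevant,
since translation permutes ℤ/κ. -/
theorem prod_pathProd {M : Type*} [CommMonoid M] {f : ℕ} [NeZero κ] (X : ZMod κ → Fin f → M)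
    (w : List (Fin f)) : ∏ i, pathProd p (fun _ => 1) X i w = (w.map fun j => ∏ i, X i j).prod := by
  induction w with
  | nil => simp [pathProd]
  | cons j w ih =>
    simp only [pathProd, prod_mul_distrib, List.map_cons, List.prod_cons]
    rw [← ih]
    congr 1
    exact Equiv.prod_comp (Equiv.addRight ((p ^ (j : ℕ) : ℕ) : ZMod κ))
      fun i => pathProd p (fun _ => 1) X i w

end CommutativePaths

/-! ### Arrow systems with dual loops. -/

section ArrowSystems

variable {O K R : Type*} [CommRing O] [IsDomain O] [IsDiscreteValuationRing O]
  [Field K] [Algebra O K] [IsFractionRing O K] [CommRing R] [Algebra K R] [Algebra O R]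
  [IsScalarTower O K R] {κ n p d : ℕ} [NeZero κ]

/-- A family of arrows in a commutative algebra with dual loops. -/
structure IsArrowSystem (O : Type*) {K R : Type*} [CommRing O] [Field K] [Algebra O K]
    [CommRing R] [Algebra K R] [Algebra O R] [IsScalarTower O K R] (p d : ℕ) {κ n : ℕ}
    (T : R →ₗ[K] K) (x : ZMod κ → Fin (n + 1) → R) (w₀ : List (Fin (n + 1))) : Prop where
  loop : ∀ i, IsLoop ((p : O) ^ (n + 1)) T (pathProd p (fun _ => 1) x i w₀)
  weight : wordWt p w₀ = κ
  count : ∀ j, w₀.count j = d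
  pow : ∀ i j, ∃ g ∈ Algebra.adjoin O {pathProd p (fun _ => 1) x i w₀},
    pathProd p (fun _ => 1) x i (List.replicate p j) = (p : R) * (x i (j + 1) * g)

variable {T : R →ₗ[K] K} {x : ZMod κ → Fin (n + 1) → R} {w₀ : List (Fin (n + 1))}

namespace IsArrowSystem

variable (h : IsArrowSystem O p d T x w₀)

include h

theorem list_prod_map {M : Type*} [CommMonoid M] (W : Fin (n + 1) → M) (hd : 0 < d) :
    (w₀.map W).prod = (∏ j, W j) ^ d := by
  have h1 : w₀.toFinset = univ := by
    ext j
    simp only [List.mem_toFinset, mem_univ, iff_true]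
    rw [← List.count_pos_iff, h.count]
    exact hd
  rw [prod_list_map_count, h1, ← prod_pow]
  exact prod_congr rfl fun j _ => by rw [h.count]

/-- The factors of the `p`-th powers of the arrows are units. -/
theorem exists_inverse [FiniteDimensional K R] (hp : (p : O) ≠ 0)
    (hc : Module.finrank K R * d + 1 = p) (hd : 0 < d) {g : ZMod κ → Fin (n + 1) → R}
    (hg : ∀ i j, g i j ∈ Algebra.adjoin O {pathProd p (fun _ => 1) x i w₀})
    (hpow : ∀ i j, pathProd p (fun _ => 1) x i (List.replicate p j) =
      (p : R) * (x i (j + 1) * g i j)) (i : ZMod κ) (j : Fin (n + 1)) :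
    ∃ s ∈ Algebra.adjoin O {pathProd p (fun _ => 1) x i w₀}, g i j * s = 1 := by
  set c := Module.finrank K R with hcdef
  let N : R →* K := Algebra.norm K
  -- Norms are multiplied over all starting points, so that only the letters of a word count.
  set W : Fin (n + 1) → K := fun j => ∏ i, N (x i j) with hW
  have hpath : ∀ w, ∏ i, N (pathProd p (fun _ => 1) x i w) = (w.map W).prod := by
    intro w
    have h1 := prod_pathProd (p := p) (fun i j => N (x i j)) w
    rw [hW, ← h1]
    refine prod_congr rfl fun i _ => ?_
    rw [map_pathProd]
    simp only [map_one]
  choose v hv using fun i => (h.loop i).norm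
  choose o ho s hs hgs using fun i j => (h.loop i).full.exists_norm (hg i j)
  have hpK : (p : K) ≠ 0 := by
    rw [← map_natCast (algebraMap O K)]
    exact (FaithfulSMul.algebraMap_eq_zero_iff O K).not.2 hp
  have h1 : (∏ j, W j) ^ d = (∏ i, algebraMap O K (v i)) * (p : K) ^ (κ * (n + 1)) := by
    rw [← h.list_prod_map W hd, ← hpath]
    have : ∀ i, N (pathProd p (fun _ => 1) x i w₀) = algebraMap O K (v i) * (p : K) ^ (n + 1) := by
      intro i
      change Algebra.norm K _ = _
      rw [hv, map_mul, map_pow, map_natCast]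
    simp only [this, prod_mul_distrib, prod_const, card_univ, ZMod.card]
    rw [← pow_mul, mul_comm κ]
  have hWne : (∏ j, W j) ≠ 0 := by
    intro h0
    rw [h0, zero_pow hd.ne'] at h1
    refine mul_ne_zero ?_ (pow_ne_zero _ hpK) h1.symm
    rw [prod_ne_zero_iff]
    intro i _
    exact (FaithfulSMul.algebraMap_eq_zero_iff O K).not.2 (v i).ne_zero
  have h2 : ∀ j, W j ^ p = ((p : K) ^ (c * κ) * W (j + 1)) * ∏ i, algebraMap O K (o i j) := by
    intro j
    have h3 := hpath (List.replicate p j)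
    rw [List.map_replicate, List.prod_replicate] at h3
    rw [← h3]
    have : ∀ i, N (pathProd p (fun _ => 1) x i (List.replicate p j)) =
        (p : K) ^ c * (N (x i (j + 1)) * algebraMap O K (o i j)) := by
      intro i
      rw [hpow, map_mul, map_mul]
      congr 1
      · change Algebra.norm K _ = _
        rw [← map_natCast (algebraMap K R), Algebra.norm_algebraMap]
      · rw [ho]
    simp only [this, prod_mul_distrib, prod_const, card_univ, ZMod.card]
    rw [← pow_mul, mul_assoc]
  have h3 : (∏ j, W j) ^ p = (p : K) ^ (c * κ * (n + 1)) * (∏ j, W j) *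
      ∏ j, ∏ i, algebraMap O K (o i j) := by
    rw [← prod_pow]
    simp only [h2, prod_mul_distrib, prod_const, card_univ, Fintype.card_fin]
    rw [← pow_mul]
    congr 2
    exact Equiv.prod_comp (Equiv.addRight (1 : Fin (n + 1))) W
  -- The loops give (∏ W)^d = unit · p^(κ(n+1)). The p-th power relations, multiplied over the
  -- cyclic set of letters, give (∏ W)^p = p^(cκ(n+1)) · ∏ W · ∏ o. As p = cd + 1 the powers of p
  -- cancel, so the product of all norms o is a unit and each of them is.
  have h4 : ∏ j, ∏ i, o i j = (∏ i, (v i : O)) ^ c := by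
    apply IsFractionRing.injective O K
    simp only [map_prod, map_pow]
    have h5 : (∏ j, W j) ^ p = ((∏ j, W j) ^ d) ^ c * ∏ j, W j := by
      rw [← pow_mul, ← pow_succ]
      congr 1
      rw [← hc]; ring
    rw [h3, h1, mul_pow, ← pow_mul] at h5
    have h6 : (p : K) ^ (c * κ * (n + 1)) * ∏ j, W j ≠ 0 := mul_ne_zero (pow_ne_zero _ hpK) hWne
    apply mul_left_cancel₀ h6
    rw [h5]
    rw [show κ * (n + 1) * c = c * κ * (n + 1) by ring]
    ring
  have h5 : IsUnit (o i j) := by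
    refine isUnit_of_dvd_unit ?_ ((Units.isUnit (∏ i, v i)).pow c)
    rw [Units.coe_prod, ← h4]
    exact (dvd_prod_of_mem (fun i => o i j) (mem_univ i)).trans
      (dvd_prod_of_mem (fun j => ∏ i, o i j) (mem_univ j))
  exact (h.loop i).full.exists_inverse (hg i j) h5 (ho i j).symm

/-- The loops are units of R because their norms are nonzero, and every arrow divides some loop
because every letter occurs in `w₀`. -/
theorem isUnit_arrow [FiniteDimensional K R] (hp : (p : O) ≠ 0) (hd : 0 < d) (i : ZMod κ)
    (j : Fin (n + 1)) : IsUnit (x i j) := by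
  have h0 : ∀ i, IsUnit (pathProd p (fun _ => 1) x i w₀) := by
    intro i
    obtain ⟨v, hv⟩ := (h.loop i).norm
    obtain ⟨o, ho, s, -, hs⟩ := (h.loop i).full.exists_norm (Algebra.self_mem_adjoin_singleton O _)
    rw [hv] at ho
    have ho' := IsFractionRing.injective O K ho
    refine isUnit_of_dvd_unit (Dvd.intro s hs) ?_
    rw [IsScalarTower.algebraMap_apply O K R, ho']
    refine IsUnit.map _ (IsUnit.mk0 _ ?_)
    exact (FaithfulSMul.algebraMap_eq_zero_iff O K).not.2
      (mul_ne_zero v.ne_zero (pow_ne_zero _ hp))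
  have key : ∀ (w : List (Fin (n + 1))), j ∈ w → ∃ a : ℕ, ∀ i, x (i + a) j ∣
      pathProd p (fun _ => 1) x i w := by
    intro w
    induction w with
    | nil => simp
    | cons l w ih =>
      intro hj
      by_cases hl : j = l
      · subst hl
        exact ⟨0, fun i => by rw [Nat.cast_zero, add_zero, pathProd]; exact dvd_mul_right _ _⟩
      · obtain ⟨a, ha⟩ := ih (by simpa [hl] using hj)
        refine ⟨p ^ (l : ℕ) + a, fun i => ?_⟩
        rw [pathProd, Nat.cast_add, ← add_assoc]
        exact (ha _).mul_left _
  obtain ⟨a, ha⟩ := key w₀ (by rw [← List.count_pos_iff, h.count]; exact hd)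
  have := ha (i - a)
  rw [sub_add_cancel] at this
  exact isUnit_of_dvd_unit this (h0 _)

theorem adjoin_eq [Nontrivial R] [FiniteDimensional K R] (hp : (p : O) ≠ 0)
    (hR : Module.finrank K R ≤ 2) (i l : ZMod κ) :
    Algebra.adjoin O {pathProd p (fun _ => 1) x i w₀} =
      Algebra.adjoin O {pathProd p (fun _ => 1) x l w₀} :=
  ((h.loop i).eq hR (h.loop l) (pow_ne_zero _ hp) 1 (by simp)).1

end IsArrowSystem

/-- The span of the paths from `i` to `l`. -/
def pathSpan (O : Type*) {R : Type*} [CommRing O] [CommRing R] [Algebra O R] (p : ℕ) {κ n : ℕ}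
    (x : ZMod κ → Fin (n + 1) → R) (i l : ZMod κ) : Submodule O R :=
  Submodule.span O {r | ∃ w, i + (wordWt p w : ℕ) = l ∧ r = pathProd p (fun _ => 1) x i w}

theorem pathProd_append {M : Type*} [CommMonoid M] {f : ℕ} (x : ZMod κ → Fin f → M) (i : ZMod κ)
    (w w' : List (Fin f)) : pathProd p (fun _ => 1) x i (w ++ w') =
      pathProd p (fun _ => 1) x i w * pathProd p (fun _ => 1) x (i + (wordWt p w : ℕ)) w' := by
  induction w generalizing i with
  | nil => simp [pathProd, wordWt]
  | cons j w ih =>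
    rw [List.cons_append, pathProd, ih, pathProd, wordWt_cons, mul_assoc, Nat.cast_add, add_assoc]

/-- Multiplication by the loop amounts to prefixing the word `w₀`, whose weight κ returns to the
starting point. -/
theorem mul_mem_pathSpan (hw : wordWt p w₀ = κ) {i l : ZMod κ} {g : R}
    (hg : g ∈ Algebra.adjoin O {pathProd p (fun _ => 1) x i w₀}) {z : R}
    (hz : z ∈ pathSpan O p x i l) : z * g ∈ pathSpan O p x i l := by
  induction hg using Algebra.adjoin_induction generalizing z with
  | mem a ha =>
    rw [Set.mem_singleton_iff.1 ha]
    induction hz using Submodule.span_induction with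
    | mem r hr =>
      obtain ⟨w, hwl, rfl⟩ := hr
      refine Submodule.subset_span ⟨w₀ ++ w, ?_, ?_⟩
      · rw [← hwl, wordWt, List.map_append, List.sum_append]
        change i + ((wordWt p w₀ + wordWt p w : ℕ) : ZMod κ) = _
        rw [hw, Nat.cast_add, ZMod.natCast_self, zero_add]
      · rw [pathProd_append, hw, ZMod.natCast_self, add_zero, mul_comm]
    | zero => rw [zero_mul]; exact Submodule.zero_mem _
    | add a b _ _ h1 h2 => rw [add_mul]; exact Submodule.add_mem _ h1 h2
    | smul o a _ h1 => rw [smul_mul_assoc]; exact Submodule.smul_mem _ _ h1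
  | algebraMap o =>
    rw [mul_comm, ← Algebra.smul_def]
    exact Submodule.smul_mem _ _ hz
  | add a b _ _ h1 h2 => rw [mul_add]; exact Submodule.add_mem _ (h1 hz) (h2 hz)
  | mul a b _ _ h1 h2 => rw [← mul_assoc]; exact h2 (h1 hz)

/-- Two arrow systems with proportional forms differ by a change of frame. -/
theorem IsArrowSystem.exists_frame [Nontrivial R] [FiniteDimensional K R] (hp : (p : O) ≠ 0)
    (hR : Module.finrank K R ≤ 2) (hc : Module.finrank K R * d + 1 = p) (hd : 0 < d)
    {T' : R →ₗ[K] K} {x' : ZMod κ → Fin (n + 1) → R} {w₀' : List (Fin (n + 1))}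
    (h : IsArrowSystem O p d T x w₀) (h' : IsArrowSystem O p d T' x' w₀') (w : Oˣ)
    (hw : ∀ r, T' r = (w : O) • T r) :
    (∀ i z, (∃ s ∈ Algebra.adjoin O {pathProd p (fun _ => 1) x' i w₀'},
        z = pathProd p (fun _ => 1) x' i w₀' * s) ↔
      ∃ s ∈ Algebra.adjoin O {pathProd p (fun _ => 1) x i w₀},
        z = pathProd p (fun _ => 1) x i w₀ * s) ∧
    ∃ r : ZMod κ → Rˣ, ∀ i l z, z ∈ pathSpan O p x' i l ↔
      ↑(r i)⁻¹ * z * r l ∈ pathSpan O p x i l := by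
  have hp' : (p : O) ^ (n + 1) ≠ 0 := pow_ne_zero _ hp
  have hpR : IsUnit (p : R) := by
    rw [← map_natCast (algebraMap K R), ← map_natCast (algebraMap O K)]
    exact IsUnit.map _ (IsUnit.mk0 _ ((FaithfulSMul.algebraMap_eq_zero_iff O K).not.2 hp))
  set Γ := Algebra.adjoin O {pathProd p (fun _ => 1) x 0 w₀} with hΓ
  have hΓi : ∀ i, Algebra.adjoin O {pathProd p (fun _ => 1) x i w₀} = Γ :=
    fun i => h.adjoin_eq hp hR i 0
  have hcmp := fun i => (h.loop i).eq hR (h'.loop i) hp' w hw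
  have hΓi' : ∀ i, Algebra.adjoin O {pathProd p (fun _ => 1) x' i w₀'} = Γ :=
    fun i => (hcmp i).1.symm.trans (hΓi i)
  constructor
  · intro i z
    rw [hΓi, hΓi']
    obtain ⟨g, hg, g', hg', hgg, hy⟩ := (hcmp i).2
    rw [hΓi] at hg hg'
    constructor
    · rintro ⟨s, hs, rfl⟩
      exact ⟨g * s, Γ.mul_mem hg hs, by rw [hy, mul_assoc]⟩
    · rintro ⟨s, hs, rfl⟩
      refine ⟨g' * s, Γ.mul_mem hg' hs, ?_⟩
      rw [hy]
      linear_combination (-(pathProd p (fun _ => 1) x i w₀ * s)) * hgg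
  choose X hX using fun i j => h.isUnit_arrow hp hd i j
  choose X' hX' using fun i j => h'.isUnit_arrow hp hd i j
  obtain ⟨P, hP⟩ := hpR
  -- Modulo the units of Γ the factors g in the p-th power relations disappear and the loops of both
  -- systems agree, so the statement about abelian groups applies in the quotient by U.
  let U : Subgroup Rˣ := Γ.toSubmonoid.units
  have hU : ∀ {u : Rˣ}, u ∈ U ↔ (u : R) ∈ Γ ∧ (↑u⁻¹ : R) ∈ Γ := fun {u} =>
    Submonoid.mem_units_iff _ _
  have hval : ∀ i w, ((pathProd p (fun _ => 1) X i w : Rˣ) : R) =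
      pathProd p (fun _ => 1) x i w := by
    intro i w
    have := map_pathProd (Units.coeHom R) p (fun _ => 1) X i w
    simpa only [Units.coeHom_apply, hX, Units.val_one] using this
  have hval' : ∀ i w, ((pathProd p (fun _ => 1) X' i w : Rˣ) : R) =
      pathProd p (fun _ => 1) x' i w := by
    intro i w
    have := map_pathProd (Units.coeHom R) p (fun _ => 1) X' i w
    simpa only [Units.coeHom_apply, hX', Units.val_one] using this
  let q := QuotientGroup.mk' U
  have hq : ∀ a b : Rˣ, q a = q b ↔ ∃ g ∈ U, a = b * g := by
    intro a b
    rw [QuotientGroup.mk'_eq_mk']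
    constructor
    · rintro ⟨z, hz, rfl⟩; exact ⟨z⁻¹, U.inv_mem hz, by group⟩
    · rintro ⟨z, hz, rfl⟩; exact ⟨z⁻¹, U.inv_mem hz, by group⟩
  have hqpath : ∀ (Y : ZMod κ → Fin (n + 1) → Rˣ) i w, q (pathProd p (fun _ => 1) Y i w) =
      pathProd p (fun _ => 1) (fun i j => q (Y i j)) i w := by
    intro Y i w
    rw [map_pathProd]
    simp only [map_one]
  have hrel : ∀ {x : ZMod κ → Fin (n + 1) → R} {w₀ : List (Fin (n + 1))} {T : R →ₗ[K] K}
      (X : ZMod κ → Fin (n + 1) → Rˣ), IsArrowSystem O p d T x w₀ → (∀ i j, (X i j : R) = x i j) →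
      (∀ i w, ((pathProd p (fun _ => 1) X i w : Rˣ) : R) = pathProd p (fun _ => 1) x i w) →
      (∀ i, Algebra.adjoin O {pathProd p (fun _ => 1) x i w₀} = Γ) → ∀ i j,
      pathProd p (fun _ => 1) (fun i j => q (X i j)) i (List.replicate p j) =
        q P * q (X i (j + 1)) := by
    intro x w₀ T X h hX hval hΓi i j
    choose g hg hgp using h.pow
    obtain ⟨s, hs, hgs⟩ := h.exists_inverse hp hc hd hg hgp i j
    have hg' := hg i j
    rw [hΓi] at hs hg'
    rw [← hqpath, ← map_mul, hq]
    refine ⟨⟨g i j, s, hgs, by rw [mul_comm, hgs]⟩, hU.2 ⟨hg', hs⟩, ?_⟩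
    ext
    rw [hval, hgp, Units.val_mul, Units.val_mul, hP, hX, mul_assoc]
  have hperm : w₀.Perm w₀' := by
    rw [List.perm_iff_count]
    intro j
    rw [h.count, h'.count]
  obtain ⟨r, hr⟩ := UniqueLifting.exists_frame (hrel X h hX hval hΓi) (hrel X' h' hX' hval' hΓi')
    hperm h.weight (by
      rw [← hqpath, ← hqpath, hq]
      obtain ⟨g, hg, g', hg', hgg, hy⟩ := (hcmp 0).2
      refine ⟨⟨g, g', hgg, by rw [mul_comm, hgg]⟩, hU.2 ⟨hg, hg'⟩, ?_⟩
      ext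
      rw [hval', hy, Units.val_mul, hval])
  choose r' hr' using fun i => QuotientGroup.mk'_surjective U (r i)
  have hpath : ∀ i w, ∃ g ∈ U, pathProd p (fun _ => 1) X' i w =
      r' i * pathProd p (fun _ => 1) X i w * (r' (i + (wordWt p w : ℕ)))⁻¹ * g := by
    intro i w
    rw [← hq, hqpath, hr, map_mul, map_mul, map_inv, hqpath]
    simp only [q, hr']
  -- Any lifts of the frame will do: the discrepancy is a unit of Γ, and path spans are stable under
  -- Γ.
  refine ⟨r', fun i l z => ⟨fun hz => ?_, fun hz => ?_⟩⟩
  · induction hz using Submodule.span_induction with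
    | mem a ha =>
      obtain ⟨w, hwl, rfl⟩ := ha
      obtain ⟨g, hg, he⟩ := hpath i w
      have h1 : (↑(r' i)⁻¹ * pathProd p (fun _ => 1) x' i w * r' l : R) =
          pathProd p (fun _ => 1) x i w * g := by
        rw [← hval, ← hval', he, hwl, ← Units.val_mul, ← Units.val_mul, ← Units.val_mul]
        congr 1
        rw [mul_comm _ g]
        simp only [mul_assoc]
        rw [mul_left_comm g, inv_mul_cancel_left, inv_mul_cancel, mul_one, mul_comm]
      rw [h1]
      exact mul_mem_pathSpan h.weight (by rw [hΓi]; exact (hU.1 hg).1)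
        (Submodule.subset_span ⟨w, hwl, rfl⟩)
    | zero => rw [mul_zero, zero_mul]; exact Submodule.zero_mem _
    | add a b _ _ h1 h2 => rw [mul_add, add_mul]; exact Submodule.add_mem _ h1 h2
    | smul o a _ h1 => rw [mul_smul_comm, smul_mul_assoc]; exact Submodule.smul_mem _ _ h1
  · have key : ∀ y ∈ pathSpan O p x i l, (r' i * y * ↑(r' l)⁻¹ : R) ∈ pathSpan O p x' i l := by
      intro y hy
      induction hy using Submodule.span_induction with
      | mem a ha =>
        obtain ⟨w, hwl, rfl⟩ := ha
        obtain ⟨g, hg, he⟩ := hpath i w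
        have h1 : (r' i * pathProd p (fun _ => 1) x i w * ↑(r' l)⁻¹ : R) =
            pathProd p (fun _ => 1) x' i w * (g⁻¹ : Rˣ) := by
          rw [← hval, ← hval', he, hwl, ← Units.val_mul, ← Units.val_mul, ← Units.val_mul,
            mul_inv_cancel_right]
        rw [h1]
        exact mul_mem_pathSpan h'.weight (by rw [hΓi']; exact (hU.1 hg).2)
          (Submodule.subset_span ⟨w, hwl, rfl⟩)
      | zero => rw [mul_zero, zero_mul]; exact Submodule.zero_mem _
      | add a b _ _ h1 h2 => rw [mul_add, add_mul]; exact Submodule.add_mem _ h1 h2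
      | smul o a _ h1 => rw [mul_smul_comm, smul_mul_assoc]; exact Submodule.smul_mem _ _ h1
    have h1 := key _ hz
    have h2 : (r' i * (↑(r' i)⁻¹ * z * r' l) * ↑(r' l)⁻¹ : R) = z := by
      rw [← mul_assoc, ← mul_assoc, Units.mul_inv, one_mul, mul_assoc, Units.mul_inv, mul_one]
    rwa [h2] at h1

end ArrowSystems

end UniqueLifting

end

noncomputable section

namespace UniqueLifting

open Finset

set_option linter.unusedSectionVars false

section Coordinates

variable {K A R : Type*} [Field K] [Ring A] [Algebra K A] [CommRing R] [Algebra K R]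
  {ι : Type*} [Fintype ι] [DecidableEq ι]

theorem coordinates_mul_mul (Φ : A ≃ₐ[K] (ι → K) × Matrix ι ι R) {e : ι → A}
    (he : ∀ i, Φ (e i) = (Pi.single i 1, Matrix.single i i 1)) (i l : ι) (a : A) :
    Φ (e i * a * e l) = (if i = l then Pi.single i ((Φ a).1 i) else 0,
      Matrix.single i l ((Φ a).2 i l)) := by
  rw [map_mul, map_mul, he, he]
  refine Prod.ext ?_ ?_
  · ext m
    split_ifs with hil
    · subst hil
      by_cases hm : m = i
      · subst hm; simp
      · simp [hm]
    · by_cases hm : m = i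
      · subst hm; simp [hil]
      · simp [hm]
  · simp [Matrix.single_mul_mul_single]

theorem single_mul_single_pow (i : ι) (y : R) (t : ℕ) :
    Matrix.single i i (1 : R) * Matrix.single i i y ^ t = Matrix.single i i (y ^ t) := by
  induction t with
  | zero => simp
  | succ t ih => rw [pow_succ, ← mul_assoc, ih, Matrix.single_mul_single_same, pow_succ]

end Coordinates

/-! ### The order in coordinates. -/

section Lattice

variable {O K A R : Type*} [CommRing O] [IsDomain O] [IsDiscreteValuationRing O]
  [Field K] [Algebra O K] [IsFractionRing O K] [Ring A] [Algebra K A] [Algebra O A]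
  [IsScalarTower O K A] [CommRing R] [Algebra K R] [Algebra O R] [IsScalarTower O K R]
  {p n κ c d : ℕ} [NeZero κ] {Λ : Subalgebra O A} {ε : ZMod κ → Λ} {X : ZMod κ → Fin (n + 1) → Λ}
  {w₀ : List (Fin (n + 1))} (h : IsCyclicOrder O p (n + 1) κ c d ε X w₀)
  (Φ : A ≃ₐ[K] (ZMod κ → K) × Matrix (ZMod κ) (ZMod κ) R)
  (hΦ : ∀ i, Φ (ε i) = (Pi.single i 1, Matrix.single i i 1))
  (hlt : ∀ j : Fin (n + 1), 0 < p ^ (j : ℕ) ∧ p ^ (j : ℕ) < κ)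

/-- The coordinates of the arrows. -/
def arrowCoord (X : ZMod κ → Fin (n + 1) → Λ) (p : ℕ) (i : ZMod κ) (j : Fin (n + 1)) : R :=
  (Φ (X i j)).2 i (i + (p ^ (j : ℕ) : ℕ))

local notation "𝔵" => arrowCoord Φ X p

include h hΦ hlt

/-- As 0 < p^j < κ, an arrow is strictly off-diagonal and has no one-dimensional component. -/
theorem coordinates_arrow (i : ZMod κ) (j : Fin (n + 1)) : Φ (X i j) =
    (0, Matrix.single i (i + (p ^ (j : ℕ) : ℕ)) (𝔵 i j)) := by
  have h1 : (X i j : A) = (ε i : A) * X i j * ε (i + (p ^ (j : ℕ) : ℕ)) := by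
    have h2 := h.idem_mul_arrow i j
    have h3 := h.arrow_mul_idem i j
    rw [← Subalgebra.coe_mul, ← Subalgebra.coe_mul, h2, h3]
  have hne : i ≠ i + (p ^ (j : ℕ) : ℕ) := by
    intro h0
    have h2 : ((p ^ (j : ℕ) : ℕ) : ZMod κ) = 0 := left_eq_add.1 h0
    rw [ZMod.natCast_eq_zero_iff] at h2
    exact absurd (Nat.le_of_dvd (hlt j).1 h2) (by have := (hlt j).2; omega)
  conv_lhs => rw [h1]
  rw [coordinates_mul_mul (e := fun i => (ε i : A)) Φ hΦ, if_neg hne, arrowCoord]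

theorem coordinates_path (i : ZMod κ) (w : List (Fin (n + 1))) :
    Φ (pathProd p ε X i w : Λ) = (if w = [] then Pi.single i 1 else 0,
      Matrix.single i (i + (wordWt p w : ℕ)) (pathProd p (fun _ => 1) 𝔵 i w)) := by
  induction w generalizing i with
  | nil => simp [pathProd, wordWt, hΦ]
  | cons j w ih =>
    rw [pathProd, Subalgebra.coe_mul, map_mul, ih, coordinates_arrow h Φ hΦ hlt]
    refine Prod.ext (by simp) ?_
    rw [Prod.snd_mul, Matrix.single_mul_single_same, wordWt_cons, pathProd]
    rw [Nat.cast_add, add_assoc]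

theorem coordinates_loop (i : ZMod κ) : Φ (pathProd p ε X i w₀ : Λ) =
    (0, Matrix.single i i (pathProd p (fun _ => 1) 𝔵 i w₀)) := by
  have hne : w₀ ≠ [] := by
    rintro rfl
    have := h.weight
    rw [wordWt_nil] at this
    exact NeZero.ne κ this.symm
  rw [coordinates_path h Φ hΦ hlt, if_neg hne, h.weight, ZMod.natCast_self, add_zero]

/-- The corner consists of polynomials in the loop, and the loop vanishes in the one-dimensional
factor. Hence the same o is the scalar coordinate and the constant term of the matrix entry; this is
how the blocks are glued. -/
theorem exists_diagonal {a : A} (ha : a ∈ Λ) (i : ZMod κ) : ∃ o : O,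
    (Φ a).1 i = algebraMap O K o ∧ ∃ s ∈ Algebra.adjoin O {pathProd p (fun _ => 1) 𝔵 i w₀},
      (Φ a).2 i i = algebraMap O R o + pathProd p (fun _ => 1) 𝔵 i w₀ * s := by
  obtain ⟨g, hg⟩ := h.loops i ⟨a, ha⟩
  set y := pathProd p (fun _ => 1) 𝔵 i w₀ with hy
  have h1 : Φ ((ε i : A) * a * ε i) = ∑ t ∈ range (c + 1),
      algebraMap O K (g t) • ((Pi.single i 1, Matrix.single i i 1) *
        ((0 : ZMod κ → K), Matrix.single i i y) ^ t) := by
    have h2 := congrArg (fun b : Λ => Φ b) hg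
    simp only [Subalgebra.coe_mul, AddSubmonoidClass.coe_finsetSum, map_sum] at h2
    rw [h2]
    refine sum_congr rfl fun t _ => ?_
    rw [SetLike.val_smul, ← algebraMap_smul K, map_smul, Subalgebra.coe_mul, map_mul, hΦ,
      SubmonoidClass.coe_pow, map_pow, coordinates_loop h Φ hΦ hlt]
  rw [coordinates_mul_mul (e := fun i => (ε i : A)) Φ hΦ, if_pos rfl, sum_range_succ'] at h1
  refine ⟨g 0, ?_, ∑ t ∈ range c, g (t + 1) • y ^ t, ?_, ?_⟩
  · have h2 := congrFun (congrArg Prod.fst h1) i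
    simpa [Prod.fst_sum, Algebra.smul_def] using h2
  · exact Subalgebra.sum_mem _ fun t _ => Subalgebra.smul_mem _
      (Subalgebra.pow_mem _ (Algebra.self_mem_adjoin_singleton O y) _) _
  · have h2 := congrFun (congrFun (congrArg Prod.snd h1) i) i
    rw [Prod.snd_add, Prod.snd_sum] at h2
    simp only [Prod.smul_snd, Prod.snd_mul, Prod.pow_snd, single_mul_single_pow, Matrix.smul_single,
      Matrix.add_apply, Matrix.sum_apply, Matrix.single_apply_same, pow_zero, mul_one] at h2
    rw [h2, add_comm, algebraMap_smul, ← Algebra.algebraMap_eq_smul_one, mul_sum]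
    congr 1
    refine sum_congr rfl fun t _ => ?_
    rw [algebraMap_smul, mul_smul_comm, pow_succ']

theorem mem_pathSpan_of_mem {a : A} (ha : a ∈ Λ) (i l : ZMod κ) :
    (Φ a).2 i l ∈ pathSpan O p 𝔵 i l := by
  let φ : Λ →ₗ[O] R :=
    { toFun := fun b => (Φ b).2 i l
      map_add' := fun b b' => by simp
      map_smul' := fun o b => by
        rw [SetLike.val_smul, ← algebraMap_smul K, map_smul, RingHom.id_apply, Prod.smul_snd,
          Matrix.smul_apply, algebraMap_smul] }
  have h1 := Submodule.mem_map_of_mem (f := φ) (h.paths i l ⟨a, ha⟩)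
  have h2 : φ (ε i * ⟨a, ha⟩ * ε l) = (Φ a).2 i l := by
    change (Φ ((ε i : A) * a * ε l)).2 i l = _
    rw [coordinates_mul_mul (e := fun i => (ε i : A)) Φ hΦ]
    exact Matrix.single_apply_same _ _ _
  rw [h2, Submodule.map_span] at h1
  refine Submodule.span_mono ?_ h1
  rintro _ ⟨_, ⟨w, hw, rfl⟩, rfl⟩
  refine ⟨w, hw, ?_⟩
  change (Φ (pathProd p ε X i w : Λ)).2 i l = _
  rw [coordinates_path h Φ hΦ hlt, hw]
  exact Matrix.single_apply_same _ _ _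

theorem symm_single_mem {i l : ZMod κ} (hil : i ≠ l) {z : R} (hz : z ∈ pathSpan O p 𝔵 i l) :
    Φ.symm (0, Matrix.single i l z) ∈ Λ := by
  induction hz using Submodule.span_induction with
  | mem r hr =>
    obtain ⟨w, hw, rfl⟩ := hr
    have hne : w ≠ [] := by
      rintro rfl
      exact hil (by simpa [wordWt] using hw)
    have h1 := coordinates_path h Φ hΦ hlt i w
    rw [if_neg hne, hw] at h1
    rw [← h1, AlgEquiv.symm_apply_apply]
    exact (pathProd p ε X i w).2
  | zero => rw [Matrix.single_zero, Prod.mk_zero_zero, map_zero]; exact Λ.zero_mem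
  | add a b _ _ h1 h2 =>
    have : ((0 : ZMod κ → K), Matrix.single i l (a + b)) =
        (0, Matrix.single i l a) + (0, Matrix.single i l b) := by
      rw [Matrix.single_add, Prod.mk_add_mk, add_zero]
    rw [this, map_add]
    exact Λ.add_mem h1 h2
  | smul o a _ h1 =>
    have : ((0 : ZMod κ → K), Matrix.single i l (o • a)) =
        algebraMap O K o • (0, Matrix.single i l a) := by
      rw [Prod.smul_mk, smul_zero, Matrix.smul_single, algebraMap_smul]
    rw [this, map_smul, algebraMap_smul]
    exact Λ.smul_mem h1 o

theorem symm_single_loop_mem (i : ZMod κ) {s : R}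
    (hs : s ∈ Algebra.adjoin O {pathProd p (fun _ => 1) 𝔵 i w₀}) :
    Φ.symm (0, Matrix.single i i (pathProd p (fun _ => 1) 𝔵 i w₀ * s)) ∈ Λ := by
  set y := pathProd p (fun _ => 1) 𝔵 i w₀ with hy
  have h0 : Φ.symm (0, Matrix.single i i y) ∈ Λ := by
    rw [hy, ← coordinates_loop h Φ hΦ hlt, AlgEquiv.symm_apply_apply]
    exact (pathProd p ε X i w₀).2
  have key : ∀ z, Φ.symm (0, Matrix.single i i z) ∈ Λ → Φ.symm (0, Matrix.single i i (z * s)) ∈ Λ := by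
    induction hs using Algebra.adjoin_induction with
    | mem a ha =>
      intro z hz
      rw [Set.mem_singleton_iff.1 ha]
      have h1 := Λ.mul_mem hz h0
      rwa [← map_mul, Prod.mk_mul_mk, Matrix.single_mul_single_same, mul_zero] at h1
    | algebraMap o =>
      intro z hz
      have h1 := Λ.smul_mem hz o
      rwa [← algebraMap_smul K, ← map_smul, Prod.smul_mk, smul_zero, Matrix.smul_single,
        algebraMap_smul, Algebra.smul_def, mul_comm] at h1
    | add a b _ _ h1 h2 =>
      intro z hz
      have h3 := Λ.add_mem (h1 z hz) (h2 z hz)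
      rwa [← map_add, Prod.mk_add_mk, ← Matrix.single_add, add_zero, ← mul_add] at h3
    | mul a b _ _ h1 h2 =>
      intro z hz
      rw [← mul_assoc]
      exact h2 _ (h1 z hz)
  exact key y h0

/-- An order in terms of coordinates. -/
theorem mem_iff_coordinates (a : A) : a ∈ Λ ↔
    (∀ i, ∃ o : O, (Φ a).1 i = algebraMap O K o ∧
      ∃ s ∈ Algebra.adjoin O {pathProd p (fun _ => 1) 𝔵 i w₀},
        (Φ a).2 i i = algebraMap O R o + pathProd p (fun _ => 1) 𝔵 i w₀ * s) ∧
    ∀ i l, i ≠ l → (Φ a).2 i l ∈ pathSpan O p 𝔵 i l := by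
  refine ⟨fun ha => ⟨exists_diagonal h Φ hΦ hlt ha, fun i l _ =>
    mem_pathSpan_of_mem h Φ hΦ hlt ha i l⟩, fun ⟨h1, h2⟩ => ?_⟩
  have hsum : ∑ i, (ε i : A) = 1 := by
    have := congrArg (Subalgebra.val Λ) h.idem_sum
    rwa [map_sum, map_one] at this
  have ha : a = ∑ i, ∑ l, (ε i : A) * a * ε l := by
    conv_lhs => rw [← one_mul a, ← mul_one (1 * a), ← hsum, sum_mul, sum_mul]
    exact sum_congr rfl fun i _ => mul_sum _ _ _
  rw [ha]
  refine Λ.sum_mem fun i _ => Λ.sum_mem fun l _ => ?_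
  rw [← Φ.symm_apply_apply ((ε i : A) * a * ε l),
    coordinates_mul_mul (e := fun i => (ε i : A)) Φ hΦ]
  split_ifs with hil
  · subst hil
    obtain ⟨o, ho, s, hs, he⟩ := h1 i
    have h3 : ((Pi.single i ((Φ a).1 i) : ZMod κ → K), Matrix.single i i ((Φ a).2 i i)) =
        algebraMap O K o • Φ (ε i) +
          (0, Matrix.single i i (pathProd p (fun _ => 1) 𝔵 i w₀ * s)) := by
      rw [hΦ, ho, he, Prod.smul_mk, Matrix.smul_single, Prod.mk_add_mk, ← Matrix.single_add,
        add_zero, ← Pi.single_smul, smul_eq_mul, mul_one, algebraMap_smul,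
        Algebra.algebraMap_eq_smul_one (A := K), Algebra.algebraMap_eq_smul_one (A := R)]
    rw [h3, map_add, map_smul, AlgEquiv.symm_apply_apply, algebraMap_smul]
    exact Λ.add_mem (Λ.smul_mem (ε i).2 _) (symm_single_loop_mem h Φ hΦ hlt i hs)
  · exact symm_single_mem h Φ hΦ hlt hil (h2 i l hil)

theorem symm_single_mem_iff (i : ZMod κ) (o : O) (r : R) :
    Φ.symm (Pi.single i (algebraMap O K o), Matrix.single i i r) ∈ Λ ↔
      ∃ s ∈ Algebra.adjoin O {pathProd p (fun _ => 1) 𝔵 i w₀},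
        r = algebraMap O R o + pathProd p (fun _ => 1) 𝔵 i w₀ * s := by
  rw [mem_iff_coordinates h Φ hΦ hlt, AlgEquiv.apply_symm_apply]
  constructor
  · rintro ⟨h1, -⟩
    obtain ⟨o', ho', s, hs, hr⟩ := h1 i
    simp only [Pi.single_eq_same, Matrix.single_apply_same] at ho' hr
    rw [IsFractionRing.injective O K ho']
    exact ⟨s, hs, hr⟩
  · rintro ⟨s, hs, hr⟩
    refine ⟨fun l => ?_, fun l m hlm => ?_⟩
    · by_cases hl : l = i
      · subst hl
        exact ⟨o, by simp, s, hs, by simpa using hr⟩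
      · refine ⟨0, by simp [hl], 0, Subalgebra.zero_mem _, ?_⟩
        simp [Matrix.single_apply_of_ne (h := fun h0 : i = l ∧ i = l => hl h0.1.symm)]
    · have h0 : Matrix.single i i r l m = 0 :=
        Matrix.single_apply_of_ne (h := fun h0 : i = l ∧ i = m => hlm (h0.1.symm.trans h0.2)) ..
      change Matrix.single i i r l m ∈ _
      rw [h0]
      exact Submodule.zero_mem _

/-- The algebra generated by the loop is the image of Λ under the diagonal entry at i, and so
inherits finiteness and fullness. -/
theorem isFullOrder_adjoin (hΛ : IsFullOrder O K Λ) (i : ZMod κ) :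
    IsFullOrder O K (Algebra.adjoin O {pathProd p (fun _ => 1) 𝔵 i w₀}) := by
  set y := pathProd p (fun _ => 1) 𝔵 i w₀ with hy
  have hdiag : ∀ a ∈ Λ, (Φ a).2 i i ∈ Algebra.adjoin O {y} := by
    intro a ha
    obtain ⟨o, -, s, hs, he⟩ := exists_diagonal h Φ hΦ hlt ha i
    rw [he]
    exact Subalgebra.add_mem _ (Subalgebra.algebraMap_mem _ _)
      (Subalgebra.mul_mem _ (Algebra.self_mem_adjoin_singleton O y) hs)
  constructor
  · let φ : A →ₗ[O] R :=
      { toFun := fun b => (Φ b).2 i i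
        map_add' := fun b b' => by simp
        map_smul' := fun o b => by
          rw [← algebraMap_smul K, map_smul, RingHom.id_apply, Prod.smul_snd,
            Matrix.smul_apply, algebraMap_smul] }
    have h1 : (Algebra.adjoin O {y}).toSubmodule = Λ.toSubmodule.map φ := by
      apply le_antisymm
      · intro r hr
        obtain ⟨o, s, hs, rfl⟩ := exists_of_mem_adjoin hr
        refine ⟨_, (symm_single_mem_iff h Φ hΦ hlt i o _).2 ⟨s, hs, rfl⟩, ?_⟩
        change (Φ (Φ.symm _)).2 i i = _
        simp only [AlgEquiv.apply_symm_apply, Matrix.single_apply_same]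
        rw [← hy]
      · rintro _ ⟨a, ha, rfl⟩
        exact hdiag a ha
    rw [h1]
    exact hΛ.fg.map φ
  · rw [eq_top_iff]
    intro r _
    have h1 : Φ.symm (0, Matrix.single i i r) ∈ Submodule.span K (Λ : Set A) := by
      rw [hΛ.span_eq_top]; trivial
    have h2 : ∀ a ∈ Submodule.span K (Λ : Set A),
        (Φ a).2 i i ∈ Submodule.span K (Algebra.adjoin O {y} : Set R) := by
      intro a ha
      induction ha using Submodule.span_induction with
      | mem a ha => exact Submodule.subset_span (hdiag a ha)
      | zero => simp
      | add a b _ _ h1 h2 => rw [map_add]; exact Submodule.add_mem _ h1 h2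
      | smul c a _ h1 => rw [map_smul]; exact Submodule.smul_mem _ c h1
    have h3 := h2 _ h1
    simpa only [AlgEquiv.apply_symm_apply, Matrix.single_apply_same] using h3

/-- Self-duality is tested on elements supported at position i. Those without scalar part give the
duality between O[y] and yO[y]. Those with scalar part o and zero matrix part lie in Λ exactly when
u_i o is integral, that is, when p^(n+1) divides o. -/
theorem isLoop_of_dual (hΛ : IsFullOrder O K Λ) (hp : (p : O) ≠ 0) {u : ZMod κ → K}
    {T : R →ₗ[K] K} (hu : ∀ i, ∃ v : Oˣ, u i * (p : K) ^ (n + 1) = algebraMap O K v)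
    (hdual : ∀ a, a ∈ Λ ↔ ∀ b ∈ Λ, ∃ o : O,
      ∑ i, u i * (Φ (a * b)).1 i + T (Φ (a * b)).2.trace = algebraMap O K o) (i : ZMod κ) :
    IsLoop ((p : O) ^ (n + 1)) T (pathProd p (fun _ => 1) 𝔵 i w₀) := by
  have hform : ∀ (k : K) (r : R) (b : A),
      ∑ l, u l * (Φ (Φ.symm (Pi.single i k, Matrix.single i i r) * b)).1 l +
        T (Φ (Φ.symm (Pi.single i k, Matrix.single i i r) * b)).2.trace =
      u i * (k * (Φ b).1 i) + T (r * (Φ b).2 i i) := by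
    intro k r b
    rw [map_mul, AlgEquiv.apply_symm_apply]
    congr 1
    · rw [sum_eq_single i]
      · simp
      · intro l _ hl; simp [hl]
      · simp
    · congr 1
      rw [Prod.snd_mul, Matrix.trace, sum_eq_single i]
      · rw [Matrix.diag_apply, Matrix.single_mul_apply_same]
      · intro l _ hl
        rw [Matrix.diag_apply, Matrix.single_mul_apply_of_ne (h := hl)]
      · simp
  refine ⟨isFullOrder_adjoin h Φ hΦ hlt hΛ i, fun r => ?_, fun o => ?_⟩
  · have h1 := symm_single_mem_iff h Φ hΦ hlt i 0 r
    simp only [map_zero, zero_add] at h1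
    rw [← h1, hdual]
    simp only [hform, zero_mul, mul_zero, zero_add]
    constructor
    · intro h2 g hg
      obtain ⟨o, s, hs, rfl⟩ := exists_of_mem_adjoin hg
      have h3 := h2 _ ((symm_single_mem_iff h Φ hΦ hlt i o _).2 ⟨s, hs, rfl⟩)
      simpa only [AlgEquiv.apply_symm_apply, Matrix.single_apply_same] using h3
    · intro h2 b hb
      obtain ⟨o, -, s, hs, he⟩ := exists_diagonal h Φ hΦ hlt hb i
      rw [he]
      exact h2 _ (Subalgebra.add_mem _ (Subalgebra.algebraMap_mem _ _)
        (Subalgebra.mul_mem _ (Algebra.self_mem_adjoin_singleton O _) hs))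
  · have h1 : (∃ s ∈ Algebra.adjoin O {pathProd p (fun _ => 1) 𝔵 i w₀},
        algebraMap O R o = pathProd p (fun _ => 1) 𝔵 i w₀ * s) ↔
        Φ.symm (Pi.single i (algebraMap O K o), Matrix.single i i 0) ∈ Λ := by
      rw [symm_single_mem_iff h Φ hΦ hlt]
      constructor
      · rintro ⟨s, hs, he⟩
        exact ⟨-s, Subalgebra.neg_mem _ hs, by rw [he]; ring⟩
      · rintro ⟨s, hs, he⟩
        exact ⟨-s, Subalgebra.neg_mem _ hs, by linear_combination -he⟩
    obtain ⟨v, hv⟩ := hu i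
    have hpK : (p : K) ≠ 0 := by
      rw [← map_natCast (algebraMap O K)]
      exact (FaithfulSMul.algebraMap_eq_zero_iff O K).not.2 hp
    rw [h1, hdual]
    simp only [hform, zero_mul, map_zero, add_zero]
    constructor
    · intro h2
      obtain ⟨o', ho'⟩ := h2 1 Λ.one_mem
      rw [map_one, Prod.fst_one, Pi.one_apply, mul_one] at ho'
      refine ⟨↑v⁻¹ * o', ?_⟩
      apply IsFractionRing.injective O K
      rw [map_mul, map_pow, map_natCast, map_mul, ← ho']
      have h3 : algebraMap O K ↑v⁻¹ * algebraMap O K v = 1 := by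
        rw [← map_mul, Units.inv_mul, map_one]
      rw [← hv] at h3
      linear_combination (-algebraMap O K o) * h3
    · rintro ⟨o', rfl⟩ b hb
      obtain ⟨o, ho, -⟩ := exists_diagonal h Φ hΦ hlt hb i
      refine ⟨v * (o' * o), ?_⟩
      rw [ho, map_mul, map_mul, map_mul, map_pow, map_natCast, ← hv]
      ring

/-- An order which is self-dual for a form gives an arrow system. -/
theorem isArrowSystem_of_dual [Nontrivial R] [FiniteDimensional K R]
    (hR : Module.finrank K R ≤ 2) (hq : p ^ (n + 1) = c * κ + 1)
    (hΛ : IsFullOrder O K Λ) (hp : (p : O) ≠ 0) {u : ZMod κ → K}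
    {T : R →ₗ[K] K} (hu : ∀ i, ∃ v : Oˣ, u i * (p : K) ^ (n + 1) = algebraMap O K v)
    (hdual : ∀ a, a ∈ Λ ↔ ∀ b ∈ Λ, ∃ o : O,
      ∑ i, u i * (Φ (a * b)).1 i + T (Φ (a * b)).2.trace = algebraMap O K o) :
    IsArrowSystem O p d T 𝔵 w₀ := by
  have hloop := isLoop_of_dual h Φ hΦ hlt hΛ hp hu hdual
  refine ⟨hloop, h.weight, h.count, fun i j => ?_⟩
  obtain ⟨b, hb⟩ := h.pow i j
  set l : ZMod κ := i + (p ^ ((j + 1 : Fin (n + 1)) : ℕ) : ℕ) with hl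
  -- Repeating a letter p times has the weight of the next letter. For the last letter that weight
  -- is q = cκ + 1 ≡ 1, so the letters are cyclic.
  have hwt : i + ((wordWt p (List.replicate p j) : ℕ) : ZMod κ) = l := by
    rw [hl, wordWt_replicate, ← pow_succ']
    congr 1
    by_cases hj : j = Fin.last n
    · subst hj
      rw [Fin.last_add_one, Fin.val_zero, pow_zero, Fin.val_last, hq]
      simp
    · rw [Fin.val_add_one_of_lt (Fin.lt_last_iff_ne_last.2 hj)]
  have h1 : pathProd p (fun _ => 1) 𝔵 i (List.replicate p j) = (p : R) * (Φ b).2 i l := by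
    have h2 := congrArg (fun b : Λ => (Φ b).2 i l) hb
    simp only [coordinates_path h Φ hΦ hlt, hwt, Matrix.single_apply_same, SetLike.val_smul] at h2
    rw [h2, ← algebraMap_smul K, map_smul, Prod.smul_snd, Matrix.smul_apply, map_natCast,
      Nat.cast_smul_eq_nsmul, nsmul_eq_mul]
  -- The quotient by p lies in the Peirce component of the next arrow and is therefore left
  -- divisible by it.
  obtain ⟨b', hb'⟩ := h.factor i (j + 1) b
  refine ⟨(Φ b').2 l l, ?_, ?_⟩
  · obtain ⟨o, -, s, hs, he⟩ := exists_diagonal h Φ hΦ hlt b'.2 l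
    rw [((hloop i).eq hR (hloop l) (pow_ne_zero _ hp) 1 (by simp)).1, he]
    exact Subalgebra.add_mem _ (Subalgebra.algebraMap_mem _ _)
      (Subalgebra.mul_mem _ (Algebra.self_mem_adjoin_singleton O _) hs)
  · rw [h1]
    congr 1
    have h2 := congrArg (fun b : Λ => (Φ b).2 i l) hb'
    simp only [Subalgebra.coe_mul] at h2
    rw [coordinates_mul_mul (e := fun i => (ε i : A)) Φ hΦ, ← hl, map_mul,
      coordinates_arrow h Φ hΦ hlt, ← hl, Prod.snd_mul, Matrix.single_mul_apply_same] at h2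
    rw [← h2]
    exact (Matrix.single_apply_same ..).symm

end Lattice

end UniqueLifting

end

noncomputable section

namespace UniqueLifting

open Finset

set_option linter.unusedSectionVars false

/-! ### The ambient algebra of a cyclic order. -/

section Orders

variable {O K A : Type*} [CommRing O] [IsDomain O] [IsDiscreteValuationRing O]
  [Field K] [Algebra O K] [IsFractionRing O K] [Ring A] [Algebra K A] [Algebra O A]
  [IsScalarTower O K A] {Λ : Subalgebra O A}

theorem IsFullOrder.exists_coeff (hΛ : IsFullOrder O K Λ) {e e' : A} {m : ℕ} {v : ℕ → A}
    (h : ∀ a ∈ Λ, ∃ g : ℕ → O, e * a * e' = ∑ t ∈ range m, g t • v t) (a : A) :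
    ∃ g : ℕ → K, e * a * e' = ∑ t ∈ range m, g t • v t := by
  have ha : a ∈ Submodule.span K (Λ : Set A) := by rw [hΛ.span_eq_top]; trivial
  induction ha using Submodule.span_induction with
  | mem a ha =>
    obtain ⟨g, hg⟩ := h a ha
    exact ⟨fun t => algebraMap O K (g t), by simp only [algebraMap_smul, hg]⟩
  | zero => exact ⟨0, by simp⟩
  | add a b _ _ h1 h2 =>
    obtain ⟨g, hg⟩ := h1
    obtain ⟨g', hg'⟩ := h2
    refine ⟨g + g', ?_⟩
    rw [mul_add, add_mul, hg, hg', ← sum_add_distrib]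
    exact sum_congr rfl fun t _ => (add_smul _ _ _).symm
  | smul k a _ h1 =>
    obtain ⟨g, hg⟩ := h1
    refine ⟨k • g, ?_⟩
    rw [mul_smul_comm, smul_mul_assoc, hg, smul_sum]
    exact sum_congr rfl fun t _ => smul_smul _ _ _

theorem finrank_peirce_le [FiniteDimensional K A] {e e' : A} {m : ℕ} {v : ℕ → A}
    (h : ∀ a, ∃ g : ℕ → K, e * a * e' = ∑ t ∈ range m, g t • v t) :
    Module.finrank K (peirce K e e') ≤ m := by
  have h1 : peirce K e e' ≤ Submodule.span K (Set.range fun t : Fin m => v t) := by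
    intro x hx
    obtain ⟨a, rfl⟩ := mem_peirce.1 hx
    obtain ⟨g, hg⟩ := h a
    rw [hg, Finset.sum_range]
    exact Submodule.sum_mem _ fun t _ => Submodule.smul_mem _ _ (Submodule.subset_span ⟨t, rfl⟩)
  refine (Submodule.finrank_mono h1).trans ((finrank_range_le_card _).trans ?_)
  simp

variable [FiniteDimensional K A] [IsSemisimpleRing A]
  {Z : Type*} [CommRing Z] [Algebra K Z] [FiniteDimensional K Z]
  {ζ : Z →ₐ[K] A} (hζ : IsCentre ζ) {p f κ c d : ℕ} [NeZero κ]
  {ε : ZMod κ → Λ} {X : ZMod κ → Fin f → Λ} {w₀ : List (Fin f)}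

include hζ in
/-- The ambient algebra of a cyclic order in coordinates. -/
theorem IsCyclicOrder.exists_coordinates (h : IsCyclicOrder O p f κ c d ε X w₀)
    (hΛ : IsFullOrder O K Λ) (hκ : 2 ≤ κ) (hA : Module.finrank K A = κ * (c * κ + 1))
    (hZ : κ + c ≤ Module.finrank K Z) :
    ∃ (η : Z) (π : ZMod κ → Z), η * η = η ∧ η + ∑ i, π i = 1 ∧ idealRank K η = c ∧
      (∀ i, IsLinear K (ζ (π i))) ∧
      ∃ Φ : A ≃ₐ[K] (ZMod κ → K) × Matrix (ZMod κ) (ZMod κ) (Z ⧸ Ideal.span {1 - η}),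
        (∀ i, Φ (ε i) = (Pi.single i 1, Matrix.single i i 1)) ∧ Φ (ζ η) = (0, 1) ∧
        ∀ z, (Φ (ζ z)).2 = Matrix.scalar _ (Ideal.Quotient.mk _ z) := by
  set e : ZMod κ → A := fun i => (ε i : A) with he
  have hmul : ∀ i j, e i * e j = if i = j then e i else 0 := by
    intro i j
    have := congrArg (Subalgebra.val Λ) (h.idem_mul i j)
    rw [map_mul] at this
    split_ifs with hij
    · rwa [if_pos hij] at this
    · rwa [if_neg hij, map_zero] at this
  have hsum : ∑ i, e i = 1 := by
    have := congrArg (Subalgebra.val Λ) h.idem_sum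
    rwa [map_sum, map_one] at this
  have hid : ∀ i, e i * e i = e i := fun i => by rw [hmul, if_pos rfl]
  set y : ZMod κ → A := fun i => (pathProd p ε X i w₀ : Λ) with hy
  have hloop : ∀ i a, ∃ g : ℕ → K, e i * a * e i = ∑ t ∈ range (c + 1), g t • (e i * y i ^ t) := by
    intro i
    refine hΛ.exists_coeff fun a ha => ?_
    obtain ⟨g, hg⟩ := h.loops i ⟨a, ha⟩
    refine ⟨g, ?_⟩
    have := congrArg (Subalgebra.val Λ) hg
    rw [map_sum] at this
    exact this
  have hey : ∀ i, Commute (e i) (y i) := by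
    intro i
    have h0 : ∀ i, ε i * ε i = ε i := fun i => by rw [h.idem_mul, if_pos rfl]
    have h1 := idem_mul_pathProd (p := p) h0 h.idem_mul_arrow i w₀
    have h2 := pathProd_mul_idem (X := X) (p := p) h0 i w₀
    rw [h.weight, ZMod.natCast_self, add_zero] at h2
    have h3 := h1.trans h2.symm
    exact congrArg (Subalgebra.val Λ) h3
  -- A corner spanned by the powers of a single loop is commutative.
  have hcomm : ∀ i x x', (e i * x * e i) * (e i * x' * e i) =
      (e i * x' * e i) * (e i * x * e i) := by
    intro i x x'
    obtain ⟨g, hg⟩ := hloop i x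
    obtain ⟨g', hg'⟩ := hloop i x'
    rw [hg, hg']
    refine Commute.sum_left _ _ _ fun s _ => Commute.sum_right _ _ _ fun t _ =>
      (Commute.smul_right (Commute.smul_left ?_ _) _)
    refine Commute.mul_left (Commute.mul_right (Commute.refl _) ((hey i).pow_right t)) ?_
    exact Commute.mul_right ((hey i).symm.pow_left s) (Commute.pow_pow (Commute.refl _) s t)
  have hle : ∀ i j, Module.finrank K (peirce K (e i) (e j)) ≤ c + if i = j then 1 else 0 := by
    intro i j
    split_ifs with hij
    · subst hij
      exact finrank_peirce_le (hloop i)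
    · obtain ⟨v, hv⟩ := h.generators i j hij
      refine finrank_peirce_le (v := fun t => (v t : A)) (hΛ.exists_coeff fun a ha => ?_)
      obtain ⟨g, hg⟩ := hv ⟨a, ha⟩
      refine ⟨g, ?_⟩
      have := congrArg (Subalgebra.val Λ) hg
      rw [map_sum] at this
      exact this
  -- The bounds add up to κ · κc + κ = κ(cκ + 1), the dimension of A, so all of them are equalities.
  have hdim := finrank_peirce_eq hsum hle (by
    rw [hA]
    simp only [sum_add_distrib, sum_const, card_univ, ZMod.card, sum_ite_eq, mem_univ, if_true,
      smul_eq_mul]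
    ring)
  have hc : ∀ i x, ∃ z : A, (∀ a, a * z = z * a) ∧ e i * x * e i = z * e i := by
    intro i x
    obtain ⟨g, hg⟩ := exists_isCentralSupport (e i)
    exact hg.exists_central (hid i) (hcomm i) x
  obtain ⟨η, π, hη, hπ, hηπ, hηsum, hrη, hrπ, heπ, hsupp⟩ :=
    exists_blocks hζ hκ hmul hsum hc hdim hZ
  obtain ⟨Φ, h1, h2, h3⟩ := UniqueLifting.exists_coordinates hζ hmul hsum hc hA hη hπ hηπ hηsum
    hrη hrπ heπ hsupp
  refine ⟨η, π, hη, hηsum, hrη, fun i a => ⟨(Φ a).1 i, ?_⟩, Φ, h1, ?_, h3⟩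
  · apply Φ.injective
    rw [map_mul, map_smul, h2]
    refine Prod.ext ?_ (by simp)
    ext l
    by_cases hl : l = i
    · subst hl; simp
    · simp [hl]
  · have h4 : ζ η = 1 - ∑ i, ζ (π i) := by
      rw [← map_sum, ← map_one ζ, ← map_sub, ← hηsum, add_sub_cancel_right]
    have h5 : Φ (ζ η) = 1 - ∑ i, Φ (ζ (π i)) := by
      rw [h4]; simp only [map_sub, map_one, map_sum]
    rw [h5]
    simp only [h2]
    refine Prod.ext ?_ ?_
    · rw [Prod.fst_sub, Prod.fst_sum, Prod.fst_one]
      have := Finset.univ_sum_single (1 : ZMod κ → K)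
      simp only [Pi.one_apply] at this
      rw [this, sub_self]
    · rw [Prod.snd_sub, Prod.snd_sum]
      simp

/-- The central idempotent of the nonlinear part is determined by the algebra. -/
theorem eq_of_linear {ι : Type*} [Fintype ι] [DecidableEq ι] [Nontrivial ι] {η η' : Z}
    {π π' : ι → Z} (hη : η + ∑ i, π i = 1) (hη' : η' + ∑ i, π' i = 1)
    (hπ : ∀ i, IsLinear K (ζ (π i))) (hπ' : ∀ i, IsLinear K (ζ (π' i)))
    (hlin : ∀ z, IsLinear K (ζ z) → η * z = 0) (hlin' : ∀ z, IsLinear K (ζ z) → η' * z = 0) :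
    η = η' := by
  have h1 : η * η' = η := by
    have : η' = 1 - ∑ i, π' i := by rw [← hη']; ring
    rw [this, mul_sub, mul_one, mul_sum, sum_eq_zero fun i _ => hlin _ (hπ' i), sub_zero]
  have h2 : η' * η = η' := by
    have : η = 1 - ∑ i, π i := by rw [← hη]; ring
    rw [this, mul_sub, mul_one, mul_sum, sum_eq_zero fun i _ => hlin' _ (hπ i), sub_zero]
  rw [← h1, mul_comm, h2]

theorem mul_eq_zero_of_isLinear {ι : Type*} [Fintype ι] [DecidableEq ι] [Nontrivial ι] {η : Z}
    (hη : η * η = η) (Φ : A ≃ₐ[K] (ι → K) × Matrix ι ι (Z ⧸ Ideal.span {1 - η}))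
    (hΦ : ∀ z, (Φ (ζ z)).2 = Matrix.scalar _ (Ideal.Quotient.mk _ z)) {z : Z}
    (hz : IsLinear K (ζ z)) : η * z = 0 := by
  have h1 := mul_eq_zero_of_linear (ρ := Ideal.Quotient.mkₐ K (Ideal.span {1 - η})) Φ hΦ hz
  rw [Ideal.Quotient.mkₐ_eq_mk, Ideal.Quotient.eq_zero_iff_mem, Ideal.mem_span_singleton'] at h1
  obtain ⟨a, rfl⟩ := h1
  linear_combination (-a) * hη

end Orders

end UniqueLifting

end

noncomputable section

namespace UniqueLifting

open Finset

set_option linter.unusedSectionVars false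

/-! ### Conjugacy of self-dual cyclic orders. -/

section Uniqueness

variable {O K A : Type*} [CommRing O] [IsDomain O] [IsDiscreteValuationRing O]
  [Field K] [Algebra O K] [IsFractionRing O K] [Ring A] [Algebra K A] [Algebra O A]
  [IsScalarTower O K A]

theorem exists_conj_of_frame {ι R : Type*} [Fintype ι] [DecidableEq ι] [CommRing R] [Algebra K R]
    (Φ : A ≃ₐ[K] (ι → K) × Matrix ι ι R) (r : ι → Rˣ) : ∃ D : Aˣ, ∀ a,
      (∀ i, (Φ (D * a * (D⁻¹ : Aˣ))).1 i = (Φ a).1 i) ∧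
      ∀ i l, (Φ (D * a * (D⁻¹ : Aˣ))).2 i l = r i * (Φ a).2 i l * ↑(r l)⁻¹ := by
  let D : Aˣ :=
    { val := Φ.symm (1, Matrix.diagonal fun i => (r i : R))
      inv := Φ.symm (1, Matrix.diagonal fun i => (↑(r i)⁻¹ : R))
      val_inv := by
        rw [← map_mul, Prod.mk_mul_mk, Matrix.diagonal_mul_diagonal]
        simp only [Units.mul_inv, mul_one, Matrix.diagonal_one]
        exact map_one _
      inv_val := by
        rw [← map_mul, Prod.mk_mul_mk, Matrix.diagonal_mul_diagonal]
        simp only [Units.inv_mul, mul_one, Matrix.diagonal_one]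
        exact map_one _ }
  have h1 : Φ (D : A) = (1, Matrix.diagonal fun i => (r i : R)) := Φ.apply_symm_apply _
  have h2 : Φ (D⁻¹ : Aˣ) = (1, Matrix.diagonal fun i => (↑(r i)⁻¹ : R)) := Φ.apply_symm_apply _
  refine ⟨D, fun a => ⟨fun i => ?_, fun i l => ?_⟩⟩
  · rw [map_mul, map_mul, h1, h2]; simp
  · rw [map_mul, map_mul, h1, h2, Prod.snd_mul, Prod.snd_mul, Matrix.mul_diagonal,
      Matrix.diagonal_mul]

variable [FiniteDimensional K A] [IsSemisimpleRing A]
  {Z : Type*} [CommRing Z] [Algebra K Z] [FiniteDimensional K Z] [Algebra O Z]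
  [IsScalarTower O K Z] {ζ : Z →ₐ[K] A} (hζ : IsCentre ζ) {p n κ c d : ℕ} [Fact p.Prime] [NeZero κ]
  {Λ Λ' : Subalgebra O A} {ε : ZMod κ → Λ} {X : ZMod κ → Fin (n + 1) → Λ} {w₀ : List (Fin (n + 1))}
  {ε' : ZMod κ → Λ'} {X' : ZMod κ → Fin (n + 1) → Λ'} {w₀' : List (Fin (n + 1))}

include hζ in
/-- Two self-dual cyclic orders are conjugate. -/
theorem IsCyclicOrder.conjUpToLinear (h : IsCyclicOrder O p (n + 1) κ c d ε X w₀)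
    (h' : IsCyclicOrder O p (n + 1) κ c d ε' X' w₀') (hΛ : IsFullOrder O K Λ)
    (hΛ' : IsFullOrder O K Λ') (hκ : 2 ≤ κ) (hA : Module.finrank K A = κ * (c * κ + 1))
    (hZ : κ + c ≤ Module.finrank K Z) (hp0 : (p : O) ≠ 0) (hq : p ^ (n + 1) = c * κ + 1)
    (hc : c = 1 ∧ p = 2 ∨ c = 2 ∧ p ≠ 2) (hcd : c * d = p - 1) {υ υ' : Z}
    (hs : Nonempty (Splitting K A))
    (hval : ∀ χ : Z →ₐ[K] K, ∃ v : Oˣ, χ υ * (p : K) ^ (n + 1) = algebraMap O K v)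
    (hval' : ∀ χ : Z →ₐ[K] K, ∃ v : Oˣ, χ υ' * (p : K) ^ (n + 1) = algebraMap O K v)
    (hdual : ∀ a, a ∈ Λ ↔ ∀ b ∈ Λ, ∃ o : O, reducedTrace K (ζ υ * (a * b)) =
      algebraMap K (AlgebraicClosure K) (algebraMap O K o))
    (hdual' : ∀ a, a ∈ Λ' ↔ ∀ b ∈ Λ', ∃ o : O, reducedTrace K (ζ υ' * (a * b)) =
      algebraMap K (AlgebraicClosure K) (algebraMap O K o))
    (hw : ∀ η, η * η = η → idealRank K η = c → (∀ z, IsLinear K (ζ z) → η * z = 0) →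
      ∃ w : Oˣ, η * υ' = (w : O) • (η * υ)) :
    ConjUpToLinear O K Λ Λ' := by
  have : Fact (1 < κ) := ⟨hκ⟩
  obtain ⟨η, π, hη, hsum, hrank, hlin, Φ, hΦ1, hΦ2, hΦ3⟩ := h.exists_coordinates hζ hΛ hκ hA hZ
  obtain ⟨η', π', hη', hsum', hrank', hlin', Φ', hΦ1', hΦ2', hΦ3'⟩ :=
    h'.exists_coordinates hζ hΛ' hκ hA hZ
  have hl := fun z (hz : IsLinear K (ζ z)) => mul_eq_zero_of_isLinear hη Φ hΦ3 hz
  have hl' := fun z (hz : IsLinear K (ζ z)) => mul_eq_zero_of_isLinear hη' Φ' hΦ3' hz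
  -- The complement of the matrix block consists of linear components, all annihilated by η and by
  -- η'. So both orders live over the same block and the same R.
  obtain rfl : η = η' := eq_of_linear hsum hsum' hlin hlin' hl hl'
  set R := Z ⧸ Ideal.span {1 - η} with hRdef
  let ρ : Z →ₐ[K] R := Ideal.Quotient.mkₐ K (Ideal.span {1 - η})
  have hρ : Function.Surjective ρ := Ideal.Quotient.mkₐ_surjective K _
  have hfin : Module.finrank K R = c := (finrank_quotient_eq_idealRank hη).trans hrank
  have hc0 : 0 < c := by omega
  have hnt : Nontrivial R := Module.nontrivial_of_finrank_pos (R := K) (by omega)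
  have hp2 := (Fact.out : p.Prime).two_le
  have hd : 0 < d := Nat.pos_of_ne_zero fun h0 => by rw [h0, mul_zero] at hcd; omega
  have hlt : ∀ j : Fin (n + 1), 0 < p ^ (j : ℕ) ∧ p ^ (j : ℕ) < κ := fun j =>
    ⟨pow_pos (by omega) _, pow_lt_of_two_le hq hc hκ j.2⟩
  let T : Z → R →ₗ[K] K := fun υ => (Algebra.trace K R).comp (LinearMap.mulLeft K (ρ υ))
  have hform : ∀ (Ψ : A ≃ₐ[K] (ZMod κ → K) × Matrix (ZMod κ) (ZMod κ) R),
      (∀ z, (Ψ (ζ z)).2 = Matrix.scalar _ (ρ z)) → ∀ υ a, reducedTrace K (ζ υ * a) =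
        algebraMap K _ (∑ i, (Ψ (ζ υ)).1 i * (Ψ a).1 i + T υ (Ψ a).2.trace) := by
    intro Ψ hΨ υ a
    rw [reducedTrace_eq hs Ψ, map_mul, Prod.fst_mul, Prod.snd_mul, hΨ]
    congr 2
    change _ = Algebra.trace K R (ρ υ * (Ψ a).2.trace)
    rw [Matrix.scalar_apply, ← Matrix.smul_one_eq_diagonal, smul_mul_assoc, one_mul,
      Matrix.trace_smul, smul_eq_mul]
  have hdual2 : ∀ (Ψ : A ≃ₐ[K] (ZMod κ → K) × Matrix (ZMod κ) (ZMod κ) R),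
      (∀ z, (Ψ (ζ z)).2 = Matrix.scalar _ (ρ z)) → ∀ (υ : Z) (Λ : Subalgebra O A),
      (∀ a, a ∈ Λ ↔ ∀ b ∈ Λ, ∃ o : O, reducedTrace K (ζ υ * (a * b)) =
        algebraMap K (AlgebraicClosure K) (algebraMap O K o)) →
      ∀ a, a ∈ Λ ↔ ∀ b ∈ Λ, ∃ o : O, ∑ i, (Ψ (ζ υ)).1 i * (Ψ (a * b)).1 i +
        T υ (Ψ (a * b)).2.trace = algebraMap O K o := by
    intro Ψ hΨ υ Λ hΛ a
    rw [hΛ]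
    simp only [hform Ψ hΨ, (algebraMap K (AlgebraicClosure K)).injective.eq_iff]
  have hu : ∀ (Ψ : A ≃ₐ[K] (ZMod κ → K) × Matrix (ZMod κ) (ZMod κ) R) (υ : Z),
      (∀ χ : Z →ₐ[K] K, ∃ v : Oˣ, χ υ * (p : K) ^ (n + 1) = algebraMap O K v) →
      ∀ i, ∃ v : Oˣ, (Ψ (ζ υ)).1 i * (p : K) ^ (n + 1) = algebraMap O K v := by
    intro Ψ υ hυ i
    exact hυ (((Pi.evalAlgHom K (fun _ : ZMod κ => K) i).comp ((AlgHom.fst K (ZMod κ → K) (Matrix (ZMod κ) (ZMod κ) R)).comp Ψ.toAlgHom)).comp ζ)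
  have hR2 : Module.finrank K R ≤ 2 := by omega
  have S := isArrowSystem_of_dual h Φ hΦ1 hlt hR2 hq hΛ hp0 (hu Φ υ hval)
    (hdual2 Φ hΦ3 υ Λ hdual)
  have S' := isArrowSystem_of_dual h' Φ' hΦ1' hlt hR2 hq hΛ' hp0 (hu Φ' υ' hval')
    (hdual2 Φ' hΦ3' υ' Λ' hdual')
  obtain ⟨w, hw⟩ := hw η hη hrank hl
  have hρη : ρ η = 1 := by
    refine (Ideal.Quotient.mk_eq_mk_iff_sub_mem _ _).2 ?_
    rw [Ideal.mem_span_singleton']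
    exact ⟨-1, by ring⟩
  have hρw : ρ υ' = (w : O) • ρ υ := by
    have h1 := congrArg ρ hw
    rw [← algebraMap_smul K (w : O), map_smul, map_mul, map_mul, hρη, one_mul, one_mul,
      algebraMap_smul] at h1
    exact h1
  obtain ⟨hdiag, r, hr⟩ := S.exists_frame hp0 hR2 (by rw [hfin]; omega) hd S' w (by
    intro r
    change Algebra.trace K R (ρ υ' * r) = (w : O) • Algebra.trace K R (ρ υ * r)
    rw [hρw, smul_mul_assoc, ← algebraMap_smul K (w : O), map_smul, algebraMap_smul])
  -- The pair τ, y carries the coordinates of Λ to those of Λ', with τ accounting for the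
  -- one-dimensional factors. The diagonal unit D then realises the change of frame.
  obtain ⟨τ, y, hτ, hτ'⟩ := exists_conj_coordinates hζ hρ Φ Φ' hΦ3 hΦ3' hΦ2 hΦ2'
  obtain ⟨D, hD⟩ := exists_conj_of_frame Φ' r
  refine ⟨τ, hτ', D * y, ?_⟩
  have hmem : ∀ a, (↑(D * y) * τ a * ↑(D * y)⁻¹ : A) ∈ Λ' ↔ a ∈ Λ := by
    intro a
    have h1 : (↑(D * y) * τ a * ↑(D * y)⁻¹ : A) = D * (y * τ a * (y⁻¹ : Aˣ)) * (D⁻¹ : Aˣ) := by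
      rw [mul_inv_rev, Units.val_mul, Units.val_mul]
      simp only [mul_assoc]
    obtain ⟨h2, h3⟩ := hD (y * τ a * (y⁻¹ : Aˣ))
    rw [← h1, hτ] at h2 h3
    rw [mem_iff_coordinates h' Φ' hΦ1' hlt, mem_iff_coordinates h Φ hΦ1 hlt]
    refine and_congr ?_ ?_
    · refine forall_congr' fun i => exists_congr fun o => ?_
      rw [h2, h3, mul_right_comm, Units.mul_inv, one_mul]
      refine and_congr_right fun _ => ?_
      have h4 := hdiag i ((Φ a).2 i i - algebraMap O R o)
      simpa only [sub_eq_iff_eq_add'] using h4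
    · refine forall_congr' fun i => forall_congr' fun l => imp_congr_right fun _ => ?_
      rw [hr, h3]
      have h4 : (↑(r i)⁻¹ * (r i * (Φ a).2 i l * ↑(r l)⁻¹) * r l : R) = (Φ a).2 i l := by
        rw [← mul_assoc, ← mul_assoc, Units.inv_mul, one_mul, mul_assoc, Units.inv_mul, mul_one]
      rw [h4]
  ext b
  constructor
  · intro hb
    refine ⟨τ.symm (↑(D * y)⁻¹ * b * ↑(D * y)), ?_, ?_⟩
    · rw [SetLike.mem_coe, ← hmem, AlgEquiv.apply_symm_apply, ← mul_assoc, ← mul_assoc,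
        Units.mul_inv, one_mul, mul_assoc, Units.mul_inv, mul_one]
      exact hb
    · simp only
      rw [AlgEquiv.apply_symm_apply, ← mul_assoc, ← mul_assoc,
        Units.mul_inv, one_mul, mul_assoc, Units.mul_inv, mul_one]
  · rintro ⟨a, ha, rfl⟩
    exact (hmem a).2 ha

end Uniqueness

end UniqueLifting

end

noncomputable section

namespace UniqueLifting

open Finset Polynomial

set_option linter.unusedSectionVars false

/-! ### The commutative case κ = 1. -/

section Integrality

variable {O K R : Type*} [CommRing O] [IsDomain O] [IsDiscreteValuationRing O]
  [Field K] [Algebra O K] [IsFractionRing O K] [CommRing R] [Algebra K R] [Algebra O R]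
  [IsScalarTower O K R]

/-- Every field quotient of a finite-dimensional algebra is seen by a geometric point. -/
theorem exists_geometric_point [FiniteDimensional K R] (m : Ideal R) [hm : m.IsMaximal] :
    ∃ φ : R ⧸ m →ₐ[K] AlgebraicClosure K, Function.Injective φ := by
  let : Field (R ⧸ m) := Ideal.Quotient.field m
  have : FiniteDimensional K (R ⧸ m) :=
    Module.Finite.of_surjective (Ideal.Quotient.mkₐ K m).toLinearMap
      (Ideal.Quotient.mkₐ_surjective K m)
  exact ⟨IsAlgClosed.lift, RingHom.injective _⟩

/-- Every residue field embeds in the algebraic closure and provides a monic equation. The product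
of these equations takes a value in the Jacobson radical, which is nilpotent for an Artinian ring,
so a power of the product kills z. -/
theorem isIntegral_of_geometric_points [FiniteDimensional K R] {z : R}
    (h : ∀ χ : R →ₐ[K] AlgebraicClosure K, IsIntegral O (χ z)) : IsIntegral O z := by
  classical
  have : IsArtinianRing R := IsArtinianRing.of_finite K R
  have : Fintype (MaximalSpectrum R) := Fintype.ofFinite _
  have key : ∀ m : MaximalSpectrum R, ∃ P : O[X], P.Monic ∧ aeval z P ∈ m.asIdeal := by
    intro m
    have := m.isMaximal
    obtain ⟨φ, hφ⟩ := exists_geometric_point (K := K) m.asIdeal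
    obtain ⟨P, hP, hP0⟩ := (isIntegral_algHom_iff (φ.restrictScalars O) hφ).1
      (h (φ.comp (Ideal.Quotient.mkₐ K m.asIdeal)))
    refine ⟨P, hP, ?_⟩
    rw [← Ideal.Quotient.eq_zero_iff_mem]
    exact (aeval_algHom_apply (Ideal.Quotient.mkₐ O m.asIdeal) z P).symm.trans hP0
  choose P hP hP0 using key
  have h1 : aeval z (∏ m, P m) ∈ (⊥ : Ideal R).jacobson := by
    refine Ideal.mem_sInf.2 ?_
    rintro J ⟨-, hJ⟩
    rw [map_prod]
    exact Ideal.mem_of_dvd _ (dvd_prod_of_mem _ (mem_univ (⟨J, hJ⟩ : MaximalSpectrum R)))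
      (hP0 ⟨J, hJ⟩)
  rw [IsArtinianRing.jacobson_eq_radical] at h1
  obtain ⟨n, hn⟩ := h1
  refine ⟨(∏ m, P m) ^ n, (monic_prod_of_monic _ _ fun m _ => hP m).pow n, ?_⟩
  rw [← map_pow] at hn
  exact hn

/-- Reversing a monic equation of z = x⁻¹ yields a polynomial in x with constant term 1 that
vanishes, which expresses z through x. -/
theorem mem_of_isIntegral_inverse {Γ : Subalgebra O R} {x z : R} (hx : x ∈ Γ) (hxz : x * z = 1)
    (hz : IsIntegral O z) : z ∈ Γ := by
  obtain ⟨P, hP, hP0⟩ := hz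
  let i : Invertible z := ⟨x, hxz, by rw [mul_comm, hxz]⟩
  have h1 := eval₂_reverse_mul_pow (algebraMap O R) z P
  rw [hP0] at h1
  have h2 : aeval x P.reverse = 0 := by
    have h3 : eval₂ (algebraMap O R) x P.reverse * z ^ P.natDegree * x ^ P.natDegree = 0 := by
      rw [← zero_mul (x ^ P.natDegree), ← h1]; rfl
    rwa [mul_assoc, ← mul_pow, mul_comm z, hxz, one_pow, mul_one] at h3
  have h3 := congrArg (aeval x) (divX_mul_X_add P.reverse)
  rw [map_add, map_mul, aeval_X, aeval_C, h2, coeff_zero_reverse, hP.leadingCoeff, map_one] at h3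
  have h4 : z = - aeval x P.reverse.divX := by linear_combination z * h3 - aeval x P.reverse.divX * hxz
  rw [h4]
  exact Γ.neg_mem (Algebra.adjoin_le (by simpa using hx) (aeval_mem_adjoin_singleton O x))

variable {p : ℕ} (hp : IsLocalRing.maximalIdeal O = Ideal.span {(p : O)})

-- Modulo the maximal ideal the multiplication matrix is nilpotent, so its trace vanishes there.
include hp in
theorem IsFullOrder.exists_trace_eq {Γ : Subalgebra O R} (h : IsFullOrder O K Γ) {m b : R}
    (hm : m ∈ Γ) (hb : b ∈ Γ) {k : ℕ} (hmk : m ^ k = (p : O) • b) :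
    ∃ o : O, Algebra.trace K R m = algebraMap O K (p * o) := by
  classical
  have := h.finite
  have := h.free
  let B := Module.Free.chooseBasis O Γ
  obtain ⟨B', hB'⟩ := h.exists_leftMulMatrix B
  have h1 := hB' ⟨m, hm⟩
  set M := Algebra.leftMulMatrix B ⟨m, hm⟩ with hM
  have h2 : M ^ k = (p : O) • Algebra.leftMulMatrix B ⟨b, hb⟩ := by
    rw [hM, ← map_pow, ← map_smul]
    congr 1
    exact Subtype.ext hmk
  have h3 : IsNilpotent (M.map (IsLocalRing.residue O)) := by
    refine ⟨k, ?_⟩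
    have h4 := congrArg (RingHom.mapMatrix (IsLocalRing.residue O)) h2
    rw [map_pow, RingHom.mapMatrix_apply] at h4
    rw [h4]
    ext i j
    have h5 : IsLocalRing.residue O (p : O) = 0 := by
      rw [IsLocalRing.residue_eq_zero_iff, hp]
      exact Ideal.mem_span_singleton_self _
    rw [RingHom.mapMatrix_apply, Matrix.map_apply, Matrix.smul_apply, smul_eq_mul, map_mul, h5,
      zero_mul, Matrix.zero_apply]
  have h4 := (Matrix.isNilpotent_trace_of_isNilpotent h3).eq_zero
  have h5 : M.trace ∈ IsLocalRing.maximalIdeal O := by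
    rw [← IsLocalRing.residue_eq_zero_iff, ← h4, Matrix.trace, map_sum]
    rfl
  rw [hp, Ideal.mem_span_singleton] at h5
  obtain ⟨o, ho⟩ := h5
  refine ⟨o, ?_⟩
  rw [Algebra.trace_eq_matrix_trace B', h1, ← ho, Matrix.trace, Matrix.trace, map_sum]
  rfl

/-- The elements of `Γ` which are congruent to a scalar plus a nilpotent element modulo `p`. -/
def localElements (O : Type*) {R : Type*} [CommRing O] [CommRing R] [Algebra O R] (p : ℕ)
    (Γ : Subalgebra O R) : Set R :=
  {x | ∃ (o : O) (k : ℕ), ∃ b ∈ Γ, (x - algebraMap O R o) ^ k = (p : O) • b}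

/-- Elements that are scalar modulo the radical of pΓ form a subalgebra, so it suffices to know
generators. -/
theorem closure_le_localElements {Λ Λ' : Subalgebra O R}
    (h : ∀ a ∈ Λ, a ∈ localElements O p (Λ ⊔ Λ')) (h' : ∀ a ∈ Λ', a ∈ localElements O p (Λ ⊔ Λ'))
    {a : R} (ha : a ∈ Λ ⊔ Λ') : a ∈ localElements O p (Λ ⊔ Λ') := by
  set Γ := Λ ⊔ Λ' with hΓ
  let I : Ideal Γ := Ideal.span {(p : Γ)}
  have hI : ∀ (x : Γ) (o : O), (∃ (k : ℕ), ∃ b ∈ Γ, ((x : R) - algebraMap O R o) ^ k = (p : O) • b) ↔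
      x - algebraMap O Γ o ∈ I.radical := by
    intro x o
    refine exists_congr fun k => ?_
    rw [Ideal.mem_span_singleton']
    constructor
    · rintro ⟨b, hb, he⟩
      refine ⟨⟨b, hb⟩, Subtype.ext ?_⟩
      change b * ((p : Γ) : R) = ((x : R) - algebraMap O R o) ^ k
      rw [he, Algebra.smul_def, map_natCast, mul_comm]
      rfl
    · rintro ⟨b, he⟩
      refine ⟨b, b.2, ?_⟩
      have := congrArg (Subalgebra.val Γ) he
      change (b : R) * ((p : Γ) : R) = ((x : R) - algebraMap O R o) ^ k at this
      rw [← this, Algebra.smul_def, map_natCast, mul_comm]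
      rfl
  have hmem : ∀ x : Γ, (x : R) ∈ localElements O p Γ ↔ ∃ o : O, x - algebraMap O Γ o ∈ I.radical :=
    fun x => exists_congr fun o => hI x o
  have key : ∀ x (hx : x ∈ Γ), ∃ o : O, (⟨x, hx⟩ : Γ) - algebraMap O Γ o ∈ I.radical := by
    intro x hx
    have hx' : x ∈ Algebra.adjoin O ((Λ : Set R) ∪ Λ') := by
      rwa [Algebra.adjoin_union, Algebra.adjoin_eq, Algebra.adjoin_eq]
    have h1 : ∀ x ∈ Algebra.adjoin O ((Λ : Set R) ∪ Λ'), ∃ hx : x ∈ Γ, ∃ o : O,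
        (⟨x, hx⟩ : Γ) - algebraMap O Γ o ∈ I.radical := by
      intro x hx
      induction hx using Algebra.adjoin_induction with
      | mem a ha =>
        have haΓ : a ∈ Γ := ha.elim (fun h => (le_sup_left : Λ ≤ Γ) h)
          (fun h => (le_sup_right : Λ' ≤ Γ) h)
        exact ⟨haΓ, (hmem ⟨a, haΓ⟩).1 (ha.elim (h a) (h' a))⟩
      | algebraMap o =>
        refine ⟨Γ.algebraMap_mem o, o, ?_⟩
        have : (⟨algebraMap O R o, Γ.algebraMap_mem o⟩ : Γ) = algebraMap O Γ o := rfl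
        rw [this, sub_self]
        exact Ideal.zero_mem _
      | add a b _ _ h1 h2 =>
        obtain ⟨ha, o, ho⟩ := h1
        obtain ⟨hb, o', ho'⟩ := h2
        refine ⟨Γ.add_mem ha hb, o + o', ?_⟩
        have h3 := I.radical.add_mem ho ho'
        convert h3 using 1
        rw [map_add]
        change (⟨a, ha⟩ : Γ) + ⟨b, hb⟩ - _ = _
        ring
      | mul a b _ _ h1 h2 =>
        obtain ⟨ha, o, ho⟩ := h1
        obtain ⟨hb, o', ho'⟩ := h2
        refine ⟨Γ.mul_mem ha hb, o * o', ?_⟩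
        have h3 := I.radical.add_mem (I.radical.mul_mem_right ⟨b, hb⟩ ho)
          (I.radical.mul_mem_left (algebraMap O Γ o) ho')
        convert h3 using 1
        rw [map_mul]
        change (⟨a, ha⟩ : Γ) * ⟨b, hb⟩ - _ = _
        ring
    exact (h1 x hx').2
  exact (hmem ⟨a, ha⟩).2 (key a ha)

include hp in
/-- Self-dual local orders of rank `p` in a commutative algebra are unique. -/
theorem le_of_dual_of_local [FiniteDimensional K R] (hfin : Module.finrank K R = p)
    {Λ Λ' : Subalgebra O R} (hp0 : (p : O) ≠ 0)
    (hΛ : IsFullOrder O K Λ) (hΛ' : IsFullOrder O K Λ')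
    (h : ∀ a ∈ Λ, a ∈ localElements O p Λ) (h' : ∀ a ∈ Λ', a ∈ localElements O p Λ')
    {x υ : R} (hx : x * ((p : R) * υ) = 1) (hint : IsIntegral O ((p : R) * υ))
    (hdual : ∀ a, a ∈ Λ ↔ ∀ b ∈ Λ, ∃ o : O, Algebra.trace K R (υ * (a * b)) = algebraMap O K o) :
    Λ' ≤ Λ := by
  set Γ := Λ ⊔ Λ' with hΓ
  have hmono : ∀ {Λ : Subalgebra O R}, Λ ≤ Γ → (∀ a ∈ Λ, a ∈ localElements O p Λ) →
      ∀ a ∈ Λ, a ∈ localElements O p Γ := by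
    intro Λ hle h a ha
    obtain ⟨o, k, b, hb, he⟩ := h a ha
    exact ⟨o, k, b, hle hb, he⟩
  have hfull : IsFullOrder O K Γ := by
    refine ⟨?_, ?_⟩
    · rw [hΓ, ← Subalgebra.mul_toSubmodule]
      exact hΛ.fg.mul hΛ'.fg
    · rw [eq_top_iff, ← hΛ.span_eq_top]
      exact Submodule.span_mono (le_sup_left : Λ ≤ Γ)
  -- An element of Γ is a scalar o plus a part nilpotent modulo p. The scalar has trace p · o
  -- because the rank is p, and the other part has trace divisible by p.
  have htrace : ∀ r ∈ Γ, ∃ o : O, Algebra.trace K R r = algebraMap O K (p * o) := by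
    intro r hr
    obtain ⟨o, k, b, hb, he⟩ := closure_le_localElements (hmono le_sup_left h)
      (hmono le_sup_right h') hr
    obtain ⟨o', ho'⟩ := hfull.exists_trace_eq hp (Γ.sub_mem hr (Γ.algebraMap_mem o)) hb he
    refine ⟨o + o', ?_⟩
    rw [map_sub, IsScalarTower.algebraMap_apply O K R, Algebra.trace_algebraMap, hfin,
      sub_eq_iff_eq_add] at ho'
    rw [ho', mul_add, map_add, nsmul_eq_mul, map_mul _ (p : O) o, map_natCast, add_comm]
  have hpK : (p : K) ≠ 0 := by
    rw [← map_natCast (algebraMap O K)]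
    exact (FaithfulSMul.algebraMap_eq_zero_iff O K).not.2 hp0
  -- As x inverts pυ, the form on xr is p⁻¹ times the trace, hence integral on Γ. Self-duality puts
  -- xΓ inside Λ.
  have hxΓ : ∀ r ∈ Γ, x * r ∈ Λ := by
    intro r hr
    rw [hdual]
    intro b hb
    obtain ⟨o, ho⟩ := htrace (r * b) (Γ.mul_mem hr ((le_sup_left : Λ ≤ Γ) hb))
    refine ⟨o, ?_⟩
    apply mul_left_cancel₀ hpK
    have h1 : (p : K) * Algebra.trace K R (υ * (x * r * b)) =
        Algebra.trace K R ((p : K) • (υ * (x * r * b))) := by rw [map_smul, smul_eq_mul]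
    rw [h1, Algebra.smul_def, map_natCast,
      show (p : R) * (υ * (x * r * b)) = (x * ((p : R) * υ)) * (r * b) by ring, hx, one_mul, ho,
      map_mul, map_natCast]
  have hxΛ : x ∈ Λ := by simpa using hxΓ 1 Γ.one_mem
  -- Now x lies in Λ and its inverse is integral, so x is a unit of Λ and xΓ ⊆ Λ becomes Γ ⊆ Λ.
  have hυ := mem_of_isIntegral_inverse hxΛ hx hint
  intro r hr
  have h1 := Λ.mul_mem hυ (hxΓ r ((le_sup_right : Λ' ≤ Γ) hr))
  rwa [← mul_assoc, mul_comm _ x, hx, one_mul] at h1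

end Integrality

end UniqueLifting

end

noncomputable section

namespace UniqueLifting

open Finset TensorProduct

set_option linter.unusedSectionVars false

/-! ### Central primitive idempotents and the nonlinear part. -/

section Centre

variable {K A : Type*} [Field K] [Ring A] [Algebra K A]

theorem isCentre_center : IsCentre (Subalgebra.center K A).val where
  injective := Subtype.val_injective
  comm z a := Subalgebra.mem_center_iff.1 z.2 a
  exists_eq a ha := ⟨⟨a, Subalgebra.mem_center_iff.2 ha⟩, rfl⟩

theorem IsCentralPrimitive.mul_eq_zero {ε ε' : A} (h : IsCentralPrimitive ε)
    (h' : IsCentralPrimitive ε') (hne : ε ≠ ε') : ε * ε' = 0 := by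
  have hcomm : ε' * ε = ε * ε' := Subring.mem_center_iff.1 h.central ε'
  have hc := Subring.mul_mem _ h.central h'.central
  have hi : IsIdempotentElem (ε * ε') := h.idem.mul_of_commute hcomm.symm h'.idem
  by_contra h0
  have h1 := (h.minimal _ hc hi (by rw [mul_assoc, hcomm, ← mul_assoc, h.idem.eq])).resolve_left h0
  have h2 := (h'.minimal _ hc hi (by rw [mul_assoc, h'.idem.eq])).resolve_left h0
  exact hne (h1.symm.trans h2)

variable {Z : Type*} [CommRing Z] [Algebra K Z] [FiniteDimensional K Z] {ζ : Z →ₐ[K] A}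

/-- Below every nonzero central idempotent there is a central primitive one. -/
theorem IsCentre.exists_isCentralPrimitive (hζ : IsCentre ζ) {μ : Z} (hμ : μ * μ = μ)
    (h0 : μ ≠ 0) : ∃ d : Z, d * μ = d ∧ IsCentralPrimitive (ζ d) := by
  classical
  have hex : ∃ n, ∃ d : Z, d * d = d ∧ d ≠ 0 ∧ d * μ = d ∧ idealRank K d = n :=
    ⟨_, μ, hμ, h0, hμ, rfl⟩
  obtain ⟨d, hd, hd0, hdμ, hrank⟩ := Nat.find_spec hex
  have hcen : ∀ z, ζ z ∈ Subring.center A := fun z => Subring.mem_center_iff.2 (hζ.comm z)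
  refine ⟨d, hdμ, hcen d, ?_, fun h => hd0 (hζ.injective (h.trans (map_zero ζ).symm)), ?_⟩
  · rw [IsIdempotentElem, ← map_mul, hd]
  intro e he hidem hed
  obtain ⟨e, rfl⟩ := hζ.exists_eq e (Subring.mem_center_iff.1 he)
  have h1 : e * e = e := hζ.injective (by rw [map_mul]; exact hidem)
  have h2 : e * d = e := hζ.injective (by rw [map_mul]; exact hed)
  by_cases h3 : e = 0
  · exact Or.inl (by rw [h3, map_zero])
  right
  have h4 : Nat.find hex ≤ idealRank K e :=
    Nat.find_min' hex ⟨e, h1, h3, by rw [← h2, mul_assoc, hdμ], rfl⟩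
  have h5 := idealRank_eq_add (K := K) (x := d) h1
  rw [mul_comm d e, h2, hrank] at h5
  have h6 : d * (1 - e) = 0 := idealRank_eq_zero (K := K) (by omega)
  have h7 : d = e := by linear_combination h6 + h2
  rw [h7]

/-- A central primitive idempotent below the remainder η(1 - e₁ - e₂) would be linear and therefore
annihilated by η. So the remainder is zero. -/
theorem IsCentre.eq_sum_of_isLastPair (hζ : IsCentre ζ) {η : Z} (hη : η * η = η)
    (hlin : ∀ z : Z, IsLinear K (ζ z) → η * z = 0)
    {e₁ e₂ : Z} (h : IsLastPair K (ζ e₁) (ζ e₂)) : η = η * e₁ + η * e₂ := by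
  obtain ⟨h1, h2, hne, h3⟩ := h
  have h4 : e₁ * e₁ = e₁ := hζ.injective (by rw [map_mul]; exact h1.idem)
  have h5 : e₂ * e₂ = e₂ := hζ.injective (by rw [map_mul]; exact h2.idem)
  have h6 : e₁ * e₂ = 0 := hζ.injective (by rw [map_mul, map_zero]; exact h1.mul_eq_zero h2 hne)
  set μ := η * (1 - e₁ - e₂) with hμ
  have h7 : μ * μ = μ := by
    rw [hμ]
    linear_combination (1 - e₁ - e₂) * (1 - e₁ - e₂) * hη + η * h4 + η * h5 + 2 * η * h6
  by_cases h8 : μ = 0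
  · rw [hμ] at h8; linear_combination h8
  exfalso
  obtain ⟨d, hd, hdp⟩ := hζ.exists_isCentralPrimitive h7 h8
  have hd1 : d * e₁ = 0 := by
    rw [← hd, hμ]
    linear_combination (-d * η) * h4 - d * η * h6
  have hd2 : d * e₂ = 0 := by
    rw [← hd, hμ]
    linear_combination (-d * η) * h5 - d * η * h6
  have h9 : IsLinear K (ζ d) := by
    refine h3 _ hdp (fun h0 => h1.ne_zero ?_) (fun h0 => h2.ne_zero ?_)
    · rw [hζ.injective h0, h4] at hd1
      rw [hd1, map_zero]
    · rw [hζ.injective h0, h5] at hd2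
      rw [hd2, map_zero]
  refine hdp.ne_zero ?_
  have h10 : d = 0 := by
    rw [← hd, hμ]
    linear_combination (1 - e₁ - e₂) * hlin d h9
  rw [h10, map_zero]

theorem IsCentre.eq_mul_of_isLast (hζ : IsCentre ζ) {η : Z} (hη : η * η = η)
    (hlin : ∀ z : Z, IsLinear K (ζ z) → η * z = 0) {e : Z} (h : IsLast K (ζ e)) :
    η = η * e := by
  obtain ⟨h1, h3⟩ := h
  have h4 : e * e = e := hζ.injective (by rw [map_mul]; exact h1.idem)
  set μ := η * (1 - e) with hμ
  have h7 : μ * μ = μ := by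
    rw [hμ]
    linear_combination (1 - e) * (1 - e) * hη + η * h4
  by_cases h8 : μ = 0
  · rw [hμ] at h8; linear_combination h8
  exfalso
  obtain ⟨d, hd, hdp⟩ := hζ.exists_isCentralPrimitive h7 h8
  have hd1 : d * e = 0 := by
    rw [← hd, hμ]
    linear_combination (-d * η) * h4
  have h9 : IsLinear K (ζ d) := by
    refine h3 _ hdp fun h0 => h1.ne_zero ?_
    rw [hζ.injective h0, h4] at hd1
    rw [hd1, map_zero]
  refine hdp.ne_zero ?_
  have h10 : d = 0 := by
    rw [← hd, hμ]
    linear_combination (1 - e) * hlin d h9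
  rw [h10, map_zero]

theorem exists_geometric_point_of_idempotent {e : Z} (he : e * e = e)
    (h0 : e ≠ 0) : ∃ χ : Z →ₐ[K] AlgebraicClosure K, χ e = 1 := by
  have h1 : Ideal.span {1 - e} ≠ ⊤ := by
    rw [Ne, Ideal.span_singleton_eq_top]
    rintro ⟨v, hv⟩
    apply h0
    have h2 : (v : Z) * e = 0 := by rw [hv]; linear_combination -he
    exact (Units.mul_right_eq_zero v).1 h2
  obtain ⟨m, hm, hle⟩ := Ideal.exists_le_maximal _ h1
  obtain ⟨φ, -⟩ := exists_geometric_point (K := K) m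
  refine ⟨φ.comp (Ideal.Quotient.mkₐ K m), ?_⟩
  have h2 : Ideal.Quotient.mkₐ K m e = 1 := by
    rw [← map_one (Ideal.Quotient.mkₐ K m)]
    refine (Ideal.Quotient.mk_eq_mk_iff_sub_mem _ _).2 ?_
    rw [← neg_sub, Ideal.neg_mem_iff]
    exact hle (Ideal.mem_span_singleton_self _)
  rw [AlgHom.comp_apply, h2, map_one]

end Centre

/-! ### From valuations to units of O. -/

section Valuation

variable {O K Z : Type*} [CommRing O] [IsDomain O] [IsDiscreteValuationRing O]
  [Field K] [Algebra O K] [IsFractionRing O K] [CommRing Z] [Algebra K Z]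

theorem HasValuation.exists_unit {p f : ℕ} (hp0 : (p : K) ≠ 0) {k : K}
    (h : HasValuation O p (-f) (algebraMap K (AlgebraicClosure K) k)) :
    ∃ v : Oˣ, k * (p : K) ^ f = algebraMap O K v := by
  obtain ⟨h0, h1, h2⟩ := h
  have h3 : algebraMap K (AlgebraicClosure K) k / (p : AlgebraicClosure K) ^ (-(f : ℤ)) =
      algebraMap K (AlgebraicClosure K) (k * (p : K) ^ f) := by
    rw [zpow_neg, div_inv_eq_mul, zpow_natCast, map_mul, map_pow, map_natCast]
  rw [h3] at h1 h2
  rw [← map_inv₀] at h2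
  obtain ⟨o, ho⟩ := exists_algebraMap_eq_of_isIntegral h1
  obtain ⟨o', ho'⟩ := exists_algebraMap_eq_of_isIntegral h2
  have hne : k * (p : K) ^ f ≠ 0 := by
    refine mul_ne_zero (fun hk => h0 ?_) (pow_ne_zero _ hp0)
    rw [hk, map_zero]
  have h4 : o * o' = 1 := by
    apply IsFractionRing.injective O K
    rw [map_mul, ho, ho', mul_inv_cancel₀ hne, map_one]
  exact ⟨⟨o, o', h4, by rw [mul_comm, h4]⟩, ho.symm⟩

theorem exists_unit_of_idempotent [FiniteDimensional K Z] {p f : ℕ} (hp0 : (p : K) ≠ 0) {υ : Z}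
    (h : ∀ χ : Z →ₐ[K] AlgebraicClosure K, HasValuation O p (-f) (χ υ)) {e : Z} (he : e * e = e)
    (h0 : e ≠ 0) {k : K} (hk : e * υ = k • e) : ∃ v : Oˣ, k * (p : K) ^ f = algebraMap O K v := by
  obtain ⟨χ, hχ⟩ := exists_geometric_point_of_idempotent (K := K) he h0
  have h1 := congrArg χ hk
  rw [map_mul, map_smul, hχ, one_mul, ← Algebra.algebraMap_eq_smul_one] at h1
  have h2 := h χ
  rw [h1] at h2
  exact h2.exists_unit hp0

theorem exists_unit_of_character {p f : ℕ} (hp0 : (p : K) ≠ 0) {υ : Z}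
    (h : ∀ χ : Z →ₐ[K] AlgebraicClosure K, HasValuation O p (-f) (χ υ)) (χ : Z →ₐ[K] K) :
    ∃ v : Oˣ, χ υ * (p : K) ^ f = algebraMap O K v :=
  HasValuation.exists_unit hp0 (h ((Algebra.ofId K (AlgebraicClosure K)).comp χ))

end Valuation

/-! ### Consequences of self-duality. -/

section SelfDual

variable {O K A : Type*} [CommRing O] [IsDomain O] [IsDiscreteValuationRing O]
  [Field K] [Algebra O K] [IsFractionRing O K] [Ring A] [Algebra K A] [Algebra O A]
  [IsScalarTower O K A] [FiniteDimensional K A] {p : ℕ}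

/-- The inverse of p is not integral over O. -/
theorem IsFullOrder.ne_top [Nontrivial A] (hp : ¬ IsUnit (p : O)) (hp0 : (p : O) ≠ 0)
    {Λ : Subalgebra O A} (hΛ : IsFullOrder O K Λ) : Λ ≠ ⊤ := by
  intro htop
  have := hΛ.finite
  have hmem : algebraMap K A (p : K)⁻¹ ∈ Λ := by rw [htop]; trivial
  have h1 : IsIntegral O (algebraMap K A (p : K)⁻¹) :=
    (IsIntegral.of_finite O (⟨_, hmem⟩ : Λ)).map Λ.val
  have h2 : IsIntegral O (p : K)⁻¹ := (isIntegral_algHom_iff (IsScalarTower.toAlgHom O K A)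
    (algebraMap K A).injective).1 h1
  obtain ⟨o, ho⟩ := IsIntegrallyClosed.isIntegral_iff.1 h2
  apply hp
  refine IsUnit.of_mul_eq_one o ?_
  apply IsFractionRing.injective O K
  rw [map_mul, ho, map_natCast, map_one, mul_inv_cancel₀]
  rw [← map_natCast (algebraMap O K)]
  exact (FaithfulSMul.algebraMap_eq_zero_iff O K).not.2 hp0

/-- Without a splitting, `reducedTrace` takes its default value 0 and self-duality would make Λ the
whole algebra. -/
theorem IsSelfDual.nonempty_splitting [Nontrivial A] (hp : ¬ IsUnit (p : O)) (hp0 : (p : O) ≠ 0)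
    {Λ : Subalgebra O A} (hΛ : IsFullOrder O K Λ) {u : (Subalgebra.center K A)ˣ}
    (h : IsSelfDual O K u Λ) : Nonempty (Splitting K A) := by
  by_contra hs
  refine hΛ.ne_top hp hp0 (eq_top_iff.2 fun a _ => ?_)
  rw [h]
  intro b _
  refine ⟨0, ?_⟩
  rw [traceForm, reducedTrace, dif_neg hs, map_zero, map_zero]

theorem Splitting.trace_eq_of_comm {R : Type*} [CommRing R] [Algebra K R] [FiniteDimensional K R]
    (s : Splitting K R) (a : R) :
    s.trace a = algebraMap K (AlgebraicClosure K) (Algebra.trace K R a) := by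
  rw [s.trace_eq_of_corner (e := 1) (mul_one 1) (fun x y => by ring) (by ring)]
  have h : LinearMap.mulLeftRight K (a, 1) = LinearMap.mulLeft K a :=
    LinearMap.ext fun x => by rw [LinearMap.mulLeftRight_apply, mul_one]; rfl
  rw [h]
  rfl

theorem le_of_isSelfDual_of_local (hp : IsLocalRing.maximalIdeal O = Ideal.span {(p : O)})
    (hp0 : (p : O) ≠ 0) (hfin : Module.finrank K A = p) (hcomm : ∀ a b : A, a * b = b * a)
    (hs : Nonempty (Splitting K A)) {Λ Λ' : Subalgebra O A}
    (hΛ : IsFullOrder O K Λ) (hΛ' : IsFullOrder O K Λ')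
    (h : ∀ a : Λ, ∃ (o : O) (k : ℕ) (b : Λ), (a - o • (1 : Λ)) ^ k = (p : O) • b)
    (h' : ∀ a : Λ', ∃ (o : O) (k : ℕ) (b : Λ'), (a - o • (1 : Λ')) ^ k = (p : O) • b)
    {u : (Subalgebra.center K A)ˣ} (hu : HasValuationEverywhere O K p (-(1 : ℕ)) u)
    (hdual : IsSelfDual O K u Λ) : Λ' ≤ Λ := by
  rename_i hring _ _ _ _
  -- The given ring structure is replaced by a commutative one with the same underlying ring, so
  -- that the results on commutative algebras apply.
  obtain ⟨C, rfl⟩ : ∃ C : CommRing A, C.toRing = hring :=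
    ⟨{ hring with mul_comm := hcomm }, rfl⟩
  have hloc : ∀ {Λ : Subalgebra O A}, (∀ a : Λ, ∃ (o : O) (k : ℕ) (b : Λ),
      (a - o • (1 : Λ)) ^ k = (p : O) • b) → ∀ a ∈ Λ, a ∈ localElements O p Λ := by
    intro Λ h a ha
    obtain ⟨o, k, b, hb⟩ := h ⟨a, ha⟩
    refine ⟨o, k, b, b.2, ?_⟩
    rw [Algebra.algebraMap_eq_smul_one]
    exact congrArg (Subalgebra.val Λ) hb
  have hpK : (p : K) ≠ 0 := by
    rw [← map_natCast (algebraMap O K)]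
    exact (FaithfulSMul.algebraMap_eq_zero_iff O K).not.2 hp0
  have hinv : ((↑u⁻¹ : Subalgebra.center K A) : A) * ((u : Subalgebra.center K A) : A) = 1 :=
    congrArg Subtype.val (Units.inv_mul u)
  refine le_of_dual_of_local (K := K) hp hfin hp0 hΛ hΛ' (hloc h) (hloc h')
    (x := algebraMap K A (p : K)⁻¹ * ((↑u⁻¹ : Subalgebra.center K A) : A))
    (υ := ((u : Subalgebra.center K A) : A)) ?_ ?_ ?_
  · have h1 : algebraMap K A (p : K)⁻¹ * (p : A) = 1 := by
      rw [← map_natCast (algebraMap K A), ← map_mul, inv_mul_cancel₀ hpK, map_one]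
    calc _ = (algebraMap K A (p : K)⁻¹ * (p : A)) *
        (((↑u⁻¹ : Subalgebra.center K A) : A) * ((u : Subalgebra.center K A) : A)) := by ring
      _ = 1 := by rw [h1, hinv, one_mul]
  · refine isIntegral_of_geometric_points (K := K) fun χ => ?_
    have h1 := (hu (χ.comp (Subalgebra.center K A).val)).2.1
    rw [zpow_neg, div_inv_eq_mul, zpow_natCast, pow_one, mul_comm] at h1
    rw [map_mul, map_natCast]
    exact h1
  · intro a
    rw [hdual]
    refine forall_congr' fun b => imp_congr_right fun _ => exists_congr fun o => ?_
    rw [traceForm, reducedTrace, dif_pos hs]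
    have h1 := hs.some.trace_eq_of_comm (((u : Subalgebra.center K A) : A) * (a * b))
    rw [← (algebraMap K (AlgebraicClosure K)).injective.eq_iff, ← h1]
    rfl

end SelfDual

end UniqueLifting

end

noncomputable section

namespace UniqueLifting

open Finset TensorProduct

set_option linter.unusedSectionVars false

/-! ### Comparison of the two forms on the matrix block. -/

section Ratio

variable {O K Z : Type*} [CommRing O] [IsDomain O] [IsDiscreteValuationRing O]
  [Field K] [Algebra O K] [IsFractionRing O K] [CommRing Z] [Algebra K Z] [FiniteDimensional K Z]
  [Algebra O Z] [IsScalarTower O K Z]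

theorem exists_ratio_of_idempotent {p f : ℕ} (hp0 : (p : K) ≠ 0) {υ υ' : Z}
    (h : ∀ χ : Z →ₐ[K] AlgebraicClosure K, HasValuation O p (-f) (χ υ))
    (h' : ∀ χ : Z →ₐ[K] AlgebraicClosure K, HasValuation O p (-f) (χ υ')) {e : Z} (he : e * e = e)
    (h0 : e ≠ 0) {k k' : K} (hk : e * υ = k • e) (hk' : e * υ' = k' • e) :
    k ≠ 0 ∧ ∃ w : Oˣ, k' = algebraMap O K w * k := by
  obtain ⟨v, hv⟩ := exists_unit_of_idempotent hp0 h he h0 hk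
  obtain ⟨v', hv'⟩ := exists_unit_of_idempotent hp0 h' he h0 hk'
  have hpf := pow_ne_zero f hp0
  constructor
  · rintro rfl
    rw [zero_mul] at hv
    exact v.ne_zero ((FaithfulSMul.algebraMap_eq_zero_iff O K).1 hv.symm)
  refine ⟨v' * v⁻¹, mul_right_cancel₀ hpf ?_⟩
  rw [hv', mul_assoc, hv, ← map_mul, Units.val_mul, mul_assoc, Units.inv_mul, mul_one]

/-- In rank one both components are scalars, and equal valuations make their quotient a unit. This
is the case p = 2. -/
theorem exists_unit_smul_of_idealRank_eq_one {p f : ℕ} (hp0 : (p : K) ≠ 0) {υ υ' : Z}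
    (h : ∀ χ : Z →ₐ[K] AlgebraicClosure K, HasValuation O p (-f) (χ υ))
    (h' : ∀ χ : Z →ₐ[K] AlgebraicClosure K, HasValuation O p (-f) (χ υ')) {η : Z}
    (hη : η * η = η) (h1 : idealRank K η = 1) : ∃ w : Oˣ, η * υ' = (w : O) • (η * υ) := by
  have h0 : η ≠ 0 := by
    rintro rfl
    rw [idealRank, LinearMap.mulLeft_zero_eq_zero, LinearMap.range_zero, finrank_bot] at h1
    exact zero_ne_one h1
  have key : ∀ z, ∃ k : K, η * z = k • η := by
    intro z
    obtain ⟨k, hk⟩ := (finrank_eq_one_iff_of_nonzero'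
      (⟨η, ⟨1, mul_one η⟩⟩ : LinearMap.range (LinearMap.mulLeft K η))
      fun h => h0 (congrArg Subtype.val h)).1 h1 ⟨η * z, ⟨z, rfl⟩⟩
    exact ⟨k, (congrArg Subtype.val hk).symm⟩
  obtain ⟨k, hk⟩ := key υ
  obtain ⟨k', hk'⟩ := key υ'
  obtain ⟨-, w, hw⟩ := exists_ratio_of_idempotent hp0 h h' hη h0 hk hk'
  exact ⟨w, by rw [hk, hk', hw, mul_smul, algebraMap_smul]⟩

/-- Each coefficient changes by its own unit of O, and equality of the ratios forces the two units
to agree, so one unit serves the whole block. -/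
theorem IsCentre.exists_unit_smul_of_isLastPair {A : Type*} [Ring A] [Algebra K A]
    {ζ : Z →ₐ[K] A} (hζ : IsCentre ζ) {p f : ℕ} (hp0 : (p : K) ≠ 0) {υ υ' : Z}
    (h : ∀ χ : Z →ₐ[K] AlgebraicClosure K, HasValuation O p (-f) (χ υ))
    (h' : ∀ χ : Z →ₐ[K] AlgebraicClosure K, HasValuation O p (-f) (χ υ'))
    {ε₁ ε₂ : A} (hε : IsLastPair K ε₁ ε₂) {c₁ c₂ c₁' c₂' : K}
    (h1 : ε₁ * ζ υ = c₁ • ε₁) (h2 : ε₂ * ζ υ = c₂ • ε₂)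
    (h1' : ε₁ * ζ υ' = c₁' • ε₁) (h2' : ε₂ * ζ υ' = c₂' • ε₂) (hcc : c₁ / c₂ = c₁' / c₂')
    {η : Z} (hη : η * η = η) (hlin : ∀ z, IsLinear K (ζ z) → η * z = 0) :
    ∃ w : Oˣ, η * υ' = (w : O) • (η * υ) := by
  obtain ⟨e₁, rfl⟩ := hζ.exists_eq ε₁ (Subring.mem_center_iff.1 hε.1.central)
  obtain ⟨e₂, rfl⟩ := hζ.exists_eq ε₂ (Subring.mem_center_iff.1 hε.2.1.central)
  have hsum := hζ.eq_sum_of_isLastPair hη hlin hε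
  rw [← map_mul, ← map_smul] at h1 h2 h1' h2'
  replace h1 := hζ.injective h1
  replace h2 := hζ.injective h2
  replace h1' := hζ.injective h1'
  replace h2' := hζ.injective h2'
  have hi : ∀ {e : Z}, IsCentralPrimitive (ζ e) → e * e = e ∧ e ≠ 0 := fun he =>
    ⟨hζ.injective (by rw [map_mul]; exact he.idem),
      fun h0 => he.ne_zero (by rw [h0, map_zero])⟩
  obtain ⟨hn1, w, hw⟩ := exists_ratio_of_idempotent hp0 h h' (hi hε.1).1 (hi hε.1).2 h1 h1'
  obtain ⟨hn2, w₂, hw₂⟩ := exists_ratio_of_idempotent hp0 h h' (hi hε.2.1).1 (hi hε.2.1).2 h2 h2'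
  have hw0 : ∀ w : Oˣ, algebraMap O K w ≠ 0 := fun w hw =>
    w.ne_zero ((FaithfulSMul.algebraMap_eq_zero_iff O K).1 hw)
  have hww : algebraMap O K w = algebraMap O K w₂ := by
    rw [hw, hw₂, div_eq_div_iff hn2 (mul_ne_zero (hw0 _) hn2)] at hcc
    apply mul_right_cancel₀ (mul_ne_zero hn1 hn2)
    linear_combination -hcc
  refine ⟨w, ?_⟩
  have h3 : ∀ z : Z, η * z = η * (e₁ * z) + η * (e₂ * z) := by
    intro z
    rw [← mul_assoc, ← mul_assoc, ← add_mul, ← hsum]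
  rw [h3 υ', h3 υ, h1, h2, h1', h2', hw, hw₂, ← hww, ← algebraMap_smul K (w : O)]
  simp only [mul_smul_comm, smul_add, mul_smul]

theorem IsCentre.exists_unit_smul_of_isLast {A : Type*} [Ring A] [Algebra K A] [Algebra O A]
    [IsScalarTower O K A] {ζ : Z →ₐ[K] A} (hζ : IsCentre ζ) {υ υ' : Z}
    {ε : A} (hε : IsLast K ε) {w : Oˣ} (hw : ε * ζ υ' = (w : O) • (ε * ζ υ))
    {η : Z} (hη : η * η = η) (hlin : ∀ z, IsLinear K (ζ z) → η * z = 0) :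
    ∃ w : Oˣ, η * υ' = (w : O) • (η * υ) := by
  obtain ⟨e, rfl⟩ := hζ.exists_eq ε (Subring.mem_center_iff.1 hε.1.central)
  have h1 := hζ.eq_mul_of_isLast hη hlin hε
  rw [← algebraMap_smul K (w : O), ← map_mul, ← map_mul, ← map_smul, algebraMap_smul] at hw
  replace hw := hζ.injective hw
  exact ⟨w, by rw [h1, mul_assoc, mul_assoc, hw, mul_smul_comm]⟩

end Ratio

/-! ### The two cases κ = 1 and κ ≥ 2. -/

section Main

theorem exists_pow_eq (p : ℕ) [hpr : Fact p.Prime] {f : ℕ} (hf : 1 ≤ f) :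
    ∃ c κ : ℕ, κ ≠ 0 ∧ p ^ f = c * κ + 1 ∧ (c = 1 ∧ p = 2 ∨ c = 2 ∧ p ≠ 2) := by
  have h1 : p ≤ p ^ f := Nat.le_self_pow (by omega) p
  have h2 := hpr.out.two_le
  by_cases hp2 : p = 2
  · exact ⟨1, p ^ f - 1, by omega, by omega, Or.inl ⟨rfl, hp2⟩⟩
  · obtain ⟨m, hm⟩ := (hpr.out.odd_of_ne_two hp2).pow (n := f)
    exact ⟨2, m, by omega, hm, Or.inr ⟨rfl, hp2⟩⟩

variable {p f : ℕ} [hpr : Fact p.Prime] {O K A : Type*} [CommRing O] [IsDomain O]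
  [IsDiscreteValuationRing O] [IsAdicComplete (IsLocalRing.maximalIdeal O) O]
  [Field K] [Algebra O K] [IsFractionRing O K] [Ring A] [Algebra K A] [Algebra O A]
  [IsScalarTower O K A] [FiniteDimensional K A] [IsSemisimpleRing A]

/-- All four assertions of the theorem are instances; they differ only in why the two forms are
proportional by a unit of O on the nonlinear part η, which is the hypothesis `hw`. -/
theorem IsDelta2Order.conjUpToLinear (hf : 1 ≤ f)
    (hp : IsLocalRing.maximalIdeal O = Ideal.span {(p : O)}) (hp0 : (p : O) ≠ 0)
    (hZ : Module.finrank K (Subalgebra.center K A) =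
      Module.finrank (AlgebraicClosure (IsLocalRing.ResidueField O))
        (Subalgebra.center (AlgebraicClosure (IsLocalRing.ResidueField O))
          (PrincipalBlock (AlgebraicClosure (IsLocalRing.ResidueField O)) (Delta2 p f))))
    {u u' : (Subalgebra.center K A)ˣ} (hu : HasValuationEverywhere O K p (-f) u)
    (hu' : HasValuationEverywhere O K p (-f) u') {Λ Λ' : Subalgebra O A}
    (hΛ : IsDelta2Order O K p f u Λ) (hΛ' : IsDelta2Order O K p f u' Λ')
    (hw : ∀ η : Subalgebra.center K A, η * η = η → (p = 2 → idealRank K η = 1) →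
      (∀ z : Subalgebra.center K A, IsLinear K (z : A) → η * z = 0) →
      ∃ w : Oˣ, η * (u' : Subalgebra.center K A) =
        (w : O) • (η * (u : Subalgebra.center K A))) :
    ConjUpToLinear O K Λ Λ' := by
  obtain ⟨c, κ, hκ0, hq, hc⟩ := exists_pow_eq p hf
  have : NeZero κ := ⟨hκ0⟩
  have := hΛ.full.finite
  have := hΛ.full.free
  have := hΛ'.full.finite
  have := hΛ'.full.free
  have hA : Module.finrank K A = κ * p ^ f := by
    rw [hΛ.full.finrank_eq, finrank_of_form hp hΛ.reduction hf hq hc]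
  have hA0 : 0 < Module.finrank K A := by
    rw [hA]; exact Nat.mul_pos (Nat.pos_of_ne_zero hκ0) (pow_pos hpr.out.pos f)
  have : Nontrivial A := Module.nontrivial_of_finrank_pos hA0
  have := charP_residueField hp
  have : CharP (AlgebraicClosure (IsLocalRing.ResidueField O)) p := charP_of_injective_algebraMap
    (algebraMap (IsLocalRing.ResidueField O) _).injective p
  have hZ' : κ + c ≤ Module.finrank K (Subalgebra.center K A) :=
    hZ ▸ le_finrank_center_principalBlock p hf hq hc _
  have hpu : ¬ IsUnit (p : O) := by
    have h1 : (p : O) ∈ IsLocalRing.maximalIdeal O := hp ▸ Ideal.mem_span_singleton_self _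
    exact (IsLocalRing.mem_maximalIdeal _).1 h1
  have hs := hΛ.selfDual.nonempty_splitting hpu hp0 hΛ.full
  have hpK : (p : K) ≠ 0 := by
    rw [← map_natCast (algebraMap O K)]
    exact (FaithfulSMul.algebraMap_eq_zero_iff O K).not.2 hp0
  obtain hκ | hκ : κ = 1 ∨ 2 ≤ κ := by omega
  · subst hκ
    obtain rfl : f = 1 := by
      have h1 : p ^ f ≤ p ^ 1 := by rw [pow_one]; have := hpr.out.two_le; omega
      have := (Nat.pow_le_pow_iff_right hpr.out.one_lt).1 h1
      omega
    have hfin : Module.finrank K A = p := by rw [hA, one_mul, pow_one]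
    -- For κ = 1 the lower bound κ + c for the centre equals c + 1 = p = dim A, so A is commutative.
    have htop : Subalgebra.toSubmodule (Subalgebra.center K A) = ⊤ := by
      apply Submodule.eq_top_of_finrank_eq
      refine le_antisymm (Submodule.finrank_le _) ?_
      rw [hfin]
      refine le_trans ?_ hZ'
      omega
    have hcomm : ∀ a b : A, a * b = b * a := by
      intro a b
      have h1 : b ∈ Subalgebra.toSubmodule (Subalgebra.center K A) := htop ▸ Submodule.mem_top
      exact (Subalgebra.mem_center_iff (R := K)).1 h1 a
    have hl : ∀ a : Λ, ∃ (o : O) (k : ℕ) (b : Λ), (a - o • (1 : Λ)) ^ k = (p : O) • b :=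
      fun a => (exists_nilpotent_of_form hp hΛ.reduction hf hq hc rfl a).imp fun _ h => ⟨_, h⟩
    have hl' : ∀ a : Λ', ∃ (o : O) (k : ℕ) (b : Λ'), (a - o • (1 : Λ')) ^ k = (p : O) • b :=
      fun a => (exists_nilpotent_of_form hp hΛ'.reduction hf hq hc rfl a).imp fun _ h => ⟨_, h⟩
    have heq : Λ = Λ' := le_antisymm
      (le_of_isSelfDual_of_local hp hp0 hfin hcomm hs hΛ'.full hΛ.full hl' hl hu' hΛ'.selfDual)
      (le_of_isSelfDual_of_local hp hp0 hfin hcomm hs hΛ.full hΛ'.full hl hl' hu hΛ.selfDual)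
    subst heq
    refine ⟨AlgEquiv.refl, fun _ _ _ _ => rfl, 1, ?_⟩
    simp
  · obtain ⟨n, rfl⟩ : ∃ n, f = n + 1 := ⟨f - 1, by omega⟩
    obtain ⟨d, -, hcd, ε, X, w₀, h⟩ := exists_isCyclicOrder_of_form hp hΛ.reduction hf hq hc hκ
    obtain ⟨d', -, hcd', ε', X', w₀', h'⟩ :=
      exists_isCyclicOrder_of_form hp hΛ'.reduction hf hq hc hκ
    obtain rfl : d = d' := Nat.eq_of_mul_eq_mul_left (by omega) (hcd.trans hcd'.symm)
    refine IsCyclicOrder.conjUpToLinear (ζ := (Subalgebra.center K A).val) isCentre_center h h'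
      hΛ.full hΛ'.full hκ (by rw [hA, hq]) hZ' hp0 hq hc hcd hs
      (exists_unit_of_character hpK hu) (exists_unit_of_character hpK hu')
      hΛ.selfDual hΛ'.selfDual ?_
    intro η hη hr hlin
    refine hw η hη (fun h2 => ?_) hlin
    rw [hr]
    omega

end Main

end UniqueLifting

end

theorem mainTheorem3
    (p : ℕ) [Fact p.Prime] (f : ℕ) (hf : 1 ≤ f)
    {O K L A : Type*}
    [CommRing O] [IsDomain O] [IsDiscreteValuationRing O]
    [IsAdicComplete (IsLocalRing.maximalIdeal O) O]
    (hp : IsLocalRing.maximalIdeal O = Ideal.span {(p : O)})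
    [Field K] [Algebra O K] [IsFractionRing O K]
    [Ring A] [Algebra K A] [Algebra O A] [IsScalarTower O K A]
    [FiniteDimensional K A] [IsSemisimpleRing A]
    (hZ : Module.finrank K (Subalgebra.center K A) =
      Module.finrank (AlgebraicClosure (IsLocalRing.ResidueField O))
        (Subalgebra.center (AlgebraicClosure (IsLocalRing.ResidueField O))
          (UniqueLifting.PrincipalBlock (AlgebraicClosure (IsLocalRing.ResidueField O))
            (UniqueLifting.Delta2 p f))))
    [Field L] [Algebra K L] [Algebra O L] [IsScalarTower O K L]
    (hL : UniqueLifting.IsTotallyRamified O K L)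
    (hLA : UniqueLifting.IsSplitSemisimple L (L ⊗[K] A)) :
    -- uniqueness
    (∀ u : (Subalgebra.center K A)ˣ, UniqueLifting.HasValuationEverywhere O K p (-f) u →
      ∀ Λ Λ' : Subalgebra O A,
        UniqueLifting.IsDelta2Order O K p f u Λ → UniqueLifting.IsDelta2Order O K p f u Λ' →
          UniqueLifting.ConjUpToLinear O K Λ Λ') ∧
    -- dependence on `u`
    (∀ u u' : (Subalgebra.center K A)ˣ,
      UniqueLifting.HasValuationEverywhere O K p (-f) u →
      UniqueLifting.HasValuationEverywhere O K p (-f) u' →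
      ∀ Λ Λ' : Subalgebra O A,
        UniqueLifting.IsDelta2Order O K p f u Λ → UniqueLifting.IsDelta2Order O K p f u' Λ' →
        (p = 2 → UniqueLifting.ConjUpToLinear O K Λ Λ') ∧
        (p ≠ 2 → UniqueLifting.IsSplitSemisimple K A →
          ∀ ε₁ ε₂ : A, UniqueLifting.IsLastPair K ε₁ ε₂ →
          ∀ c₁ c₂ c₁' c₂' : K,
            ε₁ * (u : Subalgebra.center K A) = c₁ • ε₁ →
            ε₂ * (u : Subalgebra.center K A) = c₂ • ε₂ →
            ε₁ * (u' : Subalgebra.center K A) = c₁' • ε₁ →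
            ε₂ * (u' : Subalgebra.center K A) = c₂' • ε₂ →
            c₁ / c₂ = c₁' / c₂' →
            UniqueLifting.ConjUpToLinear O K Λ Λ') ∧
        (p ≠ 2 → ¬ UniqueLifting.IsSplitSemisimple K A →
          ∀ ε : A, UniqueLifting.IsLast K ε →
          ∀ w : Oˣ, ε * (u' : Subalgebra.center K A) =
              (w : O) • (ε * (u : Subalgebra.center K A)) →
            UniqueLifting.ConjUpToLinear O K Λ Λ')) := by 
  have hp0 : (p : O) ≠ 0 := by
    intro h0
    refine IsDiscreteValuationRing.not_a_field O ?_
    rw [hp, h0, Ideal.span_singleton_eq_bot]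
  have hpK : (p : K) ≠ 0 := by
    rw [← map_natCast (algebraMap O K)]
    exact (FaithfulSMul.algebraMap_eq_zero_iff O K).not.2 hp0
  have hζ := UniqueLifting.isCentre_center (K := K) (A := A)
  refine ⟨fun u hu Λ Λ' hΛ hΛ' => ?_, fun u u' hu hu' Λ Λ' hΛ hΛ' => ⟨?_, ?_, ?_⟩⟩
  -- With the same u the forms coincide and the unit is 1.
  · exact hΛ.conjUpToLinear hf hp hp0 hZ hu hu hΛ'
      fun η _ _ _ => ⟨1, by rw [Units.val_one, one_smul]⟩
  · exact fun h2 => hΛ.conjUpToLinear hf hp hp0 hZ hu hu' hΛ'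
      fun η hη h1 _ => UniqueLifting.exists_unit_smul_of_idealRank_eq_one hpK hu hu' hη (h1 h2)
  · exact fun _ _ ε₁ ε₂ hε c₁ c₂ c₁' c₂' h1 h2 h1' h2' hcc =>
      hΛ.conjUpToLinear hf hp hp0 hZ hu hu' hΛ' fun η hη _ hlin =>
        hζ.exists_unit_smul_of_isLastPair hpK hu hu' hε h1 h2 h1' h2' hcc hη hlin
  · exact fun _ _ ε hε w hw => hΛ.conjUpToLinear hf hp hp0 hZ hu hu' hΛ' fun η hη _ hlin =>
      hζ.exists_unit_smul_of_isLast hε hw hη hlin
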